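/- Let $\mathbb F$ be an algebraically closed field of characteristic $p\ge 3$ and let $n\ge 0$. Let $\mathcal Y_n=\mathcal C_n\rtimes\mathbb F S_n$ be the finite Hecke-Clifford algebra: $\mathcal C_n$ is generated by $c_1,\dots,c_n$ with $c_k^2=1$ and $c_kc_l=-c_lc_k$ for $k\ne l$, and $\sigma c_k=c_{\sigma(k)}\sigma$ for $\sigma\in S_n$. It is a superalgebra with the $c_k$ odd and $S_n$ even. Put $s_k=(k\ k{+}1)$ and $L_k=\sum_{j<k}(1+c_jc_k)(jk)$ (the Jucys-Murphy elements). Modules are $\mathbb Z_2$-graded left modules; homomorphisms are sums of homogeneous linear maps $f$ with $f(av)=(-1)^{\bar f\bar a}af(v)$. A module is completely splittable if $L_1,\dots,L_n$ act semisimply. An irreducible module is of type $\texttt M$ (resp. $\texttt Q$) if its endomorphism algebra has dimension $1$ (resp. $2$). Let $\Gamma$ be the set of strict partitions $\lambda$ of $n$ such that either (a) $\lambda_1\le\frac{p+1}2$, or (b) $\lambda_1=p-u$ and $\lambda_2\le u$ for some $1\le u\le\frac{p-3}2$ (missing parts are $0$). Let $l(\lambda)$ be the number of nonzero parts and $f^\lambda$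 the number of standard tableaux of the shifted diagram of $\lambda$. Call a standard tableau $T$ of shape $\lambda\in\Gamma$ admissible if, in case (b) with $\lambda_2=u$, the number in the last box of the second row is greater than the number in the last box of the first row (no condition otherwise), and in case (b) let $f_p^\lambda$ be the number of admissible tableaux. The module $D_p(\lambda)$ is defined as follows. A box $d$ diagonals above the main diagonal of the shifted diagram has content $d$ if $d\le\frac{p-1}2$ and $p-1-d$ otherwise. Take an admissible tableau $T$ of shape $\lambda$ and let $\underline i=(i_1,\dots,i_n)$, where $i_k$ is the content of the box of $T$ labeled $k$. Put $q(i)=i(i+1)\in\mathbb F$ and fix a choice of square roots in $\mathbb F$. Let $L(i)$ be the superspace with even basis vector $v_0$ and odd basis vector $v_1$ and operators $xv_0=\sqrt{q(i)}\,v_0$, $xv_1=-\sqrt{q(i)}\,v_1$, $cv_0=v_1$, $cv_1=v_0$ ($x$ even, $c$ odd), and let $L(\underline i)$ be an irreducible graded submodule of $L(i_1)\otimes\cdots\otimes L(i_n)$ for the operators $x_1,\dots,x_n,c_1,\dots,c_n$ acting on the respective factors with the usual sign rule. For $\tau\in S_n$ put $\tau\cdot\underline i=(i_{\tau^{-1}(1)},\dots,i_{\tau^{-1}(n)})$;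 $s_k$ is admissible with respect to $\underline j$ if $j_k\ne j_{k+1}\pm1$. Let $P_{\underline i}$ be the set of products $s_{k_t}\cdots s_{k_1}$ ($t\ge0$) such that $s_{k_m}$ is admissible with respect to $s_{k_{m-1}}\cdots s_{k_1}\cdot\underline i$ for all $m$. Then $D_p(\lambda)=\bigoplus_{\tau\in P_{\underline i}}L(\underline i)^\tau$, where $L(\underline i)^\tau=\{z^\tau\mid z\in L(\underline i)\}$ is a copy of the superspace $L(\underline i)$ with $x_kz^\tau=(x_{\tau^{-1}(k)}z)^\tau$ and $c_kz^\tau=(c_{\tau^{-1}(k)}z)^\tau$. Writing $\underline j=\tau\cdot\underline i$, $a=q(j_k)$, $b=q(j_{k+1})$, the action of $s_k$ is $$s_kz^\tau=-\frac{(x_k+x_{k+1})+c_kc_{k+1}(x_k-x_{k+1})}{a-b}\,z^\tau+\begin{cases}\sqrt{1-\frac{2(a+b)}{(a-b)^2}}\;z^{s_k\tau}&\text{if } s_k\text{ is admissible with respect to }\underline j,\\0&\text{otherwise,}\end{cases}$$ and $L_k$ acts as $x_k$. Theorem. For every $\lambda\in\Gamma$ these formulas define a $\mathcal Y_n$-module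 $D_p(\lambda)$, which up to isomorphism depends only on $\lambda$, and the following hold. (1) $D_p(\lambda)$ is of type $\texttt M$ if $l(\lambda)$ is even and of type $\texttt Q$ if $l(\lambda)$ is odd. Its dimension is $2^{n-\lfloor l(\lambda)/2\rfloor}f^\lambda$ in case (a) and $2^{n-\lfloor l(\lambda)/2\rfloor}f_p^\lambda$ in case (b). (2) The modules $D_p(\lambda)$, $\lambda\in\Gamma$, form a complete set of pairwise non-isomorphic irreducible completely splittable $\mathcal Y_n$-modules. -/

import Mathlib

universe u v w

noncomputable section

namespace HeckeClifford

open Equiv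

/-! ## The finite Hecke-Clifford algebra -/

/-- Generators of `𝒴ₙ = 𝒞ₙ ⋊ F Sₙ`: the Clifford generators `c₁, …, cₙ` and the group elements. -/
inductive YGen (n : ℕ) : Type
  | c (k : Fin n) : YGen n
  | w (σ : Perm (Fin n)) : YGen n

/-- Defining relations of the crossed product `𝒞ₙ ⋊ F Sₙ`. -/
inductive YRel (F : Type u) [Field F] (n : ℕ) :
    FreeAlgebra F (YGen n) → FreeAlgebra F (YGen n) → Prop
  | w_one : YRel F n (FreeAlgebra.ι F (YGen.w 1)) 1
  | w_mul (σ τ : Perm (Fin n)) :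
      YRel F n (FreeAlgebra.ι F (YGen.w (σ * τ)))
        (FreeAlgebra.ι F (YGen.w σ) * FreeAlgebra.ι F (YGen.w τ))
  | c_sq (k : Fin n) :
      YRel F n (FreeAlgebra.ι F (YGen.c k) * FreeAlgebra.ι F (YGen.c k)) 1
  | c_anticomm (k l : Fin n) (h : k ≠ l) :
      YRel F n (FreeAlgebra.ι F (YGen.c k) * FreeAlgebra.ι F (YGen.c l))
        (-(FreeAlgebra.ι F (YGen.c l) * FreeAlgebra.ι F (YGen.c k)))
  | w_c (σ : Perm (Fin n)) (k : Fin n) :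
      YRel F n (FreeAlgebra.ι F (YGen.w σ) * FreeAlgebra.ι F (YGen.c k))
        (FreeAlgebra.ι F (YGen.c (σ k)) * FreeAlgebra.ι F (YGen.w σ))

/-- The finite Hecke-Clifford algebra `𝒴ₙ = 𝒞ₙ ⋊ F Sₙ`. -/
abbrev Y (F : Type u) [Field F] (n : ℕ) : Type u := RingQuot (YRel F n)

section algebra

variable (F : Type u) [Field F] {n : ℕ}

/-- The Clifford generator `c_k` of `𝒴ₙ`. -/
def Y.c (k : Fin n) : Y F n := RingQuot.mkAlgHom F (YRel F n) (FreeAlgebra.ι F (YGen.c k))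

/-- The permutation `σ` as an element of `𝒴ₙ`. -/
def Y.w (σ : Perm (Fin n)) : Y F n :=
  RingQuot.mkAlgHom F (YRel F n) (FreeAlgebra.ι F (YGen.w σ))

/-- The Jucys-Murphy element `L_k = ∑_{j < k} (1 + c_j c_k) (j k)`. -/
def Y.jm (k : Fin n) : Y F n :=
  ∑ j ∈ Finset.Iio k, (1 + Y.c F j * Y.c F k) * Y.w F (swap j k)

/-- The superalgebra structure of `𝒴ₙ`: the `c_k` are odd and the permutations are even. -/
def Y.parity (e : ZMod 2) : Submodule F (Y F n) :=
  Submodule.span F {a | ∃ (l : List (Fin n)) (σ : Perm (Fin n)),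
    (l.length : ZMod 2) = e ∧ a = (l.map (Y.c F)).prod * Y.w F σ}

end algebra

/-! ## Modules over the superalgebra `𝒴ₙ` -/

/-- A `𝒴ₙ`-module in the sense of superalgebras: a `ℤ/2`-graded left `𝒴ₙ`-module. -/
structure YSupermodule (F : Type u) [Field F] (n : ℕ) where
  carrier : Type v
  [addCommGroup : AddCommGroup carrier]
  [module : Module F carrier]
  [moduleY : Module (Y F n) carrier]
  [isScalarTower : IsScalarTower F (Y F n) carrier]
  /-- The homogeneous components. -/
  gr : ZMod 2 → Submodule F carrier
  isCompl : IsCompl (gr 0) (gr 1)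
  smul_mem : ∀ (d e : ZMod 2) (a : Y F n) (z : carrier),
    a ∈ Y.parity F d → z ∈ gr e → a • z ∈ gr (d + e)

attribute [instance] YSupermodule.addCommGroup YSupermodule.module YSupermodule.moduleY
  YSupermodule.isScalarTower

namespace YSupermodule

variable {F : Type u} [Field F] {n : ℕ}

instance : CoeSort (YSupermodule.{u, v} F n) (Type v) := ⟨YSupermodule.carrier⟩

/-- Irreducible supermodule: nonzero, with no graded submodules other than `0` and itself. -/
def IsIrreducible (V : YSupermodule.{u, v} F n) : Prop :=
  Nontrivial V ∧ ∀ N : Submodule (Y F n) V,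
    N.restrictScalars F ≤ ⨆ e : ZMod 2, N.restrictScalars F ⊓ V.gr e → N = ⊥ ∨ N = ⊤

/-- Completely splittable: all Jucys-Murphy elements act semisimply. -/
def IsCompletelySplittable (V : YSupermodule.{u, v} F n) : Prop :=
  ∀ k : Fin n, (Algebra.lsmul F F V (Y.jm F k) : Module.End F V).IsSemisimple

/-- Homogeneous homomorphisms of parity `d`: linear maps that shift degrees by `d` and satisfy
`f (a z) = (-1)^{d·|a|} a f(z)` for homogeneous `a`. -/
def IsHomogeneousHom (V : YSupermodule.{u, v} F n) (W : YSupermodule.{u, w} F n)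
    (d : ZMod 2) (f : V →ₗ[F] W) : Prop :=
  (∀ (e : ZMod 2) (z : V), z ∈ V.gr e → f z ∈ W.gr (d + e)) ∧
  ∀ (e : ZMod 2) (a : Y F n) (z : V), a ∈ Y.parity F e →
    f (a • z) = (-1 : F) ^ (d.val * e.val) • (a • f z)

/-- The space `Hom(V, W)` of all supermodule homomorphisms (sums of homogeneous ones). -/
def Hom (V : YSupermodule.{u, v} F n) (W : YSupermodule.{u, w} F n) : Submodule F (V →ₗ[F] W) :=
  Submodule.span F {f | ∃ d : ZMod 2, IsHomogeneousHom V W d f}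

/-- Isomorphism of supermodules (not necessarily even). -/
def Isomorphic (V : YSupermodule.{u, v} F n) (W : YSupermodule.{u, w} F n) : Prop :=
  ∃ f ∈ Hom V W, Function.Bijective f

/-- Type `M`: the endomorphism algebra is one dimensional. -/
def IsTypeM (V : YSupermodule.{u, v} F n) : Prop := Module.finrank F (Hom V V) = 1

/-- Type `Q`: the endomorphism algebra is two dimensional. -/
def IsTypeQ (V : YSupermodule.{u, v} F n) : Prop := Module.finrank F (Hom V V) = 2

end YSupermodule

/-! ## The modules `L(i)` over the superalgebra generated by the `x_k` and `c_k` -/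

section seminormal

variable (F : Type u) [Field F]

/-- `q(i) = i (i + 1)`. -/
def q (i : ℕ) : F := (i : F) * ((i : F) + 1)

/-- A fixed choice of square roots in `F`. -/
def sqrtF [IsAlgClosed F] (a : F) : F :=
  (IsAlgClosed.exists_pow_nat_eq a (n := 2) Nat.zero_lt_two).choose

/-- The space of `L(i₁) ⊠ ⋯ ⊠ L(iₙ)`: `f : Box F n` stands for the sum of all
`f ε • (v_{ε₁} ⊗ ⋯ ⊗ v_{εₙ})`, where `L(i)` has the even basis vector `v₀` and the odd one `v₁`. -/
abbrev Box (n : ℕ) : Type u := (Fin n → ZMod 2) → F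

/-- The homogeneous components of `L(i₁) ⊠ ⋯ ⊠ L(iₙ)`. -/
def boxParity (n : ℕ) (e : ZMod 2) : Submodule F (Box F n) where
  carrier := {f | ∀ ε : Fin n → ZMod 2, ∑ k, ε k ≠ e → f ε = 0}
  zero_mem' := fun _ _ => rfl
  add_mem' := fun hf hg ε h => by simp [hf ε h, hg ε h]
  smul_mem' := fun a f hf ε h => by simp [hf ε h]

/-- `c_k` on `L(i₁) ⊠ ⋯ ⊠ L(iₙ)`: it exchanges `v₀` and `v₁` in the `k`-th factor, with the sign
`(-1)^{ε₁ + ⋯ + ε_{k-1}}` for passing the earlier factors. -/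
def boxC {n : ℕ} (k : Fin n) : Box F n →ₗ[F] Box F n where
  toFun f := fun ε => (-1) ^ (∑ j ∈ Finset.Iio k, (ε j).val) * f (ε + Pi.single k 1)
  map_add' f g := by ext ε; simp [mul_add]
  map_smul' a f := by ext ε; simp [mul_left_comm]

/-- `x_k` on `L(i₁) ⊠ ⋯ ⊠ L(iₙ)`: it is `√q(i_k)` on `v₀` and `-√q(i_k)` on `v₁` in the
`k`-th factor. -/
def boxX [IsAlgClosed F] {n : ℕ} (i : Fin n → ℕ) (k : Fin n) : Box F n →ₗ[F] Box F n where
  toFun f := fun ε => (-1) ^ (ε k).val * sqrtF F (q F (i k)) * f ε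
  map_add' f g := by ext ε; simp [mul_add]
  map_smul' a f := by ext ε; simp [mul_left_comm]

/-- `L(i) = L(i₁) ⊛ ⋯ ⊛ L(iₙ)`: an irreducible graded submodule of `L(i₁) ⊠ ⋯ ⊠ L(iₙ)`
for the action of all `x_k` and `c_k`. -/
structure LModule [IsAlgClosed F] {n : ℕ} (i : Fin n → ℕ) where
  U : Submodule F (Box F n)
  graded : U ≤ ⨆ e : ZMod 2, U ⊓ boxParity F n e
  c_mem : ∀ (k : Fin n), ∀ z ∈ U, boxC F k z ∈ U
  x_mem : ∀ (k : Fin n), ∀ z ∈ U, boxX F i k z ∈ U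
  ne_bot : U ≠ ⊥
  minimal : ∀ N : Submodule F (Box F n), N ≤ U →
    N ≤ ⨆ e : ZMod 2, N ⊓ boxParity F n e →
    (∀ (k : Fin n), ∀ z ∈ N, boxC F k z ∈ N) →
    (∀ (k : Fin n), ∀ z ∈ N, boxX F i k z ∈ N) → N = ⊥ ∨ N = U

/-! ## The modules `D^i` -/

/-- The simple transposition `(k, k+1)` (with indices starting from `0`). -/
def simple {n : ℕ} (k : ℕ) (hk : k + 1 < n) : Perm (Fin n) :=
  swap ⟨k, Nat.lt_of_succ_lt hk⟩ ⟨k + 1, hk⟩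

/-- `τ · i = (i_{τ⁻¹(1)}, …, i_{τ⁻¹(n)})`. -/
def permAct {n : ℕ} (τ : Perm (Fin n)) (i : Fin n → ℕ) : Fin n → ℕ := fun k => i (τ⁻¹ k)

/-- `s_k` is admissible with respect to `i` if `i_k ≠ i_{k+1} ± 1`. -/
def Admissible {n : ℕ} (i : Fin n → ℕ) (k : ℕ) (hk : k + 1 < n) : Prop :=
  i ⟨k, Nat.lt_of_succ_lt hk⟩ ≠ i ⟨k + 1, hk⟩ + 1 ∧
  i ⟨k, Nat.lt_of_succ_lt hk⟩ + 1 ≠ i ⟨k + 1, hk⟩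

/-- `P_i`: the products `s_{k_t} ⋯ s_{k_1}` in which every `s_{k_l}` is admissible with respect to
`s_{k_{l-1}} ⋯ s_{k_1} · i`. -/
inductive InP {n : ℕ} (i : Fin n → ℕ) : Perm (Fin n) → Prop
  | one : InP i 1
  | step (τ : Perm (Fin n)) (k : ℕ) (hk : k + 1 < n) (h : InP i τ)
      (hadm : Admissible (permAct τ i) k hk) : InP i (simple k hk * τ)

variable {F}

namespace LModule

variable [IsAlgClosed F] {n : ℕ} {i : Fin n → ℕ} (L : LModule F i)

/-- `c_k` on `L(i)`. -/
def c (k : Fin n) : L.U →ₗ[F] L.U := (boxC F k).restrict (L.c_mem k)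

/-- `x_k` on `L(i)`. -/
def x (k : Fin n) : L.U →ₗ[F] L.U := (boxX F i k).restrict (L.x_mem k)

/-- `Ξ_{a,b} = -((x_a + x_b) / (x_a² - x_b²) + c_a c_b (x_a - x_b) / (x_a² - x_b²))` on `L(i)`,
where `x_a²` and `x_b²` are the scalars `q(i_a)` and `q(i_b)`. -/
def Xi (a b : Fin n) : L.U →ₗ[F] L.U :=
  -((q F (i a) - q F (i b))⁻¹ •
    ((L.x a + L.x b) + L.c a ∘ₗ L.c b ∘ₗ (L.x a - L.x b)))

/-- The underlying space `⊕_{τ ∈ P_i} L(i)^τ` of `D^i` (the index set `P_i` is finite). -/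
abbrev D : Type u := {τ : Perm (Fin n) // InP i τ} → L.U

/-- The element `z^τ` of the summand `L(i)^τ` of `D^i`. -/
def twist (τ : Perm (Fin n)) (hτ : InP i τ) (z : L.U) : L.D := Pi.single ⟨τ, hτ⟩ z

end LModule

/-- The scalar `√(1 - 2 (q(a) + q(b)) / (q(a) - q(b))²)` by which `Ω_k` acts on a weight space
whose `k`-th and `(k+1)`-st weights are `a` and `b`. -/
def omega (F : Type u) [Field F] [IsAlgClosed F] (a b : ℕ) : F :=
  sqrtF F (1 - 2 * (q F a + q F b) / (q F a - q F b) ^ 2)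

/-- The `𝒴ₙ`-module `V` is (a copy of) `D^i`. It is identified by an even linear bijection with
the superspace `⊕_{τ ∈ P_i} L(i)^τ` in such a way that
* `c_k z^τ = (c_{τ⁻¹(k)} z)^τ`;
* `L_k` acts as `x_k`, that is, `L_k z^τ = (x_{τ⁻¹(k)} z)^τ`;
* `s_k z^τ = Ξ_k z^τ + Ω_k z^{s_k τ}` if `s_k` is admissible with respect to `τ · i`;
* `s_k z^τ = Ξ_k z^τ` otherwise.

Here `Ξ_k z^τ = (Ξ_{τ⁻¹(k), τ⁻¹(k+1)} z)^τ`. -/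
def IsD [IsAlgClosed F] {n : ℕ} (i : Fin n → ℕ) (V : YSupermodule.{u, v} F n) : Prop :=
  ∃ (L : LModule F i) (φ : L.D ≃ₗ[F] V),
    (∀ (e : ZMod 2) (τ : Perm (Fin n)) (hτ : InP i τ) (z : L.U),
      (z : Box F n) ∈ boxParity F n e → φ (L.twist τ hτ z) ∈ V.gr e) ∧
    (∀ (k : Fin n) (τ : Perm (Fin n)) (hτ : InP i τ) (z : L.U),
      Y.c F k • φ (L.twist τ hτ z) = φ (L.twist τ hτ (L.c (τ⁻¹ k) z))) ∧
    (∀ (k : Fin n) (τ : Perm (Fin n)) (hτ : InP i τ) (z : L.U),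
      Y.jm F k • φ (L.twist τ hτ z) = φ (L.twist τ hτ (L.x (τ⁻¹ k) z))) ∧
    (∀ (k : ℕ) (hk : k + 1 < n) (τ : Perm (Fin n)) (hτ : InP i τ) (z : L.U)
      (hadm : Admissible (permAct τ i) k hk),
      Y.w F (simple k hk) • φ (L.twist τ hτ z) =
        φ (L.twist τ hτ (L.Xi (τ⁻¹ ⟨k, Nat.lt_of_succ_lt hk⟩) (τ⁻¹ ⟨k + 1, hk⟩) z) +
          omega F (permAct τ i ⟨k, Nat.lt_of_succ_lt hk⟩) (permAct τ i ⟨k + 1, hk⟩) •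
            L.twist (simple k hk * τ) (InP.step τ k hk hτ hadm) z)) ∧
    (∀ (k : ℕ) (hk : k + 1 < n) (τ : Perm (Fin n)) (hτ : InP i τ) (z : L.U),
      ¬ Admissible (permAct τ i) k hk →
      Y.w F (simple k hk) • φ (L.twist τ hτ z) =
        φ (L.twist τ hτ (L.Xi (τ⁻¹ ⟨k, Nat.lt_of_succ_lt hk⟩) (τ⁻¹ ⟨k + 1, hk⟩) z)))

end seminormal

/-! ## Strict partitions and standard tableaux -/

/-- The part `λ_{r+1}` (so `row lam 0` is the largest part); it is `0` for `r ≥ l(λ)`. -/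
def row {n : ℕ} (lam : n.Partition) (r : ℕ) : ℕ := (lam.parts.sort (· ≥ ·)).getD r 0

/-- The number `l(λ)` of nonzero parts. -/
def len {n : ℕ} (lam : n.Partition) : ℕ := lam.parts.card

/-- The boxes (row, column), numbered from `0`, of the shifted Young diagram of `λ`: its row `r` is
shifted to the right by `r` squares. -/
def cells {n : ℕ} (lam : n.Partition) : Set (ℕ × ℕ) :=
  {b | b.1 ≤ b.2 ∧ b.2 < b.1 + row lam b.1}

/-- `T` is a standard tableau of shape `λ`; `T k` is the box that carries the label `k`. The labels
increase along rows and down columns. -/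
structure IsStandard {n : ℕ} (lam : n.Partition) (T : Fin n → ℕ × ℕ) : Prop where
  bijOn : Set.BijOn T Set.univ (cells lam)
  row_lt : ∀ a b : Fin n, (T a).1 = (T b).1 → (T a).2 < (T b).2 → a < b
  col_lt : ∀ a b : Fin n, (T a).2 = (T b).2 → (T a).1 < (T b).1 → a < b

/-- `λ₁ = p - u` and `λ₂ ≤ u` for the given `u`, where `1 ≤ u ≤ (p - 3)/2`. -/
def IsLong (p : ℕ) {n : ℕ} (lam : n.Partition) (u : ℕ) : Prop :=
  1 ≤ u ∧ 2 * u + 3 ≤ p ∧ row lam 0 + u = p ∧ row lam 1 ≤ u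

/-- Standard tableaux which, if `λ₁ = p - u` and `λ₂ = u` for some `1 ≤ u ≤ (p - 3)/2`, have a
greater number in the last box of the second row than in the last box of the first row. -/
def IsPStandard (p : ℕ) {n : ℕ} (lam : n.Partition) (T : Fin n → ℕ × ℕ) : Prop :=
  IsStandard lam T ∧ ∀ u : ℕ, IsLong p lam u → row lam 1 = u →
    ∀ a b : Fin n, T a = (0, row lam 0 - 1) → T b = (1, row lam 1) → a < b

/-- `f^λ`. -/
def fStd {n : ℕ} (lam : n.Partition) : ℕ := {T | IsStandard lam T}.ncard

/-- `f_p^λ`. -/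
def fPStd (p : ℕ) {n : ℕ} (lam : n.Partition) : ℕ := {T | IsPStandard p lam T}.ncard

/-- Strict partitions `λ` with `λ₁ ≤ (p + 1)/2`, or with `λ₁ = p - u` and `λ₂ ≤ u` for some
`1 ≤ u ≤ (p - 3)/2`. -/
def InGamma (p : ℕ) {n : ℕ} (lam : n.Partition) : Prop :=
  lam.parts.Nodup ∧ (row lam 0 ≤ (p + 1) / 2 ∨ ∃ u, IsLong p lam u)

/-- The content of a box of the shifted diagram: on the successive diagonals it runs through
`0, 1, …, (p - 3)/2, (p - 1)/2, (p - 3)/2, …`. -/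
def content (p : ℕ) (b : ℕ × ℕ) : ℕ :=
  if 2 * (b.2 - b.1) ≤ p - 1 then b.2 - b.1 else p - 1 - (b.2 - b.1)

/-- `V` is (a copy of) `D_p(λ) = D^i`, where `i = (c(T(1)), …, c(T(n)))` is the content sequence of
a tableau `T` of shape `λ` as above. -/
def IsDp {F : Type u} [Field F] [IsAlgClosed F] (p : ℕ) {n : ℕ} (lam : n.Partition)
    (V : YSupermodule.{u, v} F n) : Prop :=
  ∃ T : Fin n → ℕ × ℕ, IsPStandard p lam T ∧ IsD (fun k => content p (T k)) V

end HeckeClifford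

end

noncomputable section
namespace HeckeClifford
open Equiv

/-! ## Reduced words in the symmetric group -/

/-! The Jucys-Murphy elements `x_k = L_k` satisfy, together with the `c_k` and `s_k`, the relations
of the affine Hecke-Clifford algebra (`Y.hcRel`). The squares `x_k²` commute with all `x_l` and
`c_l`, so a completely splittable module is studied through its weight spaces, the joint eigenspaces
`wt` of the `x_k²`. The intertwiners `Φ_k = s_k (x_k² - x_{k+1}²) + e_k` permute the `x`'s and the
`c`'s, hence the weights. They satisfy the braid relations, and `Φ_k²` is the scalar `2(a + b) - (a
- b)²` on a weight with neighbouring entries `a`, `b`.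

Semisimplicity forces neighbouring entries of a weight to be distinct (`SplitHC.eq_zero_of_eq`), so
`s_k` can be recovered from `Φ_k`. The submodule generated by a Clifford submodule `L` of a weight
space is therefore the sum of the `Θ_w L`, where `Θ_w` is a product of intertwiners along a reduced
word. A nonzero `Θ_w L` requires `w` to preserve the order of equal entries, and such a `w` is
determined by the weight of `Θ_w L`. Consequently this submodule meets the original weight space
only in `L` (`SuperHC.exists_cyclic`). An irreducible module thus has weight spaces that are
irreducible over the `x_k`, `c_k`. It is determined by any one of its weights
(`SuperHC.exists_equiv`), and its type is decided by the parity of the number of zero entries,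
because zero entries leave Clifford generators that no `x_k` can separate.

On an irreducible module an intertwiner with square zero vanishes. The braid relation for the `s_k`
then restricts the weights of the form `(…, a, b, a, …)`. This gives the closure properties
`WeightClosed`: weights begin with `0`, neighbours differ, the triples are restricted, and
neighbours with `Φ_k² ≠ 0` may be exchanged. With `p = 2h + 1`, the map `q` is injective on `0, …,
h`, folds at `h`, and `Φ_k² = 0` means that the two contents differ by one. A combinatorial
induction shows that the weights allowed by `WeightClosed` are content sequences of admissible
tableaux of shapes in `Γ` (`WeightClosed.exists_word`). Two tableaux of one shape are linked by
admissible exchanges (`IsWord.moves`), so a module sees all admissible tableaux of its shape.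

Conversely, the contents of an admissible tableau satisfy these conditions (`IsWord.good`), and they
suffice for the formulas defining `D^i` to respect all relations. When three neighbouring entries
are distinct, the braid relation follows from that of the intertwiners by cancelling a nonzero
scalar; on a triple `(a, b, a)` it is the identity `CXRel.eOp_braid` (`LData.braid_sD`). The
summands of `D^i` have distinct weights and are linked by nonzero scalars, so `D^i` is irreducible.
Its dimension is the number of admissible tableaux times `dim L(i)`, and the number of zero contents
is the number of diagonal boxes, which is `l(λ)`. -/

theorem simple_inv {n : ℕ} (k : ℕ) (hk : k + 1 < n) : (simple k hk)⁻¹ = simple k hk :=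
  swap_inv _ _

@[simp] theorem simple_mul_self {n : ℕ} (k : ℕ) (hk : k + 1 < n) :
    simple k hk * simple k hk = 1 := swap_mul_self _ _

@[simp] theorem simple_mul_self_assoc {n : ℕ} (k : ℕ) (hk : k + 1 < n) (w : Perm (Fin n)) :
    simple k hk * (simple k hk * w) = w := by rw [← mul_assoc, simple_mul_self, one_mul]

theorem simple_left {n : ℕ} (k : ℕ) (hk : k + 1 < n) :
    simple k hk ⟨k, Nat.lt_of_succ_lt hk⟩ = ⟨k + 1, hk⟩ := swap_apply_left _ _

theorem simple_right {n : ℕ} (k : ℕ) (hk : k + 1 < n) :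
    simple k hk ⟨k + 1, hk⟩ = ⟨k, Nat.lt_of_succ_lt hk⟩ := swap_apply_right _ _

theorem simple_of_ne {n : ℕ} (k : ℕ) (hk : k + 1 < n) (a : Fin n) (h : a.val ≠ k)
    (h' : a.val ≠ k + 1) : simple k hk a = a :=
  swap_apply_of_ne_of_ne (fun e => h (by rw [e])) (fun e => h' (by rw [e]))

theorem simple_val {n : ℕ} (k : ℕ) (hk : k + 1 < n) (a : Fin n) :
    (simple k hk a).val = if a.val = k then k + 1 else if a.val = k + 1 then k else a.val := by
  unfold simple
  rw [swap_apply_def]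
  simp only [Fin.ext_iff]
  split_ifs <;> simp_all

theorem simple_lt {n : ℕ} (k : ℕ) (hk : k + 1 < n) {a b : Fin n} (hab : a < b)
    (h : ¬ (a.val = k ∧ b.val = k + 1)) : simple k hk a < simple k hk b := by
  rw [Fin.lt_def] at hab ⊢
  rw [simple_val, simple_val]
  split_ifs <;> omega

theorem simple_comm {n : ℕ} (k l : ℕ) (hk : k + 1 < n) (hl : l + 1 < n) (h : k + 1 < l) :
    simple k hk * simple l hl = simple l hl * simple k hk := by
  ext a
  simp only [Perm.coe_mul, Function.comp_apply, simple_val]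
  split_ifs <;> omega

theorem simple_braid {n : ℕ} (k : ℕ) (hk : k + 2 < n) :
    simple k (Nat.lt_of_succ_lt hk) * (simple (k + 1) hk * simple k (Nat.lt_of_succ_lt hk)) =
      simple (k + 1) hk * (simple k (Nat.lt_of_succ_lt hk) * simple (k + 1) hk) := by
  ext a
  simp only [Perm.coe_mul, Function.comp_apply, simple_val]
  split_ifs <;> omega

/-- A permutation that preserves the fibres of `χ` and is increasing on them is trivial. -/
theorem perm_eq_one_of_fiber {n : ℕ} {α : Type*} (χ : Fin n → α) (w : Perm (Fin n))
    (hχ : ∀ a, χ (w a) = χ a) (ho : ∀ a b, a < b → χ a = χ b → w a < w b) : w = 1 := by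
  -- If `w a < a`, then `w a` lies in the fibre of `a`, so `w (w a) < w a`, against the induction
  -- hypothesis at `w a`. Applied to `w` and to `w⁻¹`, this gives equality.
  have key : ∀ (w : Perm (Fin n)), (∀ a, χ (w a) = χ a) →
      (∀ a b, a < b → χ a = χ b → w a < w b) → ∀ a, a ≤ w a := by
    intro w hχ ho a
    induction a using WellFoundedLT.induction with
    | _ a ih =>
      by_contra hlt
      push Not at hlt
      have h1 := ih _ hlt
      have h2 := ho _ _ hlt (hχ a)
      exact absurd h1 (not_le.mpr h2)
  have hχ' : ∀ a, χ (w⁻¹ a) = χ a := fun a => by rw [← hχ (w⁻¹ a)]; simp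
  have h2 := key w⁻¹ hχ' (by
    intro a b hab e
    by_contra hlt
    push Not at hlt
    rcases hlt.lt_or_eq with h | h
    · have := ho _ _ h (by rw [hχ', hχ', e])
      rw [← Perm.mul_apply, ← Perm.mul_apply, mul_inv_cancel] at this
      exact absurd this (not_lt.mpr hab.le)
    · exact hab.ne' (w⁻¹.injective h))
  ext a
  have h1 := key w hχ ho a
  have h3 := h2 (w a)
  rw [← Perm.mul_apply, inv_mul_cancel] at h3
  exact congrArg Fin.val (le_antisymm h3 h1)

/-- The position of `k` precedes that of `k + 1` in `w`, so `s_k w` is longer than `w`. -/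
def Ascent {n : ℕ} (w : Perm (Fin n)) (k : ℕ) (hk : k + 1 < n) : Prop :=
  w⁻¹ ⟨k, Nat.lt_of_succ_lt hk⟩ < w⁻¹ ⟨k + 1, hk⟩

theorem simple_mul_inv_apply {n : ℕ} (w : Perm (Fin n)) (k : ℕ) (hk : k + 1 < n) (a : Fin n) :
    (simple k hk * w)⁻¹ a = w⁻¹ (simple k hk a) := by
  rw [mul_inv_rev, simple_inv]; rfl

theorem not_ascent {n : ℕ} {w : Perm (Fin n)} {k : ℕ} {hk : k + 1 < n} (h : ¬ Ascent w k hk) :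
    Ascent (simple k hk * w) k hk := by
  unfold Ascent at *
  rw [simple_mul_inv_apply, simple_mul_inv_apply, simple_left, simple_right]
  refine lt_of_le_of_ne (not_lt.mp h) (fun e => ?_)
  have := congrArg Fin.val (w⁻¹.injective e)
  simp at this

/-- A weight that increases along ascents. -/
def permWeight {n : ℕ} (w : Perm (Fin n)) : ℤ := ∑ x : Fin n, (x.val : ℤ) * (n - (w⁻¹ x).val)

theorem permWeight_nonneg {n : ℕ} (w : Perm (Fin n)) : 0 ≤ permWeight w :=
  Finset.sum_nonneg fun x _ => mul_nonneg (by positivity) (by have := (w⁻¹ x).2; omega)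

/-- Only the terms of `k` and `k + 1` change, and the difference is `w⁻¹(k+1) - w⁻¹(k)`. The weight
can thus replace the length in inductions. -/
theorem permWeight_lt {n : ℕ} {w : Perm (Fin n)} {k : ℕ} {hk : k + 1 < n} (h : Ascent w k hk) :
    permWeight w < permWeight (simple k hk * w) := by
  have e : permWeight (simple k hk * w) =
      ∑ x : Fin n, ((simple k hk x).val : ℤ) * (n - (w⁻¹ x).val) := by
    unfold permWeight
    rw [← Equiv.sum_comp (simple k hk)]
    refine Finset.sum_congr rfl fun x _ => ?_
    rw [simple_mul_inv_apply, ← Perm.mul_apply (simple k hk), simple_mul_self, Perm.one_apply]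
  have ha : (⟨k, Nat.lt_of_succ_lt hk⟩ : Fin n) ≠ ⟨k + 1, hk⟩ := by simp
  have e2 : permWeight (simple k hk * w) - permWeight w =
      ((w⁻¹ ⟨k + 1, hk⟩).val : ℤ) - (w⁻¹ ⟨k, Nat.lt_of_succ_lt hk⟩).val := by
    rw [e, permWeight, ← Finset.sum_sub_distrib,
      ← Finset.sum_subset (Finset.subset_univ {⟨k, Nat.lt_of_succ_lt hk⟩, ⟨k + 1, hk⟩}),
      Finset.sum_pair ha, simple_left, simple_right]
    · push_cast; ring
    · intro x _ hx
      simp only [Finset.mem_insert, Finset.mem_singleton, not_or, Fin.ext_iff] at hx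
      rw [simple_of_ne k hk x hx.1 hx.2, sub_self]
  have h' : (w⁻¹ ⟨k, Nat.lt_of_succ_lt hk⟩).val < (w⁻¹ ⟨k + 1, hk⟩).val := h
  omega

theorem eq_one_of_forall_ascent {n : ℕ} (w : Perm (Fin n)) (h : ∀ k hk, Ascent w k hk) :
    w = 1 := by
  have key : ∀ d k (hk : k + d + 1 < n), w⁻¹ ⟨k, by omega⟩ < w⁻¹ ⟨k + d + 1, hk⟩ := by
    intro d
    induction d with
    | zero => exact fun k hk => h k hk
    | succ d ih => exact fun k hk => (ih k (by omega)).trans (h (k + d + 1) hk)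
  rw [← inv_eq_one]
  refine perm_eq_one_of_fiber (fun _ => ()) _ (fun _ => rfl) fun a b hab _ => ?_
  have := key (b.val - a.val - 1) a.val (by have := b.2; have : a.val < b.val := hab; omega)
  have e : a.val + (b.val - a.val - 1) + 1 = b.val := by
    have : a.val < b.val := hab
    omega
  simpa only [e] using this

/-- A permutation other than `1` has a descent, and removing it lowers the nonnegative integer
`permWeight`. -/
theorem perm_induction {n : ℕ} {P : Perm (Fin n) → Prop} (w : Perm (Fin n)) (one : P 1)
    (step : ∀ w k hk, Ascent w k hk → P w → P (simple k hk * w)) : P w := by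
  by_cases h : ∀ k hk, Ascent w k hk
  · rwa [eq_one_of_forall_ascent w h]
  · push Not at h
    obtain ⟨k, hk, h⟩ := h
    have h1 := not_ascent h
    have h2 := permWeight_lt h1
    rw [simple_mul_self_assoc] at h2
    have h3 := permWeight_nonneg (simple k hk * w)
    have h4 : (permWeight (simple k hk * w)).toNat < (permWeight w).toNat := by omega
    have := step _ k hk h1 (perm_induction _ one step)
    rwa [simple_mul_self_assoc] at this
termination_by (permWeight w).toNat
decreasing_by exact h4

/-! ### Matsumoto's theorem and the Coxeter presentation -/

section Matsumoto

variable {G : Type*} [Monoid G] {n : ℕ} (t : ∀ k, k + 1 < n → G)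

/-- `g` is the product of the `t k` along some reduced word of `w`. -/
inductive ReducedVal : Perm (Fin n) → G → Prop
  | one : ReducedVal 1 1
  | step (w : Perm (Fin n)) (g : G) (k : ℕ) (hk : k + 1 < n) (h : ReducedVal w g)
      (ha : Ascent w k hk) : ReducedVal (simple k hk * w) (t k hk * g)

variable {t}

theorem ReducedVal.exists (w : Perm (Fin n)) : ∃ g, ReducedVal t w g :=
  perm_induction (P := fun w => ∃ g, ReducedVal t w g) w ⟨1, .one⟩
    fun w k hk ha ⟨g, hg⟩ => ⟨_, .step w g k hk hg ha⟩

/-- At a descent `k` some reduced word of `w` begins with `s_k`. -/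
theorem ReducedVal.exists_step {w : Perm (Fin n)} {k : ℕ} {hk : k + 1 < n}
    (h : ¬ Ascent w k hk) : ∃ g, ReducedVal t (simple k hk * w) g ∧ ReducedVal t w (t k hk * g) := by
  obtain ⟨g, hg⟩ := ReducedVal.exists (t := t) (simple k hk * w)
  refine ⟨g, hg, ?_⟩
  have := ReducedVal.step _ _ k hk hg (not_ascent h)
  rwa [simple_mul_self_assoc] at this

theorem ascent_simple_mul {w : Perm (Fin n)} {k l : ℕ} {hk : k + 1 < n} {hl : l + 1 < n} :
    Ascent (simple k hk * w) l hl ↔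
      w⁻¹ (simple k hk ⟨l, Nat.lt_of_succ_lt hl⟩) < w⁻¹ (simple k hk ⟨l + 1, hl⟩) := by
  unfold Ascent
  rw [simple_mul_inv_apply, simple_mul_inv_apply]

theorem not_ascent_simple_mul {w : Perm (Fin n)} {k : ℕ} {hk : k + 1 < n}
    (h : Ascent w k hk) : ¬ Ascent (simple k hk * w) k hk := by
  rw [ascent_simple_mul, simple_left, simple_right]
  exact not_lt.mpr h.le

/-- Here `u = s_l y` and `v = s_k y` for a common `y`. By uniqueness for `u` and `v` both values may
be computed through one reduced word of `y`, and commutation compares them. -/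
theorem ReducedVal.unique_far
    (comm : ∀ k l hk hl, k + 1 < l → t k hk * t l hl = t l hl * t k hk)
    (k l : ℕ) (hk : k + 1 < n) (hl : l + 1 < n) (u v : Perm (Fin n)) (g g' : G)
    (hu : ∀ g g', ReducedVal t u g → ReducedVal t u g' → g = g')
    (hv : ∀ g g', ReducedVal t v g → ReducedVal t v g' → g = g')
    (h : ReducedVal t u g) (h' : ReducedVal t v g') (ha : Ascent u k hk) (hl' : Ascent v l hl)
    (hw : simple k hk * u = simple l hl * v) (hkl : k + 1 < l) :
    t k hk * g = t l hl * g' := by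
  have e1 : u = simple l hl * (simple k hk * v) := by
    rw [← mul_assoc, ← simple_comm k l hk hl hkl, mul_assoc, ← hw, simple_mul_self_assoc]
  have d1 : ¬ Ascent u l hl := by
    have := not_ascent_simple_mul hl'
    rw [← hw, ascent_simple_mul, simple_of_ne, simple_of_ne] at this
    · exact this
    all_goals simp; try omega
  obtain ⟨y, hy, hy'⟩ := ReducedVal.exists_step (t := t) d1
  rw [hu _ _ h hy']
  have e2 : simple l hl * u = simple k hk * v := by
    rw [e1, simple_mul_self_assoc]
  have d2 : ¬ Ascent v k hk := by
    have := not_ascent_simple_mul ha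
    rw [hw, ascent_simple_mul, simple_of_ne, simple_of_ne] at this
    · exact this
    all_goals simp; try omega
  rw [e2] at hy
  have hy2 := ReducedVal.step _ _ k hk hy (not_ascent d2)
  rw [simple_mul_self_assoc] at hy2
  rw [hv _ _ h' hy2, ← mul_assoc, ← mul_assoc, comm k l hk hl hkl]

/-- The common product is `s_k s_{k+1} s_k z = s_{k+1} s_k s_{k+1} z`, both reduced. Both values are
rewritten through one reduced word of `z`, and the braid relation compares them. -/
theorem ReducedVal.unique_near
    (braid : ∀ k (hk : k + 2 < n), t k (Nat.lt_of_succ_lt hk) * (t (k + 1) hk *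
      t k (Nat.lt_of_succ_lt hk)) = t (k + 1) hk * (t k (Nat.lt_of_succ_lt hk) * t (k + 1) hk))
    (k : ℕ) (hk : k + 2 < n) (u v : Perm (Fin n)) (g g' : G)
    (ih : ∀ w : Perm (Fin n), permWeight w ≤ permWeight u →
      ∀ g g', ReducedVal t w g → ReducedVal t w g' → g = g')
    (hv : ∀ g g', ReducedVal t v g → ReducedVal t v g' → g = g')
    (h : ReducedVal t u g) (h' : ReducedVal t v g') (ha : Ascent u k (Nat.lt_of_succ_lt hk))
    (hl' : Ascent v (k + 1) hk)
    (hw : simple k (Nat.lt_of_succ_lt hk) * u = simple (k + 1) hk * v) :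
    t k (Nat.lt_of_succ_lt hk) * g = t (k + 1) hk * g' := by
  have hk1 : k + 1 < n := Nat.lt_of_succ_lt hk
  set a : Fin n := ⟨k, Nat.lt_of_succ_lt hk1⟩
  set b : Fin n := ⟨k + 1, hk1⟩
  set c : Fin n := ⟨k + 2, hk⟩
  have sa : simple k hk1 a = b := simple_left _ _
  have sb : simple k hk1 b = a := simple_right _ _
  have sc : simple k hk1 c = c := simple_of_ne _ _ _ (by simp [c]) (by simp [c])
  have ra : simple (k + 1) hk a = a :=
    simple_of_ne _ _ _ (by simp [a]) (by simp only [a]; omega)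
  have rb : simple (k + 1) hk b = c := simple_left _ _
  have rc : simple (k + 1) hk c = b := simple_right _ _
  -- Since `k + 1` is a descent of `s_k u`, the inverse of `u` takes `c`, `a`, `b` in increasing
  -- order. Hence `u` has the descent `k + 1`, and `s_{k+1} u` has the descent `k`.
  have i1 : u⁻¹ c < u⁻¹ a := by
    have := not_ascent_simple_mul hl'
    rw [← hw, ascent_simple_mul] at this
    change ¬ (u⁻¹ (simple k hk1 b) < u⁻¹ (simple k hk1 c)) at this
    rw [sb, sc] at this
    refine lt_of_le_of_ne (not_lt.mp this) fun e => ?_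
    have := congrArg Fin.val (u⁻¹.injective e)
    simp [a, c] at this
  have i0 : u⁻¹ a < u⁻¹ b := ha
  have d1 : ¬ Ascent u (k + 1) hk := not_lt.mpr (i1.trans i0).le
  obtain ⟨y, hy, hy'⟩ := ReducedVal.exists_step (t := t) d1
  rw [ih u le_rfl _ _ h hy']
  have hu2 := permWeight_lt (not_ascent d1)
  rw [simple_mul_self_assoc] at hu2
  have d2 : ¬ Ascent (simple (k + 1) hk * u) k hk1 := by
    rw [ascent_simple_mul]
    change ¬ (u⁻¹ (simple (k + 1) hk a) < u⁻¹ (simple (k + 1) hk b))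
    rw [ra, rb]
    exact not_lt.mpr i1.le
  obtain ⟨z, hz, hz'⟩ := ReducedVal.exists_step (t := t) d2
  have hb : t k hk1 * (t (k + 1) hk * (t k hk1 * z)) =
      t (k + 1) hk * (t k hk1 * (t (k + 1) hk * z)) := by
    have := congrArg (· * z) (braid k hk)
    simpa only [mul_assoc] using this
  rw [ih _ hu2.le _ _ hy hz', hb]
  have hv2 : v = simple (k + 1) hk * (simple k hk1 * u) := by
    rw [hw, simple_mul_self_assoc]
  have a1 : Ascent (simple k hk1 * (simple (k + 1) hk * u)) (k + 1) hk := by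
    rw [ascent_simple_mul, simple_mul_inv_apply, simple_mul_inv_apply]
    change u⁻¹ (simple (k + 1) hk (simple k hk1 b)) < u⁻¹ (simple (k + 1) hk (simple k hk1 c))
    rw [sb, sc, ra, rc]
    exact i0
  have h1 := ReducedVal.step _ _ (k + 1) hk hz a1
  have a2 : Ascent (simple (k + 1) hk * (simple k hk1 * (simple (k + 1) hk * u))) k hk1 := by
    rw [ascent_simple_mul, simple_mul_inv_apply, simple_mul_inv_apply,
      simple_mul_inv_apply, simple_mul_inv_apply]
    change u⁻¹ (simple (k + 1) hk (simple k hk1 (simple (k + 1) hk a))) <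
      u⁻¹ (simple (k + 1) hk (simple k hk1 (simple (k + 1) hk b)))
    rw [ra, rb, sa, sc, rb, rc]
    exact i1.trans i0
  have h2 := ReducedVal.step _ _ k hk1 h1 a2
  have e : simple k hk1 * (simple (k + 1) hk * (simple k hk1 * (simple (k + 1) hk * u))) = v := by
    have := congrArg (· * (simple (k + 1) hk * u)) (simple_braid k hk)
    simp only [mul_assoc] at this
    rw [hv2, this, simple_mul_self_assoc]
  rw [e] at h2
  rw [hv _ _ h' h2]

/-- Induction on a bound for `permWeight`. Two reduced words are compared by their leftmost letters,
which are equal, neighbouring or distant. -/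
theorem ReducedVal.unique
    (braid : ∀ k (hk : k + 2 < n), t k (Nat.lt_of_succ_lt hk) * (t (k + 1) hk *
      t k (Nat.lt_of_succ_lt hk)) = t (k + 1) hk * (t k (Nat.lt_of_succ_lt hk) * t (k + 1) hk))
    (comm : ∀ k l hk hl, k + 1 < l → t k hk * t l hl = t l hl * t k hk)
    (w : Perm (Fin n)) (g g' : G) (h : ReducedVal t w g) (h' : ReducedVal t w g') : g = g' := by
  obtain ⟨N, hN⟩ : ∃ N : ℕ, permWeight w < N :=
    ⟨(permWeight w).toNat + 1, by have := permWeight_nonneg w; omega⟩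
  induction N generalizing w g g' with
  | zero => exact absurd (permWeight_nonneg w) (by simpa using hN)
  | succ N ih =>
    have ih' : ∀ u : Perm (Fin n), permWeight u < permWeight w →
        ∀ g g', ReducedVal t u g → ReducedVal t u g' → g = g' :=
      fun u hu g g' h h' => ih u g g' h h' (by omega)
    cases h with
    | one =>
      generalize hw : (1 : Perm (Fin n)) = w at h'
      cases h' with
      | one => rfl
      | step v g' l hl h' hl' =>
        have := not_ascent_simple_mul hl'
        rw [← hw] at this
        exact absurd (show Ascent 1 l hl by simp [Ascent]) this
    | step u g k hk h ha =>
      have hu := permWeight_lt ha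
      generalize hw : simple k hk * u = w at h' hu ih'
      cases h' with
      | one =>
        have := not_ascent_simple_mul ha
        rw [hw] at this
        exact absurd (show Ascent 1 k hk by simp [Ascent]) this
      | step v g' l hl h' hl' =>
        have hv := permWeight_lt hl'
        rcases lt_trichotomy k l with hkl | hkl | hkl
        · by_cases h1 : k + 1 = l
          · subst h1
            exact unique_near braid k hl u v g g' (fun w hw => ih' w (hw.trans_lt hu))
              (ih' v hv) h h' ha hl' hw
          · exact unique_far comm k l hk hl u v g g' (ih' u hu) (ih' v hv) h h' ha hl' hw (by omega)
        · subst hkl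
          have : u = v := mul_left_cancel hw
          subst this
          rw [ih' u hu g g' h h']
        · by_cases h1 : l + 1 = k
          · subst h1
            exact (unique_near braid l hk v u g' g (fun w hw => ih' w (hw.trans_lt hv))
              (ih' u hu) h' h hl' ha hw.symm).symm
          · exact (unique_far comm l k hl hk v u g' g (ih' v hv) (ih' u hu) h' h hl' ha hw.symm
              (by omega)).symm

/-- Matsumoto's theorem for the symmetric group. -/
theorem exists_reducedProduct
    (braid : ∀ k (hk : k + 2 < n), t k (Nat.lt_of_succ_lt hk) * (t (k + 1) hk *
      t k (Nat.lt_of_succ_lt hk)) = t (k + 1) hk * (t k (Nat.lt_of_succ_lt hk) * t (k + 1) hk))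
    (comm : ∀ k l hk hl, k + 1 < l → t k hk * t l hl = t l hl * t k hk) :
    ∃ Θ : Perm (Fin n) → G, Θ 1 = 1 ∧
      ∀ w k hk, Ascent w k hk → Θ (simple k hk * w) = t k hk * Θ w := by
  choose Θ hΘ using fun w => ReducedVal.exists (t := t) w
  exact ⟨Θ, ReducedVal.unique braid comm _ _ _ (hΘ 1) .one, fun w k hk ha =>
    ReducedVal.unique braid comm _ _ _ (hΘ _) (.step _ _ _ _ (hΘ w) ha)⟩

/-- The Coxeter presentation of the symmetric group. -/
theorem exists_monoidHom_of_coxeter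
    (sq : ∀ k hk, t k hk * t k hk = 1)
    (braid : ∀ k (hk : k + 2 < n), t k (Nat.lt_of_succ_lt hk) * (t (k + 1) hk *
      t k (Nat.lt_of_succ_lt hk)) = t (k + 1) hk * (t k (Nat.lt_of_succ_lt hk) * t (k + 1) hk))
    (comm : ∀ k l hk hl, k + 1 < l → t k hk * t l hl = t l hl * t k hk) :
    ∃ Θ : Perm (Fin n) →* G, ∀ k hk, Θ (simple k hk) = t k hk := by
  obtain ⟨Θ, h1, hs⟩ := exists_reducedProduct braid comm
  -- Since `t_k² = 1`, the recursion along ascents also holds at descents.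
  have hs' : ∀ w k hk, Θ (simple k hk * w) = t k hk * Θ w := by
    intro w k hk
    by_cases ha : Ascent w k hk
    · exact hs w k hk ha
    · have := hs _ k hk (not_ascent ha)
      rw [simple_mul_self_assoc] at this
      rw [this, ← mul_assoc, sq, one_mul]
  refine ⟨⟨⟨Θ, h1⟩, fun v w => ?_⟩, fun k hk => ?_⟩
  · change Θ (v * w) = Θ v * Θ w
    induction v using perm_induction with
    | one => rw [one_mul, h1, one_mul]
    | step v k hk _ ih => rw [mul_assoc, hs', ih, hs', mul_assoc]
  · have := hs' 1 k hk
    rwa [mul_one, h1, mul_one] at this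

end Matsumoto

/-! ## Relations of the affine Hecke-Clifford algebra -/

/-- Makes a two-letter rewriting rule applicable inside a right-associated product. With rules that
move the letters into a fixed order, noncommutative identities reduce to a comparison of normal
forms by `abel`. -/
theorem assoc_of {R : Type*} [Semigroup R] {a b r : R} (h : a * b = r) (t : R) :
    a * (b * t) = r * t := by rw [← mul_assoc, h]

/-- The relations between the generators `x_k` and `c_k`. -/
structure CXRel {R : Type*} [Ring R] {n : ℕ} (x c : Fin n → R) : Prop where
  c_sq (k : Fin n) : c k * c k = 1
  c_anti (k l : Fin n) (h : k ≠ l) : c k * c l = -(c l * c k)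
  x_comm (k l : Fin n) : x k * x l = x l * x k
  x_c (k : Fin n) : x k * c k = -(c k * x k)
  x_c_ne (k l : Fin n) (h : k ≠ l) : x k * c l = c l * x k

/-- The relations of the affine Hecke-Clifford algebra, without the braid relations. -/
structure HCRel {R : Type*} [Ring R] {n : ℕ} (x c : Fin n → R) (s : ∀ k, k + 1 < n → R) : Prop
    extends CXRel x c where
  s_sq (k : ℕ) (hk : k + 1 < n) : s k hk * s k hk = 1
  s_c (k : ℕ) (hk : k + 1 < n) (m : Fin n) : s k hk * c m = c (simple k hk m) * s k hk
  s_x (k : ℕ) (hk : k + 1 < n) : s k hk * x ⟨k, Nat.lt_of_succ_lt hk⟩ =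
    x ⟨k + 1, hk⟩ * s k hk - (1 + c ⟨k, Nat.lt_of_succ_lt hk⟩ * c ⟨k + 1, hk⟩)
  s_x_ne (k : ℕ) (hk : k + 1 < n) (m : Fin n) (h : m.val ≠ k) (h' : m.val ≠ k + 1) :
    s k hk * x m = x m * s k hk

/-- `e_{ab} = (x_a + x_b) + c_a c_b (x_a - x_b)`. -/
def eOp {R : Type*} [Ring R] {n : ℕ} (x c : Fin n → R) (a b : Fin n) : R :=
  (x a + x b) + c a * (c b * (x a - x b))

theorem CXRel.map {R S : Type*} [Ring R] [Ring S] {n : ℕ} {x c : Fin n → R} (h : CXRel x c)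
    (f : R →+* S) : CXRel (fun k => f (x k)) (fun k => f (c k)) where
  c_sq k := by rw [← map_mul, h.c_sq, map_one]
  c_anti k l e := by rw [← map_mul, h.c_anti k l e, map_neg, map_mul]
  x_comm k l := by rw [← map_mul, h.x_comm, map_mul]
  x_c k := by rw [← map_mul, h.x_c, map_neg, map_mul]
  x_c_ne k l e := by rw [← map_mul, h.x_c_ne k l e, map_mul]

theorem HCRel.map {R S : Type*} [Ring R] [Ring S] {n : ℕ} {x c : Fin n → R}
    {s : ∀ k, k + 1 < n → R} (h : HCRel x c s) (f : R →+* S) :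
    HCRel (fun k => f (x k)) (fun k => f (c k)) (fun k hk => f (s k hk)) where
  toCXRel := h.toCXRel.map f
  s_sq k hk := by rw [← map_mul, h.s_sq, map_one]
  s_c k hk m := by rw [← map_mul, h.s_c, map_mul]
  s_x k hk := by rw [← map_mul, h.s_x]; simp
  s_x_ne k hk m e e' := by rw [← map_mul, h.s_x_ne k hk m e e', map_mul]

/-! ### Identities for the elements `eOp` -/

section two

variable {R : Type*} [Ring R] {n : ℕ} {x c : Fin n → R}

theorem CXRel.eOp_sq (h : CXRel x c) {a b : Fin n} (hab : a ≠ b) :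
    eOp x c a b * eOp x c a b = 2 * (x a * x a + x b * x b) := by
  have r1 := h.c_sq a
  have r2 := h.c_sq b
  have r3 := h.c_anti b a hab.symm
  have r4 := h.x_c a
  have r5 := h.x_c b
  have r6 := h.x_c_ne a b hab
  have r7 := h.x_c_ne b a hab.symm
  have r8 := h.x_comm b a
  unfold eOp
  simp only [mul_add, add_mul, mul_sub, sub_mul, mul_assoc, r1, r2, r3, r4, r5, r6, r7, r8,
    assoc_of r1, assoc_of r2, assoc_of r3, assoc_of r4, assoc_of r5, assoc_of r6, assoc_of r7,
    assoc_of r8, neg_mul, mul_neg, neg_neg, one_mul, mul_one, two_mul]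
  abel

theorem CXRel.eOp_swap (h : CXRel x c) {a b : Fin n} (hab : a ≠ b) :
    eOp x c b a = eOp x c a b := by
  have r3 := h.c_anti b a hab.symm
  unfold eOp
  rw [← mul_assoc, r3, add_comm (x b), neg_mul, ← mul_neg, neg_sub, mul_assoc]

theorem CXRel.x_eOp (h : CXRel x c) {a b m : Fin n} (ha : m ≠ a) (hb : m ≠ b) :
    x m * eOp x c a b = eOp x c a b * x m := by
  have r4 := h.x_c_ne m a ha
  have r5 := h.x_c_ne m b hb
  have r6 := h.x_comm m a
  have r7 := h.x_comm m b
  unfold eOp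
  simp only [mul_add, add_mul, mul_sub, sub_mul, mul_assoc, r4, r5, r6, r7,
    assoc_of r4, assoc_of r5]

/-- The sign in `x_k c_k = -c_k x_k` occurs twice. The squares are thus central in the algebra of
the `x`'s and `c`'s, which makes their eigenspaces Clifford modules. -/
theorem CXRel.xsq_c (h : CXRel x c) (m l : Fin n) :
    x m * (x m * c l) = c l * (x m * x m) := by
  by_cases e : m = l
  · subst e
    rw [h.x_c, mul_neg, assoc_of (h.x_c m)]
    simp [mul_assoc]
  · rw [h.x_c_ne m l e, assoc_of (h.x_c_ne m l e), mul_assoc]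

theorem CXRel.xsq_x (h : CXRel x c) (m l : Fin n) :
    x m * (x m * x l) = x l * (x m * x m) := by
  rw [h.x_comm m l, assoc_of (h.x_comm m l), mul_assoc]

theorem CXRel.xsq_eOp (h : CXRel x c) (a b m : Fin n) :
    x m * (x m * eOp x c a b) = eOp x c a b * (x m * x m) := by
  have r1 : ∀ l t, x m * (x m * (c l * t)) = c l * (x m * (x m * t)) := fun l t => by
    have := congrArg (· * t) (h.xsq_c m l)
    simpa only [mul_assoc] using this
  have r2 := h.xsq_x m
  unfold eOp
  simp only [mul_add, add_mul, mul_sub, sub_mul, r1, r2, mul_assoc]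

/-- After division by `-(x_a² - x_b²)` these are the relations of a transposition with `c_a`, `c_b`
and `x_a`. This is why `Ξ` can be the diagonal part of `s_k`. -/
theorem CXRel.eOp_pair (h : CXRel x c) {a b : Fin n} (hab : a ≠ b) :
    eOp x c a b * c a = c b * eOp x c a b ∧ eOp x c a b * c b = c a * eOp x c a b ∧
    eOp x c a b * x a = x b * eOp x c a b + (x a * x a - x b * x b) +
      c a * (c b * (x a * x a - x b * x b)) := by
  have r1 := h.c_sq a
  have r2 := h.c_sq b
  have r3 := h.c_anti b a hab.symm
  have r4 := h.x_c a
  have r5 := h.x_c b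
  have r6 := h.x_c_ne a b hab
  have r7 := h.x_c_ne b a hab.symm
  have r8 := h.x_comm b a
  unfold eOp
  refine ⟨?_, ?_, ?_⟩ <;>
  · simp only [mul_add, add_mul, mul_sub, sub_mul, mul_assoc, r1, r2, r3, r4, r5, r6, r7, r8,
      assoc_of r1, assoc_of r2, assoc_of r3, assoc_of r4, assoc_of r5, assoc_of r6, assoc_of r7,
      assoc_of r8, neg_mul, mul_neg, neg_neg, one_mul, mul_one, two_mul]
    abel

theorem CXRel.eOp_c_ne (h : CXRel x c) {a b m : Fin n} (ha : a ≠ m) (hb : b ≠ m) :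
    eOp x c a b * c m = c m * eOp x c a b := by
  have t1 := h.x_c_ne _ m ha
  have t2 := h.x_c_ne _ m hb
  have t3 := h.c_anti _ m ha
  have t4 := h.c_anti _ m hb
  unfold eOp
  simp only [mul_add, add_mul, mul_sub, sub_mul, mul_assoc, t1, t2, t3, t4, assoc_of t1,
    assoc_of t2, assoc_of t3, assoc_of t4, neg_mul, mul_neg, neg_neg]

/-- The obstruction to the braid relation on a weight of the form `(a, b, a)`. -/
theorem CXRel.eOp_braid (h : CXRel x c) {a b d : Fin n} (hab : a ≠ b) (hbd : b ≠ d)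
    (had : a ≠ d) :
    eOp x c a b * (eOp x c b d * eOp x c a b) + eOp x c b d * (eOp x c a b * eOp x c b d) =
      (6 * x a * (x b * x b) + 2 * x d * (x a * x a) + 6 * x d * (x b * x b) +
        2 * x a * (x d * x d)) +
      c a * (c d * ((6 * x a * (x b * x b) - 2 * x d * (x a * x a) - 6 * x d * (x b * x b) +
        2 * x a * (x d * x d)))) +
      2 * (c a * (c b * (x b * (x a * x a - x d * x d)))) +
      2 * (c b * (c d * (x b * (x a * x a - x d * x d)))) := by
  have r1 := h.c_sq a
  have r2 := h.c_sq b
  have r3 := h.c_sq d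
  have r4 := h.c_anti b a hab.symm
  have r5 := h.c_anti d b hbd.symm
  have r6 := h.c_anti d a had.symm
  have r7 := h.x_c a
  have r8 := h.x_c b
  have r9 := h.x_c d
  have q1 := h.x_c_ne a b hab
  have q2 := h.x_c_ne a d had
  have q3 := h.x_c_ne b a hab.symm
  have q4 := h.x_c_ne b d hbd
  have q5 := h.x_c_ne d a had.symm
  have q6 := h.x_c_ne d b hbd.symm
  have q7 := h.x_comm b a
  have q8 := h.x_comm d a
  have q9 := h.x_comm d b
  have n6 : (6 : R) = 1 + 1 + 1 + 1 + 1 + 1 := by norm_num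
  unfold eOp
  rw [n6]
  simp only [mul_add, add_mul, mul_sub, sub_mul, mul_assoc, r1, r2, r3, r4, r5, r6, r7, r8, r9,
    q1, q2, q3, q4, q5, q6, q7, q8, q9,
    assoc_of r1, assoc_of r2, assoc_of r3, assoc_of r4, assoc_of r5, assoc_of r6, assoc_of r7,
    assoc_of r8, assoc_of r9, assoc_of q1, assoc_of q2, assoc_of q3, assoc_of q4, assoc_of q5,
    assoc_of q6, assoc_of q7, assoc_of q8, assoc_of q9,
    neg_mul, mul_neg, neg_neg, one_mul, mul_one, two_mul]
  abel

end two

/-! ### Intertwining elements and their relations -/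

section affine

variable {R : Type*} [Ring R] {n : ℕ} {x c : Fin n → R} {s : ∀ k, k + 1 < n → R}

/-- The intertwining element `Φ_k = s_k (x_k² - x_{k+1}²) + e_k`. -/
def Phi (x c : Fin n → R) (s : ∀ k, k + 1 < n → R) (k : ℕ) (hk : k + 1 < n) : R :=
  s k hk * (x ⟨k, Nat.lt_of_succ_lt hk⟩ * x ⟨k, Nat.lt_of_succ_lt hk⟩ -
    x ⟨k + 1, hk⟩ * x ⟨k + 1, hk⟩) + eOp x c ⟨k, Nat.lt_of_succ_lt hk⟩ ⟨k + 1, hk⟩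

theorem ne_succ {k : ℕ} (hk : k + 1 < n) :
    (⟨k, Nat.lt_of_succ_lt hk⟩ : Fin n) ≠ ⟨k + 1, hk⟩ := by simp

theorem HCRel.s_x' (h : HCRel x c s) (k : ℕ) (hk : k + 1 < n) :
    s k hk * x ⟨k + 1, hk⟩ = x ⟨k, Nat.lt_of_succ_lt hk⟩ * s k hk +
      (1 - c ⟨k, Nat.lt_of_succ_lt hk⟩ * c ⟨k + 1, hk⟩) := by
  have h1 := h.s_x k hk
  have h2 := h.s_c k hk ⟨k, Nat.lt_of_succ_lt hk⟩
  have h3 := h.s_c k hk ⟨k + 1, hk⟩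
  have h4 := h.c_anti _ _ (ne_succ hk).symm
  rw [simple_left] at h2
  rw [simple_right] at h3
  have h0 := h.s_sq k hk
  have := congrArg (fun t => s k hk * (t * s k hk)) h1
  simp only [mul_sub, sub_mul, mul_add, add_mul, mul_assoc, h2, h3, h4, h0, assoc_of h0,
    assoc_of h2, assoc_of h3, mul_one, one_mul, assoc_of h4, neg_mul] at this
  rw [this]
  abel

theorem HCRel.s_c_left (h : HCRel x c s) (k : ℕ) (hk : k + 1 < n) :
    s k hk * c ⟨k, Nat.lt_of_succ_lt hk⟩ = c ⟨k + 1, hk⟩ * s k hk := by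
  rw [h.s_c, simple_left]

theorem HCRel.s_c_right (h : HCRel x c s) (k : ℕ) (hk : k + 1 < n) :
    s k hk * c ⟨k + 1, hk⟩ = c ⟨k, Nat.lt_of_succ_lt hk⟩ * s k hk := by
  rw [h.s_c, simple_right]

/-- The summand `e_k` cancels the inhomogeneous term `1 + c_k c_{k+1}` of the relation between `s_k`
and `x_k`. -/
theorem HCRel.Phi_relations (h : HCRel x c s) (k : ℕ) (hk : k + 1 < n) :
    Phi x c s k hk * x ⟨k, Nat.lt_of_succ_lt hk⟩ = x ⟨k + 1, hk⟩ * Phi x c s k hk ∧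
    Phi x c s k hk * x ⟨k + 1, hk⟩ = x ⟨k, Nat.lt_of_succ_lt hk⟩ * Phi x c s k hk ∧
    Phi x c s k hk * c ⟨k, Nat.lt_of_succ_lt hk⟩ = c ⟨k + 1, hk⟩ * Phi x c s k hk ∧
    Phi x c s k hk * c ⟨k + 1, hk⟩ = c ⟨k, Nat.lt_of_succ_lt hk⟩ * Phi x c s k hk ∧
    s k hk * Phi x c s k hk = (x ⟨k, Nat.lt_of_succ_lt hk⟩ * x ⟨k, Nat.lt_of_succ_lt hk⟩ -
      x ⟨k + 1, hk⟩ * x ⟨k + 1, hk⟩) +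
      s k hk * eOp x c ⟨k, Nat.lt_of_succ_lt hk⟩ ⟨k + 1, hk⟩ := by
  have hab := ne_succ hk
  have s1 := h.s_x k hk
  have s2 := h.s_x' k hk
  have s3 := h.s_c_left k hk
  have s4 := h.s_c_right k hk
  have s5 := h.s_sq k hk
  unfold Phi eOp
  generalize (⟨k, Nat.lt_of_succ_lt hk⟩ : Fin n) = a at *
  generalize (⟨k + 1, hk⟩ : Fin n) = b at *
  have r1 := h.c_sq a
  have r2 := h.c_sq b
  have r3 := h.c_anti b a hab.symm
  have r4 := h.x_c a
  have r5 := h.x_c b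
  have r6 := h.x_c_ne a b hab
  have r7 := h.x_c_ne b a hab.symm
  have r8 := h.x_comm b a
  refine ⟨?_, ?_, ?_, ?_, ?_⟩
  · simp only [mul_add, add_mul, mul_sub, sub_mul, mul_assoc, r1, r2, r3, r4, r5, r6, r7, r8,
      assoc_of r1, assoc_of r2, assoc_of r3, assoc_of r4, assoc_of r5, assoc_of r6, assoc_of r7,
      assoc_of r8, neg_mul, mul_neg, neg_neg, one_mul, mul_one, s1, s2, s3, s4, s5, assoc_of s1,
      assoc_of s2, assoc_of s3, assoc_of s4, assoc_of s5]
    abel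
  · simp only [mul_add, add_mul, mul_sub, sub_mul, mul_assoc, r1, r2, r3, r4, r5, r6, r7, r8,
      assoc_of r1, assoc_of r2, assoc_of r3, assoc_of r4, assoc_of r5, assoc_of r6, assoc_of r7,
      assoc_of r8, neg_mul, mul_neg, neg_neg, one_mul, mul_one, s1, s2, s3, s4, s5, assoc_of s1,
      assoc_of s2, assoc_of s3, assoc_of s4, assoc_of s5]
    abel
  · simp only [mul_add, add_mul, mul_sub, sub_mul, mul_assoc, r1, r2, r3, r4, r5, r6, r7, r8,
      assoc_of r1, assoc_of r2, assoc_of r3, assoc_of r4, assoc_of r5, assoc_of r6, assoc_of r7,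
      assoc_of r8, neg_mul, mul_neg, neg_neg, one_mul, mul_one, s1, s2, s3, s4, s5, assoc_of s1,
      assoc_of s2, assoc_of s3, assoc_of s4, assoc_of s5]
    abel
  · simp only [mul_add, add_mul, mul_sub, sub_mul, mul_assoc, r1, r2, r3, r4, r5, r6, r7, r8,
      assoc_of r1, assoc_of r2, assoc_of r3, assoc_of r4, assoc_of r5, assoc_of r6, assoc_of r7,
      assoc_of r8, neg_mul, mul_neg, neg_neg, one_mul, mul_one, s1, s2, s3, s4, s5, assoc_of s1,
      assoc_of s2, assoc_of s3, assoc_of s4, assoc_of s5]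
    abel
  · rw [mul_add, ← mul_assoc, s5, one_mul]

theorem HCRel.Phi_c (h : HCRel x c s) (k : ℕ) (hk : k + 1 < n) (m : Fin n) :
    Phi x c s k hk * c m = c (simple k hk m) * Phi x c s k hk := by
  obtain ⟨-, -, h3, h4, -⟩ := h.Phi_relations k hk
  by_cases e : m = ⟨k, Nat.lt_of_succ_lt hk⟩
  · rw [e, simple_left, h3]
  by_cases e' : m = ⟨k + 1, hk⟩
  · rw [e', simple_right, h4]
  have e1 : m.val ≠ k := fun he => e (Fin.ext he)
  have e2 : m.val ≠ k + 1 := fun he => e' (Fin.ext he)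
  have hs := h.s_c k hk m
  rw [simple_of_ne k hk m e1 e2] at hs ⊢
  have t1 := h.x_c_ne _ m (Ne.symm e)
  have t2 := h.x_c_ne _ m (Ne.symm e')
  have t3 := h.c_anti _ m (Ne.symm e)
  have t4 := h.c_anti _ m (Ne.symm e')
  unfold Phi eOp
  simp only [mul_add, add_mul, mul_sub, sub_mul, mul_assoc, t1, t2, t3, t4, hs, assoc_of t1,
    assoc_of t2, assoc_of t3, assoc_of t4, assoc_of hs, neg_mul, mul_neg, neg_neg]

theorem HCRel.Phi_x (h : HCRel x c s) (k : ℕ) (hk : k + 1 < n) (m : Fin n) :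
    Phi x c s k hk * x m = x (simple k hk m) * Phi x c s k hk := by
  obtain ⟨h1, h2, -, -, -⟩ := h.Phi_relations k hk
  by_cases e : m = ⟨k, Nat.lt_of_succ_lt hk⟩
  · rw [e, simple_left, h1]
  by_cases e' : m = ⟨k + 1, hk⟩
  · rw [e', simple_right, h2]
  have e1 : m.val ≠ k := fun he => e (Fin.ext he)
  have e2 : m.val ≠ k + 1 := fun he => e' (Fin.ext he)
  have hs := h.s_x_ne k hk m e1 e2
  rw [simple_of_ne k hk m e1 e2]
  have t1 := h.x_comm ⟨k, Nat.lt_of_succ_lt hk⟩ m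
  have t2 := h.x_comm ⟨k + 1, hk⟩ m
  have t3 := h.x_eOp e e'
  unfold Phi
  rw [mul_add, add_mul, t3]
  congr 1
  simp only [mul_sub, sub_mul, mul_assoc, t1, t2, hs, assoc_of t1, assoc_of t2, assoc_of hs]

theorem HCRel.Phi_eOp (h : HCRel x c s) (k : ℕ) (hk : k + 1 < n) :
    Phi x c s k hk * eOp x c ⟨k, Nat.lt_of_succ_lt hk⟩ ⟨k + 1, hk⟩ =
      eOp x c ⟨k, Nat.lt_of_succ_lt hk⟩ ⟨k + 1, hk⟩ * Phi x c s k hk := by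
  obtain ⟨h1, h2, h3, h4, -⟩ := h.Phi_relations k hk
  rw [← h.eOp_swap (ne_succ hk)]
  conv_lhs => rw [h.eOp_swap (ne_succ hk)]
  unfold eOp
  simp only [mul_add, add_mul, mul_sub, sub_mul, mul_assoc, h1, h2, h3, h4, assoc_of h3,
    assoc_of h4]

theorem HCRel.Phi_xsq (h : HCRel x c s) (k : ℕ) (hk : k + 1 < n) (m : Fin n) :
    x m * (x m * Phi x c s k hk) =
      Phi x c s k hk * (x (simple k hk m) * x (simple k hk m)) := by
  have h1 := h.Phi_x k hk (simple k hk m)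
  rw [← Perm.mul_apply, simple_mul_self, Perm.one_apply] at h1
  rw [assoc_of h1, mul_assoc, h1]

/-- Put `d = x_k² - x_{k+1}²`. Then `Φ = s d + e` anticommutes with `d` and commutes with `e`, and
`s Φ = d + s e`, so the square collapses to `e² - d²`. -/
theorem HCRel.Phi_sq (h : HCRel x c s) (k : ℕ) (hk : k + 1 < n) :
    Phi x c s k hk * Phi x c s k hk =
      2 * (x ⟨k, Nat.lt_of_succ_lt hk⟩ * x ⟨k, Nat.lt_of_succ_lt hk⟩ +
        x ⟨k + 1, hk⟩ * x ⟨k + 1, hk⟩) -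
      (x ⟨k, Nat.lt_of_succ_lt hk⟩ * x ⟨k, Nat.lt_of_succ_lt hk⟩ -
        x ⟨k + 1, hk⟩ * x ⟨k + 1, hk⟩) * (x ⟨k, Nat.lt_of_succ_lt hk⟩ *
        x ⟨k, Nat.lt_of_succ_lt hk⟩ - x ⟨k + 1, hk⟩ * x ⟨k + 1, hk⟩) := by
  obtain ⟨-, -, -, -, h5⟩ := h.Phi_relations k hk
  have h6 := h.Phi_eOp k hk
  have h7 := h.eOp_sq (ne_succ hk)
  have h8 := h.Phi_xsq k hk ⟨k, Nat.lt_of_succ_lt hk⟩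
  have h9 := h.Phi_xsq k hk ⟨k + 1, hk⟩
  rw [simple_left] at h8
  rw [simple_right] at h9
  have h10 := h.xsq_eOp ⟨k, Nat.lt_of_succ_lt hk⟩ ⟨k + 1, hk⟩ ⟨k, Nat.lt_of_succ_lt hk⟩
  have h11 := h.xsq_eOp ⟨k, Nat.lt_of_succ_lt hk⟩ ⟨k + 1, hk⟩ ⟨k + 1, hk⟩
  set d := x ⟨k, Nat.lt_of_succ_lt hk⟩ * x ⟨k, Nat.lt_of_succ_lt hk⟩ -
    x ⟨k + 1, hk⟩ * x ⟨k + 1, hk⟩ with hd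
  set e := eOp x c ⟨k, Nat.lt_of_succ_lt hk⟩ ⟨k + 1, hk⟩ with he
  have h12 : d * Phi x c s k hk = - (Phi x c s k hk * d) := by
    rw [hd, sub_mul, mul_assoc, mul_assoc, h8, h9, mul_sub]; abel
  have h13 : d * e = e * d := by
    rw [hd, sub_mul, mul_assoc, mul_assoc, h10, h11, mul_sub]
  have hP : Phi x c s k hk = s k hk * d + e := rfl
  rw [← h7]
  calc Phi x c s k hk * Phi x c s k hk = (s k hk * d + e) * Phi x c s k hk := by rw [← hP]
    _ = - (s k hk * Phi x c s k hk * d) + Phi x c s k hk * e := by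
        rw [add_mul, mul_assoc, h12, h6, mul_neg, mul_assoc]
    _ = - ((d + s k hk * e) * d) + (s k hk * d + e) * e := by rw [h5, ← hP]
    _ = e * e - d * d := by
        rw [add_mul, add_mul, mul_assoc, mul_assoc, h13]; abel

/-- The commutation of the `s_k` is not assumed but kept as a factor. The identity is used in both
directions: from the `s_k` to the `Φ_k` in a given module, and from the `Φ_k` to the `s_k` on `D^i`,
where the other factor is an invertible scalar on each weight. -/
theorem HCRel.Phi_comm_diff (h : HCRel x c s) (k l : ℕ) (hk : k + 1 < n) (hl : l + 1 < n)
    (hkl : k + 1 < l) :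
    Phi x c s k hk * Phi x c s l hl - Phi x c s l hl * Phi x c s k hk =
      (s k hk * s l hl - s l hl * s k hk) *
        ((x ⟨k, Nat.lt_of_succ_lt hk⟩ * x ⟨k, Nat.lt_of_succ_lt hk⟩ -
          x ⟨k + 1, hk⟩ * x ⟨k + 1, hk⟩) *
        (x ⟨l, Nat.lt_of_succ_lt hl⟩ * x ⟨l, Nat.lt_of_succ_lt hl⟩ -
          x ⟨l + 1, hl⟩ * x ⟨l + 1, hl⟩)) := by
  have a1 := h.s_x_ne k hk ⟨l, Nat.lt_of_succ_lt hl⟩ (by simp; omega) (by simp; omega)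
  have a2 := h.s_x_ne k hk ⟨l + 1, hl⟩ (by simp; omega) (by simp; omega)
  have a3 := h.s_x_ne l hl ⟨k, Nat.lt_of_succ_lt hk⟩ (by simp; omega) (by simp; omega)
  have a4 := h.s_x_ne l hl ⟨k + 1, hk⟩ (by simp; omega) (by simp; omega)
  have b1 := h.s_c k hk ⟨l, Nat.lt_of_succ_lt hl⟩
  have b2 := h.s_c k hk ⟨l + 1, hl⟩
  have b3 := h.s_c l hl ⟨k, Nat.lt_of_succ_lt hk⟩
  have b4 := h.s_c l hl ⟨k + 1, hk⟩
  rw [simple_of_ne _ _ _ (by simp; omega) (by simp; omega)] at b1 b2 b3 b4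
  have n1 : (⟨k, Nat.lt_of_succ_lt hk⟩ : Fin n) ≠ ⟨l, Nat.lt_of_succ_lt hl⟩ := by simp; omega
  have n2 : (⟨k, Nat.lt_of_succ_lt hk⟩ : Fin n) ≠ ⟨l + 1, hl⟩ := by simp; omega
  have n3 : (⟨k + 1, hk⟩ : Fin n) ≠ ⟨l, Nat.lt_of_succ_lt hl⟩ := by simp; omega
  have n4 : (⟨k + 1, hk⟩ : Fin n) ≠ ⟨l + 1, hl⟩ := by simp; omega
  unfold Phi eOp
  generalize (⟨k, Nat.lt_of_succ_lt hk⟩ : Fin n) = p at *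
  generalize (⟨k + 1, hk⟩ : Fin n) = p' at *
  generalize (⟨l, Nat.lt_of_succ_lt hl⟩ : Fin n) = r at *
  generalize (⟨l + 1, hl⟩ : Fin n) = r' at *
  have c1 := h.c_anti _ _ n1.symm
  have c2 := h.c_anti _ _ n2.symm
  have c3 := h.c_anti _ _ n3.symm
  have c4 := h.c_anti _ _ n4.symm
  have d1 := h.x_c_ne _ _ n1
  have d2 := h.x_c_ne _ _ n2
  have d3 := h.x_c_ne _ _ n3
  have d4 := h.x_c_ne _ _ n4
  have d5 := h.x_c_ne _ _ n1.symm
  have d6 := h.x_c_ne _ _ n2.symm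
  have d7 := h.x_c_ne _ _ n3.symm
  have d8 := h.x_c_ne _ _ n4.symm
  have e1 := h.x_comm r p
  have e2 := h.x_comm r' p
  have e3 := h.x_comm r p'
  have e4 := h.x_comm r' p'
  generalize s k hk = S at *
  generalize s l hl = S' at *
  have f1 := a1.symm
  have f2 := a2.symm
  have f3 := a3.symm
  have f4 := a4.symm
  simp only [mul_add, add_mul, mul_sub, sub_mul, mul_assoc, b1, b2, b3, b4, c1, c2, c3, c4,
    d1, d2, d3, d4, d5, d6, d7, d8, e1, e2, e3, e4, f1, f2, f3, f4,
    assoc_of b1, assoc_of b2, assoc_of b3, assoc_of b4, assoc_of c1, assoc_of c2, assoc_of c3,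
    assoc_of c4, assoc_of d1, assoc_of d2, assoc_of d3, assoc_of d4, assoc_of d5, assoc_of d6,
    assoc_of d7, assoc_of d8, assoc_of e1, assoc_of e2, assoc_of e3, assoc_of e4, assoc_of f1,
    assoc_of f2, assoc_of f3, assoc_of f4, neg_mul, mul_neg, neg_neg]
  abel

-- A reduced form of the braid difference: one factor in each product is `s` instead of `Φ`, which
-- keeps the expansion manageable. The full difference follows by writing `Φ = s d + e` in that
-- factor.
set_option maxHeartbeats 8000000 in
theorem HCRel.Phi_braid_aux (h : HCRel x c s) (k : ℕ) (hk : k + 2 < n) :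
    let a : Fin n := ⟨k, Nat.lt_of_succ_lt (Nat.lt_of_succ_lt hk)⟩
    let b : Fin n := ⟨k + 1, Nat.lt_of_succ_lt hk⟩
    let d : Fin n := ⟨k + 2, hk⟩
    Phi x c s k (Nat.lt_of_succ_lt hk) * (Phi x c s (k + 1) hk * s k (Nat.lt_of_succ_lt hk)) -
      s (k + 1) hk * (Phi x c s k (Nat.lt_of_succ_lt hk) * Phi x c s (k + 1) hk) =
    (s k (Nat.lt_of_succ_lt hk) * (s (k + 1) hk * s k (Nat.lt_of_succ_lt hk)) -
      s (k + 1) hk * (s k (Nat.lt_of_succ_lt hk) * s (k + 1) hk)) *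
      ((x a * x a - x d * x d) * (x b * x b - x d * x d)) := by
  have hk1 : k + 1 < n := Nat.lt_of_succ_lt hk
  have a1 := h.s_x k hk1
  have a2 := h.s_x' k hk1
  have a3 := h.s_x_ne k hk1 ⟨k + 2, hk⟩ (by simp) (by simp)
  have b1 := h.s_x (k + 1) hk
  have b2 := h.s_x' (k + 1) hk
  have b3 := h.s_x_ne (k + 1) hk ⟨k, Nat.lt_of_succ_lt hk1⟩ (by simp)
    (by change k ≠ k + 1 + 1; omega)
  have a4 := h.s_c_left k hk1
  have a5 := h.s_c_right k hk1
  have a6 := h.s_c k hk1 ⟨k + 2, hk⟩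
  rw [simple_of_ne _ _ _ (by simp) (by simp)] at a6
  have b4 := h.s_c_left (k + 1) hk
  have b5 := h.s_c_right (k + 1) hk
  have b6 := h.s_c (k + 1) hk ⟨k, Nat.lt_of_succ_lt hk1⟩
  rw [simple_of_ne _ _ _ (by simp) (by change k ≠ k + 1 + 1; omega)] at b6
  have a7 := h.s_sq k hk1
  have b7 := h.s_sq (k + 1) hk
  intro a b d
  change s k hk1 * x a = x b * s k hk1 - (1 + c a * c b) at a1
  change s k hk1 * x b = x a * s k hk1 + (1 - c a * c b) at a2
  change s k hk1 * x d = x d * s k hk1 at a3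
  change s k hk1 * c a = c b * s k hk1 at a4
  change s k hk1 * c b = c a * s k hk1 at a5
  change s k hk1 * c d = c d * s k hk1 at a6
  change s (k + 1) hk * x b = x d * s (k + 1) hk - (1 + c b * c d) at b1
  change s (k + 1) hk * x d = x b * s (k + 1) hk + (1 - c b * c d) at b2
  change s (k + 1) hk * x a = x a * s (k + 1) hk at b3
  change s (k + 1) hk * c b = c d * s (k + 1) hk at b4
  change s (k + 1) hk * c d = c b * s (k + 1) hk at b5
  change s (k + 1) hk * c a = c a * s (k + 1) hk at b6
  have hab : a ≠ b := by simp [a, b]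
  have hbd : b ≠ d := by simp [b, d]
  have had : a ≠ d := by simp [a, d]
  change (s k hk1 * (x a * x a - x b * x b) + eOp x c a b) *
    ((s (k + 1) hk * (x b * x b - x d * x d) + eOp x c b d) * s k hk1) -
    s (k + 1) hk * ((s k hk1 * (x a * x a - x b * x b) + eOp x c a b) *
    (s (k + 1) hk * (x b * x b - x d * x d) + eOp x c b d)) = _
  have r1 := h.c_sq a
  have r2 := h.c_sq b
  have r3 := h.c_sq d
  have r4 := h.c_anti b a hab.symm
  have r5 := h.c_anti d b hbd.symm
  have r6 := h.c_anti d a had.symm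
  have r7 := h.x_c a
  have r8 := h.x_c b
  have r9 := h.x_c d
  have q1 := h.x_c_ne a b hab
  have q2 := h.x_c_ne a d had
  have q3 := h.x_c_ne b a hab.symm
  have q4 := h.x_c_ne b d hbd
  have q5 := h.x_c_ne d a had.symm
  have q6 := h.x_c_ne d b hbd.symm
  have q7 := h.x_comm b a
  have q8 := h.x_comm d a
  have q9 := h.x_comm d b
  unfold eOp
  generalize s k hk1 = S at *
  generalize s (k + 1) hk = S' at *
  clear_value a b d
  simp only [mul_add, add_mul, mul_sub, sub_mul, mul_assoc, a1, a2, a3, a4, a5, a6, a7, b1, b2,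
      b3, b4, b5, b6, b7, assoc_of a1, assoc_of a2, assoc_of a3, assoc_of a4, assoc_of a5,
      assoc_of a6, assoc_of a7, assoc_of b1, assoc_of b2, assoc_of b3, assoc_of b4, assoc_of b5,
      assoc_of b6, assoc_of b7, r1, r2, r3, r4, r5, r6, r7, r8, r9,
    q1, q2, q3, q4, q5, q6, q7, q8, q9,
    assoc_of r1, assoc_of r2, assoc_of r3, assoc_of r4, assoc_of r5, assoc_of r6, assoc_of r7,
    assoc_of r8, assoc_of r9, assoc_of q1, assoc_of q2, assoc_of q3, assoc_of q4, assoc_of q5,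
    assoc_of q6, assoc_of q7, assoc_of q8, assoc_of q9,
    neg_mul, mul_neg, neg_neg, one_mul, mul_one]
  abel

theorem HCRel.Phi_eOp_simple (h : HCRel x c s) (k : ℕ) (hk : k + 1 < n) (p r : Fin n) :
    Phi x c s k hk * eOp x c p r =
      eOp x c (simple k hk p) (simple k hk r) * Phi x c s k hk := by
  have h1 := h.Phi_x k hk
  have h2 := h.Phi_c k hk
  unfold eOp
  simp only [mul_add, add_mul, mul_sub, sub_mul, mul_assoc, h1, h2, fun m => assoc_of (h2 m)]

/-- The braid relation for the intertwiners is equivalent to that for the `s_k`, up to a factor. -/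
theorem HCRel.Phi_braid_diff (h : HCRel x c s) (k : ℕ) (hk : k + 2 < n) :
    let a : Fin n := ⟨k, Nat.lt_of_succ_lt (Nat.lt_of_succ_lt hk)⟩
    let b : Fin n := ⟨k + 1, Nat.lt_of_succ_lt hk⟩
    let d : Fin n := ⟨k + 2, hk⟩
    Phi x c s k (Nat.lt_of_succ_lt hk) *
        (Phi x c s (k + 1) hk * Phi x c s k (Nat.lt_of_succ_lt hk)) -
      Phi x c s (k + 1) hk * (Phi x c s k (Nat.lt_of_succ_lt hk) * Phi x c s (k + 1) hk) =
    (s k (Nat.lt_of_succ_lt hk) * (s (k + 1) hk * s k (Nat.lt_of_succ_lt hk)) -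
      s (k + 1) hk * (s k (Nat.lt_of_succ_lt hk) * s (k + 1) hk)) *
      ((x a * x a - x d * x d) * (x b * x b - x d * x d)) * (x a * x a - x b * x b) := by
  intro a b d
  have hk1 : k + 1 < n := Nat.lt_of_succ_lt hk
  have sa : simple k hk1 a = b := simple_left _ _
  have sb : simple k hk1 b = a := simple_right _ _
  have sd : simple k hk1 d = d := simple_of_ne _ _ _ (by simp [d]) (by simp [d])
  have ra : simple (k + 1) hk a = a :=
    simple_of_ne _ _ _ (by simp [a]) (by simp only [a]; omega)
  have rb : simple (k + 1) hk b = d := simple_left _ _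
  have rd : simple (k + 1) hk d = b := simple_right _ _
  have haux := h.Phi_braid_aux k hk
  change Phi x c s k hk1 * (Phi x c s (k + 1) hk * s k hk1) -
      s (k + 1) hk * (Phi x c s k hk1 * Phi x c s (k + 1) hk) = _ at haux
  have hP : Phi x c s k hk1 = s k hk1 * (x a * x a - x b * x b) + eOp x c a b := rfl
  have hP' : Phi x c s (k + 1) hk = s (k + 1) hk * (x b * x b - x d * x d) + eOp x c b d := rfl
  -- The product `Φ_k Φ_{k+1}` carries the indices `(a, b)` to `(b, d)`. Hence the `e`-parts of the
  -- two outer factors cancel, and their `s`-parts give the reduced difference.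
  have e1 : Phi x c s k hk1 * (Phi x c s (k + 1) hk * eOp x c a b) =
      eOp x c b d * (Phi x c s k hk1 * Phi x c s (k + 1) hk) := by
    rw [h.Phi_eOp_simple, ra, rb, assoc_of (h.Phi_eOp_simple k hk1 a d), sa, sd, mul_assoc]
  have e2 : (x b * x b - x d * x d) * (Phi x c s k hk1 * Phi x c s (k + 1) hk) =
      Phi x c s k hk1 * (Phi x c s (k + 1) hk * (x a * x a - x b * x b)) := by
    have m1 := h.Phi_x k hk1 a
    have m2 := h.Phi_x k hk1 d
    have m3 := h.Phi_x (k + 1) hk a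
    have m4 := h.Phi_x (k + 1) hk b
    rw [sa] at m1
    rw [sd] at m2
    rw [ra] at m3
    rw [rb] at m4
    simp only [mul_sub, sub_mul, mul_assoc, m3, m4, assoc_of m3, assoc_of m4, assoc_of m1,
      assoc_of m2, m1, m2]
  change Phi x c s k hk1 * (Phi x c s (k + 1) hk * Phi x c s k hk1) -
      Phi x c s (k + 1) hk * (Phi x c s k hk1 * Phi x c s (k + 1) hk) = _
  rw [← haux, sub_mul]
  conv_lhs =>
    enter [1, 2, 2]
    rw [hP]
  conv_lhs =>
    enter [2, 1]
    rw [hP']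
  rw [mul_add, mul_add, e1, add_mul, mul_assoc (s (k + 1) hk), e2]
  simp only [mul_assoc]
  abel

end affine

/-! ## Relations in `𝒴ₙ` -/

namespace Y

variable {F : Type u} [Field F] {n : ℕ}

theorem w_one : Y.w F (1 : Perm (Fin n)) = 1 := by
  rw [Y.w, RingQuot.mkAlgHom_rel F (YRel.w_one (F := F)), map_one]

theorem w_mul (σ τ : Perm (Fin n)) : Y.w F (σ * τ) = Y.w F σ * Y.w F τ := by
  rw [Y.w, RingQuot.mkAlgHom_rel F (YRel.w_mul (F := F) σ τ), map_mul]; rfl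

theorem c_sq (k : Fin n) : Y.c F k * Y.c F k = 1 := by
  rw [Y.c, ← map_mul, RingQuot.mkAlgHom_rel F (YRel.c_sq (F := F) k), map_one]

theorem c_anticomm (k l : Fin n) (h : k ≠ l) : Y.c F k * Y.c F l = -(Y.c F l * Y.c F k) := by
  rw [Y.c, Y.c, ← map_mul, RingQuot.mkAlgHom_rel F (YRel.c_anticomm (F := F) k l h), map_neg,
    map_mul]

theorem w_c (σ : Perm (Fin n)) (k : Fin n) :
    Y.w F σ * Y.c F k = Y.c F (σ k) * Y.w F σ := by
  rw [Y.w, Y.c, ← map_mul, RingQuot.mkAlgHom_rel F (YRel.w_c (F := F) σ k), map_mul]; rfl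

@[elab_as_elim]
theorem induction {P : Y F n → Prop} (a : Y F n) (algebraMap : ∀ r : F, P (algebraMap F _ r))
    (c : ∀ k, P (Y.c F k)) (w : ∀ σ, P (Y.w F σ)) (add : ∀ a b, P a → P b → P (a + b))
    (mul : ∀ a b, P a → P b → P (a * b)) : P a := by
  obtain ⟨a, rfl⟩ := RingQuot.mkAlgHom_surjective F (YRel F n) a
  induction a using FreeAlgebra.induction with
  | grade0 r => rw [AlgHom.commutes]; exact algebraMap r
  | grade1 g => cases g with
    | c k => exact c k
    | w σ => exact w σ
  | mul a b ha hb => rw [map_mul]; exact mul _ _ ha hb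
  | add a b ha hb => rw [map_add]; exact add _ _ ha hb

/-- The universal property of `𝒴ₙ`. -/
theorem exists_lift {A : Type*} [Ring A] [Algebra F A] (γ : Fin n → A) (ω : Perm (Fin n) →* A)
    (hsq : ∀ k, γ k * γ k = 1) (hanti : ∀ k l, k ≠ l → γ k * γ l = -(γ l * γ k))
    (hω : ∀ σ k, ω σ * γ k = γ (σ k) * ω σ) :
    ∃ f : Y F n →ₐ[F] A, (∀ k, f (Y.c F k) = γ k) ∧ ∀ σ, f (Y.w F σ) = ω σ := by
  let g : YGen n → A := fun y => match y with
    | .c k => γ k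
    | .w σ => ω σ
  have hg : ∀ ⦃a b : FreeAlgebra F (YGen n)⦄, YRel F n a b →
      FreeAlgebra.lift F g a = FreeAlgebra.lift F g b := by
    intro a b h
    cases h with
    | w_one => simp [g]
    | w_mul σ τ => simp [g]
    | c_sq k => simp [g, hsq]
    | c_anticomm k l h => simp [g, hanti k l h]
    | w_c σ k => simp [g, hω]
  refine ⟨RingQuot.liftAlgHom F ⟨FreeAlgebra.lift F g, hg⟩, fun k => ?_, fun σ => ?_⟩
  · rw [Y.c, RingQuot.liftAlgHom_mkAlgHom_apply, FreeAlgebra.lift_ι_apply]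
  · rw [Y.w, RingQuot.liftAlgHom_mkAlgHom_apply, FreeAlgebra.lift_ι_apply]

theorem neg_mul' (a b : Y F n) : -a * b = -(a * b) := neg_mul a b

theorem mul_neg' (a b : Y F n) : a * -b = -(a * b) := mul_neg a b

/-! ### Commutation relations of the Jucys-Murphy elements -/

theorem w_jm (σ : Perm (Fin n)) (l : Fin n) (hl : σ l = l) (h : ∀ j, σ j < l ↔ j < l) :
    Y.w F σ * Y.jm F l = Y.jm F l * Y.w F σ := by
  unfold Y.jm
  rw [Finset.mul_sum, Finset.sum_mul]
  refine Finset.sum_nbij' σ σ.symm (fun j hj => ?_) (fun j hj => ?_) (fun j _ => by simp)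
    (fun j _ => by simp) (fun j _ => ?_)
  · exact Finset.mem_Iio.mpr ((h j).mpr (Finset.mem_Iio.mp hj))
  · refine Finset.mem_Iio.mpr ((h _).mp ?_)
    rw [Equiv.apply_symm_apply]; exact Finset.mem_Iio.mp hj
  · have e : σ * swap j l = swap (σ j) l * σ := by
      conv_rhs => rw [← hl]
      rw [Equiv.swap_apply_apply, mul_assoc, inv_mul_cancel, mul_one]
    have e' : Y.w F σ * Y.w F (swap j l) = Y.w F (swap (σ j) l) * Y.w F σ := by
      rw [← w_mul, e, w_mul]
    have hc := w_c (F := F) σ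
    simp only [mul_add, add_mul, mul_assoc, one_mul, e', hc, fun k => assoc_of (hc k), hl]

theorem c_jm_of_gt (l m : Fin n) (h : l < m) :
    Y.jm F l * Y.c F m = Y.c F m * Y.jm F l := by
  unfold Y.jm
  rw [Finset.mul_sum, Finset.sum_mul]
  refine Finset.sum_congr rfl fun j hj => ?_
  have hj := Finset.mem_Iio.mp hj
  have h1 := w_c (F := F) (swap j l) m
  rw [swap_apply_of_ne_of_ne (hj.trans h).ne' h.ne'] at h1
  have h2 := c_anticomm (F := F) j m (hj.trans h).ne
  have h3 := c_anticomm (F := F) l m h.ne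
  simp only [mul_add, add_mul, mul_assoc, one_mul, h1, h2, h3, assoc_of h2, assoc_of h3, neg_mul', neg_mul', mul_neg',
    mul_neg, neg_neg]

theorem c_jm_self (l : Fin n) : Y.jm F l * Y.c F l = -(Y.c F l * Y.jm F l) := by
  unfold Y.jm
  rw [Finset.mul_sum, Finset.sum_mul, ← Finset.sum_neg_distrib]
  refine Finset.sum_congr rfl fun j hj => ?_
  have hj := Finset.mem_Iio.mp hj
  have h1 := w_c (F := F) (swap j l) l
  rw [swap_apply_right] at h1
  have h2 := c_anticomm (F := F) l j hj.ne'
  have h3 := c_sq (F := F) l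
  have h4 := c_sq (F := F) j
  simp only [mul_add, add_mul, mul_assoc, one_mul, h1, h2, h3, h4, assoc_of h2, assoc_of h3,
    assoc_of h4, neg_mul', mul_neg', mul_neg, neg_neg, mul_one]
  abel

/-- Holds for each summand. For `j = m` the transposition turns `c_m` into `c_l`, and `(1 + c_m c_l)
c_l = c_m + c_l = c_m (1 + c_m c_l)`. -/
theorem c_jm_of_lt (l m : Fin n) (h : m < l) :
    Y.jm F l * Y.c F m = Y.c F m * Y.jm F l := by
  unfold Y.jm
  rw [Finset.mul_sum, Finset.sum_mul]
  refine Finset.sum_congr rfl fun j hj => ?_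
  have hj := Finset.mem_Iio.mp hj
  have h1 := w_c (F := F) (swap j l) m
  have h3 := c_anticomm (F := F) l m h.ne'
  by_cases e : j = m
  · subst e
    rw [swap_apply_left] at h1
    have h4 := c_sq (F := F) j
    have h5 := c_sq (F := F) l
    simp only [mul_add, add_mul, mul_assoc, one_mul, h1, h3, assoc_of h3, h4, h5, assoc_of h4,
      assoc_of h5, neg_mul', mul_neg', mul_neg, neg_neg, mul_one]
    abel
  · rw [swap_apply_of_ne_of_ne (Ne.symm e) h.ne] at h1
    have h2 := c_anticomm (F := F) j m e
    simp only [mul_add, add_mul, mul_assoc, one_mul, h1, h2, h3, assoc_of h2, assoc_of h3,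
      neg_mul', mul_neg', mul_neg, neg_neg]

theorem c_jm_of_ne (l m : Fin n) (h : l ≠ m) :
    Y.jm F l * Y.c F m = Y.c F m * Y.jm F l := by
  rcases lt_or_gt_of_ne h with h | h
  · exact c_jm_of_gt l m h
  · exact c_jm_of_lt l m h

/-- Each summand `(1 + c_j c_k)(j k)` of `L_k` commutes with `L_l`, because `(j k)` fixes `l` and
permutes the indices below it. -/
theorem jm_comm_of_lt (k l : Fin n) (h : k < l) : Y.jm F k * Y.jm F l = Y.jm F l * Y.jm F k := by
  conv_lhs => rw [Y.jm]
  conv_rhs => enter [2]; rw [Y.jm]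
  rw [Finset.mul_sum, Finset.sum_mul]
  refine Finset.sum_congr rfl fun j hj => ?_
  have hj := Finset.mem_Iio.mp hj
  have h1 := w_jm (F := F) (swap j k) l (swap_apply_of_ne_of_ne (hj.trans h).ne' h.ne') (by
    intro i
    rw [swap_apply_def]
    split_ifs with h1 h2
    · subst h1; simp [h, hj.trans h]
    · subst h2; simp [h, hj.trans h]
    · rfl)
  have h2 := (c_jm_of_ne (F := F) l j (hj.trans h).ne').symm
  have h3 := (c_jm_of_ne (F := F) l k h.ne').symm
  simp only [mul_add, add_mul, mul_assoc, one_mul, mul_one, h1, assoc_of h2, h3, assoc_of h3, h2]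

theorem jm_comm (k l : Fin n) : Y.jm F k * Y.jm F l = Y.jm F l * Y.jm F k := by
  rcases lt_trichotomy k l with h | h | h
  · exact jm_comm_of_lt k l h
  · rw [h]
  · exact (jm_comm_of_lt l k h).symm

theorem w_simple_sq (k : ℕ) (hk : k + 1 < n) :
    Y.w F (simple k hk) * Y.w F (simple k hk) = 1 := by
  rw [← w_mul, simple_mul_self, w_one]

/-- Conjugation by `s_k` turns the summands of `L_k` into those of `L_{k+1}` with `j < k`; the
summand `j = k` gives the correction. -/
theorem jm_succ (k : ℕ) (hk : k + 1 < n) :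
    Y.w F (simple k hk) * Y.jm F ⟨k, Nat.lt_of_succ_lt hk⟩ =
      Y.jm F ⟨k + 1, hk⟩ * Y.w F (simple k hk) -
        (1 + Y.c F ⟨k, Nat.lt_of_succ_lt hk⟩ * Y.c F ⟨k + 1, hk⟩) := by
  have hI : Finset.Iio (⟨k + 1, hk⟩ : Fin n) =
      insert ⟨k, Nat.lt_of_succ_lt hk⟩ (Finset.Iio ⟨k, Nat.lt_of_succ_lt hk⟩) := by
    ext a
    simp only [Finset.mem_Iio, Finset.mem_insert, Fin.lt_def, Fin.ext_iff]
    omega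
  rw [eq_sub_iff_add_eq]
  conv_rhs => rw [Y.jm, hI, Finset.sum_insert (by simp), add_mul]
  rw [add_comm]
  congr 1
  · change _ = (_ * Y.w F (simple k hk)) * Y.w F (simple k hk)
    rw [mul_assoc, w_simple_sq, mul_one]
  · rw [Y.jm, Finset.mul_sum, Finset.sum_mul]
    refine Finset.sum_congr rfl fun j hj => ?_
    have hj := Finset.mem_Iio.mp hj
    have hj1 : j.val ≠ k := (Fin.lt_def.mp hj).ne
    have hj2 : j.val ≠ k + 1 := by have := Fin.lt_def.mp hj; simp at this; omega
    have h1 := w_c (F := F) (simple k hk) j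
    rw [simple_of_ne k hk j hj1 hj2] at h1
    have h2 := w_c (F := F) (simple k hk) ⟨k, Nat.lt_of_succ_lt hk⟩
    rw [simple_left] at h2
    have e : simple k hk * swap j ⟨k, Nat.lt_of_succ_lt hk⟩ =
        swap j ⟨k + 1, hk⟩ * simple k hk := by
      have := Equiv.swap_apply_apply (simple k hk) j ⟨k, Nat.lt_of_succ_lt hk⟩
      rw [simple_of_ne k hk j hj1 hj2, simple_left] at this
      rw [this, mul_assoc, inv_mul_cancel, mul_one]
    have e' : Y.w F (simple k hk) * Y.w F (swap j ⟨k, Nat.lt_of_succ_lt hk⟩) =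
        Y.w F (swap j ⟨k + 1, hk⟩) * Y.w F (simple k hk) := by
      rw [← w_mul, e, w_mul]
    simp only [mul_add, add_mul, mul_assoc, one_mul, e', h1, h2, assoc_of h1, assoc_of h2]

theorem hcRel : HCRel (Y.jm F (n := n)) (Y.c F) (fun k hk => Y.w F (simple k hk)) where
  c_sq := c_sq
  c_anti := c_anticomm
  x_comm := jm_comm
  x_c := c_jm_self
  x_c_ne k l h := c_jm_of_ne k l h
  s_sq := w_simple_sq
  s_c k hk m := w_c _ _
  s_x := jm_succ
  s_x_ne k hk m h h' := by
    refine w_jm _ m (simple_of_ne k hk m h h') fun j => ?_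
    rw [Fin.lt_def, Fin.lt_def, simple_val]
    split_ifs <;> omega

theorem jm_zero (h : 0 < n) : Y.jm F (⟨0, h⟩ : Fin n) = 0 := by
  unfold Y.jm
  refine Finset.sum_eq_zero fun j hj => ?_
  simp [Fin.lt_def] at hj

theorem w_braid (k : ℕ) (hk : k + 2 < n) :
    Y.w F (simple k (Nat.lt_of_succ_lt hk)) * (Y.w F (simple (k + 1) hk) *
      Y.w F (simple k (Nat.lt_of_succ_lt hk))) = Y.w F (simple (k + 1) hk) *
        (Y.w F (simple k (Nat.lt_of_succ_lt hk)) * Y.w F (simple (k + 1) hk)) := by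
  simp only [← w_mul, simple_braid]

theorem w_comm (k l : ℕ) (hk : k + 1 < n) (hl : l + 1 < n) (h : k + 1 < l) :
    Y.w F (simple k hk) * Y.w F (simple l hl) = Y.w F (simple l hl) * Y.w F (simple k hk) := by
  rw [← w_mul, simple_comm k l hk hl h, w_mul]

theorem c_mem_parity (k : Fin n) : Y.c F k ∈ Y.parity F (n := n) 1 :=
  Submodule.subset_span ⟨[k], 1, by simp, by simp [w_one]⟩

theorem w_mem_parity (σ : Perm (Fin n)) : Y.w F σ ∈ Y.parity F (n := n) 0 :=
  Submodule.subset_span ⟨[], σ, by simp, by simp⟩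

theorem prod_w_mul (σ : Perm (Fin n)) (l : List (Fin n)) :
    Y.w F σ * (l.map (Y.c F)).prod = ((l.map σ).map (Y.c F)).prod * Y.w F σ := by
  induction l with
  | nil => simp
  | cons k l ih =>
    simp only [List.map_cons, List.prod_cons]
    rw [← mul_assoc, w_c, mul_assoc, ih, mul_assoc]

theorem mul_mem_parity {d e : ZMod 2} {a b : Y F n} (ha : a ∈ Y.parity F d)
    (hb : b ∈ Y.parity F e) : a * b ∈ Y.parity F (d + e) := by
  induction ha using Submodule.span_induction with
  | zero => rw [zero_mul]; exact zero_mem _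
  | add a a' _ _ h h' => rw [add_mul]; exact add_mem h h'
  | smul r a _ h => rw [smul_mul_assoc]; exact Submodule.smul_mem _ _ h
  | mem a ha =>
    obtain ⟨l, σ, hl, rfl⟩ := ha
    induction hb using Submodule.span_induction with
    | zero => rw [mul_zero]; exact zero_mem _
    | add a a' _ _ h h' => rw [mul_add]; exact add_mem h h'
    | smul r a _ h => rw [mul_smul_comm]; exact Submodule.smul_mem _ _ h
    | mem b hb =>
      obtain ⟨l', σ', hl', rfl⟩ := hb
      refine Submodule.subset_span ⟨l ++ l'.map σ, σ * σ', ?_, ?_⟩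
      · simp [hl, hl']
      · rw [mul_assoc, ← mul_assoc (Y.w F σ), prod_w_mul, w_mul, List.map_append, List.prod_append]
        simp only [mul_assoc]

theorem jm_mem_parity (k : Fin n) : Y.jm F k ∈ Y.parity F (n := n) 0 := by
  refine Submodule.sum_mem _ fun j _ => ?_
  rw [add_mul, one_mul]
  refine add_mem (w_mem_parity _) ?_
  have := mul_mem_parity (mul_mem_parity (c_mem_parity (F := F) j) (c_mem_parity (F := F) k))
    (w_mem_parity (F := F) (swap j k))
  rwa [show (1 : ZMod 2) + 1 + 0 = 0 from rfl] at this

theorem one_mem_parity : (1 : Y F n) ∈ Y.parity F (n := n) 0 := by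
  rw [← w_one]; exact w_mem_parity 1

theorem exists_parity_add (a : Y F n) :
    ∃ b ∈ Y.parity F (n := n) 0, ∃ d ∈ Y.parity F (n := n) 1, a = b + d := by
  induction a using Y.induction with
  | algebraMap r =>
    refine ⟨_, ?_, 0, zero_mem _, (add_zero _).symm⟩
    rw [Algebra.algebraMap_eq_smul_one]
    exact Submodule.smul_mem _ _ one_mem_parity
  | c k => exact ⟨0, zero_mem _, _, c_mem_parity k, (zero_add _).symm⟩
  | w σ => exact ⟨_, w_mem_parity σ, 0, zero_mem _, (add_zero _).symm⟩
  | add a b ha hb =>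
    obtain ⟨a0, h0, a1, h1, rfl⟩ := ha
    obtain ⟨b0, k0, b1, k1, rfl⟩ := hb
    exact ⟨_, add_mem h0 k0, _, add_mem h1 k1, by abel⟩
  | mul a b ha hb =>
    obtain ⟨a0, h0, a1, h1, rfl⟩ := ha
    obtain ⟨b0, k0, b1, k1, rfl⟩ := hb
    refine ⟨a0 * b0 + a1 * b1, add_mem ?_ ?_, a0 * b1 + a1 * b0, add_mem ?_ ?_, ?_⟩
    · simpa using mul_mem_parity h0 k0
    · have := mul_mem_parity h1 k1
      rwa [show (1 : ZMod 2) + 1 = 0 from rfl] at this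
    · simpa using mul_mem_parity h0 k1
    · simpa using mul_mem_parity h1 k0
    · simp only [add_mul, mul_add]; abel

end Y

/-! ## Joint eigenspaces -/

section joint

variable {F : Type*} [Field F] {M : Type*} [AddCommGroup M] [Module F M] {κ : Type*}

/-- The joint eigenspace of a family of operators. -/
def jointEigen (f : κ → Module.End F M) (χ : κ → F) : Submodule F M where
  carrier := {v | ∀ k, f k v = χ k • v}
  zero_mem' := fun k => by simp
  add_mem' := fun {a b} ha hb k => by rw [map_add, ha k, hb k, smul_add]
  smul_mem' := fun r a ha k => by rw [map_smul, ha k, smul_comm]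

theorem mem_jointEigen {f : κ → Module.End F M} {χ : κ → F} {v : M} :
    v ∈ jointEigen f χ ↔ ∀ k, f k v = χ k • v := Iff.rfl

/-- Joint eigenspaces lie in the intersections of generalized eigenspaces, which are independent for
commuting operators. -/
theorem jointEigen_independent (f : κ → Module.End F M) (h : ∀ i j, f i * f j = f j * f i) :
    iSupIndep (jointEigen f) := by
  refine (Module.End.independent_iInf_maxGenEigenspace_of_forall_mapsTo f
    (fun i j φ => Module.End.mapsTo_maxGenEigenspace_of_comm (h j i) φ)).mono fun χ v hv => ?_
  refine Submodule.mem_iInf _ |>.mpr fun k => ?_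
  exact (Module.End.genEigenspace (f k) (χ k)).monotone le_top
    (Module.End.mem_eigenspace_iff.mpr (hv k))

/-- A joint eigenvector that is a sum of joint eigenvectors is the sum of those with the same
eigenvalues. -/
theorem sum_jointEigen {f : κ → Module.End F M} (h : ∀ i j, f i * f j = f j * f i)
    {ι : Type*} [Fintype ι] (χ : ι → κ → F) (y : ι → M) (hy : ∀ α, y α ∈ jointEigen f (χ α))
    (ψ : κ → F) (hψ : ∑ α, y α ∈ jointEigen f ψ) [DecidablePred fun α => χ α = ψ] :
    ∑ α, y α = ∑ α with χ α = ψ, y α := by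
  have h1 := Finset.sum_filter_add_sum_filter_not Finset.univ (fun α => χ α = ψ) y
  have h2 : ∑ α with χ α = ψ, y α ∈ jointEigen f ψ :=
    Submodule.sum_mem _ fun α hα => by
      rw [← (Finset.mem_filter.mp hα).2]; exact hy α
  have h3 : ∑ α with ¬ χ α = ψ, y α ∈ ⨆ (χ' : κ → F) (_ : χ' ≠ ψ), jointEigen f χ' :=
    Submodule.sum_mem _ fun α hα =>
      Submodule.mem_iSup_of_mem (χ α) (Submodule.mem_iSup_of_mem (Finset.mem_filter.mp hα).2 (hy α))
  have h4 : ∑ α with ¬ χ α = ψ, y α ∈ jointEigen f ψ := by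
    rw [eq_sub_of_add_eq' h1]
    exact sub_mem hψ h2
  have := Submodule.disjoint_def.mp (jointEigen_independent f h ψ) _ h4 h3
  rw [← h1, this, add_zero]

end joint

/-! ## Weight spaces -/

section weights

variable {F : Type*} [Field F] {M : Type*} [AddCommGroup M] [Module F M] {n : ℕ}
  {x c : Fin n → Module.End F M} {s : ∀ k, k + 1 < n → Module.End F M}

/-- The joint eigenspaces of the operators `x_k²`. -/
def wt (x : Fin n → Module.End F M) (χ : Fin n → F) : Submodule F M :=
  jointEigen (fun k => x k * x k) χ

theorem mem_wt {χ : Fin n → F} {v : M} : v ∈ wt x χ ↔ ∀ k, x k (x k v) = χ k • v := Iff.rfl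

theorem CXRel.xsq_comm (h : CXRel x c) (i j : Fin n) :
    x i * x i * (x j * x j) = x j * x j * (x i * x i) := by
  have h1 : Commute (x i) (x j) := h.x_comm i j
  exact ((h1.mul_right h1).mul_left (h1.mul_right h1)).eq

theorem CXRel.c_mem_wt (h : CXRel x c) {χ : Fin n → F} {v : M} (hv : v ∈ wt x χ) (m : Fin n) :
    c m v ∈ wt x χ := fun k => by
  have := congrArg (· v) (h.xsq_c k m)
  simp only [Module.End.mul_apply] at this ⊢
  rw [this, mem_wt.mp hv k, map_smul]

theorem CXRel.x_mem_wt (h : CXRel x c) {χ : Fin n → F} {v : M} (hv : v ∈ wt x χ) (m : Fin n) :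
    x m v ∈ wt x χ := fun k => by
  have := congrArg (· v) (h.xsq_x k m)
  simp only [Module.End.mul_apply] at this ⊢
  rw [this, mem_wt.mp hv k, map_smul]

theorem eOp_apply (a b : Fin n) (v : M) :
    eOp x c a b v = (x a v + x b v) + c a (c b (x a v - x b v)) := by
  simp [eOp]

theorem eOp_mem {L : Submodule F M} (hc : ∀ m, ∀ v ∈ L, c m v ∈ L) (hx : ∀ m, ∀ v ∈ L, x m v ∈ L)
    (a b : Fin n) {v : M} (hv : v ∈ L) : eOp x c a b v ∈ L := by
  rw [eOp_apply]
  exact add_mem (add_mem (hx _ _ hv) (hx _ _ hv)) (hc _ _ (hc _ _ (sub_mem (hx _ _ hv) (hx _ _ hv))))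

theorem CXRel.eOp_eOp (h : CXRel x c) {χ : Fin n → F} {v : M} (hv : v ∈ wt x χ) {a b : Fin n}
    (hab : a ≠ b) : eOp x c a b (eOp x c a b v) = (2 * (χ a + χ b)) • v := by
  have := congrArg (· v) (h.eOp_sq hab)
  simp only [Module.End.mul_apply, LinearMap.add_apply] at this
  rw [this, mem_wt.mp hv, mem_wt.mp hv, ← add_smul, two_mul, add_smul, ← one_add_one_eq_two,
    LinearMap.add_apply, Module.End.one_apply]
  module

theorem HCRel.Phi_mem_wt (h : HCRel x c s) {χ : Fin n → F} {v : M} (hv : v ∈ wt x χ) (k : ℕ)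
    (hk : k + 1 < n) : Phi x c s k hk v ∈ wt x (χ ∘ simple k hk) := fun m => by
  have := congrArg (· v) (h.Phi_xsq k hk m)
  simp only [Module.End.mul_apply] at this ⊢
  rw [this, mem_wt.mp hv, map_smul]; rfl

theorem Phi_apply {χ : Fin n → F} {v : M} (hv : v ∈ wt x χ) (k : ℕ) (hk : k + 1 < n) :
    Phi x c s k hk v = (χ ⟨k, Nat.lt_of_succ_lt hk⟩ - χ ⟨k + 1, hk⟩) • s k hk v +
      eOp x c ⟨k, Nat.lt_of_succ_lt hk⟩ ⟨k + 1, hk⟩ v := by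
  simp only [Phi, LinearMap.add_apply, Module.End.mul_apply, LinearMap.sub_apply]
  rw [mem_wt.mp hv, mem_wt.mp hv, ← sub_smul, map_smul]

theorem s_apply {χ : Fin n → F} {v : M} (hv : v ∈ wt x χ) (k : ℕ) (hk : k + 1 < n)
    (hne : χ ⟨k, Nat.lt_of_succ_lt hk⟩ ≠ χ ⟨k + 1, hk⟩) :
    s k hk v = (χ ⟨k, Nat.lt_of_succ_lt hk⟩ - χ ⟨k + 1, hk⟩)⁻¹ • (Phi x c s k hk v -
      eOp x c ⟨k, Nat.lt_of_succ_lt hk⟩ ⟨k + 1, hk⟩ v) := by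
  rw [Phi_apply hv, add_sub_cancel_right, smul_smul, inv_mul_cancel₀ (sub_ne_zero.mpr hne),
    one_smul]

theorem HCRel.Phi_Phi (h : HCRel x c s) {χ : Fin n → F} {v : M} (hv : v ∈ wt x χ) (k : ℕ)
    (hk : k + 1 < n) : Phi x c s k hk (Phi x c s k hk v) =
      (2 * (χ ⟨k, Nat.lt_of_succ_lt hk⟩ + χ ⟨k + 1, hk⟩) -
        (χ ⟨k, Nat.lt_of_succ_lt hk⟩ - χ ⟨k + 1, hk⟩) ^ 2) • v := by
  have := congrArg (· v) (h.Phi_sq k hk)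
  simp only [Module.End.mul_apply, LinearMap.sub_apply, LinearMap.add_apply] at this
  rw [this, ← one_add_one_eq_two]
  simp only [two_mul, LinearMap.add_apply, Module.End.one_apply, mem_wt.mp hv, map_smul,
    map_sub, map_add, sub_smul, add_smul, pow_two, mul_smul, sub_mul, mul_sub, smul_sub,
    one_mul, add_mul, smul_add]
  abel

theorem HCRel.x_s_apply (h : HCRel x c s) (k : ℕ) (hk : k + 1 < n) (v : M) :
    x ⟨k, Nat.lt_of_succ_lt hk⟩ (s k hk v) = s k hk (x ⟨k + 1, hk⟩ v) -
      (v - c ⟨k, Nat.lt_of_succ_lt hk⟩ (c ⟨k + 1, hk⟩ v)) := by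
  have := congrArg (· v) (h.s_x' k hk)
  simp only [Module.End.mul_apply, LinearMap.sub_apply, LinearMap.add_apply,
    Module.End.one_apply] at this
  rw [this]
  abel

/-- On a weight with equal neighbours this exhibits `-e v` as the nilpotent part of `x_k²` at `s_k
v`. -/
theorem HCRel.xsq_s_apply (h : HCRel x c s) (k : ℕ) (hk : k + 1 < n) (v : M) :
    x ⟨k, Nat.lt_of_succ_lt hk⟩ (x ⟨k, Nat.lt_of_succ_lt hk⟩ (s k hk v)) =
      s k hk (x ⟨k + 1, hk⟩ (x ⟨k + 1, hk⟩ v)) -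
        eOp x c ⟨k, Nat.lt_of_succ_lt hk⟩ ⟨k + 1, hk⟩ v := by
  have h1 := congrArg (· v) (h.x_c_ne ⟨k + 1, hk⟩ ⟨k, Nat.lt_of_succ_lt hk⟩ (ne_succ hk).symm)
  have h2 : ∀ u, _ := fun u => congrArg (· u) (h.x_c ⟨k, Nat.lt_of_succ_lt hk⟩)
  have h3 := congrArg (· v) (h.x_c_ne ⟨k, Nat.lt_of_succ_lt hk⟩ ⟨k + 1, hk⟩ (ne_succ hk))
  simp only [Module.End.mul_apply, LinearMap.neg_apply] at h1 h2 h3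
  rw [h.x_s_apply, map_sub, h.x_s_apply, map_sub, h2, h3, eOp_apply, map_sub, map_sub]
  abel

/-- The equations of an action with semisimple `x_k`. -/
structure SplitHC (x c : Fin n → Module.End F M) (s : ∀ k, k + 1 < n → Module.End F M) : Prop
    extends HCRel x c s where
  braid (k : ℕ) (hk : k + 2 < n) : s k (Nat.lt_of_succ_lt hk) * (s (k + 1) hk *
      s k (Nat.lt_of_succ_lt hk)) = s (k + 1) hk * (s k (Nat.lt_of_succ_lt hk) * s (k + 1) hk)
  comm (k l : ℕ) (hk : k + 1 < n) (hl : l + 1 < n) (h : k + 1 < l) :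
      s k hk * s l hl = s l hl * s k hk
  -- There are no Jordan blocks of size two for `x_k²`, nor, by the next condition, for `x_k` at the
  -- eigenvalue `0`. No more of semisimplicity is needed.
  ker_sq (k : Fin n) (a : F) (v w : M) (h : x k (x k v) = a • v + w) (h' : x k (x k w) = a • w) :
      w = 0
  ker_x (k : Fin n) (v : M) (h : x k (x k v) = 0) : x k v = 0

/-- With equal entries `a`, the vectors `s_k v` and `-e v` would form a Jordan block of `x_k²`, so
`e v = 0`. Then `0 = e² v = 4 a v`. If `a = 0`, both `x_{k+1} v` and `x_k s_k v` vanish, which gives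
`v = c_k c_{k+1} v`; but `(c_k c_{k+1})² = -1`. -/
theorem SplitHC.eq_zero_of_eq (h : SplitHC x c s) (h2 : (2 : F) ≠ 0) {χ : Fin n → F} {v : M}
    (hv : v ∈ wt x χ) (k : ℕ) (hk : k + 1 < n)
    (he : χ ⟨k, Nat.lt_of_succ_lt hk⟩ = χ ⟨k + 1, hk⟩) : v = 0 := by
  have hev : eOp x c ⟨k, Nat.lt_of_succ_lt hk⟩ ⟨k + 1, hk⟩ v ∈ wt x χ :=
    eOp_mem (fun m v hv => h.c_mem_wt hv m) (fun m v hv => h.x_mem_wt hv m) _ _ hv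
  have e0 : eOp x c ⟨k, Nat.lt_of_succ_lt hk⟩ ⟨k + 1, hk⟩ v = 0 := by
    rw [← neg_eq_zero]
    refine h.ker_sq ⟨k, Nat.lt_of_succ_lt hk⟩ (χ ⟨k, Nat.lt_of_succ_lt hk⟩) (s k hk v) _ ?_ ?_
    · rw [h.xsq_s_apply, mem_wt.mp hv, he, map_smul, sub_eq_add_neg]
    · rw [map_neg, map_neg, mem_wt.mp hev, smul_neg]
  have e1 := h.eOp_eOp hv (ne_succ hk)
  rw [e0, map_zero, he, ← two_mul] at e1
  rcases smul_eq_zero.mp e1.symm with e2 | e2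
  · have e3 : χ ⟨k + 1, hk⟩ = 0 := by simpa [h2] using e2
    have x1 : x ⟨k + 1, hk⟩ v = 0 := h.ker_x _ _ (by rw [mem_wt.mp hv, e3, zero_smul])
    have x2 : x ⟨k, Nat.lt_of_succ_lt hk⟩ (s k hk v) = 0 := h.ker_x _ _ (by
      rw [h.xsq_s_apply, x1, e0]; simp)
    rw [h.x_s_apply, x1, map_zero, zero_sub, neg_eq_zero, sub_eq_zero] at x2
    have h1 : ∀ u, _ := fun u => congrArg (· u) (h.c_anti _ _ (ne_succ hk))
    have h3 : ∀ u, _ := fun u => congrArg (· u) (h.c_sq ⟨k, Nat.lt_of_succ_lt hk⟩)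
    have h4 : ∀ u, _ := fun u => congrArg (· u) (h.c_sq ⟨k + 1, hk⟩)
    simp only [Module.End.mul_apply, LinearMap.neg_apply, Module.End.one_apply] at h1 h3 h4
    have : v = -v := by
      calc v = c ⟨k, Nat.lt_of_succ_lt hk⟩ (c ⟨k + 1, hk⟩ v) := x2
        _ = c ⟨k, Nat.lt_of_succ_lt hk⟩ (c ⟨k + 1, hk⟩ (c ⟨k, Nat.lt_of_succ_lt hk⟩
              (c ⟨k + 1, hk⟩ v))) :=
            congrArg (fun u => c ⟨k, Nat.lt_of_succ_lt hk⟩ (c ⟨k + 1, hk⟩ u)) x2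
        _ = -v := by rw [h1, h3, h4]
    have h5 : (2 : F) • v = 0 := by rw [two_smul]; nth_rewrite 1 [this]; simp
    exact (smul_eq_zero.mp h5).resolve_left h2
  · exact e2

/-! ## Products of intertwiners -/

/-- `w` preserves the order of the entries of `χ` that are equal. -/
def OrdPres {α : Type*} (χ : Fin n → α) (w : Perm (Fin n)) : Prop :=
  ∀ a b, a < b → χ a = χ b → w a < w b

theorem ordPres_one {α : Type*} (χ : Fin n → α) : OrdPres χ 1 := fun _ _ h _ => h

theorem OrdPres.simple_mul {α : Type*} {χ : Fin n → α} {w : Perm (Fin n)} (hw : OrdPres χ w)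
    {k : ℕ} {hk : k + 1 < n}
    (h : χ (w⁻¹ ⟨k, Nat.lt_of_succ_lt hk⟩) ≠ χ (w⁻¹ ⟨k + 1, hk⟩)) :
    OrdPres χ (simple k hk * w) := by
  intro a b hab e
  refine simple_lt k hk (hw a b hab e) fun ⟨h1, h2⟩ => h ?_
  have e1 : w a = ⟨k, Nat.lt_of_succ_lt hk⟩ := Fin.ext h1
  have e2 : w b = ⟨k + 1, hk⟩ := Fin.ext h2
  rw [← e1, ← e2]
  simpa using e

/-- The permutation `u⁻¹ w` preserves the fibres of `χ` and is increasing on each of them. -/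
theorem OrdPres.unique {α : Type*} {χ : Fin n → α} {w u : Perm (Fin n)} (hw : OrdPres χ w)
    (hu : OrdPres χ u) (h : χ ∘ ⇑w⁻¹ = χ ∘ ⇑u⁻¹) : w = u := by
  have hf : ∀ a, χ ((u⁻¹ * w) a) = χ a := fun a => by
    have := congrFun h (w a)
    simp only [Function.comp_apply, Perm.inv_def, Equiv.symm_apply_apply] at this
    rw [Perm.mul_apply, Perm.inv_def]; exact this.symm
  refine (inv_mul_eq_one.mp (perm_eq_one_of_fiber χ _ hf fun a b hab e => ?_)).symm
  by_contra hlt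
  push Not at hlt
  have h1 := hw a b hab e
  rcases hlt.lt_or_eq with h2 | h2
  · have h3 := hu _ _ h2 (by rw [hf, hf, e])
    simp only [Perm.mul_apply, Perm.inv_def, Equiv.apply_symm_apply] at h3
    exact absurd h1 (not_lt.mpr h3.le)
  · exact hab.ne' ((u⁻¹ * w).injective h2)

/-- Products of the intertwiners along reduced words. -/
structure IsIntertwiner (x c : Fin n → Module.End F M) (s : ∀ k, k + 1 < n → Module.End F M)
    (Θ : Perm (Fin n) → Module.End F M) : Prop where
  one : Θ 1 = 1
  step : ∀ w k hk, Ascent w k hk → Θ (simple k hk * w) = Phi x c s k hk * Θ w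

/-- The `Φ_k` inherit the braid relations from the `s_k`. They need not be invertible, so products
are taken along reduced words only. -/
theorem SplitHC.exists_intertwiner (h : SplitHC x c s) : ∃ Θ, IsIntertwiner x c s Θ := by
  obtain ⟨Θ, h1, h2⟩ := exists_reducedProduct (t := Phi x c s) (fun k hk => by
      have := h.Phi_braid_diff k hk
      simp only [h.braid k hk, sub_self, zero_mul] at this
      exact sub_eq_zero.mp this) (fun k l hk hl hkl => by
      have := h.Phi_comm_diff k l hk hl hkl
      simp only [h.comm k l hk hl hkl, sub_self, zero_mul] at this
      exact sub_eq_zero.mp this)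
  exact ⟨Θ, h1, h2⟩

variable {Θ : Perm (Fin n) → Module.End F M}

theorem IsIntertwiner.c_apply (hΘ : IsIntertwiner x c s Θ) (h : HCRel x c s) (w : Perm (Fin n))
    (m : Fin n) : Θ w * c m = c (w m) * Θ w := by
  induction w using perm_induction with
  | one => simp [hΘ.one]
  | step w k hk ha ih => rw [hΘ.step w k hk ha, mul_assoc, ih, ← mul_assoc, h.Phi_c, mul_assoc]; rfl

theorem IsIntertwiner.x_apply (hΘ : IsIntertwiner x c s Θ) (h : HCRel x c s) (w : Perm (Fin n))
    (m : Fin n) : Θ w * x m = x (w m) * Θ w := by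
  induction w using perm_induction with
  | one => simp [hΘ.one]
  | step w k hk ha ih => rw [hΘ.step w k hk ha, mul_assoc, ih, ← mul_assoc, h.Phi_x, mul_assoc]; rfl

theorem IsIntertwiner.mem_wt (hΘ : IsIntertwiner x c s Θ) (h : HCRel x c s) (w : Perm (Fin n))
    {χ : Fin n → F} {v : M} (hv : v ∈ wt x χ) : Θ w v ∈ wt x (χ ∘ ⇑w⁻¹) := by
  intro m
  have h1 : ∀ m u, x (w m) (Θ w u) = Θ w (x m u) := fun m u =>
    (congrArg (· u) (hΘ.x_apply h w m)).symm
  have e : w (w⁻¹ m) = m := by simp [Perm.inv_def]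
  have h2 := h1 (w⁻¹ m)
  rw [e] at h2
  rw [Module.End.mul_apply, h2, h2, HeckeClifford.mem_wt.mp hv, map_smul]
  rfl

/-- A step that exchanges two equal entries starts from a weight with equal neighbours, whose weight
space is zero. -/
theorem IsIntertwiner.ordPres (hΘ : IsIntertwiner x c s Θ) (h : SplitHC x c s) (h2 : (2 : F) ≠ 0)
    (w : Perm (Fin n)) {χ : Fin n → F} {v : M} (hv : v ∈ wt x χ) (hne : Θ w v ≠ 0) :
    OrdPres χ w := by
  induction w using perm_induction with
  | one => exact ordPres_one χ
  | step w k hk ha ih =>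
    rw [hΘ.step w k hk ha, Module.End.mul_apply] at hne
    have hne' : Θ w v ≠ 0 := fun e => hne (by rw [e, map_zero])
    refine (ih hne').simple_mul fun e => hne' ?_
    exact h.eq_zero_of_eq h2 (hΘ.mem_wt h.toHCRel w hv) k hk e

/-- The subspace generated by a subspace of a weight space under the intertwiners. -/
def intertwinerSpan (Θ : Perm (Fin n) → Module.End F M) (L : Submodule F M) : Submodule F M :=
  ⨆ w, L.map (Θ w)

theorem le_intertwinerSpan (hΘ : IsIntertwiner x c s Θ) (L : Submodule F M) :
    L ≤ intertwinerSpan Θ L := by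
  refine le_trans ?_ (le_iSup _ (1 : Perm (Fin n)))
  rw [hΘ.one]
  exact fun v hv => ⟨v, hv, rfl⟩

theorem mem_intertwinerSpan {L : Submodule F M} (w : Perm (Fin n)) {v : M} (hv : v ∈ L) :
    Θ w v ∈ intertwinerSpan Θ L :=
  Submodule.mem_iSup_of_mem w ⟨v, hv, rfl⟩

theorem intertwinerSpan_le_comap {L : Submodule F M} (f : Module.End F M)
    (h : ∀ w, ∀ v ∈ L, f (Θ w v) ∈ intertwinerSpan Θ L) {v : M} (hv : v ∈ intertwinerSpan Θ L) :
    f v ∈ intertwinerSpan Θ L := by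
  have : intertwinerSpan Θ L ≤ (intertwinerSpan Θ L).comap f := by
    refine iSup_le fun w => ?_
    rintro _ ⟨v, hv, rfl⟩
    exact h w v hv
  exact this hv

theorem c_mem_intertwinerSpan (hΘ : IsIntertwiner x c s Θ) (h : HCRel x c s) {L : Submodule F M}
    (hc : ∀ m, ∀ v ∈ L, c m v ∈ L) (m : Fin n) {v : M} (hv : v ∈ intertwinerSpan Θ L) :
    c m v ∈ intertwinerSpan Θ L := by
  refine intertwinerSpan_le_comap _ (fun w v hv => ?_) hv
  have := congrArg (· v) (hΘ.c_apply h w (w⁻¹ m))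
  simp only [Module.End.mul_apply, Perm.inv_def, Equiv.apply_symm_apply] at this
  rw [← this]
  exact mem_intertwinerSpan w (hc _ _ hv)

theorem x_mem_intertwinerSpan (hΘ : IsIntertwiner x c s Θ) (h : HCRel x c s) {L : Submodule F M}
    (hx : ∀ m, ∀ v ∈ L, x m v ∈ L) (m : Fin n) {v : M} (hv : v ∈ intertwinerSpan Θ L) :
    x m v ∈ intertwinerSpan Θ L := by
  refine intertwinerSpan_le_comap _ (fun w v hv => ?_) hv
  have := congrArg (· v) (hΘ.x_apply h w (w⁻¹ m))
  simp only [Module.End.mul_apply, Perm.inv_def, Equiv.apply_symm_apply] at this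
  rw [← this]
  exact mem_intertwinerSpan w (hx _ _ hv)

/-- On weights with distinct neighbours `s_k` is a combination of `Φ_k` and `e_k`. At an ascent `Φ_k
Θ_w` is `Θ_{s_k w}`; at a descent `Φ_k² Θ_{s_k w}` is a scalar multiple of `Θ_{s_k w}`. -/
theorem s_mem_intertwinerSpan (hΘ : IsIntertwiner x c s Θ) (h : SplitHC x c s) (h2 : (2 : F) ≠ 0)
    {χ : Fin n → F} {L : Submodule F M} (hL : L ≤ wt x χ)
    (hc : ∀ m, ∀ v ∈ L, c m v ∈ L) (hx : ∀ m, ∀ v ∈ L, x m v ∈ L) (k : ℕ) (hk : k + 1 < n) {v : M}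
    (hv : v ∈ intertwinerSpan Θ L) : s k hk v ∈ intertwinerSpan Θ L := by
  refine intertwinerSpan_le_comap _ (fun w v hv => ?_) hv
  have hw := hΘ.mem_wt h.toHCRel w (hL hv)
  by_cases e : (χ ∘ ⇑w⁻¹) ⟨k, Nat.lt_of_succ_lt hk⟩ = (χ ∘ ⇑w⁻¹) ⟨k + 1, hk⟩
  · rw [h.eq_zero_of_eq h2 hw k hk e, map_zero]
    exact zero_mem _
  rw [s_apply hw k hk e (c := c)]
  refine Submodule.smul_mem _ _ (sub_mem ?_ ?_)
  · by_cases ha : Ascent w k hk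
    · have := congrArg (· v) (hΘ.step w k hk ha)
      simp only [Module.End.mul_apply] at this
      rw [← this]
      exact mem_intertwinerSpan _ hv
    · have := congrArg (· v) (hΘ.step _ k hk (not_ascent ha))
      simp only [Module.End.mul_apply, simple_mul_self_assoc] at this
      rw [this, h.Phi_Phi (hΘ.mem_wt h.toHCRel _ (hL hv))]
      exact Submodule.smul_mem _ _ (mem_intertwinerSpan _ hv)
  · exact eOp_mem (fun m v hv => c_mem_intertwinerSpan hΘ h.toHCRel hc m hv)
      (fun m v hv => x_mem_intertwinerSpan hΘ h.toHCRel hx m hv) _ _ (mem_intertwinerSpan w hv)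

/-- A weight of the span of the intertwiners comes from a single intertwiner. -/
theorem mem_map_of_mem_intertwinerSpan (hΘ : IsIntertwiner x c s Θ) (h : SplitHC x c s)
    (h2 : (2 : F) ≠ 0) {χ : Fin n → F} {L : Submodule F M} (hL : L ≤ wt x χ) {u : Perm (Fin n)}
    (hu : OrdPres χ u) {y : M} (hy : y ∈ intertwinerSpan Θ L) (hyu : y ∈ wt x (χ ∘ ⇑u⁻¹)) :
    y ∈ L.map (Θ u) := by
  classical
  obtain ⟨f, hf⟩ := (Submodule.mem_iSup_iff_exists_finsupp _ _).mp hy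
  obtain ⟨hf, rfl⟩ := hf
  rw [Finsupp.sum_fintype _ _ (fun _ => rfl)] at hyu ⊢
  have hmem : ∀ w : Perm (Fin n), f w ∈ wt x (χ ∘ ⇑w⁻¹) := fun w => by
    obtain ⟨v, hv, e⟩ := hf w
    rw [← e]; exact hΘ.mem_wt h.toHCRel w (hL hv)
  rw [sum_jointEigen (f := fun k => x k * x k) h.xsq_comm (fun w : Perm (Fin n) => χ ∘ ⇑w⁻¹) f
    hmem _ hyu]
  refine Submodule.sum_mem _ fun w hw => ?_
  have hw := (Finset.mem_filter.mp hw).2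
  obtain ⟨v, hv, e⟩ := hf w
  -- A nonzero summand belongs to an order preserving `w` with the weight of `u`, which forces `w =
  -- u`.
  by_cases hz : f w = 0
  · rw [hz]; exact zero_mem _
  · have := (hΘ.ordPres h h2 w (hL hv) (by rw [e]; exact hz)).unique hu hw
    rw [← this]
    exact hf w

end weights

/-! ## Clifford modules generated by a vacuum vector -/

theorem sqrtF_sq {F : Type*} [Field F] [IsAlgClosed F] (a : F) : sqrtF F a * sqrtF F a = a := by
  rw [← pow_two]
  exact (IsAlgClosed.exists_pow_nat_eq a (n := 2) Nat.zero_lt_two).choose_spec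

section cliffSpan

variable {F : Type*} [Field F] {M : Type*} [AddCommGroup M] [Module F M] {n : ℕ}
  {c : Fin n → Module.End F M}

/-- The subspace obtained from `W` by applying the products of the `c_k`, `k ∈ l`. -/
def cliffSpan (c : Fin n → Module.End F M) : List (Fin n) → Submodule F M → Submodule F M
  | [], W => W
  | k :: l, W => cliffSpan c l W ⊔ (cliffSpan c l W).map (c k)

theorem le_cliffSpan (l : List (Fin n)) (W : Submodule F M) : W ≤ cliffSpan c l W := by
  induction l with
  | nil => exact le_rfl
  | cons k l ih => exact ih.trans le_sup_left

theorem cliffSpan_le {W N : Submodule F M} (hW : W ≤ N) (l : List (Fin n))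
    (hN : ∀ k ∈ l, ∀ v ∈ N, c k v ∈ N) : cliffSpan c l W ≤ N := by
  induction l with
  | nil => exact hW
  | cons k l ih =>
    have h := ih fun k hk => hN k (List.mem_cons_of_mem _ hk)
    refine sup_le h ?_
    rintro _ ⟨v, hv, rfl⟩
    exact hN k List.mem_cons_self v (h hv)

theorem cliffSpan_finite (l : List (Fin n)) (W : Submodule F M) [hW : FiniteDimensional F W] :
    FiniteDimensional F (cliffSpan c l W) := by
  induction l with
  | nil => exact hW
  | cons k l ih => exact Submodule.finiteDimensional_sup _ _

theorem mem_cliffSpan_of_signed (f : Module.End F M) {W : Submodule F M} (hW : ∀ v ∈ W, f v ∈ W)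
    (l : List (Fin n)) (hf : ∀ k ∈ l, f * c k = c k * f ∨ f * c k = -(c k * f)) :
    ∀ v ∈ cliffSpan c l W, f v ∈ cliffSpan c l W := by
  induction l with
  | nil => exact hW
  | cons k l ih =>
    have h := ih fun k hk => hf k (List.mem_cons_of_mem _ hk)
    intro v hv
    obtain ⟨a, ha, _, ⟨b, hb, rfl⟩, rfl⟩ := Submodule.mem_sup.mp hv
    rw [map_add]
    refine add_mem (Submodule.mem_sup_left (h a ha)) (Submodule.mem_sup_right ?_)
    rcases hf k List.mem_cons_self with e | e
    · rw [← Module.End.mul_apply, e]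
      exact ⟨f b, h b hb, rfl⟩
    · rw [← Module.End.mul_apply, e]
      exact neg_mem (⟨f b, h b hb, rfl⟩ : c k (f b) ∈ (cliffSpan c l W).map (c k))

theorem c_mem_cliffSpan (hsq : ∀ k, c k * c k = 1) (ha : ∀ k l, k ≠ l → c k * c l = -(c l * c k))
    (l : List (Fin n)) (W : Submodule F M) (m : Fin n) (hm : m ∈ l) :
    ∀ v ∈ cliffSpan c l W, c m v ∈ cliffSpan c l W := by
  induction l with
  | nil => exact absurd hm List.not_mem_nil
  | cons k l ih =>
    intro v hv
    obtain ⟨a, ha', _, ⟨b, hb, rfl⟩, rfl⟩ := Submodule.mem_sup.mp hv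
    rw [map_add]
    by_cases e : m = k
    · subst e
      rw [← Module.End.mul_apply (c m) (c m), hsq, add_comm]
      exact add_mem (Submodule.mem_sup_left hb) (Submodule.mem_sup_right ⟨a, ha', rfl⟩)
    · have h := ih ((List.mem_cons.mp hm).resolve_left e)
      rw [← Module.End.mul_apply (c m) (c k), ha m k e]
      exact add_mem (Submodule.mem_sup_left (h a ha')) (Submodule.mem_sup_right
        (neg_mem (⟨c m b, h b hb, rfl⟩ : c k (c m b) ∈ (cliffSpan c l W).map (c k))))

/-- `f` is an operator that detects `c_k` among the `c_m`, `m ∈ l`, acting on `W`. -/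
structure Detects (c : Fin n → Module.End F M) (l : List (Fin n)) (W : Submodule F M) (k : Fin n)
    (f : Module.End F M) : Prop where
  fixed : ∀ v ∈ W, f v = v
  anti : f * c k = -(c k * f)
  comm : ∀ m ∈ l, m ≠ k → f * c m = c m * f

theorem Detects.tail {l : List (Fin n)} {W : Submodule F M} {k j : Fin n} {f : Module.End F M}
    (h : Detects c (j :: l) W k f) : Detects c l W k f :=
  ⟨h.fixed, h.anti, fun m hm => h.comm m (List.mem_cons_of_mem _ hm)⟩

theorem Detects.fixed_cliffSpan {l : List (Fin n)} {W : Submodule F M} {k : Fin n}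
    {f : Module.End F M} (h : Detects c l W k f) (hk : k ∉ l) :
    ∀ v ∈ cliffSpan c l W, f v = v := by
  induction l with
  | nil => exact h.fixed
  | cons j l ih =>
    have h1 := ih h.tail fun e => hk (List.mem_cons_of_mem _ e)
    intro v hv
    obtain ⟨a, ha, _, ⟨b, hb, rfl⟩, rfl⟩ := Submodule.mem_sup.mp hv
    rw [map_add, ← Module.End.mul_apply f, h.comm j List.mem_cons_self
      (fun e => hk (e ▸ List.mem_cons_self)), Module.End.mul_apply, h1 a ha, h1 b hb]

theorem eq_zero_of_eq_neg (h2 : (2 : F) ≠ 0) {v : M} (h : v = -v) : v = 0 := by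
  have h5 : (2 : F) • v = 0 := by rw [two_smul]; nth_rewrite 1 [h]; simp
  exact (smul_eq_zero.mp h5).resolve_left h2

/-- Write `y = a + c_k b`. The operator `f_k` fixes `a` and negates `c_k b`, so a vector fixed by
`f_k` has no second component. -/
theorem mem_of_mem_cliffSpan (h2 : (2 : F) ≠ 0) {W : Submodule F M}
    {f : Fin n → Module.End F M} (l : List (Fin n)) (hl : l.Nodup)
    (hf : ∀ k ∈ l, Detects c l W k (f k)) {y : M} (hy : y ∈ cliffSpan c l W)
    (hy' : ∀ k ∈ l, f k y = y) : y ∈ W := by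
  induction l generalizing y with
  | nil => exact hy
  | cons k l ih =>
    have hd := hf k List.mem_cons_self
    have hkl := (List.nodup_cons.mp hl).1
    obtain ⟨a, ha, _, ⟨b, hb, rfl⟩, rfl⟩ := Submodule.mem_sup.mp hy
    have e := hy' k List.mem_cons_self
    rw [map_add, ← Module.End.mul_apply (f k), hd.anti, LinearMap.neg_apply, Module.End.mul_apply,
      hd.tail.fixed_cliffSpan hkl a ha, hd.tail.fixed_cliffSpan hkl b hb, add_left_cancel_iff] at e
    have e0 := eq_zero_of_eq_neg h2 e.symm
    simp only [e0, add_zero] at hy' ⊢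
    exact ih (List.nodup_cons.mp hl).2 (fun j hj => (hf j (List.mem_cons_of_mem _ hj)).tail) ha
      fun j hj => hy' j (List.mem_cons_of_mem _ hj)

/-- The detecting operator is `1` on the old subspace and `-1` on its image under `c_k`. The sum is
direct, and each `k` doubles the dimension. -/
theorem finrank_cliffSpan (h2 : (2 : F) ≠ 0) (hsq : ∀ k, c k * c k = 1) {W : Submodule F M}
    [FiniteDimensional F W] {f : Fin n → Module.End F M} (l : List (Fin n)) (hl : l.Nodup)
    (hf : ∀ k ∈ l, Detects c l W k (f k)) :
    Module.finrank F (cliffSpan c l W) = 2 ^ l.length * Module.finrank F W := by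
  induction l with
  | nil =>
    change Module.finrank F W = _
    simp
  | cons k l ih =>
    have hd := hf k List.mem_cons_self
    have hkl := (List.nodup_cons.mp hl).1
    have ih := ih (List.nodup_cons.mp hl).2 fun j hj => (hf j (List.mem_cons_of_mem _ hj)).tail
    have hinf : cliffSpan c l W ⊓ (cliffSpan c l W).map (c k) = ⊥ := by
      rw [Submodule.eq_bot_iff]
      rintro _ ⟨hy, ⟨b, hb, rfl⟩⟩
      have e := hd.tail.fixed_cliffSpan hkl _ hy
      rw [← Module.End.mul_apply (f k), hd.anti, LinearMap.neg_apply, Module.End.mul_apply,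
        hd.tail.fixed_cliffSpan hkl b hb] at e
      exact eq_zero_of_eq_neg h2 e.symm
    haveI := cliffSpan_finite (c := c) l W
    have hinj : Function.Injective (c k) := fun a b e => by
      have := congrArg (c k) e
      rwa [← Module.End.mul_apply, ← Module.End.mul_apply, hsq] at this
    have h1 := Submodule.finrank_sup_add_finrank_inf_eq (cliffSpan c l W)
      ((cliffSpan c l W).map (c k))
    rw [hinf, finrank_bot, add_zero,
      (Submodule.equivMapOfInjective (c k) hinj (cliffSpan c l W)).finrank_eq.symm, ih] at h1
    change Module.finrank F ↥(cliffSpan c l W ⊔ (cliffSpan c l W).map (c k)) = _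
    rw [h1, List.length_cons, pow_succ]
    ring

end cliffSpan

/-! ## Pairing off the zero weights -/

/-- A pairing of the elements of `Z`, with at most one element left over. -/
structure Pairing {n : ℕ} (Z : Finset (Fin n)) where
  A : Finset (Fin n)
  K : Finset (Fin n)
  π : Fin n → Fin n
  A_sub : A ⊆ Z
  K_sub : K ⊆ Z
  disj : ∀ a ∈ A, a ∉ K
  π_mem : ∀ a ∈ A, π a ∈ Z
  π_A : ∀ a ∈ A, π a ∉ A
  π_K : ∀ a ∈ A, π a ∉ K
  inj : ∀ a ∈ A, ∀ b ∈ A, π a = π b → a = b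
  cover : ∀ z ∈ Z, z ∈ A ∨ z ∈ K ∨ ∃ a ∈ A, π a = z
  card_K : K.card ≤ 1
  card : Z.card = 2 * A.card + K.card

/-- At a nonzero weight a normalized `x_k` is an involution that detects `c_k`. At a zero weight
`x_k` is useless, but the product `c_a c_b` of two such Clifford generators, times a square root of
`-1`, serves instead. A leftover element of `K` can only be detected by the parity operator. The
pairing is found by removing two elements at a time. -/
theorem Pairing.nonempty {n : ℕ} (Z : Finset (Fin n)) : Nonempty (Pairing Z) := by
  induction Z using Finset.strongInduction with
  | H Z ih =>
    by_cases hZ : Z.card ≤ 1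
    · exact ⟨⟨∅, Z, id, by simp, subset_rfl, by simp, by simp, by simp, by simp, by simp,
        fun z hz => Or.inr (Or.inl hz), hZ, by simp⟩⟩
    · push Not at hZ
      obtain ⟨a, ha, b, hb, hab⟩ := Finset.one_lt_card.mp hZ
      have hbe : b ∈ Z.erase a := Finset.mem_erase.mpr ⟨hab.symm, hb⟩
      obtain ⟨P⟩ := ih ((Z.erase a).erase b)
        ((Finset.erase_ssubset hbe).trans (Finset.erase_ssubset ha))
      have hm : ∀ z, z ∈ (Z.erase a).erase b ↔ z ≠ b ∧ z ≠ a ∧ z ∈ Z := fun z => by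
        rw [Finset.mem_erase, Finset.mem_erase]
      have haA : a ∉ P.A := fun h => ((hm a).mp (P.A_sub h)).2.1 rfl
      have hbA : b ∉ P.A := fun h => ((hm b).mp (P.A_sub h)).1 rfl
      have haK : a ∉ P.K := fun h => ((hm a).mp (P.K_sub h)).2.1 rfl
      have hbK : b ∉ P.K := fun h => ((hm b).mp (P.K_sub h)).1 rfl
      have hne : ∀ {c}, c ∈ P.A → c ≠ a := fun h e => haA (e ▸ h)
      have hπ : ∀ c ∈ P.A, Function.update P.π a b c = P.π c := fun c hc =>
        Function.update_of_ne (hne hc) _ _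
      have hπ' : ∀ c ∈ P.A, P.π c ≠ b ∧ P.π c ≠ a ∧ P.π c ∈ Z := fun c hc =>
        (hm _).mp (P.π_mem c hc)
      refine ⟨⟨insert a P.A, P.K, Function.update P.π a b, ?_, ?_, ?_, ?_, ?_, ?_, ?_, ?_,
        P.card_K, ?_⟩⟩
      · exact Finset.insert_subset ha fun z hz => ((hm z).mp (P.A_sub hz)).2.2
      · exact fun z hz => ((hm z).mp (P.K_sub hz)).2.2
      · intro z hz
        rcases Finset.mem_insert.mp hz with rfl | hz
        · exact haK
        · exact P.disj z hz
      · intro z hz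
        rcases Finset.mem_insert.mp hz with rfl | hz
        · simpa using hb
        · rw [hπ z hz]; exact (hπ' z hz).2.2
      · intro z hz
        rcases Finset.mem_insert.mp hz with rfl | hz
        · simpa using ⟨hab.symm, hbA⟩
        · rw [hπ z hz]; simpa using ⟨(hπ' z hz).2.1, P.π_A z hz⟩
      · intro z hz
        rcases Finset.mem_insert.mp hz with rfl | hz
        · simpa using hbK
        · rw [hπ z hz]; exact P.π_K z hz
      · intro z hz y hy e
        rcases Finset.mem_insert.mp hz with rfl | hz <;> rcases Finset.mem_insert.mp hy with rfl | hy
        · rfl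
        · rw [hπ y hy, Function.update_self] at e
          exact absurd e.symm (hπ' y hy).1
        · rw [hπ z hz, Function.update_self] at e
          exact absurd e (hπ' z hz).1
        · rw [hπ z hz, hπ y hy] at e
          exact P.inj z hz y hy e
      · intro z hz
        by_cases e1 : z = a
        · exact Or.inl (by simp [e1])
        by_cases e2 : z = b
        · exact Or.inr (Or.inr ⟨a, by simp, by simp [e2]⟩)
        rcases P.cover z ((hm z).mpr ⟨e2, e1, hz⟩) with h | h | ⟨c, hc, e⟩
        · exact Or.inl (Finset.mem_insert_of_mem h)
        · exact Or.inr (Or.inl h)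
        · exact Or.inr (Or.inr ⟨c, Finset.mem_insert_of_mem hc, by rw [hπ c hc, e]⟩)
      · rw [Finset.card_insert_of_notMem haA]
        have h1 := Finset.card_erase_add_one ha
        have h2 := Finset.card_erase_add_one hbe
        have h3 := P.card
        omega

open Classical in
/-- The set of zero weights. -/
def zeros {F : Type*} [Field F] {n : ℕ} (χ : Fin n → F) : Finset (Fin n) :=
  Finset.univ.filter fun k => χ k = 0

theorem mem_zeros {F : Type*} [Field F] {n : ℕ} {χ : Fin n → F} {k : Fin n} :
    k ∈ zeros χ ↔ χ k = 0 := by simp [zeros]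

/-! ### Vacuum vectors and irreducible modules for the `x_k` and `c_k` -/

section vacuum

variable {F : Type*} [Field F] [IsAlgClosed F] {M : Type*} [AddCommGroup M] [Module F M] {n : ℕ}
  {x c : Fin n → Module.End F M} {δ : Module.End F M} {χ : Fin n → F}

/-- The relations of a parity operator. -/
structure GrRel (x c : Fin n → Module.End F M) (δ : Module.End F M) : Prop where
  sq : δ * δ = 1
  c (k : Fin n) : δ * c k = -(c k * δ)
  x (k : Fin n) : δ * x k = x k * δ

/-- The positions of the raising operators. -/
def Pairing.T (P : Pairing (zeros χ)) : Finset (Fin n) := (zeros χ)ᶜ ∪ P.A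

theorem Pairing.mem_T {P : Pairing (zeros χ)} {k : Fin n} : k ∈ P.T ↔ k ∉ zeros χ ∨ k ∈ P.A := by
  simp [Pairing.T]

/-- Commuting involutions on a weight space. -/
def vacOp (x c : Fin n → Module.End F M) (P : Pairing (zeros χ)) (k : Fin n) : Module.End F M :=
  if k ∈ zeros χ then sqrtF F (-1) • (c k * c (P.π k)) else (sqrtF F (χ k))⁻¹ • x k

variable {P : Pairing (zeros χ)}

theorem Pairing.cases_T {k : Fin n} (hk : k ∈ P.T) :
    (k ∉ zeros χ) ∨ (k ∈ zeros χ ∧ k ∈ P.A ∧ P.π k ∈ zeros χ ∧ P.π k ∉ P.T ∧ P.π k ∉ P.K ∧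
      k ≠ P.π k) := by
  by_cases h : k ∈ zeros χ
  · have hA : k ∈ P.A := (Pairing.mem_T.mp hk).resolve_left (fun h' => h' h)
    refine Or.inr ⟨h, hA, P.π_mem k hA, fun h' => ?_, P.π_K k hA, fun e => P.π_A k hA (e ▸ hA)⟩
    rcases Pairing.mem_T.mp h' with h1 | h1
    · exact h1 (P.π_mem k hA)
    · exact P.π_A k hA h1
  · exact Or.inl h

theorem vacOp_anti (h : CXRel x c) {k : Fin n} (hk : k ∈ P.T) :
    vacOp x c P k * c k = -(c k * vacOp x c P k) := by
  unfold vacOp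
  rcases Pairing.cases_T hk with h1 | ⟨h1, -, -, -, -, h2⟩
  · rw [if_neg h1, smul_mul_assoc, h.x_c, mul_smul_comm, smul_neg]
  · rw [if_pos h1, smul_mul_assoc, mul_assoc, h.c_anti _ _ h2.symm, mul_smul_comm, ← smul_neg,
      mul_neg]

theorem vacOp_comm_c (h : CXRel x c) {k m : Fin n} (hk : k ∈ P.T) (hm : m ∈ P.T ∨ m ∈ P.K)
    (hne : m ≠ k) : vacOp x c P k * c m = c m * vacOp x c P k := by
  unfold vacOp
  rcases Pairing.cases_T hk with h1 | ⟨h1, -, -, h3, h4, h2⟩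
  · rw [if_neg h1, smul_mul_assoc, h.x_c_ne _ _ hne.symm, mul_smul_comm]
  · have h5 : P.π k ≠ m := fun e => hm.elim (fun h => h3 (e ▸ h)) (fun h => h4 (e ▸ h))
    rw [if_pos h1, smul_mul_assoc, mul_assoc, h.c_anti _ _ h5, mul_smul_comm, mul_neg,
      assoc_of (h.c_anti _ _ hne.symm), neg_mul, neg_neg, mul_assoc]

theorem vacOp_comm (h : CXRel x c) {k l : Fin n} (hk : k ∈ P.T) (hl : l ∈ P.T) :
    vacOp x c P k * vacOp x c P l = vacOp x c P l * vacOp x c P k := by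
  by_cases e : k = l
  · rw [e]
  have key : ∀ l, l ∈ P.T → k ≠ l → vacOp x c P k * x l = x l * vacOp x c P k ∨ l ∈ P.A := by
    intro l hl e
    rcases Pairing.cases_T hl with h1 | h1
    · refine Or.inl ?_
      unfold vacOp
      rcases Pairing.cases_T hk with h1' | ⟨h1', -, h3, -, -, h2⟩
      · rw [if_neg h1', smul_mul_assoc, h.x_comm, mul_smul_comm]
      · have n1 : l ≠ P.π k := fun e => h1 (e ▸ h3)
        rw [if_pos h1', smul_mul_assoc, mul_assoc, ← h.x_c_ne _ _ n1, mul_smul_comm,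
          assoc_of (h.x_c_ne _ _ (Ne.symm e)).symm, mul_assoc]
    · exact Or.inr h1.2.1
  rcases Pairing.cases_T hl with h1 | ⟨h1, h6, h3, h4, h5, h2⟩
  · rcases key l hl e with h' | h'
    · conv_lhs => rw [vacOp.eq_def x c P l]
      conv_rhs => rw [vacOp.eq_def x c P l]
      rw [if_neg h1, mul_smul_comm, h', smul_mul_assoc]
    · exact absurd (P.A_sub h') h1
  · have h7 : vacOp x c P k * c (P.π l) = c (P.π l) * vacOp x c P k := by
      unfold vacOp
      rcases Pairing.cases_T hk with h1' | ⟨h1', h6', h3', h4', h5', h2'⟩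
      · rw [if_neg h1', smul_mul_assoc, h.x_c_ne _ _ (show k ≠ P.π l from fun e' => h1' (e'.symm ▸ h3)), mul_smul_comm]
      · have n1 : P.π k ≠ P.π l := fun e' => e (P.inj k h6' l h6 e')
        have n2 : k ≠ P.π l := fun e' => h4 (e' ▸ hk)
        rw [if_pos h1', smul_mul_assoc, mul_assoc, h.c_anti _ _ n1, mul_smul_comm, mul_neg,
          assoc_of (h.c_anti _ _ n2), neg_mul, neg_neg, mul_assoc]
    have h8 := vacOp_comm_c h hk (Or.inl hl) (Ne.symm e)
    conv_lhs => rw [vacOp.eq_def x c P l]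
    conv_rhs => rw [vacOp.eq_def x c P l]
    rw [if_pos h1, mul_smul_comm, smul_mul_assoc, ← mul_assoc, h8, mul_assoc, h7, mul_assoc]

theorem vacOp_gr (h : GrRel x c δ) (k : Fin n) : δ * vacOp x c P k = vacOp x c P k * δ := by
  unfold vacOp
  split_ifs
  · rw [mul_smul_comm, ← mul_assoc, h.c, smul_mul_assoc, neg_mul, mul_assoc, h.c, mul_neg, neg_neg,
      mul_assoc]
  · rw [mul_smul_comm, h.x, smul_mul_assoc]

theorem vacOp_sq (h : CXRel x c) {k : Fin n} (hk : k ∈ P.T) {v : M} (hv : v ∈ wt x χ) :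
    vacOp x c P k (vacOp x c P k v) = v := by
  unfold vacOp
  rcases Pairing.cases_T hk with h1 | ⟨h1, -, -, -, -, h2⟩
  · have h3 : χ k ≠ 0 := fun e => h1 (mem_zeros.mpr e)
    simp only [if_neg h1, LinearMap.smul_apply, map_smul, smul_smul]
    rw [mem_wt.mp hv, smul_smul, ← mul_inv, sqrtF_sq, inv_mul_cancel₀ h3, one_smul]
  · have e : c k * c (P.π k) * (c k * c (P.π k)) = -1 := by
      rw [mul_assoc, assoc_of (h.c_anti _ _ h2.symm), neg_mul, mul_assoc, h.c_sq, mul_one, mul_neg,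
        h.c_sq]
    have := congrArg (· v) e
    simp only [Module.End.mul_apply] at this
    simp only [if_pos h1, LinearMap.smul_apply, map_smul, smul_smul, Module.End.mul_apply]
    rw [this, sqrtF_sq]
    simp

theorem vacOp_mem {L : Submodule F M} (hc : ∀ m, ∀ v ∈ L, c m v ∈ L)
    (hx : ∀ m, ∀ v ∈ L, x m v ∈ L) (k : Fin n) : ∀ v ∈ L, vacOp x c P k v ∈ L := by
  intro v hv
  unfold vacOp
  split_ifs
  · exact L.smul_mem _ (hc _ _ (hc _ _ hv))
  · exact L.smul_mem _ (hx _ _ hv)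

/-- A vacuum vector of parity `d`. -/
structure IsVacuum (x c : Fin n → Module.End F M) (δ : Module.End F M) (P : Pairing (zeros χ))
    (d : F) (v : M) : Prop where
  mem_wt : v ∈ wt x χ
  vac : ∀ k ∈ P.T, vacOp x c P k v = v
  gr : δ v = d • v

/-- The involutions `vacOp` commute, so a common fixed vector is built one `k` at a time. If `v +
vacOp v` vanishes, then `vacOp` negates `v`, and `c_k v` is fixed by it as well as by the earlier
involutions. In the end `v + δ v` is homogeneous, or it is zero and `v` itself has `d = -1`. -/
theorem exists_isVacuum (h : CXRel x c) (hδ : GrRel x c δ) (P : Pairing (zeros χ))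
    {L : Submodule F M} (hL : L ≤ wt x χ) (hL0 : L ≠ ⊥) (hc : ∀ m, ∀ v ∈ L, c m v ∈ L)
    (hx : ∀ m, ∀ v ∈ L, x m v ∈ L) (hg : ∀ v ∈ L, δ v ∈ L) :
    ∃ v ∈ L, v ≠ 0 ∧ ∃ d : F, (d = 1 ∨ d = -1) ∧ IsVacuum x c δ P d v := by
  have key : ∀ l : List (Fin n), l.Nodup → (∀ k ∈ l, k ∈ P.T) →
      ∃ v ∈ L, v ≠ 0 ∧ ∀ k ∈ l, vacOp x c P k v = v := by
    intro l
    induction l with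
    | nil =>
      intro _ _
      obtain ⟨v, hv, h0⟩ := Submodule.exists_mem_ne_zero_of_ne_bot hL0
      exact ⟨v, hv, h0, by simp⟩
    | cons k l ih =>
      intro hl hT
      obtain ⟨v, hv, h0, hvac⟩ := ih (List.nodup_cons.mp hl).2
        fun j hj => hT j (List.mem_cons_of_mem _ hj)
      have hk := hT k List.mem_cons_self
      by_cases e : v + vacOp x c P k v = 0
      · refine ⟨c k v, hc k v hv, fun e' => h0 ?_, fun j hj => ?_⟩
        · have := congrArg (c k) e'
          rwa [← Module.End.mul_apply, h.c_sq, map_zero] at this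
        · rcases List.mem_cons.mp hj with rfl | hj'
          · rw [← Module.End.mul_apply, vacOp_anti h hk, LinearMap.neg_apply,
              Module.End.mul_apply, ← map_neg, ← eq_neg_of_add_eq_zero_left e]
          · have hne : k ≠ j := fun e => (List.nodup_cons.mp hl).1 (e ▸ hj')
            rw [← Module.End.mul_apply, vacOp_comm_c h (hT j hj) (Or.inl hk) hne,
              Module.End.mul_apply, hvac j hj']
      · refine ⟨_, add_mem hv (vacOp_mem hc hx k v hv), e, fun j hj => ?_⟩
        rcases List.mem_cons.mp hj with rfl | hj'
        · rw [map_add, vacOp_sq h hk (hL hv), add_comm]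
        · rw [map_add, ← Module.End.mul_apply, vacOp_comm h (hT j hj) hk, Module.End.mul_apply,
            hvac j hj']
  obtain ⟨v, hv, h0, hvac⟩ := key P.T.toList P.T.nodup_toList fun k hk => Finset.mem_toList.mp hk
  have hvac : ∀ k ∈ P.T, vacOp x c P k v = v := fun k hk => hvac k (Finset.mem_toList.mpr hk)
  have hvac' : ∀ k ∈ P.T, vacOp x c P k (δ v) = δ v := fun k hk => by
    rw [← Module.End.mul_apply, ← vacOp_gr hδ, Module.End.mul_apply, hvac k hk]
  by_cases e : v + δ v = 0
  · refine ⟨v, hv, h0, -1, Or.inr rfl, hL hv, hvac, ?_⟩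
    rw [neg_smul, one_smul, eq_neg_iff_add_eq_zero, add_comm, e]
  · refine ⟨v + δ v, add_mem hv (hg v hv), e, 1, Or.inl rfl, hL (add_mem hv (hg v hv)),
      fun k hk => ?_, ?_⟩
    · rw [map_add, hvac k hk, hvac' k hk]
    · rw [map_add, ← Module.End.mul_apply, hδ.sq, one_smul, add_comm]; rfl

/-- The module generated by a vacuum vector. -/
def vacSpan (c : Fin n → Module.End F M) (P : Pairing (zeros χ)) (v : M) : Submodule F M :=
  cliffSpan c P.T.toList (cliffSpan c P.K.toList (Submodule.span F {v}))

theorem mem_vacSpan (P : Pairing (zeros χ)) (v : M) : v ∈ vacSpan c P v :=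
  le_cliffSpan _ _ (le_cliffSpan _ _ (Submodule.mem_span_singleton_self v))

theorem vacSpan_le {N : Submodule F M} (hN : ∀ k, ∀ v ∈ N, c k v ∈ N) {v : M} (hv : v ∈ N) :
    vacSpan c P v ≤ N :=
  cliffSpan_le (cliffSpan_le ((Submodule.span_singleton_le_iff_mem _ _).mpr hv) _
    fun k _ => hN k) _ fun k _ => hN k

theorem mem_vacSpan_of_signed (f : Module.End F M) {v : M} (hv : f v ∈ Submodule.span F {v})
    (hf : ∀ k, (k ∈ P.T ∨ k ∈ P.K) → f * c k = c k * f ∨ f * c k = -(c k * f)) :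
    ∀ y ∈ vacSpan c P v, f y ∈ vacSpan c P v := by
  refine mem_cliffSpan_of_signed f (mem_cliffSpan_of_signed f ?_ _ ?_) _ ?_
  · intro y hy
    obtain ⟨r, rfl⟩ := Submodule.mem_span_singleton.mp hy
    rw [map_smul]; exact Submodule.smul_mem _ _ hv
  · exact fun k hk => hf k (Or.inr (Finset.mem_toList.mp hk))
  · exact fun k hk => hf k (Or.inl (Finset.mem_toList.mp hk))

theorem IsVacuum.vacOp_mem_vacSpan (h : CXRel x c) {d : F} {v : M} (hv : IsVacuum x c δ P d v)
    {k : Fin n} (hk : k ∈ P.T) : ∀ y ∈ vacSpan c P v, vacOp x c P k y ∈ vacSpan c P v := by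
  refine mem_vacSpan_of_signed _ ?_ fun m hm => ?_
  · rw [hv.vac k hk]; exact Submodule.mem_span_singleton_self v
  · by_cases e : m = k
    · subst e; exact Or.inr (vacOp_anti h hk)
    · exact Or.inl (vacOp_comm_c h hk hm e)

theorem IsVacuum.x_mem_vacSpan (h : CXRel x c) {d : F} {v : M} (hv : IsVacuum x c δ P d v)
    (hker : ∀ k u, x k (x k u) = 0 → x k u = 0) (m : Fin n) :
    ∀ y ∈ vacSpan c P v, x m y ∈ vacSpan c P v := by
  refine mem_vacSpan_of_signed _ ?_ fun k _ => ?_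
  · by_cases hm : m ∈ zeros χ
    · rw [hker m v (by rw [HeckeClifford.mem_wt.mp hv.mem_wt, mem_zeros.mp hm, zero_smul])]
      exact zero_mem _
    · have := hv.vac m (Pairing.mem_T.mpr (Or.inl hm))
      rw [vacOp, if_neg hm, LinearMap.smul_apply] at this
      have h0 : sqrtF F (χ m) ≠ 0 := fun e => hm (mem_zeros.mpr (by rw [← sqrtF_sq (χ m), e, zero_mul]))
      rw [inv_smul_eq_iff₀ h0] at this
      rw [this]
      exact Submodule.smul_mem _ _ (Submodule.mem_span_singleton_self v)
  · by_cases e : m = k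
    · subst e; exact Or.inr (h.x_c m)
    · exact Or.inl (h.x_c_ne m k e)

theorem IsVacuum.gr_mem_vacSpan (hδ : GrRel x c δ) {d : F} {v : M} (hv : IsVacuum x c δ P d v) :
    ∀ y ∈ vacSpan c P v, δ y ∈ vacSpan c P v := by
  refine mem_vacSpan_of_signed _ ?_ fun k _ => Or.inr (hδ.c k)
  rw [hv.gr]
  exact Submodule.smul_mem _ _ (Submodule.mem_span_singleton_self v)

/-- The generators indexed by `T` and `K` act by construction. A partner `c_{π k}` is obtained from
`c_k · vacOp_k`, which is `√-1 · c_{π k}` because `c_k² = 1`. -/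
theorem IsVacuum.c_mem_vacSpan (h : CXRel x c) {d : F} {v : M} (hv : IsVacuum x c δ P d v)
    (m : Fin n) : ∀ y ∈ vacSpan c P v, c m y ∈ vacSpan c P v := by
  have hT : ∀ m ∈ P.T, ∀ y ∈ vacSpan c P v, c m y ∈ vacSpan c P v := fun m hm =>
    c_mem_cliffSpan h.c_sq h.c_anti _ _ m (Finset.mem_toList.mpr hm)
  by_cases hm : m ∈ P.T
  · exact hT m hm
  have hZ : m ∈ zeros χ := by_contra fun hZ => hm (Pairing.mem_T.mpr (Or.inl hZ))
  rcases P.cover m hZ with hA | hK | ⟨k, hA, rfl⟩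
  · exact absurd (Pairing.mem_T.mpr (Or.inr hA)) hm
  · refine mem_cliffSpan_of_signed _
      (c_mem_cliffSpan h.c_sq h.c_anti _ _ m (Finset.mem_toList.mpr hK)) _ fun k hk => ?_
    exact Or.inr (h.c_anti m k fun e => hm (e ▸ Finset.mem_toList.mp hk))
  · have hk : k ∈ P.T := Pairing.mem_T.mpr (Or.inr hA)
    intro y hy
    have e1 := hT k hk _ (hv.vacOp_mem_vacSpan h hk y hy)
    rw [vacOp, if_pos (P.A_sub hA), LinearMap.smul_apply, map_smul, Module.End.mul_apply,
      ← Module.End.mul_apply (c k) (c k), h.c_sq] at e1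
    have h0 : sqrtF F (-1) ≠ 0 := fun e => by
      have := sqrtF_sq (-1 : F)
      rw [e, zero_mul] at this
      exact one_ne_zero (neg_eq_zero.mp this.symm)
    exact (Submodule.smul_mem_iff _ h0).mp e1

theorem IsVacuum.vacSpan_le_wt (h : CXRel x c) {d : F} {v : M} (hv : IsVacuum x c δ P d v) :
    vacSpan c P v ≤ wt x χ :=
  vacSpan_le (fun k _ hu => h.c_mem_wt hu k) hv.mem_wt

theorem IsVacuum.detects_T (h : CXRel x c) {d : F} {v : M} (hv : IsVacuum x c δ P d v)
    (k : Fin n) (hk : k ∈ P.T.toList) :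
    Detects c P.T.toList (cliffSpan c P.K.toList (Submodule.span F {v})) k (vacOp x c P k) := by
  have hk := Finset.mem_toList.mp hk
  refine ⟨?_, vacOp_anti h hk, fun m hm hne =>
    vacOp_comm_c h hk (Or.inl (Finset.mem_toList.mp hm)) hne⟩
  have : Detects c P.K.toList (Submodule.span F {v}) k (vacOp x c P k) := by
    refine ⟨fun y hy => ?_, vacOp_anti h hk, fun m hm hne =>
      vacOp_comm_c h hk (Or.inr (Finset.mem_toList.mp hm)) hne⟩
    obtain ⟨r, rfl⟩ := Submodule.mem_span_singleton.mp hy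
    rw [map_smul, hv.vac k hk]
  refine this.fixed_cliffSpan fun hK => ?_
  have hK := Finset.mem_toList.mp hK
  rcases Pairing.mem_T.mp hk with h1 | h1
  · exact h1 (P.K_sub hK)
  · exact P.disj k h1 hK

theorem IsVacuum.detects_K (hδ : GrRel x c δ) {d : F} (hd : d = 1 ∨ d = -1) {v : M}
    (hv : IsVacuum x c δ P d v) (k : Fin n) (hk : k ∈ P.K.toList) :
    Detects c P.K.toList (Submodule.span F {v}) k (d • δ) := by
  have hdd : d * d = 1 := by rcases hd with rfl | rfl <;> ring
  refine ⟨fun y hy => ?_, ?_, fun m hm hne => ?_⟩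
  · obtain ⟨r, rfl⟩ := Submodule.mem_span_singleton.mp hy
    rw [map_smul, LinearMap.smul_apply, hv.gr, smul_smul d d, hdd, one_smul]
  · rw [smul_mul_assoc, hδ.c, mul_smul_comm, smul_neg]
  · exact absurd (Finset.card_le_one.mp P.card_K m (Finset.mem_toList.mp hm) k
      (Finset.mem_toList.mp hk)) hne

/-- The vacuum vectors of the module generated by a vacuum vector. -/
theorem IsVacuum.mem_span_of_mem_vacSpan (h2 : (2 : F) ≠ 0) (h : CXRel x c) (hδ : GrRel x c δ)
    {d d' : F} (hd : d = 1 ∨ d = -1) {v y : M} (hv : IsVacuum x c δ P d v)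
    (hy : y ∈ vacSpan c P v) (hy' : IsVacuum x c δ P d' y) (hdd : d = d' ∨ P.K = ∅) :
    y ∈ Submodule.span F {v} := by
  -- The involutions remove the components involving `T`. The parity operator removes the one
  -- involving `K`, if there is any.
  have h1 := mem_of_mem_cliffSpan h2 _ P.T.nodup_toList (hv.detects_T h) hy
    fun k hk => hy'.vac k (Finset.mem_toList.mp hk)
  refine mem_of_mem_cliffSpan h2 _ P.K.nodup_toList (hv.detects_K hδ hd) h1 fun k hk => ?_
  rcases hdd with rfl | e
  · have hdd : d * d = 1 := by rcases hd with rfl | rfl <;> ring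
    rw [LinearMap.smul_apply, hy'.gr, smul_smul, hdd, one_smul]
  · rw [e] at hk; simp at hk

theorem IsVacuum.eq_zero_of_mem_vacSpan (h2 : (2 : F) ≠ 0) (h : CXRel x c) (hδ : GrRel x c δ)
    {d : F} (hd : d = 1 ∨ d = -1) {v y : M} (hv : IsVacuum x c δ P d v)
    (hy : y ∈ vacSpan c P v) (hy' : IsVacuum x c δ P (-d) y) (hK : P.K = ∅) : y = 0 := by
  obtain ⟨r, rfl⟩ := Submodule.mem_span_singleton.mp
    (hv.mem_span_of_mem_vacSpan h2 h hδ hd hy hy' (Or.inr hK))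
  have := hy'.gr
  rw [map_smul, hv.gr, smul_comm, neg_smul] at this
  have h0 : d ≠ 0 := by rcases hd with rfl | rfl <;> simp
  exact (smul_eq_zero.mp (eq_zero_of_eq_neg h2 this)).resolve_left h0

/-- The unpaired generator commutes with all the involutions and reverses parity. This is the source
of type `Q`. -/
theorem IsVacuum.c_isVacuum (h : CXRel x c) (hδ : GrRel x c δ) {d : F} {v : M}
    (hv : IsVacuum x c δ P d v) {k : Fin n} (hk : k ∈ P.K) : IsVacuum x c δ P (-d) (c k v) := by
  refine ⟨h.c_mem_wt hv.mem_wt k, fun m hm => ?_, ?_⟩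
  · have hne : k ≠ m := fun e => (Pairing.mem_T.mp hm).elim
      (fun h' => h' (P.K_sub (e ▸ hk))) (fun h' => P.disj m h' (e ▸ hk))
    rw [← Module.End.mul_apply, vacOp_comm_c h hm (Or.inr hk) hne, Module.End.mul_apply, hv.vac m hm]
  · rw [← Module.End.mul_apply, hδ.c, LinearMap.neg_apply, Module.End.mul_apply, hv.gr, map_smul,
      neg_smul]

/-- With `z` zeros, `|T| = n - z + |A|` and `z = 2|A| + |K|` with `|K| ≤ 1`. -/
theorem Pairing.card_T_add_card_K (P : Pairing (zeros χ)) :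
    P.T.card + P.K.card = n - (zeros χ).card / 2 := by
  have h1 : P.T.card = (zeros χ)ᶜ.card + P.A.card := by
    refine Finset.card_union_of_disjoint ?_
    rw [Finset.disjoint_left]
    intro a ha hA
    exact Finset.mem_compl.mp ha (P.A_sub hA)
  have h2 := P.card
  have h3 := P.card_K
  have h4 := Finset.card_compl (zeros χ)
  rw [Fintype.card_fin] at h4
  have h5 := Finset.card_le_univ (zeros χ)
  rw [Fintype.card_fin] at h5
  omega

theorem IsVacuum.finrank_vacSpan (h2 : (2 : F) ≠ 0) (h : CXRel x c) (hδ : GrRel x c δ)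
    {d : F} (hd : d = 1 ∨ d = -1) {v : M} (hv : IsVacuum x c δ P d v) (h0 : v ≠ 0) :
    Module.finrank F (vacSpan c P v) = 2 ^ (n - (zeros χ).card / 2) := by
  haveI : FiniteDimensional F (cliffSpan c P.K.toList (Submodule.span F {v})) :=
    cliffSpan_finite _ _
  rw [vacSpan, finrank_cliffSpan h2 h.c_sq _ P.T.nodup_toList (hv.detects_T h),
    finrank_cliffSpan h2 h.c_sq _ P.K.nodup_toList (hv.detects_K hδ hd), finrank_span_singleton h0,
    mul_one, ← pow_add, Finset.length_toList, Finset.length_toList, P.card_T_add_card_K]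

theorem Pairing.K_nonempty_iff (P : Pairing (zeros χ)) : P.K ≠ ∅ ↔ Odd (zeros χ).card := by
  have h1 := P.card
  have h2 := P.card_K
  rw [← Finset.nonempty_iff_ne_empty, ← Finset.card_pos, Nat.odd_iff]
  omega

end vacuum

/-! ## Graded modules over the affine Hecke-Clifford algebra -/

section super

variable {F : Type*} [Field F] {M : Type*} [AddCommGroup M] [Module F M] {n : ℕ}
  {x c : Fin n → Module.End F M} {s : ∀ k, k + 1 < n → Module.End F M} {δ : Module.End F M}
  {M' : Type*} [AddCommGroup M'] [Module F M']
  {x' c' : Fin n → Module.End F M'} {s' : ∀ k, k + 1 < n → Module.End F M'} {δ' : Module.End F M'}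

/-- The equations of a graded action with semisimple `x_k`. -/
structure SuperHC (x c : Fin n → Module.End F M) (s : ∀ k, k + 1 < n → Module.End F M)
    (δ : Module.End F M) : Prop extends SplitHC x c s, GrRel x c δ where
  s (k : ℕ) (hk : k + 1 < n) : δ * s k hk = s k hk * δ

/-- A subspace that is stable under all operators. -/
structure IsStable (x c : Fin n → Module.End F M) (s : ∀ k, k + 1 < n → Module.End F M)
    (δ : Module.End F M) (N : Submodule F M) : Prop where
  x : ∀ k, ∀ v ∈ N, x k v ∈ N
  c : ∀ k, ∀ v ∈ N, c k v ∈ N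
  s : ∀ k hk, ∀ v ∈ N, s k hk v ∈ N
  gr : ∀ v ∈ N, δ v ∈ N

/-- There are no stable subspaces other than `0` and the whole space. -/
def Irr (x c : Fin n → Module.End F M) (s : ∀ k, k + 1 < n → Module.End F M)
    (δ : Module.End F M) : Prop :=
  ∀ N, IsStable x c s δ N → N = ⊥ ∨ N = ⊤

/-- `f` commutes with all operators. -/
structure Intertwines (x c : Fin n → Module.End F M) (s : ∀ k, k + 1 < n → Module.End F M)
    (δ : Module.End F M) (x' c' : Fin n → Module.End F M') (s' : ∀ k, k + 1 < n → Module.End F M')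
    (δ' : Module.End F M') (f : M →ₗ[F] M') : Prop where
  x : ∀ k v, f (x k v) = x' k (f v)
  c : ∀ k v, f (c k v) = c' k (f v)
  s : ∀ k hk v, f (s k hk v) = s' k hk (f v)
  gr : ∀ v, f (δ v) = δ' (f v)

theorem Intertwines.ker {f : M →ₗ[F] M'} (h : Intertwines x c s δ x' c' s' δ' f) :
    IsStable x c s δ (LinearMap.ker f) where
  x k v hv := by rw [LinearMap.mem_ker] at *; rw [h.x, hv, map_zero]
  c k v hv := by rw [LinearMap.mem_ker] at *; rw [h.c, hv, map_zero]
  s k hk v hv := by rw [LinearMap.mem_ker] at *; rw [h.s, hv, map_zero]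
  gr v hv := by rw [LinearMap.mem_ker] at *; rw [h.gr, hv, map_zero]

theorem Intertwines.mem_wt {f : M →ₗ[F] M'} (h : Intertwines x c s δ x' c' s' δ' f)
    {χ : Fin n → F} {v : M} (hv : v ∈ wt x χ) : f v ∈ wt x' χ := fun k => by
  rw [Module.End.mul_apply, ← h.x, ← h.x, HeckeClifford.mem_wt.mp hv, map_smul]

/-- Reversal of parity, which allows odd homomorphisms to be treated as maps that commute with the
operators. -/
theorem SuperHC.neg (h : SuperHC x c s δ) : SuperHC x c s (-δ) where
  toSplitHC := h.toSplitHC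
  sq := by rw [neg_mul_neg, h.sq]
  c k := by rw [neg_mul, h.toGrRel.c, mul_neg]
  x k := by rw [neg_mul, h.toGrRel.x, mul_neg]
  s k hk := by rw [neg_mul, h.s, mul_neg]

theorem IsStable.of_neg {N : Submodule F M} (h : IsStable x c s (-δ) N) : IsStable x c s δ N :=
  ⟨h.x, h.c, h.s, fun v hv => by simpa using h.gr v hv⟩

theorem Irr.neg (h : Irr x c s δ) : Irr x c s (-δ) := fun N hN => h N hN.of_neg

/-- The direct sum of two actions. -/
def prodOp {κ : Type*} (f : κ → Module.End F M) (f' : κ → Module.End F M') (k : κ) :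
    Module.End F (M × M') := LinearMap.prodMapRingHom F M M' (f k, f' k)

theorem SuperHC.prod (h : SuperHC x c s δ) (h' : SuperHC x' c' s' δ') :
    SuperHC (prodOp x x') (prodOp c c')
      (fun k hk => LinearMap.prodMapRingHom F M M' (s k hk, s' k hk))
      (LinearMap.prodMapRingHom F M M' (δ, δ')) where
  toHCRel := HCRel.map (x := fun k => (x k, x' k)) (c := fun k => (c k, c' k))
    (s := fun k hk => (s k hk, s' k hk))
    { c_sq := fun k => Prod.ext (h.c_sq k) (h'.c_sq k)
      c_anti := fun k l e => Prod.ext (h.c_anti k l e) (h'.c_anti k l e)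
      x_comm := fun k l => Prod.ext (h.x_comm k l) (h'.x_comm k l)
      x_c := fun k => Prod.ext (h.x_c k) (h'.x_c k)
      x_c_ne := fun k l e => Prod.ext (h.x_c_ne k l e) (h'.x_c_ne k l e)
      s_sq := fun k hk => Prod.ext (h.s_sq k hk) (h'.s_sq k hk)
      s_c := fun k hk m => Prod.ext (h.s_c k hk m) (h'.s_c k hk m)
      s_x := fun k hk => Prod.ext (h.s_x k hk) (h'.s_x k hk)
      s_x_ne := fun k hk m e e' => Prod.ext (h.s_x_ne k hk m e e') (h'.s_x_ne k hk m e e') } _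
  braid k hk := by
    simp only [← map_mul]
    exact congrArg _ (Prod.ext (h.braid k hk) (h'.braid k hk))
  comm k l hk hl e := by
    simp only [← map_mul]
    exact congrArg _ (Prod.ext (h.comm k l hk hl e) (h'.comm k l hk hl e))
  ker_sq k a v w e e' := Prod.ext
    (h.ker_sq k a v.1 w.1 (congrArg Prod.fst e) (congrArg Prod.fst e'))
    (h'.ker_sq k a v.2 w.2 (congrArg Prod.snd e) (congrArg Prod.snd e'))
  ker_x k v e := Prod.ext (h.ker_x k v.1 (congrArg Prod.fst e))
    (h'.ker_x k v.2 (congrArg Prod.snd e))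
  sq := by
    rw [← map_mul]
    exact (congrArg _ (Prod.ext h.sq h'.sq)).trans (map_one _)
  c k := by
    unfold prodOp
    rw [← map_mul, ← map_mul, ← map_neg]
    exact congrArg _ (Prod.ext (h.toGrRel.c k) (h'.toGrRel.c k))
  x k := by
    unfold prodOp
    rw [← map_mul, ← map_mul]
    exact congrArg _ (Prod.ext (h.toGrRel.x k) (h'.toGrRel.x k))
  s k hk := by
    rw [← map_mul, ← map_mul]
    exact congrArg _ (Prod.ext (h.s k hk) (h'.s k hk))

theorem SuperHC.gr_Phi (h : SuperHC x c s δ) (k : ℕ) (hk : k + 1 < n) :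
    δ * Phi x c s k hk = Phi x c s k hk * δ := by
  have h1 : ∀ m, Commute δ (x m) := h.toGrRel.x
  have h2 : Commute δ (s k hk) := h.s k hk
  have h3 : ∀ a b, Commute δ (c a * c b) := fun a b => by
    change δ * (c a * c b) = c a * c b * δ
    rw [← mul_assoc, h.toGrRel.c, neg_mul, mul_assoc, h.toGrRel.c, mul_neg, neg_neg, mul_assoc]
  unfold Phi eOp
  rw [← mul_assoc (c _)]
  exact ((h2.mul_right (((h1 _).mul_right (h1 _)).sub_right ((h1 _).mul_right (h1 _)))).add_right
    (((h1 _).add_right (h1 _)).add_right ((h3 _ _).mul_right ((h1 _).sub_right (h1 _))))).eq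

theorem SuperHC.gr_intertwiner (h : SuperHC x c s δ) {Θ : Perm (Fin n) → Module.End F M}
    (hΘ : IsIntertwiner x c s Θ) (w : Perm (Fin n)) : δ * Θ w = Θ w * δ := by
  induction w using perm_induction with
  | one => rw [hΘ.one, mul_one, one_mul]
  | step w k hk ha ih => rw [hΘ.step w k hk ha, ← mul_assoc, h.gr_Phi, mul_assoc, ih, mul_assoc]

theorem eq_top_of_irr (hI : Irr x c s δ) {N : Submodule F M} (hN : IsStable x c s δ N) {v : M}
    (hv : v ∈ N) (h0 : v ≠ 0) : N = ⊤ :=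
  (hI N hN).resolve_left fun e => h0 ((Submodule.mem_bot F).mp (e ▸ hv))

variable [IsAlgClosed F] {χ : Fin n → F} {P : Pairing (zeros χ)}

theorem SuperHC.isStable_intertwinerSpan (h2 : (2 : F) ≠ 0) (h : SuperHC x c s δ)
    {Θ : Perm (Fin n) → Module.End F M} (hΘ : IsIntertwiner x c s Θ) {d : F} {v : M}
    (hv : IsVacuum x c δ P d v) : IsStable x c s δ (intertwinerSpan Θ (vacSpan c P v)) where
  x k _ hy := x_mem_intertwinerSpan hΘ h.toHCRel (hv.x_mem_vacSpan h.toCXRel h.ker_x) k hy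
  c k _ hy := c_mem_intertwinerSpan hΘ h.toHCRel (hv.c_mem_vacSpan h.toCXRel) k hy
  s k hk _ hy := s_mem_intertwinerSpan hΘ h.toSplitHC h2 (hv.vacSpan_le_wt h.toCXRel)
    (hv.c_mem_vacSpan h.toCXRel) (hv.x_mem_vacSpan h.toCXRel h.ker_x) k hk hy
  gr _ hy := by
    refine intertwinerSpan_le_comap δ (fun w y hy => ?_) hy
    rw [← Module.End.mul_apply, h.gr_intertwiner hΘ, Module.End.mul_apply]
    exact mem_intertwinerSpan w (hv.gr_mem_vacSpan h.toGrRel y hy)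

/-- The cyclic module generated by a vacuum vector meets the weight space only in `vacSpan`. -/
theorem SuperHC.exists_cyclic (h2 : (2 : F) ≠ 0) (h : SuperHC x c s δ) {d : F} {v : M}
    (hv : IsVacuum x c δ P d v) : ∃ N, IsStable x c s δ N ∧ v ∈ N ∧
      (∀ y ∈ N, y ∈ wt x χ → y ∈ vacSpan c P v) ∧
      ∀ k hk, χ ⟨k, Nat.lt_of_succ_lt hk⟩ ≠ χ ⟨k + 1, hk⟩ → ∀ y ∈ N, y ∈ wt x (χ ∘ simple k hk) →
        ∃ z ∈ vacSpan c P v, y = Phi x c s k hk z := by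
  obtain ⟨Θ, hΘ⟩ := h.exists_intertwiner
  refine ⟨_, h.isStable_intertwinerSpan h2 hΘ hv, le_intertwinerSpan hΘ _ (mem_vacSpan P v),
    fun y hy hw => ?_, fun k hk hne y hy hw => ?_⟩
  · have := mem_map_of_mem_intertwinerSpan hΘ h.toSplitHC h2 (hv.vacSpan_le_wt h.toCXRel)
      (ordPres_one χ) hy (by simpa using hw)
    rw [hΘ.one] at this
    obtain ⟨z, hz, rfl⟩ := this
    exact hz
  · have ho : OrdPres χ (simple k hk) := by
      have := (ordPres_one χ).simple_mul (k := k) (hk := hk) (by simpa using hne)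
      rwa [mul_one] at this
    obtain ⟨z, hz, rfl⟩ := mem_map_of_mem_intertwinerSpan hΘ h.toSplitHC h2
      (hv.vacSpan_le_wt h.toCXRel) ho hy (by rwa [simple_inv])
    refine ⟨z, hz, ?_⟩
    have := hΘ.step 1 k hk (by unfold Ascent; simp [Fin.lt_def])
    rw [mul_one, hΘ.one, mul_one] at this
    rw [this]

/-- The obstruction: intertwiners with zero square vanish on irreducible modules. -/
theorem SuperHC.Phi_eq_zero (h2 : (2 : F) ≠ 0) (h : SuperHC x c s δ) (hI : Irr x c s δ)
    (k : ℕ) (hk : k + 1 < n) (hχ : 2 * (χ ⟨k, Nat.lt_of_succ_lt hk⟩ + χ ⟨k + 1, hk⟩) =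
      (χ ⟨k, Nat.lt_of_succ_lt hk⟩ - χ ⟨k + 1, hk⟩) ^ 2) {v : M} (hv : v ∈ wt x χ) :
    Phi x c s k hk v = 0 := by
  by_contra h0
  have hne : χ ⟨k, Nat.lt_of_succ_lt hk⟩ ≠ χ ⟨k + 1, hk⟩ := fun e => h0 (by
    rw [h.toSplitHC.eq_zero_of_eq h2 hv k hk e, map_zero])
  -- The image of `Φ_k` is a nonzero Clifford submodule of the exchanged weight space. A vacuum
  -- vector in it generates the whole module, so `v` is `Φ_k z` with `z` in the image of `Φ_k`. As
  -- `Φ_k² = 0` on weight `χ`, this gives `v = 0`.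
  have hL : (wt x χ).map (Phi x c s k hk) ≤ wt x (χ ∘ simple k hk) := by
    rintro _ ⟨v, hv, rfl⟩; exact h.Phi_mem_wt hv k hk
  obtain ⟨P⟩ := Pairing.nonempty (zeros (χ ∘ simple k hk))
  have hcL : ∀ m, ∀ y ∈ (wt x χ).map (Phi x c s k hk), c m y ∈ (wt x χ).map (Phi x c s k hk) := by
    rintro m _ ⟨v, hv, rfl⟩
    have := congrArg (· v) (h.Phi_c k hk (simple k hk m))
    simp only [Module.End.mul_apply] at this
    rw [← Perm.mul_apply, simple_mul_self, Perm.one_apply] at this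
    exact ⟨_, h.c_mem_wt hv _, this⟩
  have hxL : ∀ m, ∀ y ∈ (wt x χ).map (Phi x c s k hk), x m y ∈ (wt x χ).map (Phi x c s k hk) := by
    rintro m _ ⟨v, hv, rfl⟩
    have := congrArg (· v) (h.Phi_x k hk (simple k hk m))
    simp only [Module.End.mul_apply] at this
    rw [← Perm.mul_apply, simple_mul_self, Perm.one_apply] at this
    exact ⟨_, h.x_mem_wt hv _, this⟩
  have hgL : ∀ y ∈ (wt x χ).map (Phi x c s k hk), δ y ∈ (wt x χ).map (Phi x c s k hk) := by
    rintro _ ⟨v, hv, rfl⟩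
    refine ⟨δ v, fun m => ?_, ?_⟩
    · have h1 := fun u => congrArg (· u) (h.toGrRel.x m)
      simp only [Module.End.mul_apply] at h1 ⊢
      rw [← h1, ← h1, mem_wt.mp hv, map_smul]
    · rw [← Module.End.mul_apply, ← h.gr_Phi, Module.End.mul_apply]
  obtain ⟨v0, hv0, hv00, d, -, hvac⟩ := exists_isVacuum h.toCXRel h.toGrRel P hL (fun e => h0
    ((Submodule.mem_bot F).mp (e ▸ Submodule.mem_map_of_mem hv))) hcL hxL hgL
  obtain ⟨N, hN, hvN, -, hN2⟩ := h.exists_cyclic h2 hvac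
  have htop := eq_top_of_irr hI hN hvN hv00
  obtain ⟨z, hz, e⟩ := hN2 k hk (by simpa [simple_left, simple_right] using hne.symm) v
    (htop ▸ Submodule.mem_top) (by
      have : (χ ∘ simple k hk) ∘ simple k hk = χ := by
        funext m; simp [← Perm.mul_apply, simple_mul_self]
      rwa [this])
  obtain ⟨y, hy, rfl⟩ := vacSpan_le hcL hv0 hz
  rw [h.Phi_Phi hy, hχ, sub_self, zero_smul] at e
  exact h0 (by rw [e, map_zero])

/-- Irreducible modules with vacuum vectors of equal weight and parity are isomorphic. -/
theorem SuperHC.exists_equiv (h2 : (2 : F) ≠ 0) (h : SuperHC x c s δ) (hI : Irr x c s δ)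
    (h' : SuperHC x' c' s' δ') (hI' : Irr x' c' s' δ') {d : F} (hd : d = 1 ∨ d = -1) {v : M}
    (hv : IsVacuum x c δ P d v) (hv0 : v ≠ 0) {v' : M'} (hv' : IsVacuum x' c' δ' P d v')
    (hv0' : v' ≠ 0) : ∃ f : M ≃ₗ[F] M', Intertwines x c s δ x' c' s' δ' f.toLinearMap := by
  -- Goursat's argument: the submodule `N` generated by `(v, v')` in the direct sum is the graph of
  -- an isomorphism. The vacuum vectors of parity `d` in `N` are multiples of `(v, v')`, so `N`
  -- contains neither `(v, 0)` nor `(0, v')`. Irreducibility then makes both projections bijective.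
  have hp := h.prod h'
  have hvp : IsVacuum (prodOp x x') (prodOp c c') (LinearMap.prodMapRingHom F M M' (δ, δ')) P d
      (v, v') := by
    refine ⟨fun k => Prod.ext (hv.mem_wt k) (hv'.mem_wt k), fun k hk => ?_,
      Prod.ext hv.gr hv'.gr⟩
    have : vacOp (prodOp x x') (prodOp c c') P k (v, v') =
        (vacOp x c P k v, vacOp x' c' P k v') := by
      unfold vacOp
      split_ifs <;> rfl
    rw [this, hv.vac k hk, hv'.vac k hk]
  obtain ⟨N, hN, hvN, hN1, -⟩ := hp.exists_cyclic h2 hvp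
  have key : ∀ y ∈ N, IsVacuum (prodOp x x') (prodOp c c')
      (LinearMap.prodMapRingHom F M M' (δ, δ')) P d y → ∃ r : F, r • (v, v') = y := fun y hy hy' =>
    Submodule.mem_span_singleton.mp (hvp.mem_span_of_mem_vacSpan h2 hp.toCXRel hp.toGrRel hd
      (hN1 y hy hy'.mem_wt) hy' (Or.inl rfl))
  have k2 : N.comap (LinearMap.inr F M M') = ⊥ := by
    refine (hI' _ ⟨fun k y hy => ?_, fun k y hy => ?_, fun k hk y hy => ?_, fun y hy => ?_⟩).resolve_right
      fun e => ?_
    · simpa [prodOp] using hN.x k _ hy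
    · simpa [prodOp] using hN.c k _ hy
    · simpa using hN.s k hk _ hy
    · simpa using hN.gr _ hy
    · have h1 : ((0 : M), v') ∈ N := by
        have : v' ∈ N.comap (LinearMap.inr F M M') := e ▸ Submodule.mem_top
        simpa using this
      obtain ⟨r, hr⟩ := key _ h1 ⟨fun k => Prod.ext (by simp [prodOp]) (hv'.mem_wt k), fun k hk => by
        have : vacOp (prodOp x x') (prodOp c c') P k (0, v') = (0, vacOp x' c' P k v') := by
          unfold vacOp
          split_ifs <;> simp [prodOp]
        rw [this, hv'.vac k hk], Prod.ext (by simp) hv'.gr⟩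
      have e1 : r • v = 0 := congrArg Prod.fst hr
      have e2 : r • v' = v' := congrArg Prod.snd hr
      rw [(smul_eq_zero.mp e1).resolve_right hv0, zero_smul] at e2
      exact hv0' e2.symm
  have k1 : N.comap (LinearMap.inl F M M') = ⊥ := by
    refine (hI _ ⟨fun k y hy => ?_, fun k y hy => ?_, fun k hk y hy => ?_, fun y hy => ?_⟩).resolve_right
      fun e => ?_
    · simpa [prodOp] using hN.x k _ hy
    · simpa [prodOp] using hN.c k _ hy
    · simpa using hN.s k hk _ hy
    · simpa using hN.gr _ hy
    · have h1 : (v, (0 : M')) ∈ N := by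
        have : v ∈ N.comap (LinearMap.inl F M M') := e ▸ Submodule.mem_top
        simpa using this
      obtain ⟨r, hr⟩ := key _ h1 ⟨fun k => Prod.ext (hv.mem_wt k) (by simp [prodOp]), fun k hk => by
        have : vacOp (prodOp x x') (prodOp c c') P k (v, 0) = (vacOp x c P k v, 0) := by
          unfold vacOp
          split_ifs <;> simp [prodOp]
        rw [this, hv.vac k hk], Prod.ext hv.gr (by simp)⟩
      have e1 : r • v' = 0 := congrArg Prod.snd hr
      have e2 : r • v = v := congrArg Prod.fst hr
      rw [(smul_eq_zero.mp e1).resolve_right hv0', zero_smul] at e2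
      exact hv0 e2.symm
  have s1 : N.map (LinearMap.fst F M M') = ⊤ := by
    refine eq_top_of_irr hI ⟨?_, ?_, ?_, ?_⟩ ⟨_, hvN, rfl⟩ hv0
    · rintro k _ ⟨y, hy, rfl⟩; exact ⟨_, hN.x k y hy, rfl⟩
    · rintro k _ ⟨y, hy, rfl⟩; exact ⟨_, hN.c k y hy, rfl⟩
    · rintro k hk _ ⟨y, hy, rfl⟩; exact ⟨_, hN.s k hk y hy, rfl⟩
    · rintro _ ⟨y, hy, rfl⟩; exact ⟨_, hN.gr y hy, rfl⟩
  have s2 : N.map (LinearMap.snd F M M') = ⊤ := by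
    refine eq_top_of_irr hI' ⟨?_, ?_, ?_, ?_⟩ ⟨_, hvN, rfl⟩ hv0'
    · rintro k _ ⟨y, hy, rfl⟩; exact ⟨_, hN.x k y hy, rfl⟩
    · rintro k _ ⟨y, hy, rfl⟩; exact ⟨_, hN.c k y hy, rfl⟩
    · rintro k hk _ ⟨y, hy, rfl⟩; exact ⟨_, hN.s k hk y hy, rfl⟩
    · rintro _ ⟨y, hy, rfl⟩; exact ⟨_, hN.gr y hy, rfl⟩
  have i1 : ∀ y : M, (y, (0 : M')) ∈ N → y = 0 := fun y hy => by
    have : y ∈ N.comap (LinearMap.inl F M M') := by simpa using hy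
    rwa [k1] at this
  have i2 : ∀ y : M', ((0 : M), y) ∈ N → y = 0 := fun y hy => by
    have : y ∈ N.comap (LinearMap.inr F M M') := by simpa using hy
    rwa [k2] at this
  let f1 : N ≃ₗ[F] M := LinearEquiv.ofBijective ((LinearMap.fst F M M').domRestrict N) (by
    constructor
    · rw [← LinearMap.ker_eq_bot, LinearMap.ker_eq_bot']
      rintro ⟨⟨a, b⟩, hab⟩ (rfl : a = 0)
      exact Subtype.ext (Prod.ext rfl (i2 b hab))
    · intro y
      have : y ∈ N.map (LinearMap.fst F M M') := s1 ▸ Submodule.mem_top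
      obtain ⟨z, hz, rfl⟩ := this
      exact ⟨⟨z, hz⟩, rfl⟩)
  let f2 : N ≃ₗ[F] M' := LinearEquiv.ofBijective ((LinearMap.snd F M M').domRestrict N) (by
    constructor
    · rw [← LinearMap.ker_eq_bot, LinearMap.ker_eq_bot']
      rintro ⟨⟨a, b⟩, hab⟩ (rfl : b = 0)
      exact Subtype.ext (Prod.ext (i1 a hab) rfl)
    · intro y
      have : y ∈ N.map (LinearMap.snd F M M') := s2 ▸ Submodule.mem_top
      obtain ⟨z, hz, rfl⟩ := this
      exact ⟨⟨z, hz⟩, rfl⟩)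
  have hf : ∀ z ∈ N, (f1.symm.trans f2) z.1 = z.2 := fun z hz => by
    have : f1.symm z.1 = ⟨z, hz⟩ := by rw [LinearEquiv.symm_apply_eq]; rfl
    rw [LinearEquiv.trans_apply, this]; rfl
  have hf' : ∀ y, ∃ z ∈ N, z.1 = y := fun y => by
    have : y ∈ N.map (LinearMap.fst F M M') := s1 ▸ Submodule.mem_top
    obtain ⟨z, hz, e⟩ := this
    exact ⟨z, hz, e⟩
  refine ⟨f1.symm.trans f2, ⟨fun k y => ?_, fun k y => ?_, fun k hk y => ?_, fun y => ?_⟩⟩ <;>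
    obtain ⟨z, hz, rfl⟩ := hf' y <;>
    rw [LinearEquiv.coe_coe, hf z hz]
  · exact hf _ (hN.x k z hz)
  · exact hf _ (hN.c k z hz)
  · exact hf _ (hN.s k hk z hz)
  · exact hf _ (hN.gr z hz)

/-- Schur's lemma for even endomorphisms. -/
theorem SuperHC.intertwines_eq_smul (h2 : (2 : F) ≠ 0) (h : SuperHC x c s δ) (hI : Irr x c s δ)
    {d : F} (hd : d = 1 ∨ d = -1) {v : M} (hv : IsVacuum x c δ P d v) (hv0 : v ≠ 0)
    {f : Module.End F M} (hf : Intertwines x c s δ x c s δ f) : ∃ r : F, f = r • 1 := by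
  obtain ⟨N, hN, hvN, hN1, -⟩ := h.exists_cyclic h2 hv
  have htop := eq_top_of_irr hI hN hvN hv0
  -- The vector `f v` is again a vacuum vector of the same parity, hence equals `r v`. The kernel of
  -- `f - r` is stable and contains `v`.
  have hfv : IsVacuum x c δ P d (f v) := by
    refine ⟨hf.mem_wt hv.mem_wt, fun k hk => ?_, by rw [← hf.gr, hv.gr, map_smul]⟩
    have : vacOp x c P k (f v) = f (vacOp x c P k v) := by
      unfold vacOp
      split_ifs
      · simp [hf.c]
      · simp [hf.x]
    rw [this, hv.vac k hk]
  obtain ⟨r, hr⟩ := Submodule.mem_span_singleton.mp (hv.mem_span_of_mem_vacSpan h2 h.toCXRel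
    h.toGrRel hd (hN1 _ (htop ▸ Submodule.mem_top) hfv.mem_wt) hfv (Or.inl rfl))
  refine ⟨r, ?_⟩
  have hg : Intertwines x c s δ x c s δ (f - r • (1 : Module.End F M)) :=
    ⟨fun k y => by simp [hf.x], fun k y => by simp [hf.c], fun k hk y => by simp [hf.s],
      fun y => by simp [hf.gr]⟩
  have := eq_top_of_irr hI hg.ker (v := v) (by simp [hr]) hv0
  rw [LinearMap.ker_eq_top] at this
  exact sub_eq_zero.mp this

/-- The image of the vacuum vector would be a vacuum vector of opposite parity in `vacSpan`; without
an unpaired zero weight it must be `0`. -/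
theorem SuperHC.odd_eq_zero (h2 : (2 : F) ≠ 0) (h : SuperHC x c s δ) (hI : Irr x c s δ)
    {d : F} (hd : d = 1 ∨ d = -1) {v : M} (hv : IsVacuum x c δ P d v) (hv0 : v ≠ 0)
    (hK : P.K = ∅) {f : Module.End F M} (hf : Intertwines x c s δ x c s (-δ) f) : f = 0 := by
  obtain ⟨N, hN, hvN, hN1, -⟩ := h.exists_cyclic h2 hv
  have htop := eq_top_of_irr hI hN hvN hv0
  have hfv : IsVacuum x c δ P (-d) (f v) := by
    refine ⟨hf.mem_wt hv.mem_wt, fun k hk => ?_, ?_⟩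
    · have : vacOp x c P k (f v) = f (vacOp x c P k v) := by
        unfold vacOp
        split_ifs
        · simp [hf.c]
        · simp [hf.x]
      rw [this, hv.vac k hk]
    · have := hf.gr v
      rw [hv.gr, map_smul, LinearMap.neg_apply] at this
      rw [neg_smul, this, neg_neg]
  have h0 := hv.eq_zero_of_mem_vacSpan h2 h.toCXRel h.toGrRel hd
    (hN1 _ (htop ▸ Submodule.mem_top) hfv.mem_wt) hfv hK
  have := eq_top_of_irr hI hf.ker (v := v) h0 hv0
  rwa [LinearMap.ker_eq_top] at this

/-- With respect to `-δ`, the vector `c_k v` is a vacuum vector of the same parity as `v`, so the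
module is isomorphic to its parity reversal. -/
theorem SuperHC.exists_odd_equiv (h2 : (2 : F) ≠ 0) (h : SuperHC x c s δ) (hI : Irr x c s δ)
    {d : F} (hd : d = 1 ∨ d = -1) {v : M} (hv : IsVacuum x c δ P d v) (hv0 : v ≠ 0)
    {k : Fin n} (hk : k ∈ P.K) :
    ∃ f : M ≃ₗ[F] M, Intertwines x c s δ x c s (-δ) f.toLinearMap := by
  have h1 := hv.c_isVacuum h.toCXRel h.toGrRel hk
  refine h.exists_equiv h2 hI h.neg hI.neg hd hv hv0 (v' := c k v)
    ⟨h1.mem_wt, h1.vac, ?_⟩ fun e => hv0 ?_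
  · rw [LinearMap.neg_apply, h1.gr, neg_smul, neg_neg]
  · have := congrArg (c k) e
    rwa [← Module.End.mul_apply, h.c_sq, map_zero] at this

end super

/-! ## Finite dimensionality of `𝒴ₙ` -/

namespace Y

variable {F : Type u} [Field F] {n : ℕ}

/-- The algebra is the sum, over the permutations `σ`, of the translates by `σ` of the
finite-dimensional span of Clifford monomials. -/
instance finite : Module.Finite F (Y F n) := by
  let γ : Fin n → Module.End F (Y F n) := fun k => LinearMap.mulLeft F (Y.c F k)
  let C : Submodule F (Y F n) := cliffSpan γ (List.finRange n) (Submodule.span F {1})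
  have hC : ∀ l : List (Fin n), (l.map (Y.c F)).prod ∈ C := by
    intro l
    induction l with
    | nil => exact le_cliffSpan _ _ (Submodule.mem_span_singleton_self _)
    | cons k l ih =>
      rw [List.map_cons, List.prod_cons]
      refine c_mem_cliffSpan (c := γ) (fun k => ?_) (fun k l e => ?_) _ _ k (List.mem_finRange k) _ ih
      · ext a; simp [γ, ← mul_assoc, c_sq]
      · ext a; simp only [γ, Module.End.mul_apply, LinearMap.neg_apply, LinearMap.mulLeft_apply,
          ← mul_assoc]
        rw [c_anticomm k l e, neg_mul']
  haveI : FiniteDimensional F C := cliffSpan_finite _ _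
  have htop : (⨆ σ : Perm (Fin n), C.map (LinearMap.mulRight F (Y.w F σ))) = ⊤ := by
    rw [eq_top_iff]
    intro a _
    have hp : ∀ e, Y.parity F e ≤ ⨆ σ : Perm (Fin n), C.map (LinearMap.mulRight F (Y.w F σ)) := by
      intro e
      refine Submodule.span_le.mpr ?_
      rintro _ ⟨l, σ, -, rfl⟩
      exact Submodule.mem_iSup_of_mem σ ⟨_, hC l, rfl⟩
    obtain ⟨b, hb, d, hd, rfl⟩ := exists_parity_add a
    exact add_mem (hp 0 hb) (hp 1 hd)
  haveI : Module.Finite F (⊤ : Submodule F (Y F n)) := by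
    rw [← htop]
    infer_instance
  exact Module.Finite.equiv Submodule.topEquiv

end Y

/-! ## Supermodules as spaces with operators -/

theorem zmod_two_cases (e : ZMod 2) : e = 0 ∨ e = 1 := by revert e; decide

namespace YSupermodule

variable {F : Type u} [Field F] {n : ℕ} (V : YSupermodule.{u, v} F n)

/-- The action of an element of `𝒴ₙ`. -/
def act : Y F n →ₐ[F] Module.End F V := Algebra.lsmul F F V

@[simp]
theorem act_apply (a : Y F n) (z : V) : V.act a z = a • z := rfl

/-- The action of the Jucys-Murphy elements. -/
def xOp (k : Fin n) : Module.End F V := V.act (Y.jm F k)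

/-- The action of the Clifford generators. -/
def cOp (k : Fin n) : Module.End F V := V.act (Y.c F k)

/-- The action of the simple transpositions. -/
def sOp (k : ℕ) (hk : k + 1 < n) : Module.End F V := V.act (Y.w F (simple k hk))

/-- The parity operator. -/
def grOp : Module.End F V :=
  (2 : F) • ((V.gr 0).subtype ∘ₗ (V.gr 0).projectionOnto (V.gr 1) V.isCompl) - LinearMap.id

theorem grOp_zero {z : V} (hz : z ∈ V.gr 0) : V.grOp z = z := by
  have := Submodule.projectionOnto_apply_left V.isCompl ⟨z, hz⟩
  simp only [grOp, LinearMap.sub_apply, LinearMap.smul_apply, LinearMap.comp_apply,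
    Submodule.subtype_apply, LinearMap.id_apply]
  rw [this, two_smul]; simp

theorem grOp_one {z : V} (hz : z ∈ V.gr 1) : V.grOp z = -z := by
  have := Submodule.projectionOnto_apply_right V.isCompl ⟨z, hz⟩
  simp only [grOp, LinearMap.sub_apply, LinearMap.smul_apply, LinearMap.comp_apply,
    Submodule.subtype_apply, LinearMap.id_apply]
  rw [this]; simp

theorem exists_add (z : V) : ∃ a ∈ V.gr 0, ∃ b ∈ V.gr 1, z = a + b := by
  have : z ∈ V.gr 0 ⊔ V.gr 1 := V.isCompl.sup_eq_top ▸ Submodule.mem_top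
  obtain ⟨a, ha, b, hb, rfl⟩ := Submodule.mem_sup.mp this
  exact ⟨a, ha, b, hb, rfl⟩

theorem grOp_apply {e : ZMod 2} {z : V} (hz : z ∈ V.gr e) : V.grOp z = (-1 : F) ^ e.val • z := by
  rcases zmod_two_cases e with rfl | rfl
  · have : V.grOp z = z := V.grOp_zero hz
    rw [this]; simp
  · have : V.grOp z = -z := V.grOp_one hz
    rw [this]; simp [ZMod.val_one]

variable {V}

theorem mem_gr_zero (h2 : (2 : F) ≠ 0) {z : V} : z ∈ V.gr 0 ↔ V.grOp z = z := by
  refine ⟨V.grOp_zero, fun h => ?_⟩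
  obtain ⟨a, ha, b, hb, rfl⟩ := V.exists_add z
  rw [map_add, V.grOp_zero ha, V.grOp_one hb, add_left_cancel_iff] at h
  rw [eq_zero_of_eq_neg h2 h.symm, add_zero]
  exact ha

theorem mem_gr_one (h2 : (2 : F) ≠ 0) {z : V} : z ∈ V.gr 1 ↔ V.grOp z = -z := by
  refine ⟨V.grOp_one, fun h => ?_⟩
  obtain ⟨a, ha, b, hb, rfl⟩ := V.exists_add z
  rw [map_add, V.grOp_zero ha, V.grOp_one hb, neg_add, add_right_cancel_iff] at h
  rw [eq_zero_of_eq_neg h2 h, zero_add]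
  exact hb

theorem mem_gr (h2 : (2 : F) ≠ 0) {e : ZMod 2} {z : V} :
    z ∈ V.gr e ↔ V.grOp z = (-1 : F) ^ e.val • z := by
  refine ⟨V.grOp_apply, fun h => ?_⟩
  rcases zmod_two_cases e with rfl | rfl
  · exact (mem_gr_zero h2).mpr (h.trans (by simp))
  · exact (mem_gr_one h2).mpr (h.trans (by simp [ZMod.val_one]))

theorem grOp_act {e : ZMod 2} {a : Y F n} (ha : a ∈ Y.parity F e) (z : V) :
    V.grOp (a • z) = (-1 : F) ^ e.val • (a • V.grOp z) := by
  obtain ⟨b, hb, d, hd, rfl⟩ := V.exists_add z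
  rw [smul_add, map_add, map_add, V.grOp_zero hb, V.grOp_one hd, V.grOp_apply (V.smul_mem e 0 a b ha hb),
    V.grOp_apply (V.smul_mem e 1 a d ha hd), smul_add, smul_add, add_zero]
  congr 1
  rcases zmod_two_cases e with rfl | rfl
  · simp [ZMod.val_one, smul_neg]
  · have : ((1 : ZMod 2) + 1).val = 0 := rfl
    have h1 : ((1 : ZMod 2)).val = 1 := rfl
    simp [this, h1, smul_neg]

theorem grOp_grOp (z : V) : V.grOp (V.grOp z) = z := by
  obtain ⟨b, hb, d, hd, rfl⟩ := V.exists_add z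
  rw [map_add, V.grOp_zero hb, V.grOp_one hd, map_add, map_neg, V.grOp_zero hb, V.grOp_one hd,
    neg_neg]

variable (V)

theorem grRel : GrRel V.xOp V.cOp V.grOp where
  sq := by ext z; exact grOp_grOp z
  c k := by
    ext z
    have h1 : ((1 : ZMod 2)).val = 1 := rfl
    simpa [h1, cOp] using grOp_act (V := V) (Y.c_mem_parity (F := F) k) z
  x k := by
    ext z
    simpa [xOp] using grOp_act (V := V) (Y.jm_mem_parity (F := F) k) z

theorem hcRel : HCRel V.xOp V.cOp V.sOp := Y.hcRel.map V.act.toRingHom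

/-- The weights of semisimple operators. -/
theorem superHC [Module.Finite F V] [PerfectField F] (h : V.IsCompletelySplittable) :
    SuperHC V.xOp V.cOp V.sOp V.grOp where
  toHCRel := V.hcRel
  braid k hk := by
    unfold sOp
    simp only [← map_mul, Y.w_braid]
  comm k l hk hl e := by
    unfold sOp
    simp only [← map_mul, Y.w_comm k l hk hl e]
  ker_sq k a v w e e' := by
    have hs : (V.xOp k ^ 2).IsSemisimple := (h k).pow 2
    have hv : v ∈ (V.xOp k ^ 2).genEigenspace a (2 : ℕ) := by
      rw [Module.End.mem_genEigenspace_nat, LinearMap.mem_ker]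
      simp only [pow_two, Module.End.mul_apply, LinearMap.sub_apply, map_sub,
        LinearMap.smul_apply, Module.End.one_apply, map_smul, e, e',
        map_add]
      simp [smul_add, e, e']
    rw [hs.isFinitelySemisimple.genEigenspace_eq_eigenspace a (by norm_num),
      Module.End.mem_eigenspace_iff, pow_two, Module.End.mul_apply, e] at hv
    simpa using hv
  ker_x k v e := by
    have hv : v ∈ (V.xOp k).genEigenspace 0 (2 : ℕ) := by
      rw [Module.End.mem_genEigenspace_nat, LinearMap.mem_ker]
      simpa [pow_two] using e
    rw [(show (V.xOp k).IsSemisimple from h k).isFinitelySemisimple.genEigenspace_eq_eigenspace 0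
      (by norm_num), Module.End.mem_eigenspace_iff, zero_smul] at hv
    exact hv
  toGrRel := V.grRel
  s k hk := by
    ext z
    simpa [sOp] using grOp_act (V := V) (Y.w_mem_parity (F := F) (simple k hk)) z

variable {V}

theorem smul_mem_of_isStable {N : Submodule F V} (hN : IsStable V.xOp V.cOp V.sOp V.grOp N)
    (a : Y F n) {z : V} (hz : z ∈ N) : a • z ∈ N := by
  induction a using Y.induction generalizing z with
  | algebraMap r => rw [algebraMap_smul]; exact N.smul_mem r hz
  | c k => exact hN.c k z hz
  | w σ =>
    induction σ using perm_induction with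
    | one => rwa [Y.w_one, one_smul]
    | step w k hk ha ih => rw [Y.w_mul, mul_smul]; exact hN.s k hk _ ih
  | add a b ha hb => rw [add_smul]; exact add_mem (ha hz) (hb hz)
  | mul a b ha hb => rw [mul_smul]; exact ha (hb hz)

theorem irr_of_isIrreducible (h2 : (2 : F) ≠ 0) (h : V.IsIrreducible) :
    Irr V.xOp V.cOp V.sOp V.grOp := by
  intro N hN
  let N' : Submodule (Y F n) V :=
    { carrier := N
      zero_mem' := N.zero_mem
      add_mem' := fun ha hb => N.add_mem ha hb
      smul_mem' := fun a z hz => smul_mem_of_isStable hN a hz }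
  have e : N'.restrictScalars F = N := rfl
  rcases h.2 N' (by
    rw [e]
    intro z hz
    obtain ⟨a, ha, b, hb, rfl⟩ := V.exists_add z
    have h1 := hN.gr _ hz
    rw [map_add, V.grOp_zero ha, V.grOp_one hb] at h1
    have ha' : a ∈ N := by
      have := add_mem hz h1
      rw [show a + b + (a + -b) = (2 : F) • a by rw [two_smul]; abel] at this
      exact (N.smul_mem_iff h2).mp this
    have hb' : b ∈ N := by simpa using sub_mem hz ha'
    exact add_mem (Submodule.mem_iSup_of_mem 0 ⟨ha', ha⟩) (Submodule.mem_iSup_of_mem 1 ⟨hb', hb⟩))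
    with h | h
  · left; rw [← e, h]; rfl
  · right; rw [← e, h]; rfl

theorem isIrreducible_of_irr [Nontrivial V] (h : Irr V.xOp V.cOp V.sOp V.grOp) :
    V.IsIrreducible := by
  refine ⟨inferInstance, fun N hN => ?_⟩
  have hg : ∀ z ∈ N, V.grOp z ∈ N := by
    intro z hz
    have h1 : (⨆ e : ZMod 2, N.restrictScalars F ⊓ V.gr e) ≤ (N.restrictScalars F).comap V.grOp := by
      refine iSup_le fun e => ?_
      rintro y ⟨hy, hye⟩
      change V.grOp y ∈ N.restrictScalars F
      rw [V.grOp_apply hye]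
      exact (N.restrictScalars F).smul_mem _ hy
    exact h1 (hN hz)
  rcases h (N.restrictScalars F) ⟨fun k z hz => N.smul_mem _ hz, fun k z hz => N.smul_mem _ hz,
    fun k hk z hz => N.smul_mem _ hz, hg⟩ with h | h
  · left; exact (Submodule.restrictScalars_eq_bot_iff _ _ _).mp h
  · right; exact (Submodule.restrictScalars_eq_top_iff _ _ _).mp h

/-- A nonzero vector `z` need not be homogeneous, but the submodule generated by `z` and its image
under the parity operator is graded. -/
theorem finite_of_isIrreducible (h2 : (2 : F) ≠ 0) (h : V.IsIrreducible) : Module.Finite F V := by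
  obtain ⟨z, hz⟩ := @exists_ne _ h.1 (0 : V)
  let f : Y F n × Y F n →ₗ[F] V := LinearMap.coprod
    ((LinearMap.toSpanSingleton (Y F n) V z).restrictScalars F)
    ((LinearMap.toSpanSingleton (Y F n) V (V.grOp z)).restrictScalars F)
  have hf : ∀ a, f a = a.1 • z + a.2 • V.grOp z := fun a => rfl
  have hst : ∀ (b : Y F n), ∀ v ∈ LinearMap.range f, b • v ∈ LinearMap.range f := by
    rintro b _ ⟨a, rfl⟩
    exact ⟨(b * a.1, b * a.2), by rw [hf, hf, smul_add, mul_smul, mul_smul]⟩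
  have htop := eq_top_of_irr (irr_of_isIrreducible h2 h) (N := LinearMap.range f)
    ⟨fun k => hst _, fun k => hst _, fun k hk => hst _, by
      rintro _ ⟨a, rfl⟩
      rw [hf, map_add]
      obtain ⟨a0, h0, a1, h1, e⟩ := Y.exists_parity_add a.1
      obtain ⟨b0, k0, b1, k1, e'⟩ := Y.exists_parity_add a.2
      have v1 : ((1 : ZMod 2)).val = 1 := rfl
      rw [e, e', add_smul, add_smul, map_add, map_add, grOp_act h0, grOp_act h1, grOp_act k0,
        grOp_act k1, grOp_grOp]
      -- The parity operator exchanges `z` and its image and changes the sign of the odd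
      -- coefficients.
      refine ⟨(b0 - b1, a0 - a1), ?_⟩
      rw [hf, sub_smul, sub_smul, v1]
      simp only [ZMod.val_zero, pow_zero, one_smul, pow_one, neg_smul]
      abel⟩ (v := z) ⟨(1, 0), by rw [hf]; simp⟩ hz
  exact Module.Finite.of_surjective f (LinearMap.range_eq_top.mp htop)

end YSupermodule

/-! ## Homomorphisms and weights of supermodules -/

namespace YSupermodule

variable {F : Type u} [Field F] {n : ℕ} {V : YSupermodule.{u, v} F n} {W : YSupermodule.{u, w} F n}

theorem Intertwines.map_smul {d : Module.End F V} {d' : Module.End F W} {f : V →ₗ[F] W}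
    (h : Intertwines V.xOp V.cOp V.sOp d W.xOp W.cOp W.sOp d' f) (a : Y F n) (z : V) :
    f (a • z) = a • f z := by
  induction a using Y.induction generalizing z with
  | algebraMap r => rw [algebraMap_smul, algebraMap_smul, _root_.map_smul]
  | c k => exact h.c k z
  | w σ =>
    induction σ using perm_induction generalizing z with
    | one => rw [Y.w_one, one_smul, one_smul]
    | step w k hk ha ih =>
      rw [Y.w_mul, mul_smul, mul_smul, ← ih]; exact h.s k hk _
  | add a b ha hb => rw [add_smul, add_smul, map_add, ha, hb]
  | mul a b ha hb => rw [mul_smul, mul_smul, ha, hb]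

theorem intertwines_of_smul {d : Module.End F V} {d' : Module.End F W} {f : V →ₗ[F] W}
    (h : ∀ e, ∀ a ∈ Y.parity F (n := n) e, ∀ z, f (a • z) = a • f z)
    (hg : ∀ z, f (d z) = d' (f z)) :
    Intertwines V.xOp V.cOp V.sOp d W.xOp W.cOp W.sOp d' f :=
  ⟨fun k => h 0 _ (Y.jm_mem_parity k), fun k => h 1 _ (Y.c_mem_parity k),
    fun _ _ => h 0 _ (Y.w_mem_parity _), hg⟩

theorem neg_one_pow_val_sq (e : ZMod 2) : (-1 : F) ^ e.val * (-1 : F) ^ e.val = 1 := by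
  rw [← mul_pow]; simp

theorem neg_one_pow_val_add (d e : ZMod 2) :
    (-1 : F) ^ (d + e).val = (-1 : F) ^ d.val * (-1 : F) ^ e.val := by
  have h0 : ((1 : ZMod 2) + 1).val = 0 := rfl
  rcases zmod_two_cases d with rfl | rfl <;> rcases zmod_two_cases e with rfl | rfl <;>
    simp [ZMod.val_one, h0]

theorem IsHomogeneousHom.gr {d : ZMod 2} {f : V →ₗ[F] W} (h : IsHomogeneousHom V W d f) (z : V) :
    f (V.grOp z) = (-1 : F) ^ d.val • W.grOp (f z) := by
  obtain ⟨a, ha, b, hb, rfl⟩ := V.exists_add z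
  rw [map_add, V.grOp_zero ha, V.grOp_one hb, map_add, map_add, map_add, W.grOp_apply (h.1 _ _ ha),
    W.grOp_apply (h.1 _ _ hb), add_zero, smul_add, smul_smul, smul_smul, neg_one_pow_val_sq,
    neg_one_pow_val_add, ← mul_assoc, neg_one_pow_val_sq]
  simp [ZMod.val_one]

theorem isHomogeneousHom_zero_iff (h2 : (2 : F) ≠ 0) {f : V →ₗ[F] W} :
    IsHomogeneousHom V W 0 f ↔
      Intertwines V.xOp V.cOp V.sOp V.grOp W.xOp W.cOp W.sOp W.grOp f := by
  constructor
  · intro h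
    exact intertwines_of_smul (fun e a ha z => by simpa using h.2 e a z ha)
      (fun z => by simpa using h.gr z)
  · intro h
    refine ⟨fun e z hz => ?_, fun e a z ha => by simpa using Intertwines.map_smul h a z⟩
    rw [mem_gr h2, ← h.gr, V.grOp_apply hz, zero_add, _root_.map_smul]

/-- Composition with the parity operator absorbs the sign `(-1)^{|a|}`. Odd homomorphisms become
linear maps that commute with the algebra and anticommute with parity. -/
theorem isHomogeneousHom_one_iff (h2 : (2 : F) ≠ 0) {f : V →ₗ[F] W} :
    IsHomogeneousHom V W 1 f ↔
      Intertwines V.xOp V.cOp V.sOp V.grOp W.xOp W.cOp W.sOp (-W.grOp) (f ∘ₗ V.grOp) := by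
  constructor
  · intro h
    refine intertwines_of_smul (fun e a ha z => ?_) (fun z => ?_)
    · rw [LinearMap.comp_apply, grOp_act ha, _root_.map_smul, h.2 e a _ ha, smul_smul, ZMod.val_one,
        one_mul, neg_one_pow_val_sq, one_smul, LinearMap.comp_apply]
    · rw [LinearMap.comp_apply, h.gr, LinearMap.comp_apply]
      simp [ZMod.val_one]
  · intro h
    have hf : ∀ z, f z = (f ∘ₗ V.grOp) (V.grOp z) := fun z => by
      rw [LinearMap.comp_apply, grOp_grOp]
    refine ⟨fun e z hz => ?_, fun e a z ha => ?_⟩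
    · rw [mem_gr h2, hf, V.grOp_apply hz, _root_.map_smul, _root_.map_smul, neg_one_pow_val_add,
        mul_smul, smul_comm]
      congr 1
      have := h.gr z
      rw [V.grOp_apply hz, _root_.map_smul, LinearMap.neg_apply] at this
      rw [ZMod.val_one, pow_one, neg_smul, one_smul]
      rw [this, neg_neg]
    · rw [hf, grOp_act ha, _root_.map_smul, Intertwines.map_smul h, LinearMap.comp_apply, grOp_grOp,
        ZMod.val_one, one_mul]

/-- Isomorphisms are allowed to be inhomogeneous. They still commute with the even elements `L_k`,
hence preserve weights. -/
theorem Hom.map_even_smul {f : V →ₗ[F] W} (hf : f ∈ Hom V W) {a : Y F n}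
    (ha : a ∈ Y.parity F 0) (z : V) : f (a • z) = a • f z := by
  induction hf using Submodule.span_induction with
  | mem f hf => obtain ⟨d, hd⟩ := hf; simpa using hd.2 0 a z ha
  | zero => simp
  | add f g _ _ hf hg => rw [LinearMap.add_apply, hf, hg, LinearMap.add_apply, smul_add]
  | smul r f _ hf => rw [LinearMap.smul_apply, hf, LinearMap.smul_apply, smul_comm]

theorem wt_ne_bot_of_isomorphic (h : V.Isomorphic W) {χ : Fin n → F} (hχ : wt V.xOp χ ≠ ⊥) :
    wt W.xOp χ ≠ ⊥ := by
  obtain ⟨f, hf, hb⟩ := h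
  obtain ⟨z, hz, h0⟩ := Submodule.exists_mem_ne_zero_of_ne_bot hχ
  refine Submodule.ne_bot_iff _ |>.mpr ⟨f z, fun k => ?_, fun e => h0 (hb.1 (e.trans (map_zero f).symm))⟩
  change Y.jm F k • Y.jm F k • f z = _
  rw [← Hom.map_even_smul hf (Y.jm_mem_parity k), ← Hom.map_even_smul hf (Y.jm_mem_parity k),
    ← _root_.map_smul]
  exact congrArg f (mem_wt.mp hz k)

/-! ### Existence of weights, uniqueness and types of irreducible supermodules -/

variable [IsAlgClosed F]

theorem exists_weight [Module.Finite F V] [Nontrivial V] (h : V.IsCompletelySplittable) :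
    ∃ χ, wt V.xOp χ ≠ ⊥ := by
  by_contra hall
  push Not at hall
  have h1 := Module.End.iSup_iInf_maxGenEigenspace_eq_top_of_iSup_maxGenEigenspace_eq_top_of_commute
    (fun k => V.xOp k ^ 2)
    (fun i j _ => ((show Commute (V.xOp i) (V.xOp j) from V.hcRel.x_comm i j).pow_pow 2 2))
    fun k => Module.End.iSup_maxGenEigenspace_eq_top _
  have h3 : ∀ χ : Fin n → F, ⨅ k, (V.xOp k ^ 2).maxGenEigenspace (χ k) = wt V.xOp χ := by
    intro χ
    ext z
    rw [Submodule.mem_iInf]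
    refine forall_congr' fun k => ?_
    have hs : (V.xOp k ^ 2).IsSemisimple := (show (V.xOp k).IsSemisimple from h k).pow 2
    rw [hs.isFinitelySemisimple.maxGenEigenspace_eq_eigenspace, Module.End.mem_eigenspace_iff,
      pow_two]
  simp only [h3, hall, iSup_bot] at h1
  exact bot_ne_top h1

theorem exists_vacuum [Module.Finite F V] (h : V.IsCompletelySplittable) {χ : Fin n → F}
    (hχ : wt V.xOp χ ≠ ⊥) (P : Pairing (zeros χ)) : ∃ v : V, v ≠ 0 ∧ ∃ d : F, (d = 1 ∨ d = -1) ∧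
      IsVacuum V.xOp V.cOp V.grOp P d v := by
  have hV := V.superHC h
  obtain ⟨v, -, h0, d, hd, hv⟩ := exists_isVacuum hV.toCXRel hV.toGrRel P le_rfl hχ
    (fun m v hv => hV.c_mem_wt hv m) (fun m v hv => hV.x_mem_wt hv m) (fun v hv k => by
      have h1 := fun u => congrArg (· u) (hV.toGrRel.x k)
      simp only [Module.End.mul_apply] at h1 ⊢
      rw [← h1, ← h1, mem_wt.mp hv, _root_.map_smul])
  exact ⟨v, h0, d, hd, hv⟩

/-- Irreducible completely splittable modules with a common weight are isomorphic. -/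
theorem isomorphic_of_wt (h2 : (2 : F) ≠ 0) (hV : V.IsIrreducible) (hVs : V.IsCompletelySplittable)
    (hW : W.IsIrreducible) (hWs : W.IsCompletelySplittable) {χ : Fin n → F}
    (hχ : wt V.xOp χ ≠ ⊥) (hχ' : wt W.xOp χ ≠ ⊥) : V.Isomorphic W := by
  haveI := finite_of_isIrreducible h2 hV
  haveI := finite_of_isIrreducible h2 hW
  obtain ⟨P⟩ := Pairing.nonempty (zeros χ)
  obtain ⟨v, hv0, d, hd, hv⟩ := exists_vacuum hVs hχ P
  obtain ⟨v', hv0', d', hd', hv'⟩ := exists_vacuum hWs hχ' P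
  by_cases e : d = d'
  · subst e
    obtain ⟨f, hf⟩ := (V.superHC hVs).exists_equiv h2 (irr_of_isIrreducible h2 hV) (W.superHC hWs)
      (irr_of_isIrreducible h2 hW) hd hv hv0 hv' hv0'
    exact ⟨f.toLinearMap, Submodule.subset_span ⟨0, (isHomogeneousHom_zero_iff h2).mpr hf⟩,
      f.bijective⟩
  -- The vacuum vectors have opposite parities, so `V` is compared with the parity reversal of `W`,
  -- and the resulting isomorphism is odd.
  · have e' : d' = -d := by
      rcases hd with rfl | rfl <;> rcases hd' with rfl | rfl <;> simp_all
    obtain ⟨f, hf⟩ := (V.superHC hVs).exists_equiv h2 (irr_of_isIrreducible h2 hV)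
      (W.superHC hWs).neg (irr_of_isIrreducible h2 hW).neg hd hv hv0
      (v' := v') ⟨hv'.mem_wt, hv'.vac, by rw [LinearMap.neg_apply, hv'.gr, e', neg_smul, neg_neg]⟩
      hv0'
    have hgg : V.grOp ∘ₗ V.grOp = LinearMap.id := by ext z; exact grOp_grOp z
    have hgb : Function.Bijective V.grOp := Function.Involutive.bijective grOp_grOp
    refine ⟨f.toLinearMap ∘ₗ V.grOp, Submodule.subset_span ⟨1, (isHomogeneousHom_one_iff h2).mpr ?_⟩,
      f.bijective.comp hgb⟩
    rwa [LinearMap.comp_assoc, hgg, LinearMap.comp_id]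

theorem Hom_self_eq (h2 : (2 : F) ≠ 0) (hV : V.IsIrreducible) (hVs : V.IsCompletelySplittable)
    {χ : Fin n → F} (hχ : wt V.xOp χ ≠ ⊥) :
    (∀ f, IsHomogeneousHom V V 0 f → f ∈ Submodule.span F {(1 : Module.End F V)}) ∧
    IsHomogeneousHom V V 0 (1 : Module.End F V) ∧
    (Even (zeros χ).card → ∀ f, IsHomogeneousHom V V 1 f → f = 0) ∧
    (Odd (zeros χ).card → ∃ g, IsHomogeneousHom V V 1 g ∧ g ≠ 0 ∧
      ∀ f, IsHomogeneousHom V V 1 f → f ∈ Submodule.span F {g}) := by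
  haveI := finite_of_isIrreducible h2 hV
  have hI := irr_of_isIrreducible h2 hV
  have hS := V.superHC hVs
  obtain ⟨P⟩ := Pairing.nonempty (zeros χ)
  obtain ⟨v, hv0, d, hd, hv⟩ := exists_vacuum hVs hχ P
  have hgg : V.grOp ∘ₗ V.grOp = LinearMap.id := by ext z; exact grOp_grOp z
  have hback : ∀ f : V →ₗ[F] V, (f ∘ₗ V.grOp) ∘ₗ V.grOp = f := fun f => by
    rw [LinearMap.comp_assoc, hgg, LinearMap.comp_id]
  refine ⟨fun f hf => ?_, (isHomogeneousHom_zero_iff h2).mpr ⟨fun _ _ => rfl, fun _ _ => rfl,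
    fun _ _ _ => rfl, fun _ => rfl⟩, fun he f hf => ?_, fun ho => ?_⟩
  · obtain ⟨r, rfl⟩ := hS.intertwines_eq_smul h2 hI hd hv hv0 ((isHomogeneousHom_zero_iff h2).mp hf)
    exact Submodule.smul_mem _ _ (Submodule.mem_span_singleton_self _)
  · have hK : P.K = ∅ := by
      by_contra hK
      exact Nat.not_odd_iff_even.mpr he (P.K_nonempty_iff.mp hK)
    have := hS.odd_eq_zero h2 hI hd hv hv0 hK ((isHomogeneousHom_one_iff h2).mp hf)
    rw [← hback f, this, LinearMap.zero_comp]
  · obtain ⟨k, hk⟩ := Finset.nonempty_iff_ne_empty.mpr (P.K_nonempty_iff.mpr ho)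
    obtain ⟨g, hg⟩ := hS.exists_odd_equiv h2 hI hd hv hv0 hk
    refine ⟨g.toLinearMap ∘ₗ V.grOp, (isHomogeneousHom_one_iff h2).mpr (by rwa [hback]),
      fun e => hv0 ?_, fun f hf => ?_⟩
    · have : g.toLinearMap (V.grOp (V.grOp v)) = 0 := congrArg (· (V.grOp v)) e
      rw [grOp_grOp] at this
      exact g.injective (this.trans (map_zero g).symm)
    · have hf := (isHomogeneousHom_one_iff h2).mp hf
      have hgs : ∀ y, g (g.symm y) = y := g.apply_symm_apply
      -- The quotient `g⁻¹ f` of two odd endomorphisms is even, hence a scalar.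
      obtain ⟨r, hr⟩ := hS.intertwines_eq_smul h2 hI hd hv hv0
        (f := g.symm.toLinearMap ∘ₗ (f ∘ₗ V.grOp))
        ⟨fun k y => g.injective (by
          have := hg.x k (g.symm ((f ∘ₗ V.grOp) y))
          simp only [LinearEquiv.coe_coe, hgs] at this
          simp only [LinearMap.comp_apply, LinearEquiv.coe_coe, hgs]
          exact (hf.x k y).trans this.symm |>.trans (by simp [hgs])),
        fun k y => g.injective (by
          have := hg.c k (g.symm ((f ∘ₗ V.grOp) y))
          simp only [LinearEquiv.coe_coe, hgs] at this
          simp only [LinearMap.comp_apply, LinearEquiv.coe_coe, hgs]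
          exact (hf.c k y).trans this.symm |>.trans (by simp [hgs])),
        fun k hk y => g.injective (by
          have := hg.s k hk (g.symm ((f ∘ₗ V.grOp) y))
          simp only [LinearEquiv.coe_coe, hgs] at this
          simp only [LinearMap.comp_apply, LinearEquiv.coe_coe, hgs]
          exact (hf.s k hk y).trans this.symm |>.trans (by simp [hgs])),
        fun y => g.injective (by
          have := hg.gr (g.symm ((f ∘ₗ V.grOp) y))
          simp only [LinearEquiv.coe_coe, hgs] at this
          simp only [LinearMap.comp_apply, LinearEquiv.coe_coe, hgs]
          exact (hf.gr y).trans this.symm |>.trans (by simp [hgs]))⟩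
      refine Submodule.mem_span_singleton.mpr ⟨r, ?_⟩
      rw [← hback f, ← LinearMap.smul_comp]
      congr 1
      ext y
      have := congrArg g (congrArg (· y) hr)
      simp only [LinearMap.comp_apply, LinearEquiv.coe_coe, hgs, LinearMap.smul_apply,
        Module.End.one_apply, _root_.map_smul] at this
      simp [this]

theorem Hom_le_of (A B : Submodule F (V →ₗ[F] V)) (hA : ∀ f, IsHomogeneousHom V V 0 f → f ∈ A)
    (hB : ∀ f, IsHomogeneousHom V V 1 f → f ∈ B) : Hom V V ≤ A ⊔ B := by
  refine Submodule.span_le.mpr ?_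
  rintro f ⟨d, hf⟩
  rcases zmod_two_cases d with rfl | rfl
  · exact Submodule.mem_sup_left (hA f hf)
  · exact Submodule.mem_sup_right (hB f hf)

theorem isTypeM_of_even (h2 : (2 : F) ≠ 0) (hV : V.IsIrreducible) (hVs : V.IsCompletelySplittable)
    {χ : Fin n → F} (hχ : wt V.xOp χ ≠ ⊥) (he : Even (zeros χ).card) : V.IsTypeM := by
  obtain ⟨h0, h1, h3, -⟩ := Hom_self_eq h2 hV hVs hχ
  haveI := hV.1
  have : Hom V V = Submodule.span F {(1 : Module.End F V)} := by
    refine le_antisymm ?_ ?_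
    · refine (Hom_le_of _ ⊥ h0 fun f hf => ?_).trans (by rw [sup_bot_eq])
      rw [h3 he f hf]; exact zero_mem _
    · rw [Submodule.span_singleton_le_iff_mem]
      exact Submodule.subset_span ⟨0, h1⟩
  rw [IsTypeM, this, finrank_span_singleton one_ne_zero]

theorem isTypeQ_of_odd (h2 : (2 : F) ≠ 0) (hV : V.IsIrreducible) (hVs : V.IsCompletelySplittable)
    {χ : Fin n → F} (hχ : wt V.xOp χ ≠ ⊥) (ho : Odd (zeros χ).card) : V.IsTypeQ := by
  obtain ⟨h0, h1, -, h4⟩ := Hom_self_eq h2 hV hVs hχ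
  obtain ⟨g, hg, hg0, hg1⟩ := h4 ho
  haveI := hV.1
  have hind : LinearIndependent F ![(1 : Module.End F V), g] := by
    rw [LinearIndependent.pair_iff' one_ne_zero]
    intro r hr
    refine hg0 ?_
    ext z
    have e1 := hg.gr z
    rw [← hr, LinearMap.smul_apply, LinearMap.smul_apply, Module.End.one_apply, Module.End.one_apply,
      _root_.map_smul, ZMod.val_one, pow_one, neg_smul, one_smul] at e1
    have e2 := eq_zero_of_eq_neg h2 e1
    have e3 := congrArg V.grOp e2
    rw [_root_.map_smul, grOp_grOp, map_zero] at e3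
    rw [← hr]
    simpa using e3
  have : Hom V V = Submodule.span F (Set.range ![(1 : Module.End F V), g]) := by
    have hr : Set.range ![(1 : Module.End F V), g] = {1, g} := by
      ext; simp [eq_comm, or_comm]
    rw [hr, Submodule.span_insert]
    refine le_antisymm (Hom_le_of _ _ h0 hg1) (sup_le ?_ ?_)
    · rw [Submodule.span_singleton_le_iff_mem]
      exact Submodule.subset_span ⟨0, h1⟩
    · rw [Submodule.span_singleton_le_iff_mem]
      exact Submodule.subset_span ⟨1, hg⟩
  rw [IsTypeQ, this, finrank_span_eq_card hind, Fintype.card_fin]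

end YSupermodule

/-! ## Closure properties of the set of weights -/

/-- Closure properties of the set of weights of an irreducible completely splittable module. -/
structure WeightClosed {F : Type*} [Field F] {n : ℕ} (S : Set (Fin n → F)) : Prop where
  zero : ∀ χ ∈ S, ∀ h : 0 < n, χ ⟨0, h⟩ = 0
  ne : ∀ χ ∈ S, ∀ k (hk : k + 1 < n), χ ⟨k, Nat.lt_of_succ_lt hk⟩ ≠ χ ⟨k + 1, hk⟩
  -- Entries `(a, b, a)` with both intertwiners zero: the remaining content of the braid relation is
  -- `a = 0` or `2a + 6b = 0`.
  triple : ∀ χ ∈ S, ∀ k (hk : k + 2 < n), χ ⟨k + 2, hk⟩ = χ ⟨k, by omega⟩ →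
    2 * (χ ⟨k, by omega⟩ + χ ⟨k + 1, by omega⟩) = (χ ⟨k, by omega⟩ - χ ⟨k + 1, by omega⟩) ^ 2 →
      χ ⟨k, by omega⟩ = 0 ∨ 2 * χ ⟨k, by omega⟩ + 6 * χ ⟨k + 1, by omega⟩ = 0
  swap : ∀ χ ∈ S, ∀ k (hk : k + 1 < n),
    2 * (χ ⟨k, Nat.lt_of_succ_lt hk⟩ + χ ⟨k + 1, hk⟩) ≠
      (χ ⟨k, Nat.lt_of_succ_lt hk⟩ - χ ⟨k + 1, hk⟩) ^ 2 → χ ∘ simple k hk ∈ S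

section weights

variable {F : Type*} [Field F] {M : Type*} [AddCommGroup M] [Module F M] {n : ℕ}
  {x c : Fin n → Module.End F M} {s : ∀ k, k + 1 < n → Module.End F M} {δ : Module.End F M}
  {χ : Fin n → F}

theorem CXRel.eOp_braid_apply (h : CXRel x c) {a b d : Fin n} (hab : a ≠ b) (hbd : b ≠ d)
    (had : a ≠ d) {v : M} (hv : v ∈ wt x χ) (e : χ d = χ a) :
    eOp x c a b (eOp x c b d (eOp x c a b v)) + eOp x c b d (eOp x c a b (eOp x c b d v)) =
      (2 * χ a + 6 * χ b) • eOp x c a d v := by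
  have := congrArg (· v) (h.eOp_braid hab hbd had)
  simp only [LinearMap.add_apply, Module.End.mul_apply] at this
  rw [this, eOp_apply]
  have h6 : ∀ u : M, (6 : Module.End F M) u = (6 : F) • u := fun u => by
    have : (6 : Module.End F M) = (6 : F) • 1 := by
      rw [← Algebra.algebraMap_eq_smul_one, map_ofNat]
    rw [this]; simp
  have h2 : ∀ u : M, (2 : Module.End F M) u = (2 : F) • u := fun u => by
    have : (2 : Module.End F M) = (2 : F) • 1 := by
      rw [← Algebra.algebraMap_eq_smul_one, map_ofNat]
    rw [this]; simp
  simp only [LinearMap.add_apply, LinearMap.sub_apply, Module.End.mul_apply, mem_wt.mp hv, map_smul,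
    h6, h2, e, sub_self, map_zero, smul_zero, add_zero, map_add, map_sub, smul_add, smul_sub]
  module

variable [IsAlgClosed F]

theorem SuperHC.weightClosed (h2 : (2 : F) ≠ 0) (h : SuperHC x c s δ) (hI : Irr x c s δ)
    (h0 : ∀ h : 0 < n, x ⟨0, h⟩ = 0) : WeightClosed {χ | wt x χ ≠ ⊥} where
  zero χ hχ hn := by
    obtain ⟨v, hv, hv0⟩ := Submodule.exists_mem_ne_zero_of_ne_bot hχ
    have := mem_wt.mp hv ⟨0, hn⟩
    rw [h0 hn, LinearMap.zero_apply] at this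
    exact (smul_eq_zero.mp this.symm).resolve_right hv0
  ne χ hχ k hk e := by
    obtain ⟨v, hv, hv0⟩ := Submodule.exists_mem_ne_zero_of_ne_bot hχ
    exact hv0 (h.toSplitHC.eq_zero_of_eq h2 hv k hk e)
  triple χ hχ k hk e hna := by
    obtain ⟨v, hv, hv0⟩ := Submodule.exists_mem_ne_zero_of_ne_bot hχ
    have hk1 : k + 1 < n := by omega
    have hne : χ ⟨k, by omega⟩ ≠ χ ⟨k + 1, hk1⟩ := fun e =>
      hv0 (h.toSplitHC.eq_zero_of_eq h2 hv k hk1 e)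
    have hna' : 2 * (χ ⟨k + 1, hk1⟩ + χ ⟨k + 2, hk⟩) = (χ ⟨k + 1, hk1⟩ - χ ⟨k + 2, hk⟩) ^ 2 := by
      rw [e]; linear_combination hna
    -- Both intertwiners vanish, so `s_k` and `s_{k+1}` are the opposite multiples `∓(a - b)⁻¹` of
    -- `e_k` and `e_{k+1}`. The braid relation becomes the vanishing of the sum computed in
    -- `CXRel.eOp_braid_apply`.
    have hs : ∀ u ∈ wt x χ, s k hk1 u = -(χ ⟨k, by omega⟩ - χ ⟨k + 1, hk1⟩)⁻¹ •
        eOp x c ⟨k, by omega⟩ ⟨k + 1, hk1⟩ u := fun u hu => by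
      rw [s_apply hu k hk1 hne (c := c), h.Phi_eq_zero h2 hI k hk1 hna hu, zero_sub, smul_neg,
        neg_smul]
    have hs' : ∀ u ∈ wt x χ, s (k + 1) hk u = (χ ⟨k, by omega⟩ - χ ⟨k + 1, hk1⟩)⁻¹ •
        eOp x c ⟨k + 1, hk1⟩ ⟨k + 2, hk⟩ u := fun u hu => by
      rw [s_apply hu (k + 1) hk (by rw [e]; exact hne.symm) (c := c),
        h.Phi_eq_zero h2 hI (k + 1) hk hna' hu, zero_sub, smul_neg, ← neg_smul, e, neg_inv, neg_sub]
    have hw : ∀ a b, ∀ u ∈ wt x χ, eOp x c a b u ∈ wt x χ := fun a b u hu =>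
      eOp_mem (fun m v hv => h.c_mem_wt hv m) (fun m v hv => h.x_mem_wt hv m) _ _ hu
    have hb := congrArg (· v) (h.braid k hk)
    simp only [Module.End.mul_apply] at hb
    rw [hs v hv, hs' v hv, map_smul, map_smul, hs' _ (hw _ _ _ hv), map_smul,
      hs _ (hw _ _ _ (hw _ _ _ hv)), map_smul, hs _ (hw _ _ _ hv), map_smul, map_smul,
      hs' _ (hw _ _ _ (hw _ _ _ hv)), smul_smul, smul_smul, smul_smul, smul_smul,
      ← sub_eq_zero, neg_mul, neg_mul, mul_neg, mul_neg, neg_mul, neg_neg, neg_smul,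
      sub_neg_eq_add, ← smul_add,
      h.eOp_braid_apply (ne_succ hk1) (ne_succ hk) (by simp only [ne_eq, Fin.mk.injEq]; omega) hv e] at hb
    have hi : (χ ⟨k, by omega⟩ - χ ⟨k + 1, hk1⟩)⁻¹ ≠ 0 := inv_ne_zero (sub_ne_zero.mpr hne)
    have hb := (smul_eq_zero.mp hb).resolve_left (mul_ne_zero (mul_ne_zero hi hi) hi)
    rcases smul_eq_zero.mp hb with hb | hb
    · exact Or.inr hb
    · left
      -- Here `e` for the outer positions kills `v`, while its square is `4a`.
      have h3 := h.eOp_eOp hv (show (⟨k, by omega⟩ : Fin n) ≠ ⟨k + 2, hk⟩ by simp)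
      rw [hb, map_zero, e] at h3
      have h4 := (smul_eq_zero.mp h3.symm).resolve_right hv0
      rw [← two_mul] at h4
      simpa [h2] using h4
  swap χ hχ k hk ha := by
    obtain ⟨v, hv, hv0⟩ := Submodule.exists_mem_ne_zero_of_ne_bot hχ
    refine (Submodule.ne_bot_iff _).mpr ⟨_, h.Phi_mem_wt hv k hk, fun e => ?_⟩
    have := h.Phi_Phi hv k hk
    rw [e, map_zero] at this
    exact ha (sub_eq_zero.mp ((smul_eq_zero.mp this.symm).resolve_right hv0))

end weights

namespace YSupermodule

variable {F : Type u} [Field F] [IsAlgClosed F] {n : ℕ} {V : YSupermodule.{u, v} F n}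

theorem weightClosed (h2 : (2 : F) ≠ 0) (hV : V.IsIrreducible) (hVs : V.IsCompletelySplittable) :
    WeightClosed {χ | wt V.xOp χ ≠ ⊥} :=
  haveI := finite_of_isIrreducible h2 hV
  (V.superHC hVs).weightClosed h2 (irr_of_isIrreducible h2 hV) fun h => by
    rw [xOp, Y.jm_zero, map_zero]

end YSupermodule

/-! ## The operators on `L(i₁) ⊠ ⋯ ⊠ L(iₙ)` -/

section box

variable {F : Type u} [Field F] {n : ℕ}

/-- The character of `ℤ/2`. -/
def sgn (F : Type u) [Field F] (e : ZMod 2) : F := (-1) ^ e.val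

@[simp] theorem sgn_zero : sgn F 0 = 1 := by simp [sgn]

@[simp] theorem sgn_one : sgn F 1 = -1 := by simp [sgn, ZMod.val_one]

theorem sgn_add (d e : ZMod 2) : sgn F (d + e) = sgn F d * sgn F e :=
  YSupermodule.neg_one_pow_val_add d e

theorem sgn_mul_self (e : ZMod 2) : sgn F e * sgn F e = 1 := YSupermodule.neg_one_pow_val_sq e

theorem sgn_sum {ι : Type*} (t : Finset ι) (ε : ι → ZMod 2) :
    sgn F (∑ j ∈ t, ε j) = ∏ j ∈ t, sgn F (ε j) := by
  classical
  induction t using Finset.induction_on with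
  | empty => simp
  | insert a t ha ih => rw [Finset.sum_insert ha, Finset.prod_insert ha, sgn_add, ih]

theorem boxC_apply (k : Fin n) (f : Box F n) (ε : Fin n → ZMod 2) :
    boxC F k f ε = sgn F (∑ j ∈ Finset.Iio k, ε j) * f (ε + Pi.single k 1) := by
  rw [sgn_sum]
  simp only [sgn, Finset.prod_pow_eq_pow_sum]
  rfl

theorem boxX_apply [IsAlgClosed F] (i : Fin n → ℕ) (k : Fin n) (f : Box F n)
    (ε : Fin n → ZMod 2) : boxX F i k f ε = sgn F (ε k) * sqrtF F (q F (i k)) * f ε := rfl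

/-- The parity operator of `L(i₁) ⊠ ⋯ ⊠ L(iₙ)`. -/
def boxGr (F : Type u) [Field F] (n : ℕ) : Module.End F (Box F n) where
  toFun f := fun ε => sgn F (∑ k, ε k) * f ε
  map_add' f g := by ext ε; simp [mul_add]
  map_smul' a f := by ext ε; simp [mul_left_comm]

theorem boxGr_apply (f : Box F n) (ε : Fin n → ZMod 2) :
    boxGr F n f ε = sgn F (∑ k, ε k) * f ε := rfl

theorem sum_single {t : Finset (Fin n)} (k : Fin n) :
    ∑ j ∈ t, (Pi.single k (1 : ZMod 2) : Fin n → ZMod 2) j = if k ∈ t then 1 else 0 := by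
  simp [Pi.single_apply]

theorem single_add_single (k : Fin n) :
    (Pi.single k 1 : Fin n → ZMod 2) + Pi.single k 1 = 0 := by
  rw [← Pi.single_add, show (1 : ZMod 2) + 1 = 0 from rfl, Pi.single_zero]

variable [IsAlgClosed F]

theorem box_cxRel (i : Fin n → ℕ) :
    CXRel (boxX F i : Fin n → Module.End F (Box F n)) (boxC F : Fin n → Module.End F (Box F n)) where
  c_sq k := by
    refine LinearMap.ext fun f => funext fun ε => ?_
    rw [Module.End.mul_apply, boxC_apply, boxC_apply, add_assoc, single_add_single, add_zero]
    simp only [Pi.add_apply, Finset.sum_add_distrib, sum_single, Finset.mem_Iio, lt_irrefl, if_false,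
      add_zero]
    rw [← mul_assoc, sgn_mul_self, one_mul]; rfl
  c_anti k l e := by
    refine LinearMap.ext fun f => funext fun ε => ?_
    rw [LinearMap.neg_apply, Module.End.mul_apply, Module.End.mul_apply, Pi.neg_apply, boxC_apply,
      boxC_apply, boxC_apply, boxC_apply, add_right_comm]
    simp only [Pi.add_apply, Finset.sum_add_distrib, sum_single, Finset.mem_Iio, sgn_add]
    rcases lt_or_gt_of_ne e with h | h
    · simp [h, h.not_gt]; ring
    · simp [h, h.not_gt]; ring
  x_comm k l := by
    refine LinearMap.ext fun f => funext fun ε => ?_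
    simp only [Module.End.mul_apply, boxX_apply]; ring
  x_c k := by
    refine LinearMap.ext fun f => funext fun ε => ?_
    simp only [LinearMap.neg_apply, Module.End.mul_apply, Pi.neg_apply, boxX_apply, boxC_apply,
      Pi.add_apply, Pi.single_eq_same, sgn_add, sgn_one]
    ring
  x_c_ne k l e := by
    refine LinearMap.ext fun f => funext fun ε => ?_
    simp only [LinearMap.neg_apply, Module.End.mul_apply, Pi.neg_apply, boxX_apply, boxC_apply,
      Pi.add_apply, Pi.single_eq_of_ne e, add_zero]
    ring

theorem box_grRel (i : Fin n → ℕ) :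
    GrRel (boxX F i : Fin n → Module.End F (Box F n)) (boxC F : Fin n → Module.End F (Box F n))
      (boxGr F n) where
  sq := by
    refine LinearMap.ext fun f => funext fun ε => ?_
    rw [Module.End.mul_apply, boxGr_apply, boxGr_apply, ← mul_assoc, sgn_mul_self, one_mul]; rfl
  c k := by
    refine LinearMap.ext fun f => funext fun ε => ?_
    rw [LinearMap.neg_apply, Module.End.mul_apply, Module.End.mul_apply, Pi.neg_apply, boxC_apply,
      boxGr_apply, boxGr_apply, boxC_apply]
    simp only [Pi.add_apply, Finset.sum_add_distrib, sum_single, Finset.mem_univ, if_true, sgn_add,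
      sgn_one]
    ring
  x k := by
    refine LinearMap.ext fun f => funext fun ε => ?_
    simp only [Module.End.mul_apply, boxX_apply, boxGr_apply]; ring

theorem boxX_boxX (i : Fin n → ℕ) (k : Fin n) (f : Box F n) :
    boxX F i k (boxX F i k f) = q F (i k) • f := by
  ext ε
  rw [boxX_apply, boxX_apply, Pi.smul_apply, smul_eq_mul]
  linear_combination (sgn F (ε k) * sgn F (ε k) * f ε) * sqrtF_sq (q F (i k)) +
    (q F (i k) * f ε) * sgn_mul_self (F := F) (ε k)

theorem boxX_ker (i : Fin n → ℕ) (k : Fin n) (f : Box F n) (h : boxX F i k (boxX F i k f) = 0) :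
    boxX F i k f = 0 := by
  rw [boxX_boxX, smul_eq_zero] at h
  rcases h with h | h
  · have : sqrtF F (q F (i k)) = 0 := by
      have := sqrtF_sq (q F (i k))
      rw [h] at this ⊢
      simpa using this
    ext ε
    rw [boxX_apply, this]; simp
  · rw [h, map_zero]

theorem mem_boxParity (h2 : (2 : F) ≠ 0) {e : ZMod 2} {f : Box F n} :
    f ∈ boxParity F n e ↔ boxGr F n f = sgn F e • f := by
  constructor
  · intro h
    ext ε
    rw [boxGr_apply, Pi.smul_apply, smul_eq_mul]
    by_cases he : ∑ k, ε k = e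
    · rw [he]
    · rw [h ε he, mul_zero, mul_zero]
  · intro h ε he
    have := congrFun h ε
    rw [boxGr_apply, Pi.smul_apply, smul_eq_mul] at this
    have h3 : sgn F (∑ k, ε k) = -sgn F e := by
      rcases zmod_two_cases (∑ k, ε k) with h1 | h1 <;> rcases zmod_two_cases e with rfl | rfl <;>
        simp_all
    rw [h3, neg_mul] at this
    have := eq_zero_of_eq_neg h2 this.symm
    refine (mul_eq_zero.mp this).resolve_left fun h0 => ?_
    have := sgn_mul_self (F := F) e
    rw [h0, zero_mul] at this
    exact one_ne_zero this.symm

/-- Both homogeneous components of `f` are combinations of `f` and its image under the parity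
operator. -/
theorem graded_iff (h2 : (2 : F) ≠ 0) (N : Submodule F (Box F n)) :
    N ≤ (⨆ e : ZMod 2, N ⊓ boxParity F n e) ↔ ∀ f ∈ N, boxGr F n f ∈ N := by
  constructor
  · intro h f hf
    have h1 : (⨆ e : ZMod 2, N ⊓ boxParity F n e) ≤ N.comap (boxGr F n) := by
      refine iSup_le fun e => ?_
      rintro y ⟨hy, hye⟩
      rw [Submodule.mem_comap, (mem_boxParity h2).mp hye]
      exact N.smul_mem _ hy
    exact h1 (h hf)
  · intro h f hf
    have hsq : boxGr F n (boxGr F n f) = f :=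
      congrArg (· f) (box_grRel (F := F) (fun _ : Fin n => 0)).sq
    have e1 : f = (2 : F)⁻¹ • (f + boxGr F n f) + (2 : F)⁻¹ • (f - boxGr F n f) := by
      rw [← smul_add, add_add_sub_cancel, ← two_smul F f, smul_smul, inv_mul_cancel₀ h2, one_smul]
    rw [e1]
    refine add_mem (Submodule.mem_iSup_of_mem 0 ⟨N.smul_mem _ (add_mem hf (h f hf)), ?_⟩)
      (Submodule.mem_iSup_of_mem 1 ⟨N.smul_mem _ (sub_mem hf (h f hf)), ?_⟩)
    · refine (mem_boxParity h2).mpr ?_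
      rw [map_smul, map_add, hsq, sgn_zero, one_smul, add_comm]
    · refine (mem_boxParity h2).mpr ?_
      rw [map_smul, map_sub, hsq, sgn_one, neg_smul, one_smul, ← smul_neg, neg_sub]

theorem wt_box (i : Fin n → ℕ) :
    wt (boxX F i : Fin n → Module.End F (Box F n)) (fun k => q F (i k)) = ⊤ :=
  eq_top_iff.mpr fun f _ k => boxX_boxX i k f

/-- The module `L(i)` exists. -/
theorem LModule.nonempty (h2 : (2 : F) ≠ 0) (i : Fin n → ℕ) : Nonempty (LModule F i) := by
  obtain ⟨P⟩ := Pairing.nonempty (zeros fun k => q F (i k))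
  have hc := box_cxRel (F := F) i
  have hg := box_grRel (F := F) i
  obtain ⟨v, -, h0, d, hd, hv⟩ := exists_isVacuum hc hg P (L := ⊤) (wt_box (F := F) i).ge
    (by
      have : Nontrivial (Box F n) := inferInstance
      exact top_ne_bot) (fun _ _ _ => trivial) (fun _ _ _ => trivial) (fun _ _ => trivial)
  refine ⟨⟨vacSpan (boxC F : Fin n → Module.End F (Box F n)) P v,
    (graded_iff h2 _).mpr (hv.gr_mem_vacSpan hg),
    hv.c_mem_vacSpan hc, hv.x_mem_vacSpan hc (boxX_ker (F := F) i), fun e => h0 ?_, fun N hN hNg hNc hNx => ?_⟩⟩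
  · exact (Submodule.mem_bot F).mp (e ▸ mem_vacSpan P v)
  · by_cases hN0 : N = ⊥
    · exact Or.inl hN0
    refine Or.inr (le_antisymm hN (vacSpan_le hNc ?_))
    -- A nonzero stable subspace contains a vacuum vector. It, or its image under the unpaired
    -- generator, is a nonzero multiple of `v`.
    obtain ⟨y, hy, hy0, d', hd', hyv⟩ := exists_isVacuum hc hg P (L := N)
      ((wt_box (F := F) i).symm ▸ le_top) hN0 hNc hNx ((graded_iff h2 N).mp hNg)
    have key : ∀ y ∈ N, y ≠ 0 → ∀ d', (d = d' ∨ P.K = ∅) →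
        IsVacuum (boxX F i : Fin n → Module.End F (Box F n)) (boxC F) (boxGr F n) P d' y → v ∈ N := by
      intro y hy hy0 d' hdd hyv
      obtain ⟨r, rfl⟩ := Submodule.mem_span_singleton.mp
        (hv.mem_span_of_mem_vacSpan h2 hc hg hd (hN hy) hyv hdd)
      exact (N.smul_mem_iff fun e => hy0 (by rw [e, zero_smul])).mp hy
    by_cases hdd : d = d' ∨ P.K = ∅
    · exact key y hy hy0 d' hdd hyv
    · push Not at hdd
      obtain ⟨k, hk⟩ := hdd.2
      have e' : d = -d' := by
        rcases hd with rfl | rfl <;> rcases hd' with rfl | rfl <;> simp_all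
      refine key _ (hNc k y hy) (fun e => hy0 ?_) _ (Or.inl e') (hyv.c_isVacuum hc hg hk)
      have := congrArg (boxC F k) e
      have h3 := congrArg (· y) (hc.c_sq k)
      simp only [Module.End.mul_apply] at h3
      rwa [h3, map_zero] at this

namespace LModule

variable {i : Fin n → ℕ} (L : LModule F i)

/-- The parity operator of `L(i)`. -/
def gr (h2 : (2 : F) ≠ 0) : Module.End F L.U :=
  (boxGr F n).restrict ((graded_iff h2 L.U).mp L.graded)

theorem cxRel : CXRel (L.x : Fin n → Module.End F L.U) (L.c : Fin n → Module.End F L.U) where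
  c_sq k := by ext1 z; exact Subtype.ext (congrArg (· (z : Box F n)) ((box_cxRel (F := F) i).c_sq k))
  c_anti k l e := by ext1 z; exact Subtype.ext (congrArg (· (z : Box F n)) ((box_cxRel (F := F) i).c_anti k l e))
  x_comm k l := by ext1 z; exact Subtype.ext (congrArg (· (z : Box F n)) ((box_cxRel (F := F) i).x_comm k l))
  x_c k := by ext1 z; exact Subtype.ext (congrArg (· (z : Box F n)) ((box_cxRel (F := F) i).x_c k))
  x_c_ne k l e := by ext1 z; exact Subtype.ext (congrArg (· (z : Box F n)) ((box_cxRel (F := F) i).x_c_ne k l e))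

theorem grRel (h2 : (2 : F) ≠ 0) :
    GrRel (L.x : Fin n → Module.End F L.U) (L.c : Fin n → Module.End F L.U) (L.gr h2) where
  sq := by ext1 z; exact Subtype.ext (congrArg (· (z : Box F n)) (box_grRel (F := F) i).sq)
  c k := by ext1 z; exact Subtype.ext (congrArg (· (z : Box F n)) ((box_grRel (F := F) i).c k))
  x k := by ext1 z; exact Subtype.ext (congrArg (· (z : Box F n)) ((box_grRel (F := F) i).x k))

theorem x_x (k : Fin n) (z : L.U) : L.x k (L.x k z) = q F (i k) • z :=
  Subtype.ext (boxX_boxX i k (z : Box F n))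

theorem x_ker (k : Fin n) (z : L.U) (h : L.x k (L.x k z) = 0) : L.x k z = 0 :=
  Subtype.ext (boxX_ker i k (z : Box F n) (congrArg Subtype.val h))

theorem mem_wt (z : L.U) : z ∈ wt (L.x : Fin n → Module.End F L.U) (fun k => q F (i k)) :=
  fun k => L.x_x k z

theorem eq_bot_or_top (h2 : (2 : F) ≠ 0) {N : Submodule F L.U} (hc : ∀ k, ∀ z ∈ N, L.c k z ∈ N)
    (hx : ∀ k, ∀ z ∈ N, L.x k z ∈ N) (hg : ∀ z ∈ N, L.gr h2 z ∈ N) : N = ⊥ ∨ N = ⊤ := by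
  have hmin := L.minimal (N.map L.U.subtype) (Submodule.map_subtype_le _ _) ((graded_iff h2 _).mpr (by
      rintro _ ⟨z, hz, rfl⟩; exact ⟨_, hg z hz, rfl⟩))
    (by rintro k _ ⟨z, hz, rfl⟩; exact ⟨_, hc k z hz, rfl⟩)
    (by rintro k _ ⟨z, hz, rfl⟩; exact ⟨_, hx k z hz, rfl⟩)
  refine hmin.imp (fun h => ?_) fun h => ?_
  · refine (Submodule.eq_bot_iff _).mpr fun z hz => Subtype.ext ?_
    have : (z : Box F n) ∈ N.map L.U.subtype := ⟨z, hz, rfl⟩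
    rwa [h] at this
  · refine eq_top_iff.mpr fun z _ => ?_
    have h1 : ∀ y ∈ L.U, y ∈ N.map L.U.subtype := fun y hy => by rwa [h]
    obtain ⟨y, hy, e⟩ := h1 z z.2
    rwa [← Subtype.ext e]

theorem nontrivial : Nontrivial L.U := Submodule.nontrivial_iff_ne_bot.mpr L.ne_bot

/-- By irreducibility the module is the `vacSpan` of any of its nonzero vacuum vectors, so the
dimension is the same for every choice of `L(i)`. -/
theorem finrank_U (h2 : (2 : F) ≠ 0) :
    Module.finrank F L.U = 2 ^ (n - (zeros fun k => q F (i k)).card / 2) := by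
  obtain ⟨P⟩ := Pairing.nonempty (zeros fun k => q F (i k))
  have hc := L.cxRel
  have hg := L.grRel h2
  haveI := L.nontrivial
  obtain ⟨v, -, h0, d, hd, hv⟩ := exists_isVacuum hc hg P (L := ⊤) (fun z _ => L.mem_wt z)
    top_ne_bot (fun _ _ _ => trivial) (fun _ _ _ => trivial) (fun _ _ => trivial)
  have htop : vacSpan (L.c : Fin n → Module.End F L.U) P v = ⊤ :=
    (L.eq_bot_or_top h2 (hv.c_mem_vacSpan hc) (hv.x_mem_vacSpan hc L.x_ker)
      (hv.gr_mem_vacSpan hg)).resolve_left fun e =>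
        h0 ((Submodule.mem_bot F).mp (e ▸ mem_vacSpan P v))
  rw [← hv.finrank_vacSpan h2 hc hg hd h0, htop, finrank_top]

end LModule

end box

/-! ## The operators on `D^i` -/

section dmodule

variable {F : Type u} [Field F] [IsAlgClosed F] {n : ℕ} {i : Fin n → ℕ}

/-- The weights of `D^i` satisfy the conditions that are necessary for an action of `𝒴ₙ`. -/
structure Good (F : Type u) [Field F] {n : ℕ} (i : Fin n → ℕ) : Prop where
  closed : WeightClosed {χ : Fin n → F | ∃ τ, InP i τ ∧ χ = fun k => q F (permAct τ i k)}
  adm : ∀ τ, InP i τ → ∀ k (hk : k + 1 < n), Admissible (permAct τ i) k hk ↔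
    2 * (q F (permAct τ i ⟨k, Nat.lt_of_succ_lt hk⟩) + q F (permAct τ i ⟨k + 1, hk⟩)) ≠
      (q F (permAct τ i ⟨k, Nat.lt_of_succ_lt hk⟩) - q F (permAct τ i ⟨k + 1, hk⟩)) ^ 2

theorem Good.ne (h : Good F i) {τ : Perm (Fin n)} (hτ : InP i τ) (k : ℕ) (hk : k + 1 < n) :
    q F (permAct τ i ⟨k, Nat.lt_of_succ_lt hk⟩) ≠ q F (permAct τ i ⟨k + 1, hk⟩) :=
  h.closed.ne _ ⟨τ, hτ, rfl⟩ k hk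

theorem permAct_simple_mul (τ : Perm (Fin n)) (k : ℕ) (hk : k + 1 < n) (m : Fin n) :
    permAct (simple k hk * τ) i m = permAct τ i (simple k hk m) := by
  rw [permAct, simple_mul_inv_apply]; rfl

theorem omega_comm (a b : ℕ) : omega F a b = omega F b a := by
  unfold omega
  rw [add_comm (q F a), ← neg_sub (q F b), neg_sq]

theorem omega_sq (a b : ℕ) :
    omega F a b * omega F a b = 1 - 2 * (q F a + q F b) / (q F a - q F b) ^ 2 := sqrtF_sq _

/-- The structure of `L(i)`, on an abstract space. -/
structure LData (F : Type u) [Field F] {n : ℕ} (i : Fin n → ℕ) (M : Type v) [AddCommGroup M]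
    [Module F M] where
  x : Fin n → Module.End F M
  c : Fin n → Module.End F M
  gr : Module.End F M
  cxRel : CXRel x c
  grRel : GrRel x c gr
  x_x : ∀ k z, x k (x k z) = q F (i k) • z
  x_ker : ∀ k z, x k (x k z) = 0 → x k z = 0

namespace LData

variable {M : Type v} [AddCommGroup M] [Module F M] (L : LData F i M)

theorem mem_wt (z : M) : z ∈ wt L.x (fun k => q F (i k)) := fun k => L.x_x k z

/-- `Ξ_{a,b}`. -/
def Xi (a b : Fin n) : Module.End F M :=
  -((q F (i a) - q F (i b))⁻¹ • eOp L.x L.c a b)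

/-- The underlying space of `D^i`. -/
abbrev D (_ : LData F i M) : Type (max 0 v) := {τ : Perm (Fin n) // InP i τ} → M

/-- The element `z^τ`. -/
def twist (τ : Perm (Fin n)) (hτ : InP i τ) (z : M) : L.D := Pi.single ⟨τ, hτ⟩ z

theorem Xi_apply (a b : Fin n) (z : M) : L.Xi a b z = -(q F (i a) - q F (i b))⁻¹ •
    eOp L.x L.c a b z := by
  rw [neg_smul]; rfl

theorem Xi_swap {a b : Fin n} (hab : a ≠ b) (z : M) : L.Xi b a z = -L.Xi a b z := by
  rw [Xi_apply, Xi_apply, L.cxRel.eOp_swap hab, ← neg_smul, neg_neg, neg_inv, neg_sub]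

/-- The scalar is complementary to the square of `omega`, so that `Ξ² + Ω² = 1`. -/
theorem Xi_Xi {a b : Fin n} (hab : a ≠ b) (z : M) : L.Xi a b (L.Xi a b z) =
    (2 * (q F (i a) + q F (i b)) / (q F (i a) - q F (i b)) ^ 2) • z := by
  rw [Xi_apply, Xi_apply, map_smul, L.cxRel.eOp_eOp (L.mem_wt z) hab, smul_smul, smul_smul]
  congr 1
  rw [neg_mul_neg, ← mul_inv, div_eq_mul_inv, pow_two]; ring

theorem Xi_c (τ : Perm (Fin n)) (k : ℕ) (hk : k + 1 < n) (m : Fin n) (z : M) :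
    L.Xi (τ⁻¹ ⟨k, Nat.lt_of_succ_lt hk⟩) (τ⁻¹ ⟨k + 1, hk⟩) (L.c (τ⁻¹ m) z) =
      L.c (τ⁻¹ (simple k hk m)) (L.Xi (τ⁻¹ ⟨k, Nat.lt_of_succ_lt hk⟩) (τ⁻¹ ⟨k + 1, hk⟩) z) := by
  have hab : τ⁻¹ ⟨k, Nat.lt_of_succ_lt hk⟩ ≠ τ⁻¹ ⟨k + 1, hk⟩ :=
    fun e => ne_succ hk (τ⁻¹.injective e)
  rw [Xi_apply, Xi_apply, map_smul]
  congr 1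
  by_cases h1 : m.val = k
  · have e : m = ⟨k, Nat.lt_of_succ_lt hk⟩ := Fin.ext h1
    rw [e, simple_left]
    exact congrArg (· z) (L.cxRel.eOp_pair hab).1
  by_cases h2 : m.val = k + 1
  · have e : m = ⟨k + 1, hk⟩ := Fin.ext h2
    rw [e, simple_right]
    exact congrArg (· z) (L.cxRel.eOp_pair hab).2.1
  · rw [simple_of_ne k hk m h1 h2]
    refine congrArg (· z) (L.cxRel.eOp_c_ne (fun e => h1 ?_) (fun e => h2 ?_))
    · rw [← τ⁻¹.injective e]
    · rw [← τ⁻¹.injective e]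

theorem Xi_x {a b : Fin n} (hab : a ≠ b) (hne : q F (i a) ≠ q F (i b)) (z : M) :
    L.Xi a b (L.x a z) = L.x b (L.Xi a b z) - (z + L.c a (L.c b z)) := by
  have h0 : q F (i a) - q F (i b) ≠ 0 := sub_ne_zero.mpr hne
  have h := congrArg (· z) (L.cxRel.eOp_pair hab).2.2
  simp only [Module.End.mul_apply, LinearMap.add_apply, LinearMap.sub_apply, x_x, ← sub_smul,
    map_smul] at h
  rw [Xi_apply, Xi_apply, h, map_smul, smul_add, smul_add, smul_smul, smul_smul, neg_mul,
    inv_mul_cancel₀ h0, neg_smul, neg_smul, one_smul, neg_smul, one_smul]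
  abel

theorem Xi_x_ne {a b m : Fin n} (ha : m ≠ a) (hb : m ≠ b) (z : M) :
    L.Xi a b (L.x m z) = L.x m (L.Xi a b z) := by
  rw [Xi_apply, Xi_apply, map_smul]
  congr 1
  exact (congrArg (· z) (L.cxRel.x_eOp ha hb)).symm

theorem Xi_gr (a b : Fin n) (z : M) :
    L.gr (L.Xi a b z) = L.Xi a b (L.gr z) := by
  rw [Xi_apply, Xi_apply, map_smul, eOp_apply, eOp_apply]
  have h1 := fun m z => congrArg (· z) ((L.grRel).x m)
  have h3 := fun m z => congrArg (· z) ((L.grRel).c m)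
  simp only [Module.End.mul_apply, LinearMap.neg_apply] at h1 h3
  simp only [map_add, map_sub, h1, h3, map_neg, neg_neg]

/-- `c_k` on `D^i`. -/
def cD (k : Fin n) : Module.End F L.D := LinearMap.pi fun τ => L.c (τ.1⁻¹ k) ∘ₗ LinearMap.proj τ

/-- `x_k` on `D^i`. -/
def xD (k : Fin n) : Module.End F L.D := LinearMap.pi fun τ => L.x (τ.1⁻¹ k) ∘ₗ LinearMap.proj τ

/-- The parity operator on `D^i`. -/
def grD : Module.End F L.D := LinearMap.pi fun τ => L.gr ∘ₗ LinearMap.proj τ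

/-- The index `s_k τ`. -/
def next (τ : {τ : Perm (Fin n) // InP i τ}) (k : ℕ) (hk : k + 1 < n)
    (h : Admissible (permAct τ.1 i) k hk) : {τ : Perm (Fin n) // InP i τ} :=
  ⟨simple k hk * τ.1, InP.step τ.1 k hk τ.2 h⟩

open Classical in
/-- `s_k` on `D^i`. -/
def sD (k : ℕ) (hk : k + 1 < n) : Module.End F L.D := LinearMap.pi fun τ =>
  L.Xi (τ.1⁻¹ ⟨k, Nat.lt_of_succ_lt hk⟩) (τ.1⁻¹ ⟨k + 1, hk⟩) ∘ₗ LinearMap.proj τ +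
    if h : Admissible (permAct τ.1 i) k hk then
      omega F (permAct τ.1 i ⟨k, Nat.lt_of_succ_lt hk⟩) (permAct τ.1 i ⟨k + 1, hk⟩) •
        LinearMap.proj (next τ k hk h) else 0

variable {L}

theorem sD_apply {τ : {τ : Perm (Fin n) // InP i τ}} {k : ℕ} {hk : k + 1 < n}
    (h : Admissible (permAct τ.1 i) k hk) (f : L.D) : L.sD k hk f τ =
      L.Xi (τ.1⁻¹ ⟨k, Nat.lt_of_succ_lt hk⟩) (τ.1⁻¹ ⟨k + 1, hk⟩) (f τ) +
      omega F (permAct τ.1 i ⟨k, Nat.lt_of_succ_lt hk⟩) (permAct τ.1 i ⟨k + 1, hk⟩) •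
        f (next τ k hk h) := by
  simp [sD, dif_pos h]

theorem sD_apply_of_not {τ : {τ : Perm (Fin n) // InP i τ}} {k : ℕ} {hk : k + 1 < n}
    (h : ¬ Admissible (permAct τ.1 i) k hk) (f : L.D) : L.sD k hk f τ =
      L.Xi (τ.1⁻¹ ⟨k, Nat.lt_of_succ_lt hk⟩) (τ.1⁻¹ ⟨k + 1, hk⟩) (f τ) := by
  simp [sD, dif_neg h]

theorem cD_apply (k : Fin n) (f : L.D) (τ : {τ : Perm (Fin n) // InP i τ}) :
    L.cD k f τ = L.c (τ.1⁻¹ k) (f τ) := rfl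

theorem xD_apply (k : Fin n) (f : L.D) (τ : {τ : Perm (Fin n) // InP i τ}) :
    L.xD k f τ = L.x (τ.1⁻¹ k) (f τ) := rfl

theorem grD_apply (f : L.D) (τ : {τ : Perm (Fin n) // InP i τ}) :
    L.grD f τ = L.gr (f τ) := rfl

theorem adm_next {τ : {τ : Perm (Fin n) // InP i τ}} {k : ℕ} {hk : k + 1 < n}
    (h : Admissible (permAct τ.1 i) k hk) : Admissible (permAct (next τ k hk h).1 i) k hk := by
  unfold next Admissible
  rw [permAct_simple_mul, permAct_simple_mul, simple_left, simple_right]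
  exact ⟨fun e => h.2 e.symm, fun e => h.1 e.symm⟩

theorem next_next {τ : {τ : Perm (Fin n) // InP i τ}} {k : ℕ} {hk : k + 1 < n}
    (h : Admissible (permAct τ.1 i) k hk) : next (next τ k hk h) k hk (adm_next h) = τ :=
  Subtype.ext (simple_mul_self_assoc k hk τ.1)

variable (L)

theorem inv_ne (τ : Perm (Fin n)) {k : ℕ} (hk : k + 1 < n) :
    τ⁻¹ ⟨k, Nat.lt_of_succ_lt hk⟩ ≠ τ⁻¹ ⟨k + 1, hk⟩ := fun e => ne_succ hk (τ⁻¹.injective e)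

theorem hcRel (hG : Good F i) : HCRel L.xD L.cD L.sD where
  c_sq k := LinearMap.ext fun f => funext fun τ => congrArg (· (f τ)) (L.cxRel.c_sq _)
  c_anti k l e := LinearMap.ext fun f => funext fun τ =>
    congrArg (· (f τ)) (L.cxRel.c_anti _ _ fun e' => e (τ.1⁻¹.injective e'))
  x_comm k l := LinearMap.ext fun f => funext fun τ => congrArg (· (f τ)) (L.cxRel.x_comm _ _)
  x_c k := LinearMap.ext fun f => funext fun τ => congrArg (· (f τ)) (L.cxRel.x_c _)
  x_c_ne k l e := LinearMap.ext fun f => funext fun τ =>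
    congrArg (· (f τ)) (L.cxRel.x_c_ne _ _ fun e' => e (τ.1⁻¹.injective e'))
  s_sq k hk := LinearMap.ext fun f => funext fun τ => by
    rw [Module.End.mul_apply, Module.End.one_apply]
    have hX := L.Xi_Xi (inv_ne τ.1 hk) (f τ)
    by_cases h : Admissible (permAct τ.1 i) k hk
    · rw [sD_apply h, sD_apply h, sD_apply (adm_next h), next_next h, map_add, hX, map_smul]
      have e1 : ∀ m, (next τ k hk h).1⁻¹ m = τ.1⁻¹ (simple k hk m) := fun m =>
        simple_mul_inv_apply _ _ _ _
      -- The mixed terms cancel because `Ξ` changes sign when its indices are exchanged, whereas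
      -- `omega` is symmetric.
      rw [e1, e1, simple_left, simple_right, L.Xi_swap (inv_ne τ.1 hk)]
      have e2 : ∀ m, permAct (next τ k hk h).1 i m = permAct τ.1 i (simple k hk m) := fun m =>
        permAct_simple_mul _ _ _ _
      rw [e2, e2, simple_left, simple_right, omega_comm, smul_add, smul_smul, omega_sq, smul_neg,
        sub_smul, one_smul, omega_comm]
      unfold permAct
      rw [← neg_sub (q F (i (τ.1⁻¹ ⟨k, _⟩))), neg_sq, add_comm (q F (i (τ.1⁻¹ ⟨k + 1, hk⟩)))]
      module
    · rw [sD_apply_of_not h, sD_apply_of_not h, hX]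
      -- For adjacent entries `2(a + b) = (a - b)²`, so `Ξ² = 1` without any second term.
      have h1 := not_not.mp (fun h' => h ((hG.adm τ.1 τ.2 k hk).mpr h'))
      unfold permAct at h1
      have h3 := hG.ne τ.2 k hk
      unfold permAct at h3
      rw [h1, div_self (pow_ne_zero 2 (sub_ne_zero.mpr h3)), one_smul]
  s_c k hk m := LinearMap.ext fun f => funext fun τ => by
    rw [Module.End.mul_apply, Module.End.mul_apply, cD_apply]
    by_cases h : Admissible (permAct τ.1 i) k hk
    · rw [sD_apply h, sD_apply h, cD_apply, cD_apply, L.Xi_c, map_add, map_smul]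
      have e1 : ∀ m, (next τ k hk h).1⁻¹ m = τ.1⁻¹ (simple k hk m) := fun m =>
        simple_mul_inv_apply _ _ _ _
      rw [e1]
    · rw [sD_apply_of_not h, sD_apply_of_not h, cD_apply, L.Xi_c]
  s_x k hk := LinearMap.ext fun f => funext fun τ => by
    have h3 := hG.ne τ.2 k hk
    unfold permAct at h3
    simp only [Module.End.mul_apply, LinearMap.sub_apply, LinearMap.add_apply, Module.End.one_apply,
      Pi.sub_apply, Pi.add_apply, cD_apply]
    rw [xD_apply]
    by_cases h : Admissible (permAct τ.1 i) k hk
    · rw [sD_apply h, sD_apply h, xD_apply, xD_apply, L.Xi_x (inv_ne τ.1 hk) h3, map_add, map_smul]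
      have e1 : ∀ m, (next τ k hk h).1⁻¹ m = τ.1⁻¹ (simple k hk m) := fun m =>
        simple_mul_inv_apply _ _ _ _
      rw [e1, simple_left]
      abel
    · rw [sD_apply_of_not h, sD_apply_of_not h, xD_apply, L.Xi_x (inv_ne τ.1 hk) h3]
  s_x_ne k hk m e e' := LinearMap.ext fun f => funext fun τ => by
    have n1 : τ.1⁻¹ m ≠ τ.1⁻¹ ⟨k, Nat.lt_of_succ_lt hk⟩ := fun h => e (by rw [τ.1⁻¹.injective h])
    have n2 : τ.1⁻¹ m ≠ τ.1⁻¹ ⟨k + 1, hk⟩ := fun h => e' (by rw [τ.1⁻¹.injective h])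
    rw [Module.End.mul_apply, Module.End.mul_apply, xD_apply]
    by_cases h : Admissible (permAct τ.1 i) k hk
    · rw [sD_apply h, sD_apply h, xD_apply, xD_apply, L.Xi_x_ne n1 n2, map_add, map_smul]
      have e1 : ∀ m, (next τ k hk h).1⁻¹ m = τ.1⁻¹ (simple k hk m) := fun m =>
        simple_mul_inv_apply _ _ _ _
      rw [e1, simple_of_ne k hk m e e']
    · rw [sD_apply_of_not h, sD_apply_of_not h, xD_apply, L.Xi_x_ne n1 n2]

theorem grRelD : GrRel L.xD L.cD (L.grD) where
  sq := LinearMap.ext fun f => funext fun τ => congrArg (· (f τ)) (L.grRel).sq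
  c k := LinearMap.ext fun f => funext fun τ => congrArg (· (f τ)) ((L.grRel).c _)
  x k := LinearMap.ext fun f => funext fun τ => congrArg (· (f τ)) ((L.grRel).x _)

theorem grD_sD (k : ℕ) (hk : k + 1 < n) :
    L.grD * L.sD k hk = L.sD k hk * L.grD := LinearMap.ext fun f => funext fun τ => by
  rw [Module.End.mul_apply, Module.End.mul_apply, grD_apply]
  by_cases h : Admissible (permAct τ.1 i) k hk
  · rw [sD_apply h, sD_apply h, grD_apply, grD_apply, map_add, map_smul, L.Xi_gr]
  · rw [sD_apply_of_not h, sD_apply_of_not h, grD_apply, L.Xi_gr]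

theorem xD_xD (k : Fin n) (f : L.D) (τ : {τ : Perm (Fin n) // InP i τ}) :
    L.xD k (L.xD k f) τ = q F (permAct τ.1 i k) • f τ := L.x_x _ _

theorem xD_ker (k : Fin n) (f : L.D) (h : L.xD k (L.xD k f) = 0) : L.xD k f = 0 :=
  funext fun τ => L.x_ker _ _ (congrFun h τ)

theorem twist_mem_wt (τ : Perm (Fin n)) (hτ : InP i τ) (z : M) :
    L.twist τ hτ z ∈ wt L.xD (fun k => q F (permAct τ i k)) := by
  classical
  intro k
  funext σ
  rw [Module.End.mul_apply, xD_xD, Pi.smul_apply]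
  by_cases e : σ = ⟨τ, hτ⟩
  · rw [e]
  · rw [twist, Pi.single_eq_of_ne e, smul_zero, smul_zero]

theorem xD_twist (k : Fin n) (τ : Perm (Fin n)) (hτ : InP i τ) (z : M) :
    L.xD k (L.twist τ hτ z) = L.twist τ hτ (L.x (τ⁻¹ k) z) := by
  funext σ
  rw [xD_apply]
  by_cases e : σ = ⟨τ, hτ⟩
  · rw [e]; simp [twist]
  · rw [twist, twist, Pi.single_eq_of_ne e, Pi.single_eq_of_ne e, map_zero]

theorem cD_twist (k : Fin n) (τ : Perm (Fin n)) (hτ : InP i τ) (z : M) :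
    L.cD k (L.twist τ hτ z) = L.twist τ hτ (L.c (τ⁻¹ k) z) := by
  funext σ
  rw [cD_apply]
  by_cases e : σ = ⟨τ, hτ⟩
  · rw [e]; simp [twist]
  · rw [twist, twist, Pi.single_eq_of_ne e, Pi.single_eq_of_ne e, map_zero]

theorem grD_twist (τ : Perm (Fin n)) (hτ : InP i τ) (z : M) :
    L.grD (L.twist τ hτ z) = L.twist τ hτ (L.gr z) := by
  funext σ
  rw [grD_apply]
  by_cases e : σ = ⟨τ, hτ⟩
  · rw [e]; simp [twist]
  · rw [twist, twist, Pi.single_eq_of_ne e, Pi.single_eq_of_ne e, map_zero]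

theorem sD_twist_of_not (k : ℕ) (hk : k + 1 < n) (τ : Perm (Fin n)) (hτ : InP i τ) (z : M)
    (h : ¬ Admissible (permAct τ i) k hk) : L.sD k hk (L.twist τ hτ z) =
      L.twist τ hτ (L.Xi (τ⁻¹ ⟨k, Nat.lt_of_succ_lt hk⟩) (τ⁻¹ ⟨k + 1, hk⟩) z) := by
  funext σ
  by_cases e : σ = ⟨τ, hτ⟩
  · subst e
    rw [sD_apply_of_not h]; simp [twist]
  · by_cases hσ : Admissible (permAct σ.1 i) k hk
    · have n1 : next σ k hk hσ ≠ ⟨τ, hτ⟩ := fun e' => h (by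
        have := adm_next hσ
        rwa [e'] at this)
      rw [sD_apply hσ, twist, twist, Pi.single_eq_of_ne e, Pi.single_eq_of_ne e,
        Pi.single_eq_of_ne n1, map_zero, smul_zero, add_zero]
    · rw [sD_apply_of_not hσ, twist, twist, Pi.single_eq_of_ne e, Pi.single_eq_of_ne e, map_zero]

/-- The operator is defined through its components, which read the entry at `s_k τ`; the stated
formula sends a summand to `s_k τ`. The two agree since `omega` is symmetric and admissibility is
invariant under the exchange. -/
theorem sD_twist (k : ℕ) (hk : k + 1 < n) (τ : Perm (Fin n)) (hτ : InP i τ) (z : M)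
    (h : Admissible (permAct τ i) k hk) : L.sD k hk (L.twist τ hτ z) =
      L.twist τ hτ (L.Xi (τ⁻¹ ⟨k, Nat.lt_of_succ_lt hk⟩) (τ⁻¹ ⟨k + 1, hk⟩) z) +
        omega F (permAct τ i ⟨k, Nat.lt_of_succ_lt hk⟩) (permAct τ i ⟨k + 1, hk⟩) •
          L.twist (simple k hk * τ) (InP.step τ k hk hτ h) z := by
  have hne : ∀ σ : Perm (Fin n), simple k hk * σ ≠ σ := fun σ e => by
    have := congrArg Fin.val (congrArg (fun π : Perm (Fin n) => π ⟨k, Nat.lt_of_succ_lt hk⟩)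
      (mul_eq_right.mp e))
    simp [simple_left] at this
  funext σ
  rw [Pi.add_apply, Pi.smul_apply]
  by_cases e : σ = ⟨τ, hτ⟩
  · subst e
    have n1 : (next ⟨τ, hτ⟩ k hk h : {τ : Perm (Fin n) // InP i τ}) ≠ ⟨τ, hτ⟩ := fun e =>
      hne τ (congrArg Subtype.val e)
    have n2 : (⟨τ, hτ⟩ : {τ : Perm (Fin n) // InP i τ}) ≠ ⟨simple k hk * τ, InP.step τ k hk hτ h⟩ :=
      fun e => hne τ (congrArg Subtype.val e).symm
    rw [sD_apply h, twist, twist, twist, Pi.single_eq_of_ne n1, Pi.single_eq_of_ne n2,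
      Pi.single_eq_same, Pi.single_eq_same]
  · by_cases e' : σ = next ⟨τ, hτ⟩ k hk h
    · subst e'
      rw [sD_apply (adm_next h), next_next, twist, twist, twist, Pi.single_eq_of_ne e,
        Pi.single_eq_of_ne e, Pi.single_eq_same, map_zero, zero_add, zero_add]
      have : (Pi.single (⟨simple k hk * τ, InP.step τ k hk hτ h⟩ : {τ : Perm (Fin n) // InP i τ}) z :
        L.D) (next ⟨τ, hτ⟩ k hk h) = z := Pi.single_eq_same _ _
      rw [this, omega_comm]
      have e2 : ∀ m, permAct (next ⟨τ, hτ⟩ k hk h).1 i m = permAct τ i (simple k hk m) := fun m =>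
        permAct_simple_mul _ _ _ _
      rw [e2, e2, simple_left, simple_right]
    · have n2 : σ ≠ ⟨simple k hk * τ, InP.step τ k hk hτ h⟩ := e'
      rw [twist, twist, twist, Pi.single_eq_of_ne e, Pi.single_eq_of_ne n2, smul_zero, add_zero]
      by_cases hσ : Admissible (permAct σ.1 i) k hk
      · have n1 : next σ k hk hσ ≠ ⟨τ, hτ⟩ := fun e1 => e' (by
          have h3 := next_next hσ
          rw [← h3]
          exact Subtype.ext (congrArg (fun π : {τ : Perm (Fin n) // InP i τ} => simple k hk * π.1) e1))
        rw [sD_apply hσ, Pi.single_eq_of_ne e, Pi.single_eq_of_ne n1, map_zero, smul_zero, add_zero]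
      · rw [sD_apply_of_not hσ, Pi.single_eq_of_ne e, map_zero]

end LData

end dmodule

/-! ## `D^i` is an irreducible completely splittable module -/

section dmodule

variable {F : Type u} [Field F] [IsAlgClosed F] {n : ℕ} {i : Fin n → ℕ}
  {M : Type v} [AddCommGroup M] [Module F M]

namespace LData

open Classical in
/-- Extension by zero. -/
def ext0 {L : LData F i M} (f : L.D) (τ : Perm (Fin n)) : M := if h : InP i τ then f ⟨τ, h⟩ else 0

open Classical in
/-- The coefficient of the intertwiner. -/
def coef (F : Type u) [Field F] [IsAlgClosed F] (a b : ℕ) : F :=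
  if a ≠ b + 1 ∧ a + 1 ≠ b then (q F b - q F a) * omega F a b else 0

variable (L : LData F i M)

/-- The term `(a - b) Ξ` cancels against `e`, so `Φ_k` only moves the component at `s_k τ` to `τ`.
The factor `q b - q a` in `coef` has this sign because the squares are evaluated at `s_k τ`. -/
theorem Phi_xD_apply (hG : Good F i) (k : ℕ) (hk : k + 1 < n) (f : L.D) {τ : Perm (Fin n)}
    (hτ : InP i τ) : ext0 (Phi L.xD L.cD L.sD k hk f) τ =
      coef F (permAct τ i ⟨k, Nat.lt_of_succ_lt hk⟩) (permAct τ i ⟨k + 1, hk⟩) •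
        ext0 f (simple k hk * τ) := by
  have h0 := sub_ne_zero.mpr (hG.ne hτ k hk)
  have hd : ∀ σ, (L.xD ⟨k, Nat.lt_of_succ_lt hk⟩ * L.xD ⟨k, Nat.lt_of_succ_lt hk⟩ -
      L.xD ⟨k + 1, hk⟩ * L.xD ⟨k + 1, hk⟩) f σ =
        (q F (permAct σ.1 i ⟨k, Nat.lt_of_succ_lt hk⟩) - q F (permAct σ.1 i ⟨k + 1, hk⟩)) • f σ :=
    fun σ => by
      rw [LinearMap.sub_apply, Pi.sub_apply, Module.End.mul_apply, Module.End.mul_apply, xD_xD,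
        xD_xD, sub_smul]
  have hX := L.Xi_apply (τ⁻¹ ⟨k, Nat.lt_of_succ_lt hk⟩) (τ⁻¹ ⟨k + 1, hk⟩) (f ⟨τ, hτ⟩)
  have h3 : eOp L.xD L.cD ⟨k, Nat.lt_of_succ_lt hk⟩ ⟨k + 1, hk⟩ f ⟨τ, hτ⟩ =
      eOp L.x L.c (τ⁻¹ ⟨k, Nat.lt_of_succ_lt hk⟩) (τ⁻¹ ⟨k + 1, hk⟩) (f ⟨τ, hτ⟩) := by
    rw [eOp_apply, eOp_apply]; rfl
  have h4 : (q F (permAct τ i ⟨k, Nat.lt_of_succ_lt hk⟩) - q F (permAct τ i ⟨k + 1, hk⟩)) •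
      L.Xi (τ⁻¹ ⟨k, Nat.lt_of_succ_lt hk⟩) (τ⁻¹ ⟨k + 1, hk⟩) (f ⟨τ, hτ⟩) =
        -eOp L.x L.c (τ⁻¹ ⟨k, Nat.lt_of_succ_lt hk⟩) (τ⁻¹ ⟨k + 1, hk⟩) (f ⟨τ, hτ⟩) := by
    rw [hX, smul_smul, mul_neg]
    unfold permAct at h0 ⊢
    rw [mul_inv_cancel₀ h0, neg_smul, one_smul]
  rw [ext0, dif_pos hτ, Phi, LinearMap.add_apply, Pi.add_apply, Module.End.mul_apply, h3]
  by_cases h : Admissible (permAct τ i) k hk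
  · have hc : coef F (permAct τ i ⟨k, Nat.lt_of_succ_lt hk⟩) (permAct τ i ⟨k + 1, hk⟩) = _ :=
      if_pos h
    rw [sD_apply (τ := ⟨τ, hτ⟩) h, hd, hd, map_smul, h4, hc, ext0, dif_pos (InP.step τ k hk hτ h)]
    have e2 : ∀ m, permAct (next ⟨τ, hτ⟩ k hk h).1 i m = permAct τ i (simple k hk m) := fun m =>
      permAct_simple_mul _ _ _ _
    rw [e2, e2, simple_left, simple_right, smul_smul]
    change _ + (_ * _) • f (next ⟨τ, hτ⟩ k hk h) + _ = _ • f (next ⟨τ, hτ⟩ k hk h)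
    rw [mul_comm (omega F _ _)]
    abel
  · have hc : coef F (permAct τ i ⟨k, Nat.lt_of_succ_lt hk⟩) (permAct τ i ⟨k + 1, hk⟩) = 0 :=
      if_neg h
    rw [sD_apply_of_not (τ := ⟨τ, hτ⟩) h, hd, map_smul, h4, hc, zero_smul, neg_add_cancel]

theorem inP_of_coef {τ : Perm (Fin n)} (hτ : InP i τ) {k : ℕ} {hk : k + 1 < n}
    (h : coef F (permAct τ i ⟨k, Nat.lt_of_succ_lt hk⟩) (permAct τ i ⟨k + 1, hk⟩) ≠ 0) :
    InP i (simple k hk * τ) := by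
  by_cases hA : Admissible (permAct τ i) k hk
  · exact InP.step τ k hk hτ hA
  · exact absurd (if_neg hA) h

theorem Phi_Phi_xD (hG : Good F i) (k l : ℕ) (hk : k + 1 < n) (hl : l + 1 < n) (f : L.D)
    {τ : Perm (Fin n)} (hτ : InP i τ) :
    ext0 (Phi L.xD L.cD L.sD k hk (Phi L.xD L.cD L.sD l hl f)) τ =
      (coef F (permAct τ i ⟨k, Nat.lt_of_succ_lt hk⟩) (permAct τ i ⟨k + 1, hk⟩) *
        coef F (permAct τ i (simple k hk ⟨l, Nat.lt_of_succ_lt hl⟩))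
          (permAct τ i (simple k hk ⟨l + 1, hl⟩))) • ext0 f (simple l hl * (simple k hk * τ)) := by
  rw [L.Phi_xD_apply hG k hk _ hτ]
  by_cases h : coef F (permAct τ i ⟨k, Nat.lt_of_succ_lt hk⟩) (permAct τ i ⟨k + 1, hk⟩) = 0
  · rw [h, zero_smul, zero_mul, zero_smul]
  · rw [L.Phi_xD_apply hG l hl _ (inP_of_coef hτ h), permAct_simple_mul, permAct_simple_mul,
      smul_smul]

theorem Phi_Phi_Phi_xD (hG : Good F i) (k l m : ℕ) (hk : k + 1 < n) (hl : l + 1 < n)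
    (hm : m + 1 < n) (f : L.D) {τ : Perm (Fin n)} (hτ : InP i τ) :
    ext0 (Phi L.xD L.cD L.sD k hk (Phi L.xD L.cD L.sD l hl (Phi L.xD L.cD L.sD m hm f))) τ =
      (coef F (permAct τ i ⟨k, Nat.lt_of_succ_lt hk⟩) (permAct τ i ⟨k + 1, hk⟩) *
        (coef F (permAct τ i (simple k hk ⟨l, Nat.lt_of_succ_lt hl⟩))
          (permAct τ i (simple k hk ⟨l + 1, hl⟩)) *
        coef F (permAct τ i (simple k hk (simple l hl ⟨m, Nat.lt_of_succ_lt hm⟩)))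
          (permAct τ i (simple k hk (simple l hl ⟨m + 1, hm⟩))))) •
        ext0 f (simple m hm * (simple l hl * (simple k hk * τ))) := by
  rw [L.Phi_xD_apply hG k hk _ hτ]
  by_cases h : coef F (permAct τ i ⟨k, Nat.lt_of_succ_lt hk⟩) (permAct τ i ⟨k + 1, hk⟩) = 0
  · rw [h, zero_smul, zero_mul, zero_smul]
  · rw [L.Phi_Phi_xD hG l m hl hm _ (inP_of_coef hτ h)]
    simp only [permAct_simple_mul, smul_smul]

theorem ext_ext0 {f g : L.D} (h : ∀ τ, InP i τ → ext0 f τ = ext0 g τ) : f = g := funext fun τ => by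
  have := h τ.1 τ.2
  rwa [ext0, ext0, dif_pos τ.2, dif_pos τ.2] at this

/-- The coefficient depends only on the two entries that are exchanged. Both sides exchange the same
three pairs, in opposite order. -/
theorem Phi_braid_xD (hG : Good F i) (k : ℕ) (hk : k + 2 < n) :
    Phi L.xD L.cD L.sD k (Nat.lt_of_succ_lt hk) *
        (Phi L.xD L.cD L.sD (k + 1) hk * Phi L.xD L.cD L.sD k (Nat.lt_of_succ_lt hk)) =
      Phi L.xD L.cD L.sD (k + 1) hk *
        (Phi L.xD L.cD L.sD k (Nat.lt_of_succ_lt hk) * Phi L.xD L.cD L.sD (k + 1) hk) := by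
  refine LinearMap.ext fun f => L.ext_ext0 fun τ hτ => ?_
  simp only [Module.End.mul_apply]
  rw [L.Phi_Phi_Phi_xD hG _ _ _ _ _ _ _ hτ, L.Phi_Phi_Phi_xD hG _ _ _ _ _ _ _ hτ]
  have hk1 : k + 1 < n := Nat.lt_of_succ_lt hk
  have sa : simple k hk1 ⟨k, by omega⟩ = ⟨k + 1, hk1⟩ := simple_left _ _
  have sb : simple k hk1 ⟨k + 1, hk1⟩ = ⟨k, by omega⟩ := simple_right _ _
  have sd : simple k hk1 ⟨k + 2, hk⟩ = ⟨k + 2, hk⟩ := simple_of_ne _ _ _ (by simp) (by simp)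
  have ra : simple (k + 1) hk ⟨k, by omega⟩ = ⟨k, by omega⟩ :=
    simple_of_ne _ _ _ (by simp) (by simp only; omega)
  have rb : simple (k + 1) hk ⟨k + 1, hk1⟩ = ⟨k + 2, hk⟩ := simple_left _ _
  have rd : simple (k + 1) hk ⟨k + 2, hk⟩ = ⟨k + 1, hk1⟩ := simple_right _ _
  have hp := congrArg (· * τ) (simple_braid k hk)
  simp only [mul_assoc] at hp
  rw [hp]
  congr 1
  change _ * (coef F (permAct τ i (simple k hk1 ⟨k + 1, hk1⟩)) (permAct τ i (simple k hk1 ⟨k + 2, hk⟩)) *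
    coef F (permAct τ i (simple k hk1 (simple (k + 1) hk ⟨k, _⟩)))
      (permAct τ i (simple k hk1 (simple (k + 1) hk ⟨k + 1, hk1⟩)))) =
    coef F _ (permAct τ i ⟨k + 2, hk⟩) * (coef F (permAct τ i (simple (k + 1) hk ⟨k, _⟩))
      (permAct τ i (simple (k + 1) hk ⟨k + 1, hk1⟩)) *
      coef F (permAct τ i (simple (k + 1) hk (simple k hk1 ⟨k + 1, hk1⟩)))
        (permAct τ i (simple (k + 1) hk (simple k hk1 ⟨k + 2, hk⟩))))
  rw [ra, rb, sb, sd, sa, ra, rd]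
  ring

theorem Phi_comm_xD (hG : Good F i) (k l : ℕ) (hk : k + 1 < n) (hl : l + 1 < n) (hkl : k + 1 < l) :
    Phi L.xD L.cD L.sD k hk * Phi L.xD L.cD L.sD l hl =
      Phi L.xD L.cD L.sD l hl * Phi L.xD L.cD L.sD k hk := by
  refine LinearMap.ext fun f => L.ext_ext0 fun τ hτ => ?_
  simp only [Module.End.mul_apply]
  rw [L.Phi_Phi_xD hG _ _ _ _ _ hτ, L.Phi_Phi_xD hG _ _ _ _ _ hτ, ← mul_assoc, ← mul_assoc,
    simple_comm k l hk hl hkl,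
    simple_of_ne k hk ⟨l, _⟩ (by simp only; omega) (by simp only; omega),
    simple_of_ne k hk ⟨l + 1, _⟩ (by simp only; omega) (by simp only; omega),
    simple_of_ne l hl ⟨k, _⟩ (by simp only; omega) (by simp only; omega),
    simple_of_ne l hl ⟨k + 1, _⟩ (by simp only; omega) (by simp only; omega), mul_comm]

theorem eq_sum_twist (f : L.D) : ∃ s : Finset {τ : Perm (Fin n) // InP i τ},
    f = ∑ τ ∈ s, L.twist τ.1 τ.2 (f τ) := by
  classical
  haveI : Fintype {τ : Perm (Fin n) // InP i τ} := Fintype.ofFinite _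
  exact ⟨Finset.univ, (Finset.univ_sum_single f).symm⟩

theorem ext_twist {N : Type*} [AddCommGroup N] [Module F N] {f g : L.D →ₗ[F] N}
    (h : ∀ τ hτ z, f (L.twist τ hτ z) = g (L.twist τ hτ z)) : f = g := by
  refine LinearMap.ext fun y => ?_
  obtain ⟨s, hs⟩ := L.eq_sum_twist y
  rw [hs, map_sum, map_sum]
  exact Finset.sum_congr rfl fun τ _ => h _ _ _

theorem xsq_sub_twist (a b : Fin n) (τ : Perm (Fin n)) (hτ : InP i τ) (z : M) :
    (L.xD a * L.xD a - L.xD b * L.xD b) (L.twist τ hτ z) =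
      (q F (permAct τ i a) - q F (permAct τ i b)) • L.twist τ hτ z := by
  have hw := L.twist_mem_wt τ hτ z
  rw [LinearMap.sub_apply, sub_smul]
  exact congrArg₂ _ (hw a) (hw b)

theorem comm_sD (hG : Good F i) (k l : ℕ) (hk : k + 1 < n) (hl : l + 1 < n) (hkl : k + 1 < l) :
    L.sD k hk * L.sD l hl = L.sD l hl * L.sD k hk := by
  have h := (L.hcRel hG).Phi_comm_diff k l hk hl hkl
  rw [L.Phi_comm_xD hG k l hk hl hkl, sub_self] at h
  refine sub_eq_zero.mp (L.ext_twist fun τ hτ z => ?_)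
  have h1 := congrArg (· (L.twist τ hτ z)) h
  rw [Module.End.mul_apply, Module.End.mul_apply, L.xsq_sub_twist, map_smul, L.xsq_sub_twist,
    smul_smul, map_smul, LinearMap.zero_apply] at h1
  exact (smul_eq_zero.mp h1.symm).resolve_left (mul_ne_zero (sub_ne_zero.mpr (hG.ne hτ l hl))
    (sub_ne_zero.mpr (hG.ne hτ k hk)))

/-- When the three values of `q` are distinct, the braid relation of the `Φ_k` gives that of the
`s_k` after cancelling the scalar in `HCRel.Phi_braid_diff`. The case `(a, b, a)` is computed
directly. -/
theorem braid_sD (hG : Good F i) (h2 : (2 : F) ≠ 0) (k : ℕ) (hk : k + 2 < n) :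
    L.sD k (Nat.lt_of_succ_lt hk) * (L.sD (k + 1) hk * L.sD k (Nat.lt_of_succ_lt hk)) =
      L.sD (k + 1) hk * (L.sD k (Nat.lt_of_succ_lt hk) * L.sD (k + 1) hk) := by
  have hk1 : k + 1 < n := Nat.lt_of_succ_lt hk
  have h := (L.hcRel hG).Phi_braid_diff k hk
  simp only at h
  rw [L.Phi_braid_xD hG k hk, sub_self] at h
  refine sub_eq_zero.mp (L.ext_twist fun τ hτ z => ?_)
  have n1 := hG.ne hτ k hk1
  have n2 := hG.ne hτ (k + 1) hk
  by_cases n3 : q F (permAct τ i ⟨k + 2, hk⟩) = q F (permAct τ i ⟨k, by omega⟩)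
  -- An admissible exchange would produce equal neighbours. Hence `s_k` and `s_{k+1}` act by `Ξ`
  -- alone, and the relation reduces to `(2a + 6b) e = 0` for the outer positions. The triple
  -- condition grants this: if `a = 0`, the outer `x`'s vanish and so does `e`.
  · have hna : ¬ Admissible (permAct τ i) k hk1 := fun hA => by
      have h1 := hG.ne (InP.step τ k hk1 hτ hA) (k + 1) hk
      rw [permAct_simple_mul, permAct_simple_mul, simple_right,
        simple_of_ne _ _ _ (by simp only; omega) (by simp only; omega)] at h1
      exact h1 n3.symm
    have hq := not_not.mp fun h' => hna ((hG.adm τ hτ k hk1).mpr h')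
    have hna' : ¬ Admissible (permAct τ i) (k + 1) hk := fun hA => by
      refine (hG.adm τ hτ (k + 1) hk).mp hA ?_
      change 2 * (q F (permAct τ i ⟨k + 1, hk1⟩) + q F (permAct τ i ⟨k + 2, hk⟩)) = _
      change _ = (q F (permAct τ i ⟨k + 1, hk1⟩) - q F (permAct τ i ⟨k + 2, hk⟩)) ^ 2
      rw [n3]; linear_combination hq
    have ht := hG.closed.triple _ ⟨τ, hτ, rfl⟩ k hk n3 hq
    have hab := inv_ne τ hk1
    have hbd := inv_ne τ hk
    have had : τ⁻¹ ⟨k, by omega⟩ ≠ τ⁻¹ ⟨k + 2, hk⟩ := fun e => by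
      have := congrArg Fin.val (τ⁻¹.injective e)
      simp at this
    have hb := L.cxRel.eOp_braid_apply hab hbd had (L.mem_wt z) n3
    have hr : (2 * q F (i (τ⁻¹ ⟨k, by omega⟩)) + 6 * q F (i (τ⁻¹ ⟨k + 1, hk1⟩))) •
        eOp L.x L.c (τ⁻¹ ⟨k, by omega⟩) (τ⁻¹ ⟨k + 2, hk⟩) z = 0 := by
      rcases ht with ht | ht
      · have hx : ∀ m, q F (i m) = 0 → L.x m z = 0 := fun m hm => L.x_ker m z (by
          rw [L.x_x, hm, zero_smul])
        rw [eOp_apply, hx _ ht, hx _ (n3.trans ht)]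
        simp
      · unfold permAct at ht
        rw [ht, zero_smul]
    have hb' := hb.trans hr
    rw [LinearMap.zero_apply, LinearMap.sub_apply]
    simp only [Module.End.mul_apply]
    rw [L.sD_twist_of_not k hk1 τ hτ z hna, L.sD_twist_of_not (k + 1) hk τ hτ _ hna',
      L.sD_twist_of_not k hk1 τ hτ _ hna, L.sD_twist_of_not (k + 1) hk τ hτ z hna',
      L.sD_twist_of_not k hk1 τ hτ _ hna, L.sD_twist_of_not (k + 1) hk τ hτ _ hna']
    change L.twist τ hτ (L.Xi _ _ (L.Xi (τ⁻¹ ⟨k + 1, hk1⟩) (τ⁻¹ ⟨k + 2, hk⟩) _)) -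
      L.twist τ hτ (L.Xi (τ⁻¹ ⟨k + 1, hk1⟩) (τ⁻¹ ⟨k + 2, hk⟩)
        (L.Xi _ _ (L.Xi (τ⁻¹ ⟨k + 1, hk1⟩) (τ⁻¹ ⟨k + 2, hk⟩) z))) = 0
    simp only [L.Xi_apply, map_smul, smul_smul]
    have e3 : q F (i (τ⁻¹ ⟨k + 2, hk⟩)) = q F (i (τ⁻¹ ⟨k, by omega⟩)) := n3
    rw [e3, sub_eq_zero]
    congr 1
    rw [eq_neg_of_add_eq_zero_left hb', smul_neg, ← neg_smul]
    congr 1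
    rw [← neg_sub (q F (i (τ⁻¹ ⟨k + 1, _⟩))), inv_neg]
    ring
  · have h1 := congrArg (· (L.twist τ hτ z)) h
    rw [Module.End.mul_apply, Module.End.mul_apply, Module.End.mul_apply, L.xsq_sub_twist, map_smul,
      map_smul, L.xsq_sub_twist, map_smul, map_smul, L.xsq_sub_twist, smul_smul, map_smul,
      smul_smul, LinearMap.zero_apply] at h1
    exact (smul_eq_zero.mp h1.symm).resolve_left (mul_ne_zero (sub_ne_zero.mpr n1)
      (mul_ne_zero (sub_ne_zero.mpr n2) (sub_ne_zero.mpr (Ne.symm n3))))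

theorem superHC (hG : Good F i) (h2 : (2 : F) ≠ 0) : SuperHC L.xD L.cD L.sD L.grD where
  toHCRel := L.hcRel hG
  braid := L.braid_sD hG h2
  comm := L.comm_sD hG
  ker_sq k a f g h h' := funext fun τ => by
    have e1 := congrFun h τ
    have e2 := congrFun h' τ
    rw [xD_xD] at e1 e2
    by_cases e : q F (permAct τ.1 i k) = a
    · rw [e] at e1
      simpa using e1
    · exact (smul_eq_zero.mp (show (q F (permAct τ.1 i k) - a) • g τ = 0 by
        rw [sub_smul, e2, Pi.smul_apply, sub_self])).resolve_left (sub_ne_zero.mpr e)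
  ker_x := L.xD_ker
  toGrRel := L.grRelD
  s := L.grD_sD

end LData

end dmodule

/-! ## Irreducibility of `D^i` -/

/-- The operator is annihilated by the product of the distinct factors `X - b`, where `b` runs over
`±√a` with `a` in `A`. For `a = 0` the extra condition makes the single factor `X` sufficient. -/
theorem isSemisimple_of_span {F : Type*} [Field F] {M : Type*} [AddCommGroup M] [Module F M]
    (f : Module.End F M) (A : Finset F)
    (h : Submodule.span F {v | ∃ a ∈ A, f (f v) = a • v ∧ (a = 0 → f v = 0)} = ⊤)
    (h2 : (2 : F) ≠ 0) [IsAlgClosed F] : f.IsSemisimple := by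
  classical
  let B : Finset F := A.image (sqrtF F) ∪ A.image fun a => -sqrtF F a
  let P : Polynomial F := ∏ b ∈ B, (Polynomial.X - Polynomial.C b)
  refine Module.End.isSemisimple_of_squarefree_aeval_eq_zero (p := P)
    (Polynomial.separable_prod_X_sub_C_iff'.mpr fun x _ y _ e => e).squarefree ?_
  rw [← LinearMap.ker_eq_top, ← top_le_iff, ← h]
  refine Submodule.span_le.mpr ?_
  rintro v ⟨a, ha, hv, h0⟩
  change Polynomial.aeval f P v = 0
  have key : ∀ Q : Polynomial F, Q ∣ P → Polynomial.aeval f Q v = 0 →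
      Polynomial.aeval f P v = 0 := by
    rintro Q ⟨R, hR⟩ hQ
    rw [hR, mul_comm, map_mul, Module.End.mul_apply, hQ, map_zero]
  have m1 : sqrtF F a ∈ B := Finset.mem_union_left _ (Finset.mem_image_of_mem _ ha)
  have m2 : -sqrtF F a ∈ B :=
    Finset.mem_union_right _ (Finset.mem_image_of_mem (fun a => -sqrtF F a) ha)
  by_cases e : a = 0
  · refine key _ (Finset.dvd_prod_of_mem _ m1) ?_
    have h1 : sqrtF F a = 0 := mul_self_eq_zero.mp ((sqrtF_sq a).trans e)
    rw [h1]
    simpa using h0 e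
  · have hs : sqrtF F a ≠ 0 := fun h => e (by rw [← sqrtF_sq a, h, mul_zero])
    have hne : sqrtF F a ≠ -sqrtF F a := fun h => hs (by
      have : (2 : F) * sqrtF F a = 0 := by rw [two_mul]; nth_rewrite 2 [h]; ring
      exact (mul_eq_zero.mp this).resolve_left h2)
    refine key ((Polynomial.X - Polynomial.C (sqrtF F a)) *
      (Polynomial.X - Polynomial.C (-sqrtF F a))) ?_ ?_
    · rw [← Finset.prod_pair (f := fun b => Polynomial.X - Polynomial.C b) hne]
      exact Finset.prod_dvd_prod_of_subset _ _ _ (by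
        intro b hb
        rcases Finset.mem_insert.mp hb with rfl | hb
        · exact m1
        · rw [Finset.mem_singleton.mp hb]; exact m2)
    · have e1 : (Polynomial.X - Polynomial.C (sqrtF F a)) *
          (Polynomial.X - Polynomial.C (-sqrtF F a)) =
          Polynomial.X ^ 2 - Polynomial.C a := by
        conv_rhs => rw [← sqrtF_sq a]
        simp only [map_neg, map_mul]; ring
      rw [e1]
      simp [pow_two, hv]

section weights

variable {F : Type*} [Field F] {M : Type*} [AddCommGroup M] [Module F M] {κ : Type*}

/-- The components of an element of a stable subspace for distinct joint eigenvalues lie in the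
subspace. -/
theorem mem_of_sum_jointEigen {f : κ → Module.End F M} (h : ∀ i j, f i * f j = f j * f i)
    {N : Submodule F M} (hN : ∀ k, ∀ v ∈ N, f k v ∈ N)
    {ι : Type*} [Fintype ι] (χ : ι → κ → F) (hχ : Function.Injective χ) (y : ι → M)
    (hy : ∀ α, y α ∈ jointEigen f (χ α)) (hs : ∑ α, y α ∈ N) (α : ι) : y α ∈ N := by
  classical
  -- In the quotient by `N` the sum is zero, and independence of the joint eigenspaces there kills
  -- each term.
  let g : κ → Module.End F (M ⧸ N) := fun k => N.mapQ N (f k) (hN k)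
  have hg : ∀ k v, g k (N.mkQ v) = N.mkQ (f k v) := fun k v => rfl
  have hc : ∀ i j, g i * g j = g j * g i := fun i j => LinearMap.ext fun v => by
    obtain ⟨v, rfl⟩ := N.mkQ_surjective v
    rw [Module.End.mul_apply, Module.End.mul_apply, hg, hg, hg, hg]
    exact congrArg N.mkQ (congrArg (· v) (h i j))
  have h0 : ∑ α, N.mkQ (y α) = 0 := by
    rw [← map_sum]
    exact (Submodule.Quotient.mk_eq_zero N).mpr hs
  have h1 := sum_jointEigen hc χ (fun α => N.mkQ (y α)) (fun α k => by
    rw [hg, mem_jointEigen.mp (hy α) k, map_smul]) (χ α) (by rw [h0]; exact zero_mem _)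
  rw [h0, Finset.filter_congr (q := fun β => β = α) (by
    intro β _; exact hχ.eq_iff), Finset.sum_filter, Finset.sum_ite_eq'] at h1
  simp only [Finset.mem_univ, if_true] at h1
  exact (Submodule.Quotient.mk_eq_zero N).mp h1.symm

end weights

section dmodule

variable {F : Type u} [Field F] [IsAlgClosed F] {n : ℕ} {i : Fin n → ℕ}

theorem Good.ordPres (hG : Good F i) {τ : Perm (Fin n)} (hτ : InP i τ) :
    OrdPres (fun k => q F (i k)) τ := by
  induction hτ with
  | one => exact ordPres_one _
  | step τ k hk h _ ih => exact ih.simple_mul (hG.ne h k hk)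

/-- Elements of `P_i` preserve the order of equal entries, since they never exchange equal
neighbours; hence the weight determines `τ`. -/
theorem Good.weight_injective (hG : Good F i) :
    Function.Injective fun (τ : {τ : Perm (Fin n) // InP i τ}) (k : Fin n) =>
      q F (permAct τ.1 i k) :=
  fun τ σ e => Subtype.ext ((hG.ordPres τ.2).unique (hG.ordPres σ.2) e)

theorem Good.omega_ne_zero (hG : Good F i) {τ : Perm (Fin n)} (hτ : InP i τ) {k : ℕ}
    {hk : k + 1 < n} (h : Admissible (permAct τ i) k hk) :
    omega F (permAct τ i ⟨k, Nat.lt_of_succ_lt hk⟩) (permAct τ i ⟨k + 1, hk⟩) ≠ 0 := by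
  intro h0
  refine (hG.adm τ hτ k hk).mp h ?_
  have h1 := omega_sq (F := F) (permAct τ i ⟨k, Nat.lt_of_succ_lt hk⟩) (permAct τ i ⟨k + 1, hk⟩)
  rw [h0, mul_zero, eq_comm, sub_eq_zero, eq_comm,
    div_eq_one_iff_eq (pow_ne_zero 2 (sub_ne_zero.mpr (hG.ne hτ k hk)))] at h1
  exact h1

namespace LData

variable {M : Type v} [AddCommGroup M] [Module F M] (L : LData F i M)

theorem twist_add (τ : Perm (Fin n)) (hτ : InP i τ) (z z' : M) :
    L.twist τ hτ (z + z') = L.twist τ hτ z + L.twist τ hτ z' := Pi.single_add _ _ _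

theorem twist_smul (τ : Perm (Fin n)) (hτ : InP i τ) (r : F) (z : M) :
    L.twist τ hτ (r • z) = r • L.twist τ hτ z := Pi.single_smul' _ _ _

theorem twist_mem_of_mem (hG : Good F i) {N : Submodule F L.D}
    (hN : ∀ k, ∀ f ∈ N, L.xD k f ∈ N) {f : L.D} (hf : f ∈ N)
    (τ : {τ : Perm (Fin n) // InP i τ}) : L.twist τ.1 τ.2 (f τ) ∈ N := by
  classical
  haveI : Fintype {τ : Perm (Fin n) // InP i τ} := Fintype.ofFinite _
  refine mem_of_sum_jointEigen (f := fun k => L.xD k * L.xD k)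
    (fun a b => (L.hcRel hG).toCXRel.xsq_comm a b) (fun k v hv => hN k _ (hN k _ hv)) _
    hG.weight_injective (fun τ => L.twist τ.1 τ.2 (f τ)) (fun τ => L.twist_mem_wt _ _ _) ?_ τ
  have : ∑ τ, L.twist τ.1 τ.2 (f τ) = f := Finset.univ_sum_single f
  rwa [this]

/-- The summands have distinct weights, so a nonzero stable subspace contains a nonzero element of
one summand, and then the whole summand because `L(i)` is irreducible. As `omega` is nonzero along
admissible exchanges, it contains the summand of `1` and from there every other one. -/
theorem irr (hG : Good F i) (hM : ∀ N : Submodule F M, (∀ k, ∀ z ∈ N, L.c k z ∈ N) →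
    (∀ k, ∀ z ∈ N, L.x k z ∈ N) → (∀ z ∈ N, L.gr z ∈ N) → N = ⊥ ∨ N = ⊤) :
    Irr L.xD L.cD L.sD L.grD := by
  classical
  intro N hN
  by_cases hb : N = ⊥
  · exact Or.inl hb
  right
  obtain ⟨f, hf, hf0⟩ := Submodule.exists_mem_ne_zero_of_ne_bot hb
  obtain ⟨τ, hτ0⟩ := Function.ne_iff.mp hf0
  have hcomp : ∀ (τ : Perm (Fin n)) (hτ : InP i τ) (z : M), z ≠ 0 → L.twist τ hτ z ∈ N →
      ∀ y, L.twist τ hτ y ∈ N := by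
    intro τ hτ z hz hzN y
    let N' : Submodule F M :=
      { carrier := {z | L.twist τ hτ z ∈ N}
        zero_mem' := by
          change L.twist τ hτ 0 ∈ N
          rw [twist, Pi.single_zero]; exact zero_mem _
        add_mem' := fun {a b} ha hb => by
          change L.twist τ hτ (a + b) ∈ N
          rw [twist_add]; exact add_mem ha hb
        smul_mem' := fun r a ha => by
          change L.twist τ hτ (r • a) ∈ N
          rw [twist_smul]; exact N.smul_mem _ ha }
    have hi : ∀ k, τ⁻¹ (τ k) = k := fun k => by simp [Perm.inv_def]
    have := hM N' (fun k z hz => by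
        have := hN.c (τ k) _ hz
        rw [cD_twist, hi] at this
        exact this) (fun k z hz => by
        have := hN.x (τ k) _ hz
        rw [xD_twist, hi] at this
        exact this) (fun z hz => by
        have := hN.gr _ hz
        rw [grD_twist] at this
        exact this)
    have ht : N' = ⊤ := this.resolve_left fun e => hz ((Submodule.mem_bot F).mp (e ▸ (show z ∈ N' from hzN)))
    exact (ht ▸ Submodule.mem_top : y ∈ N')
  have hstep : ∀ (τ : Perm (Fin n)) (hτ : InP i τ) (k : ℕ) (hk : k + 1 < n)
      (h : Admissible (permAct τ i) k hk), (∀ y, L.twist τ hτ y ∈ N) →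
      ∀ y, L.twist (simple k hk * τ) (InP.step τ k hk hτ h) y ∈ N := by
    intro τ hτ k hk h hy y
    have h1 := hN.s k hk _ (hy y)
    rw [L.sD_twist k hk τ hτ y h] at h1
    exact (N.smul_mem_iff (hG.omega_ne_zero hτ h)).mp ((N.add_mem_iff_right (hy _)).mp h1)
  have hback : ∀ (τ : Perm (Fin n)) (hτ : InP i τ), (∀ y, L.twist τ hτ y ∈ N) →
      ∀ y, L.twist 1 InP.one y ∈ N := by
    intro τ hτ
    induction hτ with
    | one => exact fun h => h
    | step τ k hk h hadm ih =>
      intro hy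
      refine ih ?_
      have h1 := hstep _ _ k hk (adm_next (τ := ⟨τ, h⟩) hadm) hy
      have e : (simple k hk * (next ⟨τ, h⟩ k hk hadm).1) = τ := simple_mul_self_assoc k hk τ
      intro y
      have h2 := h1 y
      have : ∀ σ (hσ : InP i σ), σ = τ → L.twist σ hσ y = L.twist τ h y := by
        rintro σ hσ rfl; rfl
      rwa [this _ _ e] at h2
  have h1 := hback τ.1 τ.2 (hcomp τ.1 τ.2 _ hτ0 (L.twist_mem_of_mem hG hN.x hf τ))
  have hall : ∀ (τ : Perm (Fin n)) (hτ : InP i τ) y, L.twist τ hτ y ∈ N := by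
    intro τ hτ
    induction hτ with
    | one => exact h1
    | step τ k hk h hadm ih => exact hstep τ h k hk hadm ih
  refine eq_top_iff.mpr fun g _ => ?_
  obtain ⟨t, ht⟩ := L.eq_sum_twist g
  rw [ht]
  exact N.sum_mem fun τ _ => hall _ _ _

theorem exists_of_wt_ne_bot {ψ : Fin n → F} (h : wt L.xD ψ ≠ ⊥) :
    ∃ τ, InP i τ ∧ ψ = fun k => q F (permAct τ i k) := by
  obtain ⟨f, hf, hf0⟩ := Submodule.exists_mem_ne_zero_of_ne_bot h
  obtain ⟨τ, hτ0⟩ := Function.ne_iff.mp hf0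
  refine ⟨τ.1, τ.2, funext fun k => ?_⟩
  have h1 := congrFun (HeckeClifford.mem_wt.mp hf k) τ
  rw [xD_xD] at h1
  exact (smul_left_injective F hτ0 h1).symm

theorem wt_one_ne_bot [Nontrivial M] : wt L.xD (fun k => q F (i k)) ≠ ⊥ := by
  classical
  obtain ⟨z, hz⟩ := exists_ne (0 : M)
  refine (Submodule.ne_bot_iff _).mpr ⟨L.twist 1 InP.one z, L.twist_mem_wt 1 InP.one z, fun h => hz ?_⟩
  have := congrFun h ⟨1, InP.one⟩
  simpa [twist] using this

theorem isSemisimple_xD (h2 : (2 : F) ≠ 0) (k : Fin n) : (L.xD k).IsSemisimple := by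
  classical
  refine isSemisimple_of_span _ (Finset.univ.image fun m => q F (i m)) ?_ h2
  refine eq_top_iff.mpr fun f _ => ?_
  obtain ⟨t, ht⟩ := L.eq_sum_twist f
  rw [ht]
  refine Submodule.sum_mem _ fun τ _ => Submodule.subset_span
    ⟨q F (permAct τ.1 i k), Finset.mem_image.mpr ⟨τ.1⁻¹ k, Finset.mem_univ _, rfl⟩,
      L.twist_mem_wt τ.1 τ.2 _ k, fun h => L.xD_ker k _ ?_⟩
  have := L.twist_mem_wt τ.1 τ.2 (f τ) k
  simp only at this
  rw [h, zero_smul] at this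
  exact this

end LData

end dmodule

/-! ## Copies of `D^i` -/

theorem isSemisimple_of_intertwines {F : Type*} [Field F] {M M' : Type*} [AddCommGroup M]
    [Module F M] [AddCommGroup M'] [Module F M'] (φ : M ≃ₗ[F] M') {f : Module.End F M}
    {g : Module.End F M'} (hf : f.IsSemisimple) (h : ∀ v, φ (f v) = g (φ v)) :
    g.IsSemisimple :=
  (LinearEquiv.isSemisimple_iff f g φ (LinearMap.ext h)).mp hf

section isD

variable {F : Type u} [Field F] [IsAlgClosed F] {n : ℕ} {i : Fin n → ℕ}

namespace LModule

variable (L : LModule F i)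

/-- The operators on `L(i)`. -/
def toData (h2 : (2 : F) ≠ 0) : LData F i L.U where
  x := L.x
  c := L.c
  gr := L.gr h2
  cxRel := L.cxRel
  grRel := L.grRel h2
  x_x := L.x_x
  x_ker := L.x_ker

theorem gr_of_mem (h2 : (2 : F) ≠ 0) {e : ZMod 2} {z : L.U}
    (hz : (z : Box F n) ∈ boxParity F n e) : L.gr h2 z = sgn F e • z :=
  Subtype.ext ((mem_boxParity h2).mp hz)

theorem exists_add (h2 : (2 : F) ≠ 0) (z : L.U) : ∃ a b : L.U,
    (a : Box F n) ∈ boxParity F n 0 ∧ (b : Box F n) ∈ boxParity F n 1 ∧ z = a + b := by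
  have hsq : ∀ f : Box F n, boxGr F n (boxGr F n f) = f := fun f =>
    congrArg (· f) (box_grRel (F := F) (fun _ : Fin n => 0)).sq
  refine ⟨(2 : F)⁻¹ • (z + L.gr h2 z), (2 : F)⁻¹ • (z - L.gr h2 z), (mem_boxParity h2).mpr ?_,
    (mem_boxParity h2).mpr ?_, ?_⟩
  · change boxGr F n ((2 : F)⁻¹ • ((z : Box F n) + boxGr F n z)) = _ • ((2 : F)⁻¹ • ((z : Box F n) + boxGr F n z))
    rw [map_smul, map_add, hsq, sgn_zero, one_smul, add_comm]
  · change boxGr F n ((2 : F)⁻¹ • ((z : Box F n) - boxGr F n z)) = _ • ((2 : F)⁻¹ • ((z : Box F n) - boxGr F n z))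
    rw [map_smul, map_sub, hsq, sgn_one, neg_smul, one_smul, ← smul_neg, neg_sub]
  · refine Subtype.ext ?_
    change (z : Box F n) = (2 : F)⁻¹ • ((z : Box F n) + boxGr F n z) + (2 : F)⁻¹ • ((z : Box F n) - boxGr F n z)
    rw [← smul_add, add_add_sub_cancel, ← two_smul F (z : Box F n), smul_smul, inv_mul_cancel₀ h2,
      one_smul]

end LModule

namespace IsD

open YSupermodule

variable {V : YSupermodule.{u, v} F n}

theorem exists_intertwines (h2 : (2 : F) ≠ 0) (h : IsD i V) :
    ∃ (L : LModule F i) (φ : (L.toData h2).D ≃ₗ[F] V),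
      Intertwines (L.toData h2).xD (L.toData h2).cD (L.toData h2).sD (L.toData h2).grD
        V.xOp V.cOp V.sOp V.grOp φ.toLinearMap := by
  obtain ⟨L, φ, hg, hc, hx, hs, hs'⟩ := h
  let D := L.toData h2
  have hD : ∀ {f g : D.D →ₗ[F] V}, (∀ τ hτ z, f (D.twist τ hτ z) = g (D.twist τ hτ z)) →
      ∀ y, f y = g y := fun h y => congrArg (· y) (D.ext_twist h)
  refine ⟨L, φ, fun k => ?_, fun k => ?_, fun k hk => ?_, ?_⟩
  · refine hD (f := φ.toLinearMap ∘ₗ D.xD k) (g := V.xOp k ∘ₗ φ.toLinearMap) fun τ hτ z => ?_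
    rw [LinearMap.comp_apply, D.xD_twist]
    exact (hx k τ hτ z).symm
  · refine hD (f := φ.toLinearMap ∘ₗ D.cD k) (g := V.cOp k ∘ₗ φ.toLinearMap) fun τ hτ z => ?_
    rw [LinearMap.comp_apply, D.cD_twist]
    exact (hc k τ hτ z).symm
  · refine hD (f := φ.toLinearMap ∘ₗ D.sD k hk) (g := V.sOp k hk ∘ₗ φ.toLinearMap) fun τ hτ z => ?_
    rw [LinearMap.comp_apply]
    by_cases hadm : Admissible (permAct τ i) k hk
    · rw [D.sD_twist k hk τ hτ z hadm]
      exact (hs k hk τ hτ z hadm).symm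
    · rw [D.sD_twist_of_not k hk τ hτ z hadm]
      exact (hs' k hk τ hτ z hadm).symm
  · refine hD (f := φ.toLinearMap ∘ₗ D.grD) (g := V.grOp ∘ₗ φ.toLinearMap) fun τ hτ z => ?_
    have key : ∀ e (z : L.U), (z : Box F n) ∈ boxParity F n e →
        φ (D.twist τ hτ (L.gr h2 z)) = V.grOp (φ (D.twist τ hτ z)) := by
      intro e z hz
      rw [L.gr_of_mem h2 hz]
      refine Eq.trans ?_ (V.grOp_apply (hg e τ hτ z hz)).symm
      rw [← _root_.map_smul]
      exact congrArg φ (D.twist_smul τ hτ _ z)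
    obtain ⟨a, b, ha, hb, rfl⟩ := L.exists_add h2 z
    rw [LinearMap.comp_apply, D.grD_twist, LinearMap.comp_apply, D.twist_add]
    refine Eq.trans ?_ ((congrArg₂ (· + ·) (key 0 a ha) (key 1 b hb)).trans
      ((map_add V.grOp _ _).symm.trans
        (congrArg V.grOp (map_add φ _ _).symm)))
    refine Eq.trans (congrArg φ ?_) (map_add φ _ _)
    exact (congrArg _ (map_add (L.gr h2) a b)).trans (D.twist_add _ _ _ _)

theorem isIrreducible (hG : Good F i) (h2 : (2 : F) ≠ 0) (h : IsD i V) : V.IsIrreducible := by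
  obtain ⟨L, φ, hφ⟩ := h.exists_intertwines h2
  haveI := L.nontrivial
  haveI : Nonempty {τ : Perm (Fin n) // InP i τ} := ⟨⟨1, InP.one⟩⟩
  haveI : Nontrivial V := φ.symm.toEquiv.nontrivial
  refine isIrreducible_of_irr fun N hN => ?_
  have := (L.toData h2).irr hG (fun N hc hx hg => L.eq_bot_or_top h2 hc hx hg)
    (N.comap φ.toLinearMap) ⟨fun k v hv => ?_, fun k v hv => ?_, fun k hk v hv => ?_, fun v hv => ?_⟩
  · rcases this with h | h
    · left
      refine (Submodule.eq_bot_iff _).mpr fun z hz => ?_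
      have : φ.symm z ∈ N.comap φ.toLinearMap := by simpa using hz
      rw [h, Submodule.mem_bot] at this
      simpa using this
    · right
      refine eq_top_iff.mpr fun z _ => ?_
      have : φ.symm z ∈ N.comap φ.toLinearMap := by rw [h]; trivial
      simpa using this
  · rw [Submodule.mem_comap, hφ.x]; exact hN.x k _ hv
  · rw [Submodule.mem_comap, hφ.c]; exact hN.c k _ hv
  · rw [Submodule.mem_comap, hφ.s]; exact hN.s k hk _ hv
  · rw [Submodule.mem_comap, hφ.gr]; exact hN.gr _ hv

theorem isCompletelySplittable (h2 : (2 : F) ≠ 0) (h : IsD i V) : V.IsCompletelySplittable := by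
  obtain ⟨L, φ, hφ⟩ := h.exists_intertwines h2
  exact fun k => isSemisimple_of_intertwines φ ((L.toData h2).isSemisimple_xD h2 k) (hφ.x k)

theorem finite (hG : Good F i) (h2 : (2 : F) ≠ 0) (h : IsD i V) : Module.Finite F V := finite_of_isIrreducible h2 (h.isIrreducible hG h2)

theorem finrank_eq (h2 : (2 : F) ≠ 0) (h : IsD i V) : Module.finrank F V = 2 ^ (n - (zeros fun k => q F (i k)).card / 2) *
    {τ : Perm (Fin n) | InP i τ}.ncard := by
  classical
  obtain ⟨L, φ, -⟩ := h.exists_intertwines h2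
  haveI : Fintype {τ : Perm (Fin n) // InP i τ} := Fintype.ofFinite _
  have h1 : Module.finrank F ({τ : Perm (Fin n) // InP i τ} → L.U) =
    Fintype.card {τ : Perm (Fin n) // InP i τ} * Module.finrank F L.U := by
    rw [Module.finrank_pi_fintype, Finset.sum_const, smul_eq_mul]; rfl
  rw [← φ.finrank_eq, h1, L.finrank_U h2, mul_comm, ← Nat.card_eq_fintype_card]
  rfl

theorem wt_ne_bot (h2 : (2 : F) ≠ 0) (h : IsD i V) : wt V.xOp (fun k => q F (i k)) ≠ ⊥ := by
  obtain ⟨L, φ, hφ⟩ := h.exists_intertwines h2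
  haveI := L.nontrivial
  obtain ⟨f, hf, hf0⟩ := Submodule.exists_mem_ne_zero_of_ne_bot (L.toData h2).wt_one_ne_bot
  exact (Submodule.ne_bot_iff _).mpr ⟨φ f, hφ.mem_wt hf, fun e => hf0 (φ.map_eq_zero_iff.mp e)⟩

theorem exists_of_wt_ne_bot (h2 : (2 : F) ≠ 0) (h : IsD i V)
    {ψ : Fin n → F} (hψ : wt V.xOp ψ ≠ ⊥) :
    ∃ τ, InP i τ ∧ ψ = fun k => q F (permAct τ i k) := by
  obtain ⟨L, φ, hφ⟩ := h.exists_intertwines h2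
  obtain ⟨z, hz, hz0⟩ := Submodule.exists_mem_ne_zero_of_ne_bot hψ
  refine (L.toData h2).exists_of_wt_ne_bot ((Submodule.ne_bot_iff _).mpr
    ⟨φ.symm z, fun k => φ.injective ?_, fun e => hz0 (φ.symm.map_eq_zero_iff.mp e)⟩)
  have h1 : ∀ k f, φ ((L.toData h2).xD k f) = V.xOp k (φ f) := hφ.x
  rw [Module.End.mul_apply, h1, h1, _root_.map_smul, φ.apply_symm_apply]
  exact mem_wt.mp hz k

end IsD

/-- A graded action of the affine algebra with `x_1 = 0` gives a supermodule. -/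
theorem SuperHC.exists_supermodule {M : Type v} [AddCommGroup M] [Module F M]
    {x c : Fin n → Module.End F M} {s : ∀ k, k + 1 < n → Module.End F M} {δ : Module.End F M}
    (h : SuperHC x c s δ) (h2 : (2 : F) ≠ 0) (hx0 : ∀ h : 0 < n, x ⟨0, h⟩ = 0) :
    ∃ (V : YSupermodule.{u, v} F n) (φ : M ≃ₗ[F] V),
      Intertwines x c s δ V.xOp V.cOp V.sOp V.grOp φ.toLinearMap := by
  obtain ⟨Θ, hΘ⟩ := exists_monoidHom_of_coxeter h.s_sq h.braid h.comm
  have hΘc : ∀ σ k, Θ σ * c k = c (σ k) * Θ σ := by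
    intro σ
    induction σ using perm_induction with
    | one => intro k; rw [map_one, one_mul, mul_one]; rfl
    | step w k hk ha ih =>
      intro m
      rw [map_mul, hΘ, mul_assoc, ih, ← mul_assoc, h.s_c, mul_assoc]; rfl
  have hδΘ : ∀ σ, δ * Θ σ = Θ σ * δ := by
    intro σ
    induction σ using perm_induction with
    | one => rw [map_one, one_mul, mul_one]
    | step w k hk ha ih => rw [map_mul, hΘ, ← mul_assoc, h.s, mul_assoc, ih, mul_assoc]
  obtain ⟨f, hfc, hfw⟩ := Y.exists_lift (F := F) c Θ h.c_sq h.c_anti hΘc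
  -- The relation between `s_k` and `x_k` expresses `x_{k+1}` through `x_k`. The Jucys-Murphy
  -- elements obey the same recursion and also start from zero.
  have hjm : ∀ k (hk : k < n), f (Y.jm F ⟨k, hk⟩) = x ⟨k, hk⟩ := by
    intro k
    induction k with
    | zero => intro hk; rw [Y.jm_zero, map_zero, hx0]
    | succ k ih =>
      intro hk
      have h1 := congrArg f (Y.jm_succ (F := F) k hk)
      rw [map_mul, map_sub, map_mul, map_add, map_mul, map_one, hfw, hΘ, hfc, hfc, ih,
        h.s_x k hk, sub_left_inj] at h1
      have h3 := congrArg (· * s k hk) h1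
      simp only [mul_assoc, h.s_sq, mul_one] at h3
      exact h3.symm
  have hgr : ∀ d, ∀ a ∈ Y.parity F (n := n) d, ∀ z, δ (f a z) = (-1 : F) ^ d.val • f a (δ z) := by
    intro d a ha
    induction ha using Submodule.span_induction with
    | mem a ha =>
      obtain ⟨l, σ, rfl, rfl⟩ := ha
      intro z
      have hσ : ∀ z, δ (Θ σ z) = Θ σ (δ z) := fun z => congrArg (· z) (hδΘ σ)
      rw [map_mul, map_list_prod, hfw]
      induction l with
      | nil => simp [hσ]
      | cons k l ih =>
        have hc : ∀ z, δ (c k z) = -c k (δ z) := fun z => congrArg (· z) (h.toGrRel.c k)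
        simp only [List.map_cons, List.prod_cons, Module.End.mul_apply, hfc, hc] at ih ⊢
        rw [ih, List.length_cons, Nat.cast_succ, YSupermodule.neg_one_pow_val_add, map_smul,
          ZMod.val_one, pow_one, mul_neg_one, neg_smul]
    | zero => intro z; simp
    | add a b _ _ h h' => intro z; rw [map_add, LinearMap.add_apply, map_add, h, h', ← smul_add]; rfl
    | smul r a _ h =>
      intro z
      rw [map_smul, LinearMap.smul_apply, map_smul, h, LinearMap.smul_apply, smul_comm]
  let gr : ZMod 2 → Submodule F M := fun e => LinearMap.ker (δ - (-1 : F) ^ e.val • 1)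
  have mem_gr : ∀ e z, z ∈ gr e ↔ δ z = (-1 : F) ^ e.val • z := fun e z => by
    rw [LinearMap.mem_ker, LinearMap.sub_apply, sub_eq_zero]; rfl
  have mem0 : ∀ z, z ∈ gr 0 ↔ δ z = z := fun z => by rw [mem_gr]; simp
  have mem1 : ∀ z, z ∈ gr 1 ↔ δ z = -z := fun z => by rw [mem_gr]; simp [ZMod.val_one]
  have hsq : ∀ z, δ (δ z) = z := fun z => congrArg (· z) h.sq
  have hadd : ∀ z, (2 : F)⁻¹ • (z + δ z) ∈ gr 0 ∧ (2 : F)⁻¹ • (z - δ z) ∈ gr 1 ∧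
      z = (2 : F)⁻¹ • (z + δ z) + (2 : F)⁻¹ • (z - δ z) := fun z => by
    refine ⟨(mem0 _).mpr ?_, (mem1 _).mpr ?_, ?_⟩
    · rw [map_smul, map_add, hsq, add_comm]
    · rw [map_smul, map_sub, hsq, ← smul_neg, neg_sub]
    · rw [← smul_add, add_add_sub_cancel, ← two_smul F z, smul_smul, inv_mul_cancel₀ h2, one_smul]
  letI : Module (Y F n) M := Module.compHom M (f : Y F n →+* Module.End F M)
  have hsmul : ∀ (a : Y F n) (z : M), a • z = f a z := fun _ _ => rfl
  haveI : IsScalarTower F (Y F n) M := ⟨fun r a z => by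
    rw [hsmul, hsmul, map_smul, LinearMap.smul_apply]⟩
  let V : YSupermodule.{u, v} F n :=
    { carrier := M
      gr := gr
      isCompl := by
        refine ⟨Submodule.disjoint_def.mpr fun z h0 h1 => ?_, codisjoint_iff.mpr
          (eq_top_iff.mpr fun z _ => ?_)⟩
        · rw [mem0] at h0
          rw [mem1, h0] at h1
          exact eq_zero_of_eq_neg h2 h1
        · rw [(hadd z).2.2]
          exact Submodule.add_mem_sup (hadd z).1 (hadd z).2.1
      smul_mem := fun d e a z ha hz => by
        rw [mem_gr] at hz ⊢
        rw [hsmul, hgr d a ha, hz, map_smul, smul_smul, YSupermodule.neg_one_pow_val_add] }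
  refine ⟨V, LinearEquiv.refl F M, fun k v => ?_, fun k v => ?_, fun k hk v => ?_, fun v => ?_⟩
  · exact congrArg (· v) (hjm k k.2).symm
  · exact congrArg (· v) (hfc k).symm
  · exact congrArg (· v) ((hfw _).trans (hΘ k hk)).symm
  · change δ v = V.grOp v
    have e0 : V.grOp ((2 : F)⁻¹ • (v + δ v)) = (2 : F)⁻¹ • (v + δ v) := V.grOp_zero (hadd v).1
    have e1 : V.grOp ((2 : F)⁻¹ • (v - δ v)) = -((2 : F)⁻¹ • (v - δ v)) := V.grOp_one (hadd v).2.1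
    have h3 : V.grOp v = V.grOp ((2 : F)⁻¹ • (v + δ v) + (2 : F)⁻¹ • (v - δ v)) :=
      congrArg V.grOp (hadd v).2.2
    rw [h3]
    refine Eq.symm ((map_add V.grOp _ _).trans ?_)
    rw [e0, e1]
    change (2 : F)⁻¹ • (v + δ v) + -((2 : F)⁻¹ • (v - δ v)) = δ v
    rw [← sub_eq_add_neg, ← smul_sub, add_sub_sub_cancel, ← two_smul F (δ v), smul_smul,
      inv_mul_cancel₀ h2, one_smul]

theorem exists_isD (hG : Good F i) (h2 : (2 : F) ≠ 0) : ∃ V : YSupermodule.{u, u} F n, IsD i V := by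
  obtain ⟨L⟩ := LModule.nonempty h2 i
  let D := L.toData h2
  -- Every weight begins with `0`, so `x_1² = 0` and hence `x_1 = 0`.
  obtain ⟨V, φ, hφ⟩ := (D.superHC hG h2).exists_supermodule h2 fun hn => by
    refine D.ext_twist fun τ hτ z => ?_
    refine (D.xD_ker _ _ ?_).trans (LinearMap.zero_apply _).symm
    have h1 := D.twist_mem_wt τ hτ z ⟨0, hn⟩
    simp only at h1
    rw [hG.closed.zero _ ⟨τ, hτ, rfl⟩ hn, zero_smul] at h1
    exact h1
  refine ⟨V, L, φ, fun e τ hτ z hz => ?_, fun k τ hτ z => ?_, fun k τ hτ z => ?_,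
    fun k hk τ hτ z hadm => ?_, fun k hk τ hτ z hadm => ?_⟩
  · refine (YSupermodule.mem_gr h2).mpr ?_
    refine (hφ.gr (D.twist τ hτ z)).symm.trans ?_
    rw [D.grD_twist]
    have h1 : D.gr z = sgn F e • z := L.gr_of_mem h2 hz
    rw [h1, D.twist_smul, map_smul]; rfl
  · refine (hφ.c k (D.twist τ hτ z)).symm.trans ?_
    rw [D.cD_twist]; rfl
  · refine (hφ.x k (D.twist τ hτ z)).symm.trans ?_
    rw [D.xD_twist]; rfl
  · refine (hφ.s k hk (D.twist τ hτ z)).symm.trans ?_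
    rw [D.sD_twist k hk τ hτ z hadm]; rfl
  · refine (hφ.s k hk (D.twist τ hτ z)).symm.trans ?_
    rw [D.sD_twist_of_not k hk τ hτ z hadm]; rfl

end isD

/-! ## Shapes and words -/

/-- Adding a box to the row `r`. -/
def addBox (ρ : ℕ → ℕ) (r s : ℕ) : ℕ := ρ s + if s = r then 1 else 0

theorem addBox_self (ρ : ℕ → ℕ) (r : ℕ) : addBox ρ r r = ρ r + 1 := by simp [addBox]

theorem addBox_of_ne (ρ : ℕ → ℕ) {r s : ℕ} (h : s ≠ r) : addBox ρ r s = ρ s := by simp [addBox, h]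

theorem addBox_comm (ρ : ℕ → ℕ) (r r' : ℕ) :
    addBox (addBox ρ r) r' = addBox (addBox ρ r') r := funext fun s => by
  unfold addBox; omega

theorem addBox_injective {ρ ρ' : ℕ → ℕ} {r : ℕ} (h : addBox ρ r = addBox ρ' r) : ρ = ρ' :=
  funext fun s => by
    have := congrFun h s
    unfold addBox at this; omega

/-- The content of the box on the diagonal `d`. -/
def cont (h d : ℕ) : ℕ := if d ≤ h then d else 2 * h - d

/-- The strict partitions under consideration, where `p = 2 h + 1`. -/
structure IsShape (h : ℕ) (ρ : ℕ → ℕ) : Prop where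
  strict : ∀ r, ρ (r + 1) < ρ r ∨ ρ (r + 1) = 0
  -- Together with `le` and strictness this covers both kinds of partitions in `Γ`: if `λ₁ ≤ h + 1`
  -- it is automatic, otherwise `u = p - λ₁` satisfies `1 ≤ u ≤ h - 1` and `λ₂ ≤ u`.
  sum_le : ρ 0 + ρ 1 ≤ 2 * h + 1
  le : ρ 0 ≤ 2 * h

/-- The row `r` of `ρ` can be extended in an admissible tableau. -/
structure Addable (h : ℕ) (ρ : ℕ → ℕ) (r : ℕ) : Prop where
  -- Excludes `ρ 0 > h` with `ρ 0 + ρ 1 = 2h`. The next boxes of the first two rows would then both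
  -- have content `ρ 1`; admissibility of tableaux reserves this shape for the second row.
  zero : r = 0 → ρ 0 ≤ h ∨ ρ 0 + ρ 1 < 2 * h
  pos : ∀ s, r = s + 1 → ρ r + 1 < ρ s
  one : r = 1 → ρ 0 + ρ 1 ≤ 2 * h

variable {h : ℕ} {ρ σ : ℕ → ℕ} {r r' : ℕ}

theorem IsShape.le_of_le (hρ : IsShape h ρ) {s t : ℕ} (hst : s ≤ t) : ρ t ≤ ρ s := by
  induction t, hst using Nat.le_induction with
  | base => exact le_rfl
  | succ t _ ih => have := hρ.strict t; omega

theorem IsShape.add_two_le (hρ : IsShape h ρ) (hr : Addable h ρ r') (hlt : r < r') :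
    ρ r' + 2 ≤ ρ r := by
  obtain ⟨t, rfl⟩ := Nat.exists_eq_succ_of_ne_zero (Nat.ne_zero_of_lt hlt)
  have h1 := hr.pos t rfl
  have h2 := hρ.le_of_le (Nat.le_of_lt_succ hlt)
  omega

theorem IsShape.add_three_le (hρ : IsShape h ρ) (hr : Addable h ρ r') (hlt : r + 1 < r') :
    ρ r' + 3 ≤ ρ r := by
  obtain ⟨t, rfl⟩ := Nat.exists_eq_succ_of_ne_zero (Nat.ne_zero_of_lt hlt)
  have h1 := hr.pos t rfl
  have h2 := hρ.le_of_le (show r + 1 ≤ t by omega)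
  have h3 := hρ.strict r
  omega

theorem IsShape.addBox (h1 : 1 ≤ h) (hρ : IsShape h ρ) (hr : Addable h ρ r) :
    IsShape h (addBox ρ r) where
  strict s := by
    have e1 := hρ.strict s
    have e2 := hr.pos s
    unfold HeckeClifford.addBox
    by_cases e : s + 1 = r
    · subst e
      have := e2 rfl
      simp; omega
    · rw [if_neg e]; omega
  sum_le := by
    have := hρ.sum_le
    have e1 := hρ.strict 0
    have e2 := hr.zero
    have e3 := hr.one
    simp only [zero_add] at e1
    unfold HeckeClifford.addBox
    split_ifs <;> omega
  le := by
    have := hρ.le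
    have e2 := hr.zero
    unfold HeckeClifford.addBox
    split_ifs <;> omega

/-- Below the first row a new box lies before the fold, and its content is just the number of its
diagonal. -/
theorem Addable.le_of_pos (hρ : IsShape h ρ) (hr : Addable h ρ r) (h0 : r ≠ 0) : ρ r + 1 ≤ h := by
  have h2 := hρ.add_two_le hr (Nat.pos_of_ne_zero h0)
  have h3 := hρ.sum_le
  by_cases e : r = 1
  · subst e
    have := hr.one rfl
    omega
  · have h4 := hρ.add_two_le hr (show 1 < r by omega)
    have h5 := hρ.add_three_le hr (show 0 + 1 < r by omega)
    have h6 := hρ.strict 0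
    simp only [zero_add] at *
    omega

theorem Addable.lt (h1 : 1 ≤ h) (hρ : IsShape h ρ) (hr : Addable h ρ r) : ρ r < 2 * h := by
  by_cases h0 : r = 0
  · subst h0
    have := hr.zero rfl
    omega
  · have := hr.le_of_pos hρ h0
    omega

/-! ### Contents of addable boxes and exchange of boxes -/

theorem cont_le_of_lt {d : ℕ} (hd : d < 2 * h) : cont h d ≤ h := by unfold cont; split_ifs <;> omega

/-- The content determines the row. -/
theorem Addable.eq_of_cont (hρ : IsShape h ρ) (hr : Addable h ρ r) (hr' : Addable h ρ r')
    (e : cont h (ρ r) = cont h (ρ r')) : r = r' := by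
  wlog hlt : r < r' generalizing r r'
  · rcases lt_trichotomy r r' with h | h | h
    · exact absurd h hlt
    · exact h
    · exact (this hr' hr e.symm h).symm
  exfalso
  have h1 := hr'.le_of_pos hρ (by omega)
  have h2 := hρ.add_two_le hr' hlt
  have h3 := hρ.sum_le
  by_cases h0 : r = 0
  · subst h0
    -- Before the fold the first row is longer than row `r'`. Beyond it, equal contents would mean
    -- `ρ 0 + ρ r' = 2h`, which `zero` excludes for `r' = 1` and the smaller size of the lower rows
    -- excludes otherwise.
    have := hr.zero rfl
    have h5 := hr'.pos
    have h6 := hρ.le_of_le (show 1 ≤ r' by omega)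
    unfold cont at e
    by_cases e1 : r' = 1
    · subst e1
      split_ifs at e <;> omega
    · have h7 := hρ.add_two_le hr' (show 1 < r' by omega)
      split_ifs at e <;> omega
  · have h4 := hr.le_of_pos hρ h0
    unfold cont at e
    split_ifs at e <;> omega

/-- Boxes whose contents are not adjacent can be added in either order. -/
theorem Addable.addBox (hρ : IsShape h ρ) (hr : Addable h ρ r) (hr' : Addable h ρ r')
    (hne : r ≠ r') (e1 : cont h (ρ r) + 1 ≠ cont h (ρ r')) :
    Addable h (addBox ρ r) r' where
  zero e := by
    subst e
    have h1 := hr.le_of_pos hρ hne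
    have h2 := hr'.zero rfl
    unfold HeckeClifford.addBox
    unfold cont at e1
    by_cases e2 : r = 1
    · subst e2
      split_ifs at e1 <;> simp <;> omega
    · simp [Ne.symm hne, Ne.symm e2, h2]
  pos s e := by
    have := hr'.pos s e
    rw [addBox_of_ne _ hne.symm]
    unfold HeckeClifford.addBox
    omega
  one e := by
    subst e
    have h1 := hr'.one rfl
    have h2 := hr'.pos 0 rfl
    have h3 := hr.zero
    unfold HeckeClifford.addBox
    split_ifs <;> omega

theorem cont_succ_adj {d : ℕ} (hd : d + 1 ≤ 2 * h) :
    cont h (d + 1) = cont h d + 1 ∨ cont h (d + 1) + 1 = cont h d := by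
  unfold cont; split_ifs <;> omega

theorem Addable.of_addBox (h1 : 1 ≤ h) (hρ : IsShape h ρ) (hr : Addable h ρ r)
    (hr' : Addable h (HeckeClifford.addBox ρ r) r')
    (e1 : cont h (ρ r) ≠ cont h (HeckeClifford.addBox ρ r r') + 1)
    (e2 : cont h (ρ r) + 1 ≠ cont h (HeckeClifford.addBox ρ r r')) :
    r ≠ r' ∧ Addable h ρ r' := by
  have hne : r ≠ r' := by
    rintro rfl
    have := hr.lt h1 hρ
    rw [addBox_self] at e1 e2
    have := cont_succ_adj (show ρ r + 1 ≤ 2 * h by omega)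
    omega
  rw [addBox_of_ne _ hne.symm] at e1 e2
  refine ⟨hne, fun e => ?_, fun s e => ?_, fun e => ?_⟩
  · have := hr'.zero e
    rw [addBox_of_ne _ (by omega)] at this
    unfold HeckeClifford.addBox at this
    omega
  · have h2 := hr'.pos s e
    rw [addBox_of_ne _ hne.symm] at h2
    -- If the box in the row above had been needed to make room, the lengths would satisfy `ρ r = ρ
    -- r' + 1`, and the contents would be adjacent.
    by_cases e3 : s = r
    · subst e3
      have h3 := hr'.le_of_pos (hρ.addBox h1 hr) (by omega)
      rw [addBox_of_ne _ hne.symm] at h3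
      rw [addBox_self] at h2
      unfold cont at e1 e2
      split_ifs at e1 e2 <;> omega
    · rwa [addBox_of_ne _ e3] at h2
  · have := hr'.one e
    unfold HeckeClifford.addBox at this
    omega

theorem Addable.cont_ne (h1 : 1 ≤ h) (hρ : IsShape h ρ) (hr : Addable h ρ r)
    (hr' : Addable h (HeckeClifford.addBox ρ r) r') :
    cont h (ρ r) ≠ cont h (HeckeClifford.addBox ρ r r') := by
  intro e
  obtain ⟨hne, h2⟩ := hr.of_addBox h1 hρ hr' (by omega) (by omega)
  rw [addBox_of_ne _ hne.symm] at e
  exact hne (hr.eq_of_cont hρ h2 e)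

theorem IsShape.of_addBox (h1 : 1 ≤ h) {r r' : ℕ} (hne : r ≠ r')
    (h2 : IsShape h (HeckeClifford.addBox ρ r)) (h3 : IsShape h (HeckeClifford.addBox ρ r'))
    : IsShape h ρ where
  strict s := by
    have e1 := h2.strict s
    have e2 := h3.strict s
    unfold HeckeClifford.addBox at e1 e2
    by_cases a1 : s = r
    · have a2 : s ≠ r' := fun e => hne (a1.symm.trans e)
      rw [if_neg a2] at e2
      omega
    · rw [if_neg a1] at e1
      omega
  sum_le := by
    have := h2.sum_le
    unfold HeckeClifford.addBox at this
    omega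
  le := by
    have := h2.le
    unfold HeckeClifford.addBox at this
    omega

theorem Addable.of_addBox_addBox (hne : r ≠ r') (h2 : IsShape h (HeckeClifford.addBox ρ r))
    (hr : Addable h (HeckeClifford.addBox ρ r') r) : Addable h ρ r := by
  refine ⟨fun e => ?_, fun s e => ?_, fun e => ?_⟩
  · have := hr.zero e
    rw [addBox_of_ne _ (by omega)] at this
    unfold HeckeClifford.addBox at this
    omega
  · subst e
    have e1 := h2.strict s
    rw [addBox_self, addBox_of_ne _ (by omega)] at e1
    omega
  · have := hr.one e
    unfold HeckeClifford.addBox at this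
    omega

/-- Two removable boxes in different rows have contents that are not adjacent. -/
theorem Addable.cont_diamond (hne : r < r') (h2 : IsShape h (HeckeClifford.addBox ρ r))
    (hρ : IsShape h ρ) (h3 : IsShape h (HeckeClifford.addBox ρ r'))
    (hr' : Addable h (HeckeClifford.addBox ρ r) r')
    (hr : Addable h (HeckeClifford.addBox ρ r') r) :
    cont h (ρ r) ≠ cont h (ρ r') + 1 ∧ cont h (ρ r) + 1 ≠ cont h (ρ r') := by
  have a1 := hr.of_addBox_addBox hne.ne h2
  have a2 := hr'.of_addBox_addBox hne.ne' h3
  have e1 := hρ.add_two_le a2 hne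
  have e2 := a2.le_of_pos hρ (by omega)
  by_cases h0 : r = 0
  · subst h0
    have e3 := hr.zero rfl
    rw [addBox_of_ne _ hne.ne] at e3
    have e4 : r' = 1 ∨ ρ r' + 2 ≤ ρ 1 := by
      by_cases h5 : r' = 1
      · exact Or.inl h5
      · exact Or.inr (hρ.add_two_le a2 (by omega))
    unfold HeckeClifford.addBox at e3
    unfold cont
    rcases e4 with rfl | e4
    · simp only [if_true] at e3
      split_ifs <;> omega
    · have : (1 : ℕ) ≠ r' := by rintro rfl; omega
      rw [if_neg this] at e3
      split_ifs <;> omega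
  · have e4 := a1.le_of_pos hρ h0
    unfold cont
    split_ifs <;> omega

/-! ### Content triples `(a, b, a)` -/

theorem IsShape.lt_or (hρ : IsShape h ρ) {s t : ℕ} (hst : s < t) : ρ t < ρ s ∨ ρ t = 0 := by
  have h1 := hρ.strict s
  have h2 := hρ.le_of_le (show s + 1 ≤ t from hst)
  omega

theorem IsShape.add_le (hρ : IsShape h ρ) {t : ℕ} (ht : t ≠ 0) :
    ρ 0 + ρ t ≤ 2 * h + 1 ∧ ρ t ≤ h := by
  have h1 := hρ.le_of_le (show 1 ≤ t by omega)
  have h2 := hρ.sum_le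
  have h3 := hρ.strict 0
  simp only [zero_add] at h3
  omega

/-- The middle content of a triple of boxes with contents `a`, `b`, `a`, where `b` is adjacent to
`a`. -/
theorem Addable.triple (h1 : 1 ≤ h) (hρ : IsShape h ρ) {t : ℕ} (hr : Addable h ρ r)
    (hr' : Addable h (HeckeClifford.addBox ρ r) r')
    (ht : Addable h (HeckeClifford.addBox (HeckeClifford.addBox ρ r) r') t)
    (e : cont h (HeckeClifford.addBox (HeckeClifford.addBox ρ r) r' t) = cont h (ρ r))
    (ha : cont h (ρ r) = cont h (HeckeClifford.addBox ρ r r') + 1 ∨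
      cont h (ρ r) + 1 = cont h (HeckeClifford.addBox ρ r r')) :
    cont h (ρ r) = 0 ∨ cont h (ρ r) + 1 = h ∧ cont h (HeckeClifford.addBox ρ r r') = h := by
  -- The inequalities come from the initial and the final shape in the rows `r` and `t`. The cases
  -- depend on whether the middle box lies in row `r`, in row `t` or elsewhere.
  have hF := ((hρ.addBox h1 hr).addBox h1 hr').addBox h1 ht
  have l1 : ∀ {s t}, s < t → ρ t < ρ s ∨ ρ t = 0 := hρ.lt_or
  have l2 := fun {s t} => hF.lt_or (s := s) (t := t)
  have l3 := fun {t} => hF.add_le (t := t)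
  have l4 := hF.le
  by_cases e1 : r = t
  · subst e1
    by_cases e2 : r' = r
    · subst e2
      -- Three consecutive boxes of one row: equal outer contents occur only across the fold, as `(h
      -- - 1, h, h - 1)`.
      simp only [HeckeClifford.addBox, if_true] at e ha ⊢
      have := hr.lt h1 hρ
      unfold cont at *
      split_ifs at * <;> omega
    -- The outer boxes are neighbours in one row, so their contents differ.
    · have := hr.lt h1 hρ
      have := cont_succ_adj (show ρ r + 1 ≤ 2 * h by omega)
      rw [addBox_of_ne _ (Ne.symm e2), addBox_self] at e
      omega
  · have k1 : HeckeClifford.addBox (HeckeClifford.addBox ρ r) r' t =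
      ρ t + if r' = t then 1 else 0 := by
      rw [HeckeClifford.addBox, addBox_of_ne _ (Ne.symm e1)]
      simp only [eq_comm]
    have k2 : HeckeClifford.addBox ρ r r' = ρ r' + if r' = r then 1 else 0 := rfl
    have k3 : HeckeClifford.addBox (HeckeClifford.addBox (HeckeClifford.addBox ρ r) r') t t =
      ρ t + (if r' = t then 1 else 0) + 1 := by rw [addBox_self, k1]
    have k4 : HeckeClifford.addBox (HeckeClifford.addBox (HeckeClifford.addBox ρ r) r') t r =
      ρ r + 1 + (if r' = r then 1 else 0) := by
      rw [addBox_of_ne _ e1, HeckeClifford.addBox, addBox_self]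
      simp only [eq_comm]
    have k5 : r' = t → ρ r' = ρ t := fun e => by rw [e]
    have k6 : r' = r → ρ r' = ρ r := fun e => by rw [e]
    rw [k1] at e
    rw [k2] at ha ⊢
    have hF0 : r ≠ 0 ∨ t ≠ 0 := by omega
    rcases lt_or_gt_of_ne e1 with hlt | hlt
    · have m1 := l1 hlt
      have m2 := l2 hlt
      have m3 := l3 (Nat.ne_zero_of_lt hlt)
      rw [k3, k4] at m2
      replace m2 := m2.resolve_right (by omega)
      rw [k3] at m3
      by_cases h0 : r = 0
      · subst h0
        rw [k4] at m3 l4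
        clear l1 l2 l3 hF k1 k2 k3 k4 hρ hr hr' ht
        by_cases e2 : r' = 0
        · have := k6 e2
          have e3 : r' ≠ t := by omega
          simp only [if_pos e2, if_neg e3] at *
          unfold cont at *
          split_ifs at * <;> omega
        · by_cases e3 : r' = t
          · have := k5 e3
            simp only [if_neg e2, if_pos e3] at *
            unfold cont at *
            split_ifs at * <;> omega
          · simp only [if_neg e2, if_neg e3, add_zero] at *
            unfold cont at *
            split_ifs at * <;> omega
      · have m4 := l3 h0
        rw [k4] at m4
        clear l1 l2 l3 hF k1 k2 k3 k4 hρ hr hr' ht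
        by_cases e2 : r' = r
        · have := k6 e2
          have e3 : r' ≠ t := fun h => e1 (e2.symm.trans h)
          simp only [if_pos e2, if_neg e3] at *
          unfold cont at *
          split_ifs at * <;> omega
        · by_cases e3 : r' = t
          · have := k5 e3
            simp only [if_neg e2, if_pos e3] at *
            unfold cont at *
            split_ifs at * <;> omega
          · simp only [if_neg e2, if_neg e3, add_zero] at *
            unfold cont at *
            split_ifs at * <;> omega
    · have m1 := l1 hlt
      have m2 := l2 hlt
      have m3 := l3 (Nat.ne_zero_of_lt hlt)
      rw [k3, k4] at m2
      replace m2 := m2.resolve_right (by omega)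
      rw [k4] at m3
      by_cases h0 : t = 0
      · subst h0
        rw [k3] at m3 l4
        clear l1 l2 l3 hF k1 k2 k3 k4 hρ hr hr' ht
        by_cases e2 : r' = r
        · have := k6 e2
          have e3 : r' ≠ 0 := by omega
          simp only [if_pos e2, if_neg e3] at *
          unfold cont at *
          split_ifs at * <;> omega
        · by_cases e3 : r' = 0
          · have := k5 e3
            simp only [if_neg e2, if_pos e3] at *
            unfold cont at *
            split_ifs at * <;> omega
          · simp only [if_neg e2, if_neg e3, add_zero] at *
            unfold cont at *
            split_ifs at * <;> omega
      · have m4 := l3 h0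
        rw [k3] at m4
        clear l1 l2 l3 hF k1 k2 k3 k4 hρ hr hr' ht
        by_cases e2 : r' = r
        · have := k6 e2
          have e3 : r' ≠ t := fun h => e1 (e2.symm.trans h)
          simp only [if_pos e2, if_neg e3] at *
          unfold cont at *
          split_ifs at * <;> omega
        · by_cases e3 : r' = t
          · have := k5 e3
            simp only [if_neg e2, if_pos e3] at *
            unfold cont at *
            split_ifs at * <;> omega
          · simp only [if_neg e2, if_neg e3, add_zero] at *
            unfold cont at *
            split_ifs at * <;> omega

/-- The row of the last box, in a nonempty shape. -/
theorem IsShape.exists_addBox (h1 : 1 ≤ h) (hρ : IsShape h ρ) (h0 : ρ 0 ≠ 0) {l : ℕ} (hl : ρ l = 0) :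
    ∃ m σ, ρ = HeckeClifford.addBox σ m ∧ IsShape h σ ∧ Addable h σ m ∧ ρ (m + 1) = 0 := by
  classical
  have hex : ∃ l, ρ l = 0 := ⟨l, hl⟩
  obtain ⟨m, hm⟩ := Nat.exists_eq_succ_of_ne_zero (n := Nat.find hex) (by
    intro e
    have := Nat.find_spec hex
    rw [e] at this
    exact h0 this)
  have e1 : ρ (m + 1) = 0 := by
    have := Nat.find_spec hex
    rwa [hm] at this
  have e2 : ρ m ≠ 0 := Nat.find_min hex (by omega)
  clear hm
  refine ⟨m, fun s => ρ s - if s = m then 1 else 0, funext fun s => ?_, ⟨fun s => ?_, ?_, ?_⟩,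
    ⟨fun e => ?_, fun s e => ?_, fun e => ?_⟩, e1⟩
  · unfold HeckeClifford.addBox
    by_cases e : s = m
    · subst e; simp only [if_true]; omega
    · simp [e]
  · have := hρ.strict s
    by_cases e : s = m
    · subst e
      beta_reduce; rw [if_pos rfl]; omega
    · beta_reduce; rw [if_neg e]; omega
  · have := hρ.sum_le; omega
  · have := hρ.le; omega
  · subst e
    have := hρ.le
    simp only [zero_add] at e1
    simp only [if_true, e1]; omega
  · subst e
    have := hρ.strict s
    simp; omega
  · subst e
    have := hρ.sum_le
    simp; omega

/-! ## Words -/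

/-- The shape after `k` steps, if a box is added to the row `R j` in step `j`. -/
def cnt (R : ℕ → ℕ) (k r : ℕ) : ℕ := Nat.count (fun j => R j = r) k

/-- A sequence of rows that describes an admissible tableau with `n` boxes. -/
def IsWord (h n : ℕ) (R : ℕ → ℕ) : Prop := ∀ k < n, Addable h (cnt R k) (R k)

/-- The content of the box that is added in step `k`. -/
def wordCont (h : ℕ) (R : ℕ → ℕ) (k : ℕ) : ℕ := cont h (cnt R k (R k))

/-- Exchange of two consecutive steps. -/
def swapWord (R : ℕ → ℕ) (k : ℕ) : ℕ → ℕ := R ∘ swap k (k + 1)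

/-- The numbers `a` and `b` do not differ by `1`. -/
def NonAdj (a b : ℕ) : Prop := a ≠ b + 1 ∧ a + 1 ≠ b

theorem NonAdj.symm {a b : ℕ} (h : NonAdj a b) : NonAdj b a := ⟨fun e => h.2 e.symm, fun e => h.1 e.symm⟩

variable {h n : ℕ} {R R' : ℕ → ℕ} {k : ℕ}

theorem cnt_zero (R : ℕ → ℕ) : cnt R 0 = 0 := rfl

theorem cnt_succ (R : ℕ → ℕ) (k : ℕ) : cnt R (k + 1) = addBox (cnt R k) (R k) := funext fun r => by
  unfold cnt addBox
  rw [Nat.count_succ]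
  simp only [eq_comm]

theorem cnt_congr (e : ∀ j < k, R j = R' j) : cnt R k = cnt R' k := by
  induction k with
  | zero => rfl
  | succ k ih => rw [cnt_succ, cnt_succ, ih fun j hj => e j (by omega), e k (by omega)]

theorem IsWord.mono (hR : IsWord h n R) {m : ℕ} (hm : m ≤ n) : IsWord h m R :=
  fun k hk => hR k (by omega)

theorem IsWord.congr (hR : IsWord h n R) (e : ∀ j < n, R j = R' j) : IsWord h n R' := fun k hk => by
  rw [← cnt_congr (k := k) fun j hj => e j (by omega), ← e k hk]
  exact hR k hk

theorem isShape_zero (h : ℕ) : IsShape h 0 := ⟨fun _ => Or.inr rfl, by simp, by simp⟩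

theorem IsWord.isShape (h1 : 1 ≤ h) (hR : IsWord h n R) : IsShape h (cnt R n) := by
  induction n with
  | zero => exact isShape_zero h
  | succ n ih =>
    rw [cnt_succ]
    exact (ih (hR.mono (Nat.le_succ n))).addBox h1 (hR n (Nat.lt_succ_self n))

theorem isWord_succ : IsWord h (n + 1) R ↔ IsWord h n R ∧ Addable h (cnt R n) (R n) :=
  ⟨fun hR => ⟨hR.mono (Nat.le_succ n), hR n (Nat.lt_succ_self n)⟩, fun ⟨h1, h2⟩ k hk => by
    rcases Nat.lt_succ_iff_lt_or_eq.mp hk with e | rfl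
    · exact h1 k e
    · exact h2⟩

theorem swapWord_left (R : ℕ → ℕ) (k : ℕ) : swapWord R k k = R (k + 1) := by simp [swapWord]

theorem swapWord_right (R : ℕ → ℕ) (k : ℕ) : swapWord R k (k + 1) = R k := by simp [swapWord]

theorem swapWord_of_ne (R : ℕ → ℕ) {k j : ℕ} (h1 : j ≠ k) (h2 : j ≠ k + 1) :
    swapWord R k j = R j := by simp [swapWord, swap_apply_of_ne_of_ne h1 h2]

theorem cnt_swapWord_of_le {j : ℕ} (hj : j ≤ k) : cnt (swapWord R k) j = cnt R j :=
  cnt_congr fun i hi => swapWord_of_ne R (by omega) (by omega)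

theorem cnt_swapWord_of_ge {j : ℕ} (hj : k + 2 ≤ j) : cnt (swapWord R k) j = cnt R j := by
  induction j, hj using Nat.le_induction with
  | base =>
    rw [cnt_succ, cnt_succ, cnt_swapWord_of_le le_rfl, swapWord_left, swapWord_right, addBox_comm,
      ← cnt_succ, ← cnt_succ]
  | succ j hj ih => rw [cnt_succ, cnt_succ, ih, swapWord_of_ne R (by omega) (by omega)]

theorem IsWord.addable_swap (h1 : 1 ≤ h) (hR : IsWord h n R) (hk : k + 1 < n)
    (hA : NonAdj (wordCont h R k) (wordCont h R (k + 1))) :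
    R k ≠ R (k + 1) ∧ Addable h (cnt R k) (R (k + 1)) := by
  have h2 := hR k (by omega)
  have h3 := hR (k + 1) hk
  unfold wordCont at hA
  rw [cnt_succ] at h3 hA
  exact h2.of_addBox h1 ((hR.mono (by omega)).isShape h1) h3 hA.1 hA.2

theorem IsWord.swapWord (h1 : 1 ≤ h) (hR : IsWord h n R) (hk : k + 1 < n)
    (hA : NonAdj (wordCont h R k) (wordCont h R (k + 1))) : IsWord h n (swapWord R k) := by
  obtain ⟨hne, h2⟩ := hR.addable_swap h1 hk hA
  intro j hj
  by_cases e1 : j = k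
  · subst e1
    rw [cnt_swapWord_of_le le_rfl, swapWord_left]
    exact h2
  by_cases e2 : j = k + 1
  · subst e2
    rw [cnt_succ, cnt_swapWord_of_le le_rfl, swapWord_left, swapWord_right]
    refine h2.addBox ((hR.mono (by omega)).isShape h1) (hR k (by omega)) hne.symm ?_
    have := hA.1
    unfold wordCont at this
    rw [cnt_succ, addBox_of_ne _ hne.symm] at this
    omega
  · rw [swapWord_of_ne R e1 e2]
    rcases Nat.lt_or_gt_of_ne e1 with e | e
    · rw [cnt_swapWord_of_le (by omega)]; exact hR j hj
    · rw [cnt_swapWord_of_ge (by omega)]; exact hR j hj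

theorem wordCont_swapWord (hne : R k ≠ R (k + 1)) (j : ℕ) :
    wordCont h (HeckeClifford.swapWord R k) j = wordCont h R (swap k (k + 1) j) := by
  unfold wordCont
  by_cases e1 : j = k
  · subst e1
    rw [cnt_swapWord_of_le le_rfl, swapWord_left, swap_apply_left, cnt_succ, addBox_of_ne _ hne.symm]
  by_cases e2 : j = k + 1
  · subst e2
    rw [cnt_succ, cnt_swapWord_of_le le_rfl, swapWord_left, swapWord_right, swap_apply_right,
      addBox_of_ne _ hne]
  · rw [swapWord_of_ne R e1 e2, swap_apply_of_ne_of_ne e1 e2]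
    rcases Nat.lt_or_gt_of_ne e1 with e | e
    · rw [cnt_swapWord_of_le (by omega)]
    · rw [cnt_swapWord_of_ge (by omega)]

/-! ## Existence of words -/

/-- The shape has `m` boxes. -/
def HasSize (ρ : ℕ → ℕ) (m : ℕ) : Prop := ∃ l, (∀ r, l ≤ r → ρ r = 0) ∧ ∑ r ∈ Finset.range l, ρ r = m

theorem HasSize.sum_eq {ρ : ℕ → ℕ} {m : ℕ} (hρ : HasSize ρ m) {l : ℕ} (hl : ∀ r, l ≤ r → ρ r = 0) :
    ∑ r ∈ Finset.range l, ρ r = m := by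
  obtain ⟨l', hl', rfl⟩ := hρ
  have key : ∀ a b, a ≤ b → (∀ r, a ≤ r → ρ r = 0) →
      ∑ r ∈ Finset.range a, ρ r = ∑ r ∈ Finset.range b, ρ r := fun a b hab ha =>
    Finset.sum_subset (Finset.range_mono hab) fun r _ hr => ha r (by simpa using hr)
  rcases le_total l l' with e | e
  · exact key _ _ e hl
  · exact (key _ _ e hl').symm

theorem HasSize.unique {ρ : ℕ → ℕ} {m m' : ℕ} (h : HasSize ρ m) (h' : HasSize ρ m') : m = m' := by
  obtain ⟨l, hl, rfl⟩ := h
  exact h'.sum_eq hl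

theorem HasSize.addBox {ρ : ℕ → ℕ} {m : ℕ} (hρ : HasSize ρ m) (r : ℕ) :
    HasSize (addBox ρ r) (m + 1) := by
  obtain ⟨l, hl, -⟩ := id hρ
  have hl' : ∀ s, max l (r + 1) ≤ s → ρ s = 0 := fun s hs => hl s (by omega)
  refine ⟨max l (r + 1), fun s hs => ?_, ?_⟩
  · rw [addBox_of_ne _ (by omega), hl' s hs]
  · unfold HeckeClifford.addBox
    rw [Finset.sum_add_distrib, hρ.sum_eq hl', Finset.sum_ite_eq' , if_pos (by simp)]

theorem hasSize_cnt (R : ℕ → ℕ) (k : ℕ) : HasSize (cnt R k) k := by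
  induction k with
  | zero => exact ⟨0, fun _ _ => rfl, rfl⟩
  | succ k ih => rw [cnt_succ]; exact ih.addBox _

theorem HasSize.of_addBox {ρ : ℕ → ℕ} {m r : ℕ} (hρ : HasSize (HeckeClifford.addBox ρ r) (m + 1)) :
    HasSize ρ m := by
  obtain ⟨l, hl, -⟩ := id hρ
  have h0 : ∀ s, l ≤ s → ρ s = 0 := fun s hs => by
    have := hl s hs
    unfold HeckeClifford.addBox at this
    omega
  have h1 : HasSize ρ (∑ r ∈ Finset.range l, ρ r) := ⟨l, h0, rfl⟩
  have := (h1.addBox r).unique hρ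
  rw [Nat.succ_injective this] at h1
  exact h1

theorem eq_zero_of_hasSize {ρ : ℕ → ℕ} (hs : HasSize ρ 0) : ρ = 0 := by
  obtain ⟨l, hl, h0⟩ := hs
  funext r
  by_cases e : l ≤ r
  · exact hl r e
  · exact Finset.sum_eq_zero_iff.mp h0 r (Finset.mem_range.mpr (by omega))

/-- The word `R` with the entry `k` replaced by `r`. -/
theorem exists_cnt_update {R : ℕ → ℕ} (k r : ℕ) {ρ : ℕ → ℕ} (hR : IsWord h k R)
    (hρ : cnt R k = ρ) (hr : Addable h ρ r) : IsWord h (k + 1) (Function.update R k r) ∧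
      cnt (Function.update R k r) (k + 1) = addBox ρ r ∧ cnt (Function.update R k r) k = ρ := by
  have e : ∀ j < k, R j = Function.update R k r j := fun j hj => by
    rw [Function.update_of_ne (by omega)]
  have e1 : cnt (Function.update R k r) k = ρ := by rw [← hρ, cnt_congr e]
  refine ⟨isWord_succ.mpr ⟨hR.congr e, ?_⟩, ?_, e1⟩
  · rwa [e1, Function.update_self]
  · rw [cnt_succ, e1, Function.update_self]

/-- The shape is filled row by row: the last box of the last row can always be removed. -/
theorem IsShape.exists_word (h1 : 1 ≤ h) {ρ : ℕ → ℕ} {m : ℕ} (hρ : IsShape h ρ) (hs : HasSize ρ m) :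
    ∃ R, IsWord h m R ∧ cnt R m = ρ := by
  induction m generalizing ρ with
  | zero => exact ⟨0, fun k hk => absurd hk (Nat.not_lt_zero k), (eq_zero_of_hasSize hs).symm⟩
  | succ m ih =>
    obtain ⟨l, hl, -⟩ := id hs
    obtain ⟨r, σ, rfl, hσ, hr, -⟩ := hρ.exists_addBox h1 (fun e => by
      have : ρ = 0 := funext fun s => Nat.le_zero.mp ((hρ.le_of_le (Nat.zero_le s)).trans e.le)
      have h0 := hs.unique (m' := 0) ⟨0, fun r _ => congrFun this r, rfl⟩
      omega) (hl l le_rfl)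
    obtain ⟨R, hR, e⟩ := ih hσ hs.of_addBox
    exact ⟨_, (exists_cnt_update m r hR e hr).1, (exists_cnt_update m r hR e hr).2.1⟩

/-! ## Connectivity -/

/-- An exchange of two consecutive steps among the first `m` whose contents are not adjacent. -/
def Move (h m : ℕ) (R R' : ℕ → ℕ) : Prop :=
  ∃ k, k + 1 < m ∧ NonAdj (wordCont h R k) (wordCont h R (k + 1)) ∧ R' = swapWord R k

theorem IsWord.of_moves (h1 : 1 ≤ h) {m : ℕ} (hm : m ≤ n) (hR : IsWord h n R)
    (hs : Relation.ReflTransGen (Move h m) R R') :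
    IsWord h n R' ∧ cnt R' n = cnt R n ∧ ∀ j, m ≤ j → R' j = R j := by
  induction hs with
  | refl => exact ⟨hR, rfl, fun _ _ => rfl⟩
  | tail _ hs ih =>
    obtain ⟨k, hk, hA, rfl⟩ := hs
    exact ⟨ih.1.swapWord h1 (by omega) hA, (cnt_swapWord_of_ge (by omega)).trans ih.2.1,
      fun j hj => (swapWord_of_ne _ (by omega) (by omega)).trans (ih.2.2 j hj)⟩

/-- Suppose the last steps `r ≠ r'` differ, and let `σ` be the shape without both final boxes. For a
word `W` of `σ`, the words `W r' r` and `W r r'` differ by one exchange of nonadjacent contents.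
They end like `R` and `R'` respectively, so induction links them to these. -/
theorem IsWord.moves (h1 : 1 ≤ h) {m : ℕ} (hR : IsWord h m R) (hR' : IsWord h m R')
    (e : cnt R m = cnt R' m) (hj : ∀ j, m ≤ j → R j = R' j) :
    Relation.ReflTransGen (Move h m) R R' := by
  induction m generalizing R R' with
  | zero => rw [funext fun j => hj j (Nat.zero_le j)]
  | succ m ih =>
    have mono : ∀ {R R'}, Relation.ReflTransGen (Move h m) R R' →
        Relation.ReflTransGen (Move h (m + 1)) R R' :=
      Relation.ReflTransGen.mono (r := Move h m) (p := Move h (m + 1))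
        (fun _ _ ⟨k, hk, hA⟩ => ⟨k, by omega, hA⟩) _ _
    rw [isWord_succ] at hR hR'
    rw [cnt_succ, cnt_succ] at e
    by_cases hr : R m = R' m
    · rw [hr] at e
      refine mono (ih hR.1 hR'.1 (addBox_injective e) fun j hjm => ?_)
      rcases Nat.eq_or_lt_of_le hjm with rfl | hjm
      · exact hr
      · exact hj j hjm
    · cases m with
      | zero =>
        exfalso
        have e1 : ∀ r, Addable h 0 r → r = 0 := fun r hr => by
          by_contra h0
          obtain ⟨s, rfl⟩ := Nat.exists_eq_succ_of_ne_zero h0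
          have := hr.pos s rfl
          simp at this
        exact hr ((e1 _ hR.2).trans (e1 _ hR'.2).symm)
      | succ m =>
        have hσ : ∃ σ, cnt R (m + 1) = addBox σ (R' (m + 1)) ∧ cnt R' (m + 1) = addBox σ (R (m + 1)) := by
          refine ⟨fun s => cnt R (m + 1) s - if s = R' (m + 1) then 1 else 0, funext fun s => ?_,
            funext fun s => ?_⟩
          all_goals
            have := congrFun e s
            unfold addBox at this ⊢
            by_cases a1 : s = R' (m + 1)
            · have a2 : s ≠ R (m + 1) := fun h => hr (h.symm.trans a1)
              simp only [if_pos a1, if_neg a2] at this ⊢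
              omega
            · simp only [if_neg a1] at this ⊢
              omega
        obtain ⟨σ, hσ1, hσ2⟩ := hσ
        set r := R (m + 1)
        set r' := R' (m + 1)
        have s1 := hR.1.isShape h1
        have s2 := hR'.1.isShape h1
        have z1 := hasSize_cnt R (m + 1)
        have a1 := hR.2
        have a2 := hR'.2
        rw [hσ1] at s1 z1 a1
        rw [hσ2] at s2 a2
        have s3 : IsShape h σ := s1.of_addBox h1 (Ne.symm hr) s2
        obtain ⟨W, hW, eW⟩ := s3.exists_word h1 z1.of_addBox
        have b1 := a1.of_addBox_addBox hr s2
        have b2 := a2.of_addBox_addBox (Ne.symm hr) s1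
        have hA : NonAdj (cont h (σ r)) (cont h (σ r')) := by
          rcases lt_or_gt_of_ne hr with hlt | hlt
          · exact Addable.cont_diamond hlt s2 s3 s1 a2 a1
          · exact NonAdj.symm (Addable.cont_diamond hlt s1 s3 s2 a1 a2)
        obtain ⟨w1, w2, w3⟩ := exists_cnt_update m r' hW eW b2
        -- The word `W r' r`, continued as `R` beyond the relevant range so that moves can be
        -- compared as functions on all of `ℕ`.
        let Z : ℕ → ℕ := fun j => if j < m then W j else if j = m then r' else R j
        have hZ1 : Z m = r' := by simp [Z]
        have hZ2 : ∀ j, m + 1 ≤ j → Z j = R j := fun j hj => by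
          have u1 : ¬ j < m := by omega
          have u2 : j ≠ m := by omega
          simp [Z, u1, u2]
        have hZW : ∀ j < m + 1, Function.update W m r' j = Z j := fun j hj => by
          by_cases u : j = m
          · subst u; rw [Function.update_self, hZ1]
          · rw [Function.update_of_ne u]
            have : j < m := by omega
            simp [Z, this]
        have hZword : IsWord h (m + 1) Z := w1.congr hZW
        have hZcnt : cnt Z (m + 1) = addBox σ r' := by rw [← cnt_congr hZW, w2]
        have hZcnt' : cnt Z m = σ := by
          rw [← cnt_congr fun j hj => hZW j (by omega), w3]
        have step1 := mono (ih hR.1 hZword (by rw [hZcnt, hσ1]) fun j hj => (hZ2 j hj).symm)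
        have hc1 : wordCont h Z m = cont h (σ r') := by rw [wordCont, hZcnt', hZ1]
        have hc2 : wordCont h Z (m + 1) = cont h (σ r) := by
          rw [wordCont, hZcnt, hZ2 _ le_rfl]
          change cont h (addBox σ r' r) = _
          rw [addBox_of_ne _ hr]
        have step2 : Move h (m + 1 + 1) Z (HeckeClifford.swapWord Z m) :=
          ⟨m, by omega, by rw [hc1, hc2]; exact hA.symm, rfl⟩
        have hZword' : IsWord h (m + 1 + 1) Z := by
          refine isWord_succ.mpr ⟨hZword, ?_⟩
          rw [hZcnt, hZ2 _ le_rfl]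
          exact a1
        have hS : IsWord h (m + 1 + 1) (HeckeClifford.swapWord Z m) :=
          hZword'.swapWord h1 (by omega) (by rw [hc1, hc2]; exact hA.symm)
        have step3 := mono (ih (isWord_succ.mp hS).1 hR'.1 (by
          rw [cnt_succ, cnt_swapWord_of_le le_rfl, hZcnt', swapWord_left, hZ2 _ le_rfl, hσ2])
          fun j hjm => by
            by_cases u : j = m + 1
            · subst u; rw [swapWord_right, hZ1]
            · rw [swapWord_of_ne _ (by omega) u, hZ2 j hjm]
              exact hj j (by omega))
        exact (step1.tail step2).trans step3

/-- By induction the shapes before a step agree, and the content of an addable box determines its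
row. -/
theorem IsWord.eq_of_wordCont (h1 : 1 ≤ h) (hR : IsWord h n R) (hR' : IsWord h n R')
    (e : ∀ j < n, wordCont h R j = wordCont h R' j) : ∀ j < n, R j = R' j := by
  intro j
  induction j using Nat.strong_induction_on with
  | _ j ih =>
    intro hj
    have h2 : cnt R j = cnt R' j := cnt_congr fun i hi => ih i hi (by omega)
    have h3 := e j hj
    have h4 := hR' j hj
    unfold wordCont at h3
    rw [← h2] at h3 h4
    exact (hR j hj).eq_of_cont ((hR.mono hj.le).isShape h1) h4 h3

/-! ## Extending a shape by a box of given content -/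

section extend

variable {h : ℕ} {ρ σ : ℕ → ℕ}

theorem IsShape.exists_sub (hσ : IsShape h σ) {r : ℕ} (h0 : σ r ≠ 0)
    (h1 : σ (r + 1) + 1 < σ r ∨ σ (r + 1) = 0) :
    ∃ τ, HeckeClifford.addBox τ r = σ ∧ IsShape h τ ∧ τ r + 1 = σ r ∧ ∀ s, s ≠ r → τ s = σ s := by
  refine ⟨fun s => σ s - if s = r then 1 else 0, funext fun s => ?_, ⟨fun s => ?_, ?_, ?_⟩, ?_,
    fun s hs => ?_⟩
  · unfold HeckeClifford.addBox
    by_cases e : s = r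
    · subst e; simp only [if_true]; omega
    · simp [e]
  · have := hσ.strict s
    by_cases e : s = r
    · subst e; simp only [if_true]; omega
    · simp only [if_neg e]; omega
  · have := hσ.sum_le; omega
  · have := hσ.le; omega
  · simp only [if_true]; omega
  · simp [hs]

/-- If the content `c` is adjacent to that of the last box of the last row and does not violate the
conditions on triples, then a box of content `c` can be added. -/
theorem exists_addable (h1 : 1 ≤ h) (hσ : IsShape h σ) {l : ℕ} (hl : Addable h σ l)
    (h0 : σ (l + 1) = 0) {c : ℕ} (hc : c ≤ h) (hadj : ¬ NonAdj c (cont h (σ l)))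
    (ht : ∀ τ r, IsShape h τ → Addable h τ r → addBox τ r = σ → cont h (τ r) = c →
      c = 0 ∨ c + 1 = h ∧ cont h (σ l) = h) :
    ∃ r, Addable h (addBox σ l) r ∧ cont h (addBox σ l r) = c := by
  have hadj' : c = cont h (σ l) + 1 ∨ c + 1 = cont h (σ l) := by
    by_contra hn
    exact hadj ⟨fun e => hn (Or.inl e), fun e => hn (Or.inr e)⟩
  have hlt := hl.lt h1 hσ
  have hρ := hσ.addBox h1 hl
  have hnext : addBox σ l (l + 1) = 0 := by rw [addBox_of_ne _ (by omega), h0]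
  -- Content `0` is realized by opening the row `l + 1`.
  have new : 1 < addBox σ l l → (l = 0 → addBox σ l l ≤ 2 * h) → c = 0 →
      ∃ r, Addable h (addBox σ l) r ∧ cont h (addBox σ l r) = c := fun a1 a2 a3 => by
    refine ⟨l + 1, ⟨fun e => absurd e (by omega), fun s e => ?_, fun e => ?_⟩, ?_⟩
    · rw [← Nat.succ_injective e, hnext]; exact a1
    · have e0 : l = 0 := by omega
      subst e0
      rw [show addBox σ 0 1 = 0 from hnext]
      exact a2 rfl
    · rw [hnext, a3]; simp [cont]
  rw [addBox_self] at new
  -- A box beyond the fold lies in the first row, which is then the only row.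
  by_cases hd : h < σ l
  · have e0 : l = 0 := by
      by_contra e
      have := hl.le_of_pos hσ e
      omega
    subst e0
    have hcd : cont h (σ 0) = 2 * h - σ 0 := if_neg (by omega)
    rw [hcd] at hadj' ht
    simp only [zero_add] at h0
    rcases hadj' with e | e
    -- The preceding box of the row has content `c`, so the triple `(c, c - 1, c)` would arise
    -- beyond the fold, which `ht` forbids.
    · obtain ⟨τ, hτ, hτs, e2, e3⟩ := hσ.exists_sub (r := 0) (by omega) (Or.inr h0)
      have := ht τ 0 hτs ⟨fun _ => Or.inr (by rw [e3 1 (by omega), h0]; omega),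
        fun s e => absurd e (by omega), fun e => absurd e (by omega)⟩ hτ (by
          unfold cont; split_ifs <;> omega)
      omega
    · by_cases c0 : c = 0
      · exact new (by omega) (by omega) c0
      · refine ⟨0, ⟨fun _ => Or.inr ?_, fun s e => absurd e (by omega),
          fun e => absurd e (by omega)⟩, ?_⟩
        · rw [show addBox σ 0 1 = 0 from hnext, addBox_self]; omega
        · rw [addBox_self]; unfold cont; split_ifs <;> omega
  · have hcd : cont h (σ l) = σ l := if_pos (by omega)
    rw [hcd] at hadj' ht
    rcases hadj' with e | e
    · by_cases hadd : Addable h (addBox σ l) l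
      · exact ⟨l, hadd, by rw [addBox_self]; unfold cont; split_ifs <;> omega⟩
      exfalso
      cases l with
      | zero =>
        refine hadd ⟨fun _ => Or.inl (by rw [addBox_self]; omega), fun s e => absurd e (by omega),
          fun e => absurd e (by omega)⟩
      | succ s =>
        -- Row `l` cannot be extended for one of two reasons: the row above is too short, or `l = 1`
        -- and the bound on the first two rows is reached. In both cases the last box of the row
        -- above has content `c` and could have been added just before, against `ht`.
        have hp := hl.pos s rfl
        by_cases e1 : σ s = σ (s + 1) + 2
        · obtain ⟨τ, hτ, hτs, e2, e3⟩ := hσ.exists_sub (r := s) (by omega) (Or.inl (by omega))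
          have := ht τ s hτs ⟨fun e => Or.inl (by subst e; omega), fun t e => ?_, fun e => ?_⟩ hτ (by
            unfold cont; split_ifs <;> omega)
          · omega
          · have := hσ.strict t
            rw [← e] at this
            rw [e3 t (by omega)]; omega
          · have := hσ.sum_le
            rw [e3 0 (by omega)]
            subst e
            omega
        · have e0 : s = 0 ∧ 2 * h < σ 0 + (σ 1 + 1) := by
            by_contra hn
            refine hadd ⟨fun e => absurd e (by omega), fun t e => ?_, fun e => ?_⟩
            · have : t = s := by omega
              subst this
              rw [addBox_self, addBox_of_ne _ (by omega)]; omega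
            · have : s = 0 := by omega
              subst this
              rw [addBox_of_ne _ (by omega), addBox_self]
              exact not_lt.mp fun h => hn ⟨rfl, h⟩
          obtain ⟨rfl, e0⟩ := e0
          have hs := hρ.sum_le
          rw [addBox_of_ne _ (by omega), addBox_self] at hs
          simp only [zero_add] at *
          obtain ⟨τ, hτ, hτs, e2, e3⟩ := hσ.exists_sub (r := 0) (by omega) (Or.inl (by
            simp only [zero_add]; omega))
          have := ht τ 0 hτs ⟨fun _ => Or.inr (by rw [e3 1 (by omega)]; omega),
            fun s e => absurd e (by omega), fun e => absurd e (by omega)⟩ hτ (by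
              unfold cont; split_ifs <;> omega)
          omega
    · by_cases c0 : c = 0
      · exact new (by omega) (by omega) c0
      -- The preceding box of row `l` has content `c`, so `ht` leaves only `(h - 1, h, h - 1)`. Then
      -- `l = 0`, and the row is continued across the fold.
      · obtain ⟨τ, hτ, hτs, e2, e3⟩ := hσ.exists_sub (r := l) (by omega) (Or.inr h0)
        have := ht τ l hτs ⟨fun e => Or.inl (by subst e; omega), fun t e => ?_, fun e => ?_⟩ hτ (by
            unfold cont; split_ifs <;> omega)
        · have e0 : l = 0 := by
            by_contra e
            have := hl.le_of_pos hσ e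
            omega
          subst e0
          have hle : σ 0 + 1 + 0 < 2 * h := by clear new ht hnext; omega
          refine ⟨0, ⟨fun _ => Or.inr ?_, fun s e => absurd e (by omega),
            fun e => absurd e (by omega)⟩, ?_⟩
          · rw [show addBox σ 0 1 = 0 from hnext, addBox_self]; exact hle
          · rw [addBox_self]; unfold cont; split_ifs <;> omega
        · have := hl.pos t e
          rw [e3 t (by omega)]; omega
        · have := hl.one e
          subst e
          rw [e3 0 (by omega)]; omega

end extend

/-! ## The values `q(i)` -/

section arith

variable {F : Type u} [Field F] {h : ℕ} [CharP F (2 * h + 1)]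

theorem cast_ne_zero_of_lt (F : Type u) [Field F] {h : ℕ} [CharP F (2 * h + 1)] {m : ℕ}
    (h0 : m ≠ 0) (hm : m < 2 * h + 1) : (m : F) ≠ 0 := fun e =>
  absurd (Nat.le_of_dvd (Nat.pos_of_ne_zero h0) ((CharP.cast_eq_zero_iff F (2 * h + 1) m).mp e))
    (by omega)

theorem cast_char (F : Type u) [Field F] (h : ℕ) [CharP F (2 * h + 1)] : (2 * (h : F) + 1) = 0 := by
  have := CharP.cast_eq_zero F (2 * h + 1)
  push_cast at this
  exact this

theorem two_ne_zero_of_char (F : Type u) [Field F] (h : ℕ) [CharP F (2 * h + 1)] : (2 : F) ≠ 0 := fun e => by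
  have := cast_char F h
  rw [e, zero_mul, zero_add] at this
  exact one_ne_zero this

theorem q_zero : q F 0 = 0 := by simp [q]

theorem q_eq_q (F : Type u) [Field F] {h : ℕ} [CharP F (2 * h + 1)] {x y : ℕ} (hx : x ≤ h)
    (hy : y ≤ h) (e : q F x = q F y) : x = y := by
  wlog hxy : y < x generalizing x y
  · rcases lt_trichotomy x y with h | h | h
    · exact (this hy hx e.symm h).symm
    · exact h
    · exact absurd h hxy
  exfalso
  obtain ⟨d, rfl⟩ := Nat.exists_eq_add_of_lt hxy
  have h2 : ((d + 1 : ℕ) : F) * ((2 * y + d + 2 : ℕ) : F) = 0 := by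
    unfold q at e
    push_cast at e ⊢
    linear_combination e
  rcases mul_eq_zero.mp h2 with h3 | h3
  · exact cast_ne_zero_of_lt F (h := h) (by omega) (by omega) h3
  · exact cast_ne_zero_of_lt F (h := h) (by omega) (by omega) h3

theorem q_eq_zero (F : Type u) [Field F] {h : ℕ} [CharP F (2 * h + 1)] {x : ℕ} (hx : x ≤ h)
    (e : q F x = 0) : x = 0 := q_eq_q F hx (Nat.zero_le h) (e.trans q_zero.symm)

/-- The relation of the scalars for adjacent entries. -/
theorem q_adj_iff (F : Type u) [Field F] {h : ℕ} [CharP F (2 * h + 1)] {x y : ℕ} (hx : x ≤ h)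
    (hy : y ≤ h) (hne : x ≠ y) :
    2 * (q F x + q F y) = (q F x - q F y) ^ 2 ↔ ¬ NonAdj x y := by
  wlog hxy : y < x generalizing x y
  · have h1 : NonAdj x y ↔ NonAdj y x := ⟨NonAdj.symm, NonAdj.symm⟩
    rw [h1, ← this hy hx hne.symm (by omega), add_comm (q F x), ← neg_sub (q F y), neg_sq]
  obtain ⟨d, rfl⟩ := Nat.exists_eq_add_of_lt hxy
  -- The difference equals `((x - y)² - 1)((x + y + 1)² - 1)`, here with `x = y + d + 1`.
  have key : (q F (y + d + 1) - q F y) ^ 2 - 2 * (q F (y + d + 1) + q F y) =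
      (d : F) * ((d + 2 : ℕ) : F) * (((2 * y + d + 1 : ℕ) : F) * ((2 * y + d + 3 : ℕ) : F)) := by
    unfold q; push_cast; ring
  rw [eq_comm, ← sub_eq_zero, key]
  constructor
  · intro e hA
    have d0 : d ≠ 0 := fun h => hA.1 (by omega)
    have n1 := cast_ne_zero_of_lt F (h := h) (m := d) d0 (by omega)
    have n2 := cast_ne_zero_of_lt F (h := h) (m := d + 2) (by omega) (by omega)
    have n3 := cast_ne_zero_of_lt F (h := h) (m := 2 * y + d + 1) (by omega) (by omega)
    by_cases h4 : 2 * y + d + 3 < 2 * h + 1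
    · have n4 := cast_ne_zero_of_lt F (h := h) (m := 2 * y + d + 3) (by omega) (by omega)
      exact mul_ne_zero (mul_ne_zero n1 n2) (mul_ne_zero n3 n4) e
    · have h5 : 2 * y + d + 3 = 2 * h + 2 := by omega
      rw [h5] at e
      have n4 : ((2 * h + 2 : ℕ) : F) ≠ 0 := by
        have := cast_char F h
        push_cast
        rw [show 2 * (h : F) + 2 = (2 * h + 1) + 1 by ring, this, zero_add]
        exact one_ne_zero
      exact mul_ne_zero (mul_ne_zero n1 n2) (mul_ne_zero n3 n4) e
  · intro hA
    by_cases d0 : d = 0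
    · rw [d0]; simp
    · exact absurd ⟨by omega, by omega⟩ hA

/-- The symmetry `q(i) = q(-1 - i)` is a reflection at `-1/2`, which is `h` modulo `p`. This is why
contents turn back at `h`. -/
theorem q_fold (F : Type u) [Field F] (h : ℕ) [CharP F (2 * h + 1)] (h1 : 1 ≤ h) :
    q F (h + 1) = q F (h - 1) := by
  obtain ⟨k, rfl⟩ := Nat.exists_eq_add_of_le' h1
  have := cast_char F (k + 1)
  rw [Nat.add_sub_cancel]
  unfold q
  push_cast at this ⊢
  linear_combination 2 * this

theorem q_top (F : Type u) [Field F] (h : ℕ) [CharP F (2 * h + 1)] (h1 : 1 ≤ h) :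
    2 * q F (h - 1) + 6 * q F h = 0 := by
  obtain ⟨k, rfl⟩ := Nat.exists_eq_add_of_le' h1
  have := cast_char F (k + 1)
  rw [Nat.add_sub_cancel]
  unfold q
  push_cast at this ⊢
  linear_combination 4 * ((k : F) + 1) * this

/-- A solution of the relation for adjacent entries. -/
theorem exists_eq_q (F : Type u) [Field F] {h : ℕ} [CharP F (2 * h + 1)] (h1 : 1 ≤ h) {y : ℕ}
    (hy : y ≤ h) {a : F} (hne : a ≠ q F y) (e : 2 * (a + q F y) = (a - q F y) ^ 2) :
    ∃ c ≤ h, a = q F c ∧ ¬ NonAdj c y := by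
  -- The equation is quadratic in `a` with roots `q(y + 1)` and `q(y - 1)`. For `y = h` the first
  -- root folds back to `q(h - 1)`; for `y = 0` the second is `q(0)`, excluded by `hne`.
  have key : (a - q F (y + 1)) * (a - ((y : F) - 1) * y) = 0 := by
    unfold q at *
    push_cast
    linear_combination -e
  rcases mul_eq_zero.mp key with h2 | h2
  · rw [sub_eq_zero] at h2
    by_cases h3 : y = h
    · exact ⟨h - 1, by omega, by rw [h2, h3, q_fold F h h1], fun hA => hA.2 (by omega)⟩
    · exact ⟨y + 1, by omega, h2, fun hA => hA.1 rfl⟩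
  · rw [sub_eq_zero] at h2
    cases y with
    | zero => exact absurd (h2.trans (by simp [q])) hne
    | succ y =>
      refine ⟨y, by omega, ?_, fun hA => hA.2 rfl⟩
      rw [h2]; unfold q; push_cast; ring

/-- The expression is `4(y + 1)(2y + 1)` for `x = y + 1` and `4(x + 1)(2x + 3)` for `y = x + 1`. In
this range `p` divides it only when `2x + 3 = p`. -/
theorem q_triple (F : Type u) [Field F] {h : ℕ} [CharP F (2 * h + 1)] {x y : ℕ} (hx : x ≤ h)
    (hy : y ≤ h) (hadj : ¬ NonAdj x y) (e : 2 * q F x + 6 * q F y = 0) :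
    x = 0 ∨ x + 1 = h ∧ y = h := by
  have h2 := two_ne_zero_of_char F h
  by_cases h1 : x = y + 1
  · subst h1
    exfalso
    have h3 : (2 : F) * (((2 : ℕ) : F) * (((y + 1 : ℕ) : F) * ((2 * y + 1 : ℕ) : F))) = 0 := by
      rw [← e]; unfold q; push_cast; ring
    have n0 : ((2 : ℕ) : F) ≠ 0 := by exact_mod_cast h2
    have n1 := cast_ne_zero_of_lt F (h := h) (m := y + 1) (by omega) (by omega)
    have n2 := cast_ne_zero_of_lt F (h := h) (m := 2 * y + 1) (by omega) (by omega)
    exact mul_ne_zero h2 (mul_ne_zero n0 (mul_ne_zero n1 n2)) h3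
  · by_cases h3 : x + 1 = y
    · subst h3
      by_cases h4 : x + 1 = h
      · exact Or.inr ⟨h4, h4⟩
      exfalso
      have h3 : (2 : F) * (((2 : ℕ) : F) * (((x + 1 : ℕ) : F) * ((2 * x + 3 : ℕ) : F))) = 0 := by
        rw [← e]; unfold q; push_cast; ring
      have n0 : ((2 : ℕ) : F) ≠ 0 := by exact_mod_cast h2
      have n1 := cast_ne_zero_of_lt F (h := h) (m := x + 1) (by omega) (by omega)
      have n2 := cast_ne_zero_of_lt F (h := h) (m := 2 * x + 3) (by omega) (by omega)
      exact mul_ne_zero h2 (mul_ne_zero n0 (mul_ne_zero n1 n2)) h3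
    · exact absurd ⟨h1, h3⟩ hadj

end arith

/-! ## Weights are content sequences -/

section classification

variable {F : Type u} [Field F] {h n : ℕ} [CharP F (2 * h + 1)] {S : Set (Fin n → F)}

/-- The first `m` entries of `χ` are given by the contents of the word `R`. -/
def Matches (h m : ℕ) (R : ℕ → ℕ) (χ : Fin n → F) : Prop :=
  ∀ j, j < m → ∀ hj : j < n, χ ⟨j, hj⟩ = q F (wordCont h R j)

theorem IsWord.wordCont_le (h1 : 1 ≤ h) {m : ℕ} {R : ℕ → ℕ} (hR : IsWord h m R) {j : ℕ} (hj : j < m) :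
    wordCont h R j ≤ h :=
  cont_le_of_lt ((hR j hj).lt h1 ((hR.mono hj.le).isShape h1))

theorem wordCont_congr {R R' : ℕ → ℕ} {m : ℕ} (e : ∀ j < m, R j = R' j) {j : ℕ} (hj : j < m) :
    wordCont h R j = wordCont h R' j := by
  unfold wordCont
  rw [cnt_congr fun i hi => e i (by omega), e j hj]

theorem WeightClosed.exists_of_move (hS : WeightClosed S) (h1 : 1 ≤ h) {m : ℕ} (hm : m ≤ n)
    {R R' : ℕ → ℕ} (hR : IsWord h m R) (hmove : Move h m R R') {χ : Fin n → F} (hχ : χ ∈ S)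
    (hM : Matches h m R χ) :
    ∃ χ' ∈ S, Matches h m R' χ' ∧ ∀ j (hj : j < n), m ≤ j → χ' ⟨j, hj⟩ = χ ⟨j, hj⟩ := by
  obtain ⟨k, hk, hA, rfl⟩ := hmove
  have hkn : k + 1 < n := by omega
  have e0 := hM k (by omega) (by omega)
  have e1 := hM (k + 1) hk hkn
  have hne := hS.ne χ hχ k hkn
  rw [e0, e1] at hne
  have hne' : wordCont h R k ≠ wordCont h R (k + 1) := fun e => hne (by rw [e])
  refine ⟨χ ∘ simple k hkn, hS.swap χ hχ k hkn fun e => ?_, fun j hj hjn => ?_, fun j hj hmj => ?_⟩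
  · rw [e0, e1] at e
    exact (q_adj_iff F (hR.wordCont_le h1 (by omega)) (hR.wordCont_le h1 hk) hne').mp e hA
  · rw [wordCont_swapWord (hR.addable_swap h1 hk hA).1, Function.comp_apply]
    by_cases a1 : j = k
    · subst a1; rw [simple_left, swap_apply_left]; exact e1
    by_cases a2 : j = k + 1
    · subst a2; rw [simple_right, swap_apply_right]; exact e0
    · rw [simple_of_ne k hkn _ a1 a2, swap_apply_of_ne_of_ne a1 a2]
      exact hM j hj hjn
  · rw [Function.comp_apply, simple_of_ne k hkn _ (by simp only; omega) (by simp only; omega)]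

/-- Words of one shape are linked by moves, and each move is an exchange under which the set of
weights is closed. An initial segment can thus be rearranged at will without touching the later
entries. -/
theorem WeightClosed.exists_of_cnt_eq (hS : WeightClosed S) (h1 : 1 ≤ h) {m : ℕ} (hm : m ≤ n)
    {R R' : ℕ → ℕ} (hR : IsWord h m R) (hR' : IsWord h m R') (e : cnt R m = cnt R' m)
    {χ : Fin n → F} (hχ : χ ∈ S) (hM : Matches h m R χ) :
    ∃ χ' ∈ S, Matches h m R' χ' ∧ ∀ j (hj : j < n), m ≤ j → χ' ⟨j, hj⟩ = χ ⟨j, hj⟩ := by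
  let Z : ℕ → ℕ := fun j => if j < m then R' j else R j
  have hZ : ∀ j < m, R' j = Z j := fun j hj => by simp [Z, hj]
  have hZ' : ∀ j, m ≤ j → R j = Z j := fun j hj => by simp [Z, Nat.not_lt.mpr hj]
  have hmoves := hR.moves h1 (hR'.congr hZ) (by rw [e, cnt_congr hZ]) hZ'
  have key : ∀ W, Relation.ReflTransGen (Move h m) R W → ∃ χ' ∈ S, Matches h m W χ' ∧
      ∀ j (hj : j < n), m ≤ j → χ' ⟨j, hj⟩ = χ ⟨j, hj⟩ := by
    intro W hW
    induction hW with
    | refl => exact ⟨χ, hχ, hM, fun _ _ _ => rfl⟩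
    | tail hs hmove ih =>
      obtain ⟨χ', hχ', hM', e'⟩ := ih
      obtain ⟨χ'', hχ'', hM'', e''⟩ :=
        hS.exists_of_move h1 hm (hR.of_moves h1 le_rfl hs).1 hmove hχ' hM'
      exact ⟨χ'', hχ'', hM'', fun j hj hmj => (e'' j hj hmj).trans (e' j hj hmj)⟩
  obtain ⟨χ', hχ', hM', e'⟩ := key Z hmoves
  exact ⟨χ', hχ', fun j hj hjn => by rw [wordCont_congr hZ hj]; exact hM' j hj hjn, e'⟩

/-- The initial segment is rearranged so that its last box is the end of the last row. The next
entry is either adjacent to the content of that box, and the triple condition applies, or it can be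
exchanged with it, and the induction hypothesis applies to the exchanged weight. -/
theorem WeightClosed.exists_addable (hS : WeightClosed S) (h1 : 1 ≤ h) {m : ℕ} (hm : m < n)
    (ih : ∀ χ ∈ S, ∃ R, IsWord h m R ∧ Matches h m R χ) {χ : Fin n → F} (hχ : χ ∈ S)
    {R : ℕ → ℕ} (hR : IsWord h m R) (hM : Matches h m R χ) :
    ∃ r, Addable h (cnt R m) r ∧ χ ⟨m, hm⟩ = q F (cont h (cnt R m r)) := by
  cases m with
  | zero =>
    refine ⟨0, ⟨fun _ => Or.inl (Nat.zero_le _), fun s e => absurd e (by omega),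
      fun e => absurd e (by omega)⟩, ?_⟩
    rw [hS.zero χ hχ hm]
    simp [cnt_zero, cont, q]
  | succ m =>
    have hsize := hasSize_cnt R (m + 1)
    have hshape := hR.isShape h1
    obtain ⟨L, hL, -⟩ := id hsize
    obtain ⟨l, σ, e, hσ, hl, hl0⟩ := hshape.exists_addBox h1 (fun e => by
      have : cnt R (m + 1) = 0 := funext fun s =>
        Nat.le_zero.mp ((hshape.le_of_le (Nat.zero_le s)).trans e.le)
      have h0 := hsize.unique (m' := 0) ⟨0, fun r _ => congrFun this r, rfl⟩
      omega) (hL L le_rfl)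
    rw [e] at hsize hl0 ⊢
    rw [addBox_of_ne _ (by omega)] at hl0
    have hσsize := hsize.of_addBox
    obtain ⟨W, hW, eW⟩ := hσ.exists_word h1 hσsize
    obtain ⟨w1, w2, w3⟩ := exists_cnt_update m l hW eW hl
    obtain ⟨χ', hχ', hM', e'⟩ := hS.exists_of_cnt_eq h1 hm.le hR w1 (by rw [w2, e]) hχ hM
    have ea : χ' ⟨m + 1, hm⟩ = χ ⟨m + 1, hm⟩ := e' _ _ le_rfl
    have eb : χ' ⟨m, by omega⟩ = q F (cont h (σ l)) := by
      rw [hM' m (by omega) (by omega), wordCont, w3, Function.update_self]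
    rw [← ea]
    have hne := hS.ne χ' hχ' m hm
    rw [eb] at hne
    have hcb : cont h (σ l) ≤ h := cont_le_of_lt (hl.lt h1 hσ)
    by_cases hq : 2 * (q F (cont h (σ l)) + χ' ⟨m + 1, hm⟩) = (q F (cont h (σ l)) - χ' ⟨m + 1, hm⟩) ^ 2
    · obtain ⟨c, hc, ec, hadj⟩ := exists_eq_q F h1 hcb hne.symm (by
        rw [add_comm, hq, ← neg_sub, neg_sq])
      -- If a box of content `c` can be removed from `σ`, the segment is rearranged once more so
      -- that this box comes directly before the last one. The weight then contains the triple `(c,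
      -- b, c)`, which is restricted by `triple`.
      obtain ⟨r, hr, er⟩ := HeckeClifford.exists_addable h1 hσ hl hl0 hc hadj fun τ r hτ hr eτ ecr => by
        cases m with
        | zero =>
          exfalso
          have : σ = 0 := eq_zero_of_hasSize hσsize
          have h3 := congrFun eτ r
          rw [addBox_self, this] at h3
          simp at h3
        | succ m =>
          rw [← eτ] at hσsize hl
          obtain ⟨V, hV, eV⟩ := hτ.exists_word h1 hσsize.of_addBox
          obtain ⟨v1, v2, v3⟩ := exists_cnt_update m r hV eV hr
          obtain ⟨u1, u2, u3⟩ := exists_cnt_update (m + 1) l v1 v2 hl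
          obtain ⟨ψ, hψ, hMψ, eψ⟩ := hS.exists_of_cnt_eq h1 hm.le hR u1 (by rw [u2, e, eτ]) hχ hM
          have f2 : ψ ⟨m + 2, hm⟩ = q F c := by rw [eψ _ _ le_rfl, ← ea, ec]
          have f1 : ψ ⟨m + 1, by omega⟩ = q F (cont h (σ l)) := by
            rw [hMψ (m + 1) (by omega) (by omega), wordCont, u3, Function.update_self, eτ]
          have f0 : ψ ⟨m, by omega⟩ = q F c := by
            rw [hMψ m (by omega) (by omega), wordCont, Function.update_of_ne (by omega),
              Function.update_self, ← ecr,
              cnt_congr (R' := Function.update V m r) fun j hj => Function.update_of_ne (by omega) _ _,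
              v3]
          have h3 := hS.triple ψ hψ m hm (f2.trans f0.symm) (by
            rw [f0, f1, ← ec, add_comm, hq, ← neg_sub, neg_sq])
          rw [f0, f1] at h3
          rcases h3 with h3 | h3
          · exact Or.inl (q_eq_zero F hc h3)
          · exact q_triple F hc hcb hadj h3
      exact ⟨r, hr, by rw [er, ec]⟩
    -- After the exchange the new entry comes directly after the shape `σ`, so it is the content of
    -- a box addable to `σ`. Being nonadjacent, that box is also addable after the box in row `l`.
    · obtain ⟨R'', hR'', hM''⟩ := ih _ (hS.swap χ' hχ' m hm (by rw [eb]; exact hq))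
      have hZ : ∀ j < m, R'' j = Function.update W m l j := by
        refine (hR''.mono (Nat.le_succ m)).eq_of_wordCont h1 (w1.mono (Nat.le_succ m)) fun j hj => ?_
        have a1 := hM'' j (by omega) (by omega)
        rw [Function.comp_apply, simple_of_ne m hm _ (by simp only; omega) (by simp only; omega),
          hM' j (by omega) (by omega)] at a1
        exact (q_eq_q F (w1.wordCont_le h1 (by omega)) (hR''.wordCont_le h1 (by omega)) a1).symm
      have a1 := hM'' m (by omega) (by omega)
      have a2 := hR'' m (by omega)
      rw [Function.comp_apply, simple_left, wordCont, cnt_congr hZ, w3] at a1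
      rw [cnt_congr hZ, w3] at a2
      rw [a1] at hne hq ⊢
      have hne' : l ≠ R'' m := fun e => hne (by rw [e])
      have hcr : cont h (σ (R'' m)) ≤ h := cont_le_of_lt (a2.lt h1 hσ)
      have hA := not_not.mp (mt (q_adj_iff F hcb hcr fun e => hne (by rw [e])).mpr hq)
      refine ⟨R'' m, hl.addBox hσ a2 hne' hA.2, ?_⟩
      rw [addBox_of_ne _ hne'.symm]

/-- Every weight is the sequence of contents of a word. -/
theorem WeightClosed.exists_word (hS : WeightClosed S) (h1 : 1 ≤ h) {m : ℕ} (hm : m ≤ n) :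
    ∀ χ ∈ S, ∃ R, IsWord h m R ∧ Matches h m R χ := by
  induction m with
  | zero => exact fun χ _ => ⟨0, fun k hk => absurd hk (Nat.not_lt_zero k), fun j hj =>
      absurd hj (Nat.not_lt_zero j)⟩
  | succ m ih =>
    intro χ hχ
    obtain ⟨R, hR, hM⟩ := ih (by omega) χ hχ
    obtain ⟨r, hr, er⟩ := hS.exists_addable h1 hm (ih (by omega)) hχ hR hM
    obtain ⟨w1, w2, w3⟩ := exists_cnt_update m r hR rfl hr
    refine ⟨_, w1, fun j hj hjn => ?_⟩
    rcases Nat.lt_succ_iff_lt_or_eq.mp hj with hj | rfl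
    · rw [hM j hj hjn]
      exact congrArg _ (wordCont_congr (m := m) (fun i hi => by
        rw [Function.update_of_ne (by omega)]) hj)
    · rw [er, wordCont, w3, Function.update_self]

end classification

/-! ## Words and the set `P_i` -/

section tab

variable {F : Type u} [Field F] {h n : ℕ} {R R' : ℕ → ℕ}

/-- The tableau of a word. -/
def wordTab (n : ℕ) (R : ℕ → ℕ) (k : Fin n) : ℕ × ℕ := (R k, R k + cnt R k (R k))

/-- The contents of a word. -/
def contSeq (h n : ℕ) (R : ℕ → ℕ) (k : Fin n) : ℕ := wordCont h R k

theorem wordTab_congr (e : ∀ j < n, R j = R' j) : wordTab n R = wordTab n R' := funext fun k => by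
  unfold wordTab
  rw [cnt_congr fun i hi => e i (by omega), e k k.2]

theorem contSeq_eq (k : Fin n) : contSeq h n R k = cont h ((wordTab n R k).2 - (wordTab n R k).1) := by
  unfold contSeq wordCont wordTab
  rw [Nat.add_sub_cancel_left]

theorem contSeq_congr {τ : Perm (Fin n)} (e : wordTab n R' = wordTab n R ∘ ⇑τ⁻¹) :
    contSeq h n R' = permAct τ (contSeq h n R) := funext fun k => by
  unfold permAct
  rw [contSeq_eq, contSeq_eq, e]; rfl

theorem wordTab_swapWord {k : ℕ} (hk : k + 1 < n) (hne : R k ≠ R (k + 1)) :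
    wordTab n (swapWord R k) = wordTab n R ∘ ⇑(simple k hk)⁻¹ := funext fun j => by
  rw [simple_inv, Function.comp_apply]
  unfold wordTab
  by_cases e1 : j.val = k
  · have e : j = ⟨k, by omega⟩ := Fin.ext e1
    rw [e, simple_left]
    change (swapWord R k k, swapWord R k k + cnt (swapWord R k) k (swapWord R k k)) = _
    rw [cnt_swapWord_of_le le_rfl, swapWord_left]
    simp only
    rw [cnt_succ, addBox_of_ne _ hne.symm]
  by_cases e2 : j.val = k + 1
  · have e : j = ⟨k + 1, hk⟩ := Fin.ext e2
    rw [e, simple_right]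
    change (swapWord R k (k + 1), swapWord R k (k + 1) + cnt (swapWord R k) (k + 1) (swapWord R k (k + 1))) = _
    rw [cnt_succ, cnt_swapWord_of_le le_rfl, swapWord_left, swapWord_right, addBox_of_ne _ hne]
  · rw [simple_of_ne k hk j e1 e2, swapWord_of_ne R e1 e2]
    rcases Nat.lt_or_gt_of_ne e1 with e | e
    · rw [cnt_swapWord_of_le (by omega)]
    · rw [cnt_swapWord_of_ge (by omega)]

theorem wordTab_injective (n : ℕ) (R : ℕ → ℕ) : Function.Injective (wordTab n R) := by
  have key : ∀ j k : Fin n, j < k → wordTab n R j ≠ wordTab n R k := fun j k hjk e => by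
    have e1 : R j = R k := congrArg Prod.fst e
    have e2 : R j + cnt R j (R j) = R k + cnt R k (R k) := congrArg Prod.snd e
    have e3 : cnt R (j + 1) (R j) ≤ cnt R k (R j) := Nat.count_monotone _ (Nat.succ_le_of_lt hjk)
    rw [cnt_succ, addBox_self, e1] at e3
    rw [e1] at e2
    omega
  intro j k e
  rcases lt_trichotomy j k with hjk | hjk | hjk
  · exact absurd e (key j k hjk)
  · exact hjk
  · exact absurd e.symm (key k j hjk)

theorem IsWord.exists_of_inP (h1 : 1 ≤ h) (hR : IsWord h n R) {τ : Perm (Fin n)}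
    (hτ : InP (contSeq h n R) τ) :
    ∃ R', IsWord h n R' ∧ cnt R' n = cnt R n ∧ wordTab n R' = wordTab n R ∘ ⇑τ⁻¹ := by
  induction hτ with
  | one => exact ⟨R, hR, rfl, rfl⟩
  | step τ k hk hτ hadm ih =>
    obtain ⟨R', hR', e, e'⟩ := ih
    rw [← contSeq_congr e'] at hadm
    have hA : NonAdj (wordCont h R' k) (wordCont h R' (k + 1)) := hadm
    refine ⟨HeckeClifford.swapWord R' k, hR'.swapWord h1 hk hA, (cnt_swapWord_of_ge (by omega)).trans e, ?_⟩
    rw [wordTab_swapWord hk (hR'.addable_swap h1 hk hA).1, e', mul_inv_rev]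
    rfl

theorem IsWord.exists_inP (h1 : 1 ≤ h) (hR : IsWord h n R) (hR' : IsWord h n R')
    (e : cnt R n = cnt R' n) :
    ∃ τ, InP (contSeq h n R) τ ∧ wordTab n R' = wordTab n R ∘ ⇑τ⁻¹ := by
  let Z : ℕ → ℕ := fun j => if j < n then R' j else R j
  have hZ : ∀ j < n, R' j = Z j := fun j hj => by simp [Z, hj]
  have hZ' : ∀ j, n ≤ j → R j = Z j := fun j hj => by simp [Z, Nat.not_lt.mpr hj]
  have hmoves := hR.moves h1 (hR'.congr hZ) (by rw [e, cnt_congr hZ]) hZ'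
  rw [wordTab_congr hZ]
  have key : ∀ W, Relation.ReflTransGen (Move h n) R W →
      ∃ τ, InP (contSeq h n R) τ ∧ wordTab n W = wordTab n R ∘ ⇑τ⁻¹ := by
    intro W hW
    induction hW with
    | refl => exact ⟨1, InP.one, rfl⟩
    | tail hs hmove ih =>
      obtain ⟨τ, hτ, e'⟩ := ih
      obtain ⟨k, hk, hA, rfl⟩ := hmove
      refine ⟨simple k hk * τ, InP.step τ k hk hτ (by rw [← contSeq_congr e']; exact hA), ?_⟩
      rw [wordTab_swapWord hk ((hR.of_moves h1 le_rfl hs).1.addable_swap h1 hk hA).1, e',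
        mul_inv_rev]
      rfl
  exact key Z hmoves

/-- Composition of the tableau with `τ⁻¹` maps `P_i` bijectively onto the admissible tableaux of the
same shape; surjectivity is the connectivity by moves. -/
theorem IsWord.ncard_inP (h1 : 1 ≤ h) (hR : IsWord h n R) :
    {τ : Perm (Fin n) | InP (contSeq h n R) τ}.ncard =
      {T | ∃ R', IsWord h n R' ∧ cnt R' n = cnt R n ∧ T = wordTab n R'}.ncard := by
  have hinj : Function.Injective fun (τ : Perm (Fin n)) => wordTab n R ∘ ⇑τ⁻¹ := fun τ σ e => by
    have : τ⁻¹ = σ⁻¹ := Equiv.ext fun k => wordTab_injective n R (congrFun e k)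
    exact inv_injective this
  rw [← Set.ncard_image_of_injective _ hinj]
  congr 1
  ext T
  constructor
  · rintro ⟨τ, hτ, rfl⟩
    obtain ⟨R', h2, h3, h4⟩ := hR.exists_of_inP h1 hτ
    exact ⟨R', h2, h3, h4.symm⟩
  · rintro ⟨R', h2, h3, rfl⟩
    obtain ⟨τ, hτ, e⟩ := hR.exists_inP h1 h2 h3.symm
    exact ⟨τ, hτ, e.symm⟩

variable [CharP F (2 * h + 1)]

/-- Every `τ` in `P_i` turns the contents into those of another word, so all conditions become
statements about consecutive boxes of words. The exceptional triple `(h - 1, h, h - 1)` is harmless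
because of `q_top`. -/
theorem IsWord.good (h1 : 1 ≤ h) (hR : IsWord h n R) : Good F (contSeq h n R) := by
  have hset : ∀ τ, InP (contSeq h n R) τ → ∃ R', IsWord h n R' ∧ permAct τ (contSeq h n R) = contSeq h n R' := by
    intro τ hτ
    obtain ⟨R', h2, -, h3⟩ := hR.exists_of_inP h1 hτ
    exact ⟨R', h2, (contSeq_congr h3).symm⟩
  have hcne : ∀ R', IsWord h n R' → ∀ k, k + 1 < n → wordCont h R' k ≠ wordCont h R' (k + 1) := by
    intro R' hR' k hk
    have h2 := hR' (k + 1) hk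
    unfold wordCont
    rw [cnt_succ] at h2 ⊢
    exact (hR' k (by omega)).cont_ne h1 ((hR'.mono (by omega)).isShape h1) h2
  have hadm : ∀ τ, InP (contSeq h n R) τ → ∀ k (hk : k + 1 < n),
      Admissible (permAct τ (contSeq h n R)) k hk ↔
    2 * (q F (permAct τ (contSeq h n R) ⟨k, Nat.lt_of_succ_lt hk⟩) + q F (permAct τ (contSeq h n R) ⟨k + 1, hk⟩)) ≠
      (q F (permAct τ (contSeq h n R) ⟨k, Nat.lt_of_succ_lt hk⟩) - q F (permAct τ (contSeq h n R) ⟨k + 1, hk⟩)) ^ 2 := by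
    intro τ hτ k hk
    obtain ⟨R', hR', e⟩ := hset τ hτ
    rw [e]
    have := q_adj_iff F (hR'.wordCont_le h1 (show k < n by omega)) (hR'.wordCont_le h1 hk)
      (hcne R' hR' k hk)
    exact ⟨fun hA e => this.mp e hA, fun hn => not_not.mp (mt this.mpr hn)⟩
  refine ⟨⟨?_, ?_, ?_, ?_⟩, hadm⟩
  · rintro _ ⟨τ, hτ, rfl⟩ hn
    obtain ⟨R', hR', e⟩ := hset τ hτ
    simp only [e]
    have h2 : R' 0 = 0 := by
      by_contra h0
      obtain ⟨s, hs⟩ := Nat.exists_eq_succ_of_ne_zero h0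
      have := (hR' 0 hn).pos s hs
      simp [cnt_zero] at this
    simp [contSeq, wordCont, cnt_zero, cont, q]
  · rintro _ ⟨τ, hτ, rfl⟩ k hk
    obtain ⟨R', hR', e⟩ := hset τ hτ
    simp only [e]
    exact fun e => hcne R' hR' k hk
      (q_eq_q F (hR'.wordCont_le h1 (by omega)) (hR'.wordCont_le h1 hk) e)
  · rintro _ ⟨τ, hτ, rfl⟩ k hk e2 e3
    obtain ⟨R', hR', e⟩ := hset τ hτ
    simp only [e] at e2 e3 ⊢
    have hc : wordCont h R' (k + 2) = wordCont h R' k :=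
      q_eq_q F (hR'.wordCont_le h1 hk) (hR'.wordCont_le h1 (by omega)) e2
    have hadj := (q_adj_iff F (hR'.wordCont_le h1 (by omega)) (hR'.wordCont_le h1 (by omega))
      (hcne R' hR' k (by omega))).mp e3
    have a1 := hR' (k + 1) (by omega)
    have a2 := hR' (k + 2) hk
    change q F (wordCont h R' k) = 0 ∨ 2 * q F (wordCont h R' k) + 6 * q F (wordCont h R' (k + 1)) = 0
    have hadj' : wordCont h R' k = wordCont h R' (k + 1) + 1 ∨ wordCont h R' k + 1 = wordCont h R' (k + 1) := by
      by_contra hn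
      exact hadj ⟨fun e => hn (Or.inl e), fun e => hn (Or.inr e)⟩
    unfold wordCont at hc hadj'
    rw [cnt_succ] at a1 hadj'
    rw [cnt_succ, cnt_succ] at a2 hc
    have ht := (hR' k (by omega)).triple h1 ((hR'.mono (by omega)).isShape h1) a1 a2 hc hadj'
    unfold wordCont
    rw [cnt_succ]
    rcases ht with ht | ⟨ht, ht'⟩
    · left; rw [ht, q_zero]
    · right
      rw [ht', show cont h (cnt R' k (R' k)) = h - 1 by omega, q_top F h h1]
  · rintro _ ⟨τ, hτ, rfl⟩ k hk e
    refine ⟨simple k hk * τ, InP.step τ k hk hτ ((hadm τ hτ k hk).mpr e), funext fun m => ?_⟩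
    rw [permAct_simple_mul]; rfl

end tab

/-! ## Partitions and shapes -/

section partition

variable {n h : ℕ} {lam mu : n.Partition}

theorem row_of_lt {r : ℕ} (hr : r < len lam) : row lam r = (lam.parts.sort (· ≥ ·))[r]'(by
    rw [Multiset.length_sort]; exact hr) := by
  rw [row, List.getD_eq_getElem]

theorem row_of_ge {r : ℕ} (hr : len lam ≤ r) : row lam r = 0 := by
  rw [row, List.getD_eq_default]
  rw [Multiset.length_sort]; exact hr

theorem row_pos {r : ℕ} : 0 < row lam r ↔ r < len lam := by
  constructor
  · intro h
    by_contra hr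
    rw [row_of_ge (not_lt.mp hr)] at h
    exact lt_irrefl _ h
  · intro hr
    rw [row_of_lt hr]
    refine lam.parts_pos ?_
    rw [← Multiset.mem_sort (r := (· ≥ ·))]
    exact List.getElem_mem _

theorem row_strict (hn : lam.parts.Nodup) (r : ℕ) : row lam (r + 1) < row lam r ∨ row lam (r + 1) = 0 := by
  by_cases hr : r + 1 < len lam
  · left
    rw [row_of_lt hr, row_of_lt (by omega)]
    have h1 := List.pairwise_iff_getElem.mp (Multiset.pairwise_sort lam.parts (r := (· ≥ ·))) r (r + 1)
      (by rw [Multiset.length_sort]; exact (Nat.lt_succ_self r).trans hr)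
      (by rw [Multiset.length_sort]; exact hr) (Nat.lt_succ_self r)
    have h2 : (lam.parts.sort (· ≥ ·)).Nodup := by
      rw [← Multiset.coe_nodup, Multiset.sort_eq]; exact hn
    refine lt_of_le_of_ne h1 fun e => ?_
    have := (h2.getElem_inj_iff).mp e
    omega
  · exact Or.inr (row_of_ge (by omega))

theorem hasSize_row (lam : n.Partition) : HasSize (row lam) n := by
  refine ⟨len lam, fun r hr => row_of_ge hr, ?_⟩
  rw [Finset.sum_range]
  have h2 : ∑ i : Fin (lam.parts.sort (· ≥ ·)).length, (lam.parts.sort (· ≥ ·))[i.1] = n := by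
    rw [Fin.sum_univ_getElem, ← Multiset.sum_coe, Multiset.sort_eq, lam.parts_sum]
  refine Eq.trans ?_ h2
  refine Fintype.sum_equiv (finCongr (Multiset.length_sort (r := (· ≥ ·))).symm) _ _ fun i => ?_
  rw [row_of_lt i.2]; rfl

theorem row_injective (e : row lam = row mu) : lam = mu := by
  have hl : len lam = len mu := by
    have key : ∀ r, r < len lam ↔ r < len mu := fun r => by rw [← row_pos, ← row_pos, e]
    have h1 := key (len lam)
    have h2 := key (len mu)
    omega
  have : lam.parts.sort (· ≥ ·) = mu.parts.sort (· ≥ ·) := by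
    refine List.ext_getElem (by rw [Multiset.length_sort, Multiset.length_sort]; exact hl) ?_
    intro r h1 h2
    rw [Multiset.length_sort] at h1 h2
    rw [← row_of_lt h1, ← row_of_lt h2, e]
  refine Nat.Partition.ext ?_
  rw [← Multiset.sort_eq lam.parts (r := (· ≥ ·)), this, Multiset.sort_eq]

theorem exists_row_eq {ρ : ℕ → ℕ} (hρ : IsShape h ρ) (hs : HasSize ρ n) :
    ∃ lam : n.Partition, lam.parts.Nodup ∧ row lam = ρ := by
  classical
  have hex : ∃ l, ρ l = 0 := by
    obtain ⟨l, hl, -⟩ := hs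
    exact ⟨l, hl l le_rfl⟩
  obtain ⟨l, hl⟩ : ∃ l, l = Nat.find hex := ⟨_, rfl⟩
  have hlt : ∀ r < l, 0 < ρ r := fun r hr => Nat.pos_of_ne_zero (Nat.find_min hex (hl ▸ hr))
  have hge : ∀ r, l ≤ r → ρ r = 0 := fun r hr => Nat.le_zero.mp
    ((hρ.le_of_le hr).trans (by rw [hl, Nat.find_spec hex]))
  have hanti : ∀ i j, i < j → j < l → ρ j < ρ i := fun i j hij hj => by
    have := hρ.lt_or hij
    have := hlt j hj
    omega
  let lam : n.Partition :=
    { parts := ((List.range l).map ρ : List ℕ)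
      parts_pos := fun {i} hi => by
        rw [Multiset.mem_coe, List.mem_map] at hi
        obtain ⟨r, hr, rfl⟩ := hi
        exact hlt r (List.mem_range.mp hr)
      parts_sum := by
        rw [Multiset.sum_coe, ← hs.sum_eq hge]
        rw [← List.sum_toFinset _ List.nodup_range, List.toFinset_range] }
  have hp : ((List.range l).map ρ).Pairwise (· > ·) := by
    rw [List.pairwise_map, List.pairwise_iff_getElem]
    intro i j h1 h2 hij
    simp only [List.getElem_range]
    exact hanti i j hij (by simpa using h2)
  have hsort : lam.parts.sort (· ≥ ·) = (List.range l).map ρ := by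
    change Multiset.sort (((List.range l).map ρ : List ℕ) : Multiset ℕ) (· ≥ ·) = _
    rw [Multiset.coe_sort]
    exact List.mergeSort_of_pairwise (hp.imp fun h => by simpa using h.le)
  refine ⟨lam, Multiset.coe_nodup.mpr (hp.imp fun h => h.ne'), funext fun r => ?_⟩
  rw [row, hsort]
  by_cases hr : r < l
  · rw [List.getD_eq_getElem _ _ (by simpa using hr)]; simp
  · rw [List.getD_eq_default _ _ (by simpa using hr), hge r (by omega)]

theorem isShape_row (h1 : 1 ≤ h) (hG : InGamma (2 * h + 1) lam) : IsShape h (row lam) := by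
  have hs := row_strict hG.1
  have h0 := hs 0
  simp only [zero_add] at h0
  refine ⟨hs, ?_, ?_⟩
  · rcases hG.2 with h2 | ⟨u, h2⟩
    · omega
    · have := h2.2.2; omega
  · rcases hG.2 with h2 | ⟨u, h2, h3, h4, h5⟩ <;> omega

theorem inGamma_of_isShape (hn : lam.parts.Nodup) (hρ : IsShape h (row lam)) :
    InGamma (2 * h + 1) lam := by
  refine ⟨hn, ?_⟩
  have h2 := hρ.sum_le
  have h3 := hρ.le
  by_cases e : row lam 0 ≤ h + 1
  · left; omega
  · exact Or.inr ⟨2 * h + 1 - row lam 0, by omega, by omega, by omega, by omega⟩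

theorem not_isLong (h1 : row lam 0 ≤ (2 * h + 1 + 1) / 2) (u : ℕ) : ¬ IsLong (2 * h + 1) lam u :=
  fun ⟨h2, h3, h4, _⟩ => by omega

theorem isPStandard_iff (h1 : row lam 0 ≤ (2 * h + 1 + 1) / 2) (T : Fin n → ℕ × ℕ) :
    IsPStandard (2 * h + 1) lam T ↔ IsStandard lam T :=
  ⟨fun h => h.1, fun h => ⟨h, fun u hu => absurd hu (not_isLong h1 u)⟩⟩

theorem fPStd_eq_fStd (h1 : row lam 0 ≤ (2 * h + 1 + 1) / 2) : fPStd (2 * h + 1) lam = fStd lam := by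
  unfold fPStd fStd
  congr 1
  ext T
  exact isPStandard_iff h1 T

end partition

/-! ## Tableaux and words -/

section tableau

variable {n h : ℕ} {lam : n.Partition} {R : ℕ → ℕ}

theorem cnt_mono (R : ℕ → ℕ) {j k : ℕ} (hjk : j ≤ k) (r : ℕ) : cnt R j r ≤ cnt R k r :=
  Nat.count_monotone _ hjk

theorem cnt_lt {j k : ℕ} (hjk : j < k) : cnt R j (R j) < cnt R k (R j) := by
  have := cnt_mono R (Nat.succ_le_of_lt hjk) (R j)
  rw [Nat.succ_eq_add_one, cnt_succ, addBox_self] at this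
  omega

theorem exists_of_lt_cnt {k r c : ℕ} (hc : c < cnt R k r) : ∃ j < k, R j = r ∧ cnt R j r = c := by
  induction k with
  | zero => exact absurd hc (Nat.not_lt_zero c)
  | succ k ih =>
    by_cases h1 : c < cnt R k r
    · obtain ⟨j, hj, e⟩ := ih h1
      exact ⟨j, by omega, e⟩
    · rw [cnt_succ] at hc
      unfold addBox at hc
      split_ifs at hc with e
      · exact ⟨k, Nat.lt_succ_self k, e.symm, by omega⟩
      · omega

theorem IsShape.add_sub_le {ρ : ℕ → ℕ} (hρ : IsShape h ρ) {s t : ℕ} (hst : s ≤ t) (h0 : ρ t ≠ 0) :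
    ρ t + (t - s) ≤ ρ s := by
  induction t, hst using Nat.le_induction with
  | base => simp
  | succ t hst ih =>
    have h1 := hρ.strict t
    have h2 := ih (by omega)
    omega

/-- In an admissible extension of the row `t`, the column of the new box is already occupied in the
rows above. -/
theorem IsShape.lt_of_addable {ρ : ℕ → ℕ} (hρ : IsShape h ρ) {s t : ℕ} (ht : Addable h ρ t)
    (hst : s < t) : t + ρ t < s + ρ s := by
  obtain ⟨t, rfl⟩ := Nat.exists_eq_succ_of_ne_zero (Nat.ne_zero_of_lt hst)
  have h1 := ht.pos t rfl
  have h2 := hρ.add_sub_le (show s ≤ t by omega) (by omega)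
  simp only [Nat.succ_eq_add_one] at *
  omega

theorem IsWord.isPStandard (h1 : 1 ≤ h) (hR : IsWord h n R) (e : cnt R n = row lam) :
    IsPStandard (2 * h + 1) lam (wordTab n R) := by
  have hsh : ∀ k, k < n → IsShape h (cnt R k) := fun k hk => (hR.mono hk.le).isShape h1
  have hlt : ∀ a b : Fin n, (wordTab n R a).1 = (wordTab n R b).1 →
      (wordTab n R a).2 < (wordTab n R b).2 → a < b := by
    intro a b e1 e2
    change R a = R b at e1
    change R a + cnt R a (R a) < R b + cnt R b (R b) at e2
    by_contra hab
    have := cnt_mono R (show b.val ≤ a.val from not_lt.mp hab) (R b)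
    rw [e1] at e2
    omega
  refine ⟨⟨⟨?_, (wordTab_injective n R).injOn, ?_⟩, hlt, ?_⟩, ?_⟩
  · intro k _
    refine ⟨Nat.le_add_right _ _, Nat.add_lt_add_left ?_ _⟩
    rw [← e]
    exact cnt_lt k.2
  · rintro ⟨r, c⟩ ⟨hrc, hc⟩
    simp only at hrc hc
    rw [← e] at hc
    obtain ⟨j, hj, e1, e2⟩ := exists_of_lt_cnt (show c - r < cnt R n r by omega)
    refine ⟨⟨j, hj⟩, trivial, Prod.ext e1 ?_⟩
    change R j + cnt R j (R j) = c
    rw [e1, e2]; omega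
  · intro a b e1 e2
    change R a + cnt R a (R a) = R b + cnt R b (R b) at e1
    change R a < R b at e2
    by_contra hab
    have h3 := cnt_mono R (show b.val ≤ a.val from not_lt.mp hab) (R a)
    have h4 := (hsh b b.2).lt_of_addable (hR b b.2) e2
    omega
  · rintro u ⟨h2, h3, h4, h5⟩ hu a b ha hb
    have a1 : R a = 0 := congrArg Prod.fst ha
    have a2 : R a + cnt R a (R a) = row lam 0 - 1 := congrArg Prod.snd ha
    have b1 : R b = 1 := congrArg Prod.fst hb
    have b2 : R b + cnt R b (R b) = row lam 1 := congrArg Prod.snd hb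
    rw [a1] at a2
    rw [b1] at b2
    -- If the second row were completed before the last box of the first row, that box would be
    -- added to a shape with `ρ 0 > h` and `ρ 0 + ρ 1 = 2h`, which `zero` forbids.
    by_contra hab
    have hne : b < a := lt_of_le_of_ne (not_lt.mp hab) fun e => by rw [e, a1] at b1; omega
    have h6 := cnt_lt (R := R) (show b.val < a.val from hne)
    rw [b1] at h6
    have h7 := (hR a a.2).zero a1
    omega

theorem IsPStandard.exists_word (h1 : 1 ≤ h) (hG : InGamma (2 * h + 1) lam) {T : Fin n → ℕ × ℕ}
    (hT : IsPStandard (2 * h + 1) lam T) :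
    ∃ R, IsWord h n R ∧ cnt R n = row lam ∧ T = wordTab n R := by
  classical
  have hρ := isShape_row h1 hG
  obtain ⟨hS, hP⟩ := hT
  have hinj : ∀ a b, T a = T b → a = b := fun a b e => hS.bijOn.injOn (Set.mem_univ _) (Set.mem_univ _) e
  have hmem : ∀ k, (T k).1 ≤ (T k).2 ∧ (T k).2 < (T k).1 + row lam (T k).1 := fun k =>
    hS.bijOn.mapsTo (Set.mem_univ k)
  have hsurj : ∀ r c, r ≤ c → c < r + row lam r → ∃ j, T j = (r, c) := fun r c h1 h2 => by
    obtain ⟨j, -, e⟩ := hS.bijOn.surjOn (show (r, c) ∈ cells lam from ⟨h1, h2⟩)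
    exact ⟨j, e⟩
  let R : ℕ → ℕ := fun k => if hk : k < n then (T ⟨k, hk⟩).1 else 0
  have hRT : ∀ k : Fin n, R k = (T k).1 := fun k => by simp [R]
  -- If the labels below `m` fill exactly the columns `r, …, C - 1` of row `r`, then the row has
  -- length `C - r` at time `m`.
  have hcnt : ∀ (m r C : ℕ), m ≤ n → C ≤ r + row lam r →
      (∀ j : Fin n, (T j).1 = r → (j.val < m ↔ (T j).2 < C)) → cnt R m r = C - r := by
    intro m r C hm hC hj
    unfold cnt
    rw [Nat.count_eq_card_filter_range, ← Nat.card_Ico r C]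
    refine Finset.card_bij (fun j hj => (T ⟨j, by
      have := Finset.mem_range.mp (Finset.mem_filter.mp hj).1
      omega⟩).2) ?_ ?_ ?_
    · intro j hjm
      rw [Finset.mem_filter, Finset.mem_range] at hjm
      have e := hjm.2
      have hjn : j < n := by omega
      rw [hRT ⟨j, hjn⟩] at e
      have := (hj ⟨j, hjn⟩ e).mp hjm.1
      have h3 := (hmem ⟨j, hjn⟩).1
      rw [e] at h3
      exact Finset.mem_Ico.mpr ⟨h3, this⟩
    · intro i hi j hj e
      rw [Finset.mem_filter, Finset.mem_range] at hi hj
      have e1 := hi.2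
      have e2 := hj.2
      rw [hRT ⟨i, by omega⟩] at e1
      rw [hRT ⟨j, by omega⟩] at e2
      exact congrArg Fin.val (hinj _ _ (Prod.ext (e1.trans e2.symm) e))
    · intro c hc
      rw [Finset.mem_Ico] at hc
      obtain ⟨j, e⟩ := hsurj r c hc.1 (by omega)
      have h3 := (hj j (by rw [e])).mpr (by rw [e]; exact hc.2)
      refine ⟨j, Finset.mem_filter.mpr ⟨Finset.mem_range.mpr h3, by rw [hRT, e]⟩, ?_⟩
      simp only [Fin.eta, e]
  have hk : ∀ k : Fin n, cnt R k (R k) = (T k).2 - (T k).1 := fun k => by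
    rw [hRT]
    refine hcnt k _ _ k.2.le (hmem k).2.le fun j e => ⟨fun hjk => ?_, fun hjk => hS.row_lt j k e hjk⟩
    by_contra h3
    rcases Nat.lt_or_eq_of_le (not_lt.mp h3) with h4 | h4
    · exact absurd (hS.row_lt k j e.symm h4) (not_lt.mpr (le_of_lt hjk))
    · have := hinj k j (Prod.ext e.symm h4)
      rw [this] at hjk
      exact lt_irrefl _ hjk
  have hn : cnt R n = row lam := funext fun r => by
    rw [hcnt n r (r + row lam r) le_rfl le_rfl fun j e => ⟨fun _ => e ▸ (hmem j).2, fun _ => j.2⟩]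
    omega
  have hle : ∀ k, k ≤ n → ∀ r, cnt R k r ≤ row lam r := fun k hk r => hn ▸ cnt_mono R hk r
  have hTR : T = wordTab n R := funext fun k => Prod.ext (hRT k).symm (by
    change _ = R k + cnt R k (R k)
    rw [hk, hRT]
    have := (hmem k).1
    omega)
  refine ⟨R, fun k hkn => ?_, hn, hTR⟩
  have hlt : cnt R k (R k) < row lam (R k) := by rw [← hn]; exact cnt_lt hkn
  have h2 : (T ⟨k, hkn⟩) = (R k, R k + cnt R k (R k)) := by rw [hTR]; rfl
  refine ⟨fun e => ?_, fun s e => ?_, fun e => ?_⟩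
  · rw [e] at hlt h2
    have hρ1 := hρ.sum_le
    have hρ2 := hρ.le
    have h3 := hle k hkn.le 1
    -- Otherwise the new box is the last one of the first row, `λ₁ + λ₂ = p`, and the second row is
    -- already complete, against the condition on admissible tableaux.
    by_contra hcon
    obtain ⟨b, hb⟩ := hsurj 1 (row lam 1) (by omega) (by omega)
    have h4 := hP (row lam 1) ⟨by omega, by omega, by omega, le_rfl⟩ rfl ⟨k, hkn⟩ b (by
      rw [h2]; exact Prod.ext rfl (by simp only; omega)) hb
    have h5 := cnt_mono R (show k ≤ b.val from le_of_lt h4) 1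
    have h6 := hk b
    rw [hRT, hb] at h6
    simp only at h6
    omega
  · rw [e] at hlt h2 ⊢
    have h3 := hρ.strict s
    -- The box directly above the new one, which has a smaller label by standardness along columns.
    obtain ⟨j, hj⟩ := hsurj s (s + 1 + cnt R k (s + 1)) (by omega) (by omega)
    have h4 : j.val < k := hS.col_lt j ⟨k, hkn⟩ (by rw [hj, h2]) (by rw [hj, h2]; simp)
    have h5 := cnt_lt (R := R) h4
    have h6 := hk j
    rw [hRT, hj] at h6
    rw [hRT, hj] at h5
    simp only at h5 h6
    omega
  · rw [e] at hlt
    have h3 := hle k hkn.le 0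
    have := hρ.sum_le
    omega

theorem content_wordTab (h1 : 1 ≤ h) (hR : IsWord h n R) :
    (fun k => content (2 * h + 1) (wordTab n R k)) = contSeq h n R := funext fun k => by
  rw [contSeq_eq]
  unfold content cont
  split_ifs <;> omega

/-- Content `0` occurs exactly on the main diagonal, once in each nonempty row, since no box reaches
the diagonal `2h`. -/
theorem IsWord.card_zeros {F : Type u} [Field F] [CharP F (2 * h + 1)] (h1 : 1 ≤ h)
    (hR : IsWord h n R) (e : cnt R n = row lam) :
    (zeros fun k => q F (contSeq h n R k)).card = len lam := by
  classical
  have hz : ∀ k : Fin n, k ∈ zeros (fun k => q F (contSeq h n R k)) ↔ cnt R k (R k) = 0 := fun k => by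
    rw [mem_zeros]
    constructor
    · intro h0
      have h2 := q_eq_zero F (hR.wordCont_le h1 k.2) h0
      have h3 := (hR k k.2).lt h1 ((hR.mono k.2.le).isShape h1)
      unfold wordCont cont at h2
      split_ifs at h2 <;> omega
    · intro h0
      simp [contSeq, wordCont, h0, cont, q]
  rw [← Finset.card_range (len lam)]
  refine Finset.card_bij (fun k _ => R k) (fun k hk => ?_) (fun j hj k hk e' => ?_) fun r hr => ?_
  · rw [Finset.mem_range, ← row_pos, ← e]
    exact Nat.zero_lt_of_lt (cnt_lt k.2)
  · refine wordTab_injective n R (Prod.ext e' ?_)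
    change R j + cnt R j (R j) = R k + cnt R k (R k)
    rw [(hz j).mp hj, (hz k).mp hk, e']
  · rw [Finset.mem_range, ← row_pos, ← e] at hr
    obtain ⟨j, hj, e1, e2⟩ := exists_of_lt_cnt hr
    exact ⟨⟨j, hj⟩, (hz _).mpr (by rw [e1]; exact e2), e1⟩

end tableau

/-! ## The modules `D_p(λ)` -/

section main

variable {F : Type u} [Field F] [IsAlgClosed F] {n h : ℕ} [CharP F (2 * h + 1)]
  {lam : n.Partition} {R R' : ℕ → ℕ} {V : YSupermodule.{u, v} F n} {W : YSupermodule.{u, w} F n}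

open YSupermodule

theorem IsDp.exists_word (h1 : 1 ≤ h) (hG : InGamma (2 * h + 1) lam)
    (hV : IsDp (2 * h + 1) lam V) :
    ∃ R, IsWord h n R ∧ cnt R n = row lam ∧ IsD (contSeq h n R) V := by
  obtain ⟨T, hT, hD⟩ := hV
  obtain ⟨R, hR, e, rfl⟩ := hT.exists_word h1 hG
  rw [content_wordTab h1 hR] at hD
  exact ⟨R, hR, e, hD⟩

theorem IsWord.exists_isDp (h1 : 1 ≤ h) (hR : IsWord h n R) (e : cnt R n = row lam) :
    ∃ V : YSupermodule.{u, u} F n, IsDp (2 * h + 1) lam V ∧ IsD (contSeq h n R) V := by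
  obtain ⟨V, hV⟩ := exists_isD (F := F) (hR.good h1) (two_ne_zero_of_char F h)
  exact ⟨V, ⟨_, hR.isPStandard h1 e, by rw [content_wordTab h1 hR]; exact hV⟩, hV⟩

theorem exists_isDp (h1 : 1 ≤ h) (hG : InGamma (2 * h + 1) lam) :
    ∃ V : YSupermodule.{u, u} F n, IsDp (2 * h + 1) lam V := by
  obtain ⟨R, hR, e⟩ := (isShape_row h1 hG).exists_word h1 (hasSize_row lam)
  obtain ⟨V, hV, -⟩ := hR.exists_isDp (F := F) h1 e
  exact ⟨V, hV⟩

/-- The weight of `R` also occurs in the second module, whose weights are the contents of words with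
the shape of `R'`; contents determine the word, hence the shape. -/
theorem IsD.cnt_eq_of_isomorphic (h1 : 1 ≤ h) (hR : IsWord h n R) (hR' : IsWord h n R')
    (hV : IsD (contSeq h n R) V) (hW : IsD (contSeq h n R') W) (hVW : V.Isomorphic W) :
    cnt R n = cnt R' n := by
  have h2 := two_ne_zero_of_char F h
  obtain ⟨τ, hτ, e⟩ := hW.exists_of_wt_ne_bot h2 (wt_ne_bot_of_isomorphic hVW (hV.wt_ne_bot h2))
  obtain ⟨R'', hR'', e1, e2⟩ := hR'.exists_of_inP h1 hτ
  rw [← contSeq_congr e2] at e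
  rw [← e1]
  exact cnt_congr (hR.eq_of_wordCont h1 hR'' fun j hj => q_eq_q F (hR.wordCont_le h1 hj)
    (hR''.wordCont_le h1 hj) (congrFun e ⟨j, hj⟩))

/-- By closure under exchanges the first module also has the weight of `R'`, and a common weight
suffices. This makes the module independent of the tableau, of the choice of `L(i)` and of the
identification. -/
theorem IsD.isomorphic_of_cnt_eq (h1 : 1 ≤ h) (hR : IsWord h n R) (hR' : IsWord h n R')
    (hV : IsD (contSeq h n R) V) (hW : IsD (contSeq h n R') W) (e : cnt R n = cnt R' n) :
    V.Isomorphic W := by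
  have h2 := two_ne_zero_of_char F h
  have iV := hV.isIrreducible (hR.good h1) h2
  have cV := hV.isCompletelySplittable h2
  obtain ⟨χ, hχ, hM, -⟩ := (weightClosed h2 iV cV).exists_of_cnt_eq h1 le_rfl hR hR' e
    (hV.wt_ne_bot h2) fun j hj hjn => rfl
  have e' : χ = fun k => q F (contSeq h n R' k) := funext fun k => hM k k.2 k.2
  exact isomorphic_of_wt h2 iV cV (hW.isIrreducible (hR'.good h1) h2)
    (hW.isCompletelySplittable h2) hχ (e' ▸ hW.wt_ne_bot h2)

theorem IsD.finrank_contSeq (h1 : 1 ≤ h) (hG : InGamma (2 * h + 1) lam) (hR : IsWord h n R)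
    (e : cnt R n = row lam) (hV : IsD (contSeq h n R) V) :
    Module.finrank F V = 2 ^ (n - len lam / 2) * fPStd (2 * h + 1) lam := by
  rw [hV.finrank_eq (two_ne_zero_of_char F h), hR.card_zeros h1 e, hR.ncard_inP h1, fPStd]
  congr 2
  ext T
  constructor
  · rintro ⟨R', hR', e', rfl⟩
    exact hR'.isPStandard h1 (e'.trans e)
  · intro hT
    obtain ⟨R', hR', e', rfl⟩ := IsPStandard.exists_word h1 hG hT
    exact ⟨R', hR', e'.trans e.symm, rfl⟩

theorem exists_isomorphic_isDp (h1 : 1 ≤ h) (hV : V.IsIrreducible)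
    (hVs : V.IsCompletelySplittable) : ∃ lam : n.Partition, InGamma (2 * h + 1) lam ∧
      ∃ D : YSupermodule.{u, u} F n, IsDp (2 * h + 1) lam D ∧ V.Isomorphic D := by
  have h2 := two_ne_zero_of_char F h
  haveI := finite_of_isIrreducible h2 hV
  haveI := hV.1
  obtain ⟨χ, hχ⟩ := exists_weight hVs
  obtain ⟨R, hR, hM⟩ := (weightClosed h2 hV hVs).exists_word h1 le_rfl χ hχ
  have hsh := hR.isShape h1
  obtain ⟨lam, hn, e⟩ := exists_row_eq hsh (hasSize_cnt R n)
  obtain ⟨D, hD, hD'⟩ := hR.exists_isDp (F := F) h1 e.symm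
  have e' : χ = fun k => q F (contSeq h n R k) := funext fun k => hM k k.2 k.2
  exact ⟨lam, inGamma_of_isShape hn (e ▸ hsh), D, hD, isomorphic_of_wt h2 hV hVs
    (hD'.isIrreducible (hR.good h1) h2) (hD'.isCompletelySplittable h2) hχ
    (e' ▸ hD'.wt_ne_bot h2)⟩

end main

end HeckeClifford
end

/-! ### The classification theorem -/

theorem mainTheorem5 {F : Type u} [Field F] [IsAlgClosed F] (p : ℕ) [CharP F p] (hp : 3 ≤ p)
    (n : ℕ) :
    -- the modules `D_p(λ)` exist, and they are unique up to isomorphism and pairwise non-isomorphic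
    (∀ lam : n.Partition, HeckeClifford.InGamma p lam →
      ∃ D : HeckeClifford.YSupermodule.{u, u} F n, HeckeClifford.IsDp p lam D) ∧
    (∀ lam mu : n.Partition, HeckeClifford.InGamma p lam → HeckeClifford.InGamma p mu →
      ∀ (D : HeckeClifford.YSupermodule.{u, v} F n) (E : HeckeClifford.YSupermodule.{u, w} F n),
        HeckeClifford.IsDp p lam D → HeckeClifford.IsDp p mu E →
          (D.Isomorphic E ↔ lam = mu)) ∧
    -- they are irreducible and completely splittable, with the stated types and dimensions
    (∀ lam : n.Partition, HeckeClifford.InGamma p lam →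
      ∀ D : HeckeClifford.YSupermodule.{u, v} F n, HeckeClifford.IsDp p lam D →
        D.IsIrreducible ∧ D.IsCompletelySplittable ∧
        (Even (HeckeClifford.len lam) → D.IsTypeM) ∧
        (Odd (HeckeClifford.len lam) → D.IsTypeQ) ∧
        Module.Finite F D ∧
        (HeckeClifford.row lam 0 ≤ (p + 1) / 2 →
          Module.finrank F D =
            2 ^ (n - HeckeClifford.len lam / 2) * HeckeClifford.fStd lam) ∧
        ((∃ u : ℕ, HeckeClifford.IsLong p lam u) →
          Module.finrank F D =
            2 ^ (n - HeckeClifford.len lam / 2) * HeckeClifford.fPStd p lam)) ∧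
    -- every irreducible completely splittable module is isomorphic to one of them
    (∀ V : HeckeClifford.YSupermodule.{u, v} F n, V.IsIrreducible → V.IsCompletelySplittable →
      ∃ lam : n.Partition, HeckeClifford.InGamma p lam ∧
        ∃ D : HeckeClifford.YSupermodule.{u, u} F n,
          HeckeClifford.IsDp p lam D ∧ V.Isomorphic D) := by 
  -- The characteristic is an odd prime; with `p = 2h + 1` the contents range over `0, …, h`.
  have hpr : p.Prime := (CharP.char_is_prime_or_zero F p).resolve_right (by omega)
  obtain ⟨h, rfl⟩ := hpr.odd_of_ne_two (by omega)
  have h1 : 1 ≤ h := by omega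
  have h2 := HeckeClifford.two_ne_zero_of_char F h
  refine ⟨fun lam hG => HeckeClifford.exists_isDp h1 hG, ?_, ?_,
    fun V hV hVs => HeckeClifford.exists_isomorphic_isDp h1 hV hVs⟩
  · intro lam mu hG hG' D E hD hE
    obtain ⟨R, hR, e, hDR⟩ := hD.exists_word h1 hG
    obtain ⟨R', hR', e', hER⟩ := hE.exists_word h1 hG'
    constructor
    · intro hDE
      refine HeckeClifford.row_injective ?_
      rw [← e, ← e', hDR.cnt_eq_of_isomorphic h1 hR hR' hER hDE]
    · rintro rfl
      exact hDR.isomorphic_of_cnt_eq h1 hR hR' hER (e.trans e'.symm)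
  · intro lam hG D hD
    obtain ⟨R, hR, e, hDR⟩ := hD.exists_word h1 hG
    have hI := hDR.isIrreducible (hR.good h1) h2
    have hC := hDR.isCompletelySplittable h2
    have hχ := hDR.wt_ne_bot h2
    have hz := hR.card_zeros (F := F) h1 e
    have hf := hDR.finrank_contSeq h1 hG hR e
    refine ⟨hI, hC, fun he => HeckeClifford.YSupermodule.isTypeM_of_even h2 hI hC hχ (hz ▸ he),
      fun ho => HeckeClifford.YSupermodule.isTypeQ_of_odd h2 hI hC hχ (hz ▸ ho), hDR.finite (hR.good h1) h2, fun hl => ?_,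
      fun _ => hf⟩
    rw [hf, HeckeClifford.fPStd_eq_fStd hl]
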